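/- **Theorem 1 (Operator bound).** For every $C_0>0$ and $t\in\mathbb R$ there is a constant $C>0$, depending only on $C_0$ and $t$, such that the following holds. *Setting.* Let $\Omega\subseteq\mathbb R^d$ be open, $\mathfrak H=L^2(\Omega;\mathbb C)$, $\mathfrak H^m=L^2_{\rm sym}(\Omega^m)$ the space of permutation-symmetric functions, let $T\ge 1$ be a self-adjoint operator on $\mathfrak H$, and let $w:\mathbb R^d\to\mathbb R$ be even and measurable with $$ w(x-y)^2\le C_0\,(1\otimes T+T\otimes 1)\qquad\text{on }\mathfrak H^2 $$ in the sense of quadratic forms. Let $u_0\in D(T^{1/2})$ be normalized with $\langle u_0,Tu_0\rangle=t$ and solve the Hartree equation $(T+|u_0|^2*w-\mu_0)u_0=0$ for some $\mu_0\in\mathbb R$ (it need not be a minimizer of the Hartree energy). For $N\ge 2$ let $$H_N=\sum_{i=1}^N T_i+\frac1{N-1}\sum_{1\le i<j\le N}w(x_i-x_j)\ \text{ on }\mathfrak H^N,\qquad \mathcal E_{\rm H}(u_0)=t+\frac12\iint |u_0(x)|^2w(x-y)|u_0(y)|^2\,dx\,dy .$$ Let $P=|u_0\rangle\langle u_0|$,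 $Q=1-P$, $\mathfrak H_+=Q\mathfrak H$, and let $\mathfrak H_+^m$ be the symmetric tensor power of $\mathfrak H_+$, $\mathcal F_+=\bigoplus_{m\ge0}\mathfrak H_+^m$, $\mathcal F_+^{\le N}=\bigoplus_{m=0}^N\mathfrak H_+^m$, with orthogonal projection $1^{\le N}$ onto $\mathcal F_+^{\le N}$. Write $d\Gamma(A)=\bigoplus_m\sum_{i=1}^mA_i$ and $\mathcal N_+=d\Gamma(Q)$. With $h=T+|u_0|^2*w-\mu_0$, $K_2(x,y)=u_0(x)w(x-y)u_0(y)$, and $K_1=Qk_1Q$, where $k_1$ has the integral kernel $u_0(x)w(x-y)\overline{u_0(y)}$, the Bogoliubov Hamiltonian on $\mathcal F_+$ is $$\mathbb H=d\Gamma(h+K_1)+\frac12\sum_{m,n\ge1}\Big(\langle u_m\otimes u_n,K_2\rangle a_m^\dagger a_n^\dagger+\langle K_2,u_m\otimes u_n\rangle a_ma_n\Big),$$ where $(u_n)_{n\ge1}$ is an orthonormal basis of $\mathfrak H_+$ and $a_n=a(u_n)$. Let $U_N:\mathfrak H^N\to\mathcal F_+^{\le N}$ be the unitary map $U_N\Psi=\bigoplus_{j=0}^NQ^{\otimes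 j}\frac{a(u_0)^{N-j}}{\sqrt{(N-j)!}}\Psi$. *Conclusion.* For every $N\ge 2$, the operators $U_NH_NU_N^\dagger$ and $1^{\le N}\mathbb H1^{\le N}$, with their natural domains, are self-adjoint on $\mathcal F_+^{\le N}$ with the same domain $D\big(1^{\le N}d\Gamma(QTQ)1^{\le N}\big)$, and the operator inequality $$\Big(U_NH_NU_N^\dagger-N\mathcal E_{\rm H}(u_0)-1^{\le N}\mathbb H1^{\le N}\Big)^2\le\frac CN\Big(d\Gamma(QTQ)\,\mathcal N_+^2+1\Big)$$ holds on $\mathcal F_+^{\le N}$: for every $\Phi\in D\big(1^{\le N}d\Gamma(QTQ)1^{\le N}\big)$, $$\Big\|\Big(U_NH_NU_N^\dagger-N\mathcal E_{\rm H}(u_0)-1^{\le N}\mathbb H1^{\le N}\Big)\Phi\Big\|^2\le\frac CN\Big(\big\langle\Phi,d\Gamma(QTQ)\mathcal N_+^2\Phi\big\rangle+\|\Phi\|^2\Big).$$ -/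

import Mathlib

open MeasureTheory
open scoped ENNReal ComplexConjugate

noncomputable section

namespace MeanField

/-! ### Unbounded operators -/

section Operators

variable {E F : Type*} [NormedAddCommGroup E] [InnerProductSpace ℂ E]
  [NormedAddCommGroup F] [InnerProductSpace ℂ F]

/-- The operator `B A B†`, with its natural domain `{y | B† y ∈ D(A)}`. If `B` is an orthogonal
projection onto a closed subspace, this is the compression of `A` to that subspace; if `B` is
unitary, it is the conjugate operator. -/
def sandwich [CompleteSpace E] [CompleteSpace F] (B : E →L[ℂ] F) (A : E →ₗ.[ℂ] E) :
    F →ₗ.[ℂ] F where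
  domain := A.domain.comap (ContinuousLinearMap.adjoint B : F →L[ℂ] E).toLinearMap
  toFun :=
    { toFun := fun y => B (A ⟨ContinuousLinearMap.adjoint B y, y.2⟩)
      map_add' := fun x y => by
        rw [← map_add, ← LinearPMap.map_add]
        congr 2
        ext
        simp
      map_smul' := fun c x => by
        rw [RingHom.id_apply, ← map_smul, ← LinearPMap.map_smul]
        congr 2
        ext
        simp }

/-- The compression of `A` to a closed subspace `S`, as an operator on the Hilbert space `S`:
its domain is `S ∩ D(A)` and its values are the projections to `S` of the values of `A`. -/
def compress [CompleteSpace E] (S : Submodule ℂ E) [CompleteSpace S] (A : E →ₗ.[ℂ] E) :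
    S →ₗ.[ℂ] S :=
  sandwich S.orthogonalProjectionOnto A

/-- A bounded operator, regarded as an operator with domain the whole space. -/
def everywhere (B : E →L[ℂ] F) : E →ₗ.[ℂ] F := B.toLinearMap.toPMap ⊤

/-- The product `A B`, with its natural domain `{x ∈ D(B) | B x ∈ D(A)}`. -/
def prodOp (A B : E →ₗ.[ℂ] E) : E →ₗ.[ℂ] E :=
  Submodule.toLinearPMap
    { carrier := {p | ∃ z, (p.1, z) ∈ B.graph ∧ (z, p.2) ∈ A.graph}
      zero_mem' := ⟨0, B.graph.zero_mem, A.graph.zero_mem⟩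
      add_mem' := by
        rintro p q ⟨z, hz, hz'⟩ ⟨y, hy, hy'⟩
        exact ⟨z + y, B.graph.add_mem hz hy, A.graph.add_mem hz' hy'⟩
      smul_mem' := by
        rintro c p ⟨z, hz, hz'⟩
        exact ⟨c • z, B.graph.smul_mem c hz, A.graph.smul_mem c hz'⟩ }

/-- The operator inequality `A² ≤ B`, for a symmetric `A` and a nonnegative `B`:
`D(B) ⊆ D(A)` and `‖A x‖² ≤ ⟨x, B x⟩` for every `x ∈ D(B)`. -/
def SqLE (A B : E →ₗ.[ℂ] E) : Prop :=
  ∀ x : B.domain, ∃ hx : (x : E) ∈ A.domain,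
    ‖A ⟨x, hx⟩‖ ^ 2 ≤ (inner ℂ (x : E) (B x)).re

/-- For a symmetric operator `T` that is bounded from below: the vector `u` lies in the domain of
the closure of the quadratic form `v ↦ ⟨v, T v⟩`, and the value of the closed form at `u` is `t`.
For `T ≥ 0` self-adjoint this says `u ∈ D(T^{1/2})` and `t = ‖T^{1/2} u‖²`. -/
def HasFormValue (T : E →ₗ.[ℂ] E) (u : E) (t : ℝ) : Prop :=
  ∃ v : ℕ → T.domain,
    Filter.Tendsto (fun n => (v n : E)) Filter.atTop (nhds u) ∧
    (∀ ε > 0, ∃ n₀, ∀ m ≥ n₀, ∀ n ≥ n₀,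
      |(inner ℂ ((v m - v n : T.domain) : E) (T (v m - v n))).re| < ε) ∧
    Filter.Tendsto (fun n => (inner ℂ (v n : E) (T (v n))).re) Filter.atTop (nhds t)

end Operators

/-! ### Operators on `L²` -/

section L2

variable {α β : Type*} [MeasurableSpace α] [MeasurableSpace β]

/-- The Hilbert space `L²(μ)` of complex-valued functions. -/
abbrev L2 (μ : Measure α) : Type _ := Lp ℂ 2 μ

/-- The class in `L²(μ)` of a square-integrable function (and `0` for other functions). -/
def ofFun (μ : Measure α) (g : α → ℂ) : L2 μ :=
  open Classical in if h : MemLp g 2 μ then h.toLp g else 0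

/-- Multiplication by a real function `g`, with domain `{ψ ∈ L² | g ψ ∈ L²}`. -/
def mulOp (μ : Measure α) (g : α → ℝ) : L2 μ →ₗ.[ℂ] L2 μ :=
  Submodule.toLinearPMap
    { carrier := {p | p.2 =ᵐ[μ] fun x => (g x : ℂ) * p.1 x}
      zero_mem' := by
        filter_upwards [Lp.coeFn_zero ℂ 2 μ] with x hx
        simp only [Prod.fst_zero, Prod.snd_zero]
        rw [hx, Pi.zero_apply, mul_zero]
      add_mem' := by
        rintro p q (hp : p.2 =ᵐ[μ] _) (hq : q.2 =ᵐ[μ] _)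
        filter_upwards [hp, hq, Lp.coeFn_add p.1 q.1, Lp.coeFn_add p.2 q.2] with x h1 h2 h3 h4
        simp only [Prod.fst_add, Prod.snd_add, h3, h4, Pi.add_apply, h1, h2]
        ring
      smul_mem' := by
        rintro c p (hp : p.2 =ᵐ[μ] _)
        filter_upwards [hp, Lp.coeFn_smul c p.1, Lp.coeFn_smul c p.2] with x h1 h3 h4
        simp only [Prod.smul_fst, Prod.smul_snd, h3, h4, Pi.smul_apply, h1, smul_eq_mul]
        ring }

/-- The integral operator `(k f)(x) = ∫ k(x,y) f(y) dy`, on its natural domain. -/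
def kernelOp (μ : Measure α) (k : α → α → ℂ) : L2 μ →ₗ.[ℂ] L2 μ :=
  Submodule.toLinearPMap
    { carrier := {p | ∀ᵐ x ∂μ, Integrable (fun y => k x y * p.1 y) μ ∧
        p.2 x = ∫ y, k x y * p.1 y ∂μ}
      zero_mem' := by
        have h0 := Lp.coeFn_zero ℂ 2 μ
        filter_upwards [h0] with x hx
        have h : (fun y => k x y * (0 : L2 μ) y) =ᵐ[μ] fun _ => (0 : ℂ) := by
          filter_upwards [h0] with y hy
          rw [hy, Pi.zero_apply, mul_zero]
        refine ⟨(integrable_congr h).2 (integrable_zero _ _ _), ?_⟩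
        simp only [Prod.fst_zero, Prod.snd_zero]
        rw [integral_congr_ae h, hx]
        simp
      add_mem' := by
        intro p q hp hq
        filter_upwards [hp, hq, Lp.coeFn_add p.2 q.2] with x h1 h2 h4
        have h : (fun y => k x y * (p.1 + q.1 : L2 μ) y) =ᵐ[μ]
            fun y => k x y * p.1 y + k x y * q.1 y := by
          filter_upwards [Lp.coeFn_add p.1 q.1] with y hy
          rw [hy, Pi.add_apply, mul_add]
        refine ⟨(integrable_congr h).2 (h1.1.add h2.1), ?_⟩
        simp only [Prod.fst_add, Prod.snd_add]
        rw [integral_congr_ae h, h4, Pi.add_apply, h1.2, h2.2, integral_add h1.1 h2.1]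
      smul_mem' := by
        intro c p hp
        filter_upwards [hp, Lp.coeFn_smul c p.2] with x h1 h4
        have h : (fun y => k x y * (c • p.1 : L2 μ) y) =ᵐ[μ]
            fun y => c * (k x y * p.1 y) := by
          filter_upwards [Lp.coeFn_smul c p.1] with y hy
          rw [hy, Pi.smul_apply, smul_eq_mul]
          ring
        refine ⟨(integrable_congr h).2 (h1.1.const_mul c), ?_⟩
        simp only [Prod.smul_fst, Prod.smul_snd]
        rw [integral_congr_ae h, h4, Pi.smul_apply, h1.2, integral_const_mul, smul_eq_mul] }

variable (μ : Measure α) (ν : Measure β) [SigmaFinite ν]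

theorem contract_slice (Ψ : L2 (μ.prod ν)) :
    ∀ᵐ a ∂μ, MemLp (fun b => Ψ (a, b)) 2 ν := by
  have hΨ := Lp.memLp Ψ
  have hm := hΨ.1
  have hfin : ∫⁻ p, ‖Ψ p‖ₑ ^ (2 : ℝ) ∂(μ.prod ν) ≠ ∞ := by
    have := lintegral_rpow_enorm_lt_top_of_eLpNorm_lt_top (by norm_num) (by norm_num) hΨ.2
    simpa using this.ne
  have hme : AEMeasurable (fun p => ‖Ψ p‖ₑ ^ (2 : ℝ)) (μ.prod ν) := hm.enorm.pow_const _
  rw [lintegral_prod _ hme] at hfin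
  filter_upwards [hm.prodMk_left, ae_lt_top' hme.lintegral_prod_right' hfin] with a h1 h2
  refine ⟨h1, ?_⟩
  rw [eLpNorm_lt_top_iff_lintegral_rpow_enorm_lt_top (by norm_num) (by norm_num)]
  simpa using h2

theorem contract_integrable (K : L2 ν) (Ψ : L2 (μ.prod ν)) :
    ∀ᵐ a ∂μ, Integrable (fun b => conj (K b) * Ψ (a, b)) ν := by
  filter_upwards [contract_slice μ ν Ψ] with a ha
  exact (Lp.memLp K).star.integrable_mul ha

theorem contract_bound (K : L2 ν) (Ψ : L2 (μ.prod ν)) :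
    eLpNorm (fun a => ∫ b, conj (K b) * Ψ (a, b) ∂ν) 2 μ ≤
      eLpNorm K 2 ν * eLpNorm Ψ 2 (μ.prod ν) := by
  have hm := (Lp.memLp Ψ).1
  have hme : AEMeasurable (fun p => ‖Ψ p‖ₑ ^ (2 : ℝ)) (μ.prod ν) := hm.enorm.pow_const _
  have key : ∀ᵐ a ∂μ, ‖∫ b, conj (K b) * Ψ (a, b) ∂ν‖ₑ ^ (2 : ℝ) ≤
      eLpNorm K 2 ν ^ (2 : ℝ) * ∫⁻ b, ‖Ψ (a, b)‖ₑ ^ (2 : ℝ) ∂ν := by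
    filter_upwards [contract_slice μ ν Ψ] with a ha
    have h1 : ‖∫ b, conj (K b) * Ψ (a, b) ∂ν‖ₑ ≤
        (∫⁻ b, ‖K b‖ₑ ^ (2 : ℝ) ∂ν) ^ (1 / (2 : ℝ)) *
          (∫⁻ b, ‖Ψ (a, b)‖ₑ ^ (2 : ℝ) ∂ν) ^ (1 / (2 : ℝ)) := by
      refine (enorm_integral_le_lintegral_enorm _).trans ?_
      have h2 := ENNReal.lintegral_mul_le_Lp_mul_Lq ν Real.HolderConjugate.two_two
        (Lp.memLp K).1.enorm ha.1.enorm
      refine le_trans (le_of_eq ?_) h2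
      refine lintegral_congr fun b => ?_
      simp [enorm_mul]
    have h3 := ENNReal.rpow_le_rpow h1 (by norm_num : (0 : ℝ) ≤ 2)
    rw [ENNReal.mul_rpow_of_nonneg _ _ (by norm_num), ← ENNReal.rpow_mul,
      ← ENNReal.rpow_mul] at h3
    rw [eLpNorm_eq_lintegral_rpow_enorm_toReal (by norm_num) (by norm_num)]
    rw [← ENNReal.rpow_mul]
    simpa using h3
  rw [eLpNorm_eq_lintegral_rpow_enorm_toReal (f := Ψ) (by norm_num) (by norm_num),
    eLpNorm_eq_lintegral_rpow_enorm_toReal (f := fun a => _) (by norm_num) (by norm_num)]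
  simp only [ENNReal.toReal_ofNat]
  calc (∫⁻ a, ‖∫ b, conj (K b) * Ψ (a, b) ∂ν‖ₑ ^ (2 : ℝ) ∂μ) ^ (1 / (2 : ℝ))
      ≤ (∫⁻ a, eLpNorm K 2 ν ^ (2 : ℝ) * ∫⁻ b, ‖Ψ (a, b)‖ₑ ^ (2 : ℝ) ∂ν ∂μ) ^ (1 / (2 : ℝ)) :=
        ENNReal.rpow_le_rpow (lintegral_mono_ae key) (by norm_num)
    _ = eLpNorm K 2 ν * (∫⁻ p, ‖Ψ p‖ₑ ^ (2 : ℝ) ∂(μ.prod ν)) ^ (1 / (2 : ℝ)) := by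
        rw [lintegral_const_mul'' _ hme.lintegral_prod_right', ← lintegral_prod _ hme,
          ENNReal.mul_rpow_of_nonneg _ _ (by norm_num), ← ENNReal.rpow_mul]
        norm_num

theorem contract_memLp (K : L2 ν) (Ψ : L2 (μ.prod ν)) :
    MemLp (fun a => ∫ b, conj (K b) * Ψ (a, b) ∂ν) 2 μ := by
  refine ⟨?_, (contract_bound μ ν K Ψ).trans_lt
    (ENNReal.mul_lt_top (Lp.memLp K).2 (Lp.memLp Ψ).2)⟩
  have hK : AEStronglyMeasurable (fun p : α × β => conj (K p.2)) (μ.prod ν) :=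
    (Lp.memLp K).star.1.comp_snd
  exact (hK.mul (Lp.memLp Ψ).1).integral_prod_right'

/-- Partial integration against `K`: the bounded map `L²(α × β) → L²(α)`,
`Ψ ↦ (a ↦ ∫ conj K(b) Ψ(a,b) db)`. -/
def contract (K : L2 ν) : L2 (μ.prod ν) →L[ℂ] L2 μ :=
  LinearMap.mkContinuous
    { toFun := fun Ψ => (contract_memLp μ ν K Ψ).toLp _
      map_add' := fun Ψ Φ => by
        ext1
        refine (MemLp.coeFn_toLp _).trans ?_
        filter_upwards [Lp.coeFn_add ((contract_memLp μ ν K Ψ).toLp _)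
          ((contract_memLp μ ν K Φ).toLp _), MemLp.coeFn_toLp (contract_memLp μ ν K Ψ),
          MemLp.coeFn_toLp (contract_memLp μ ν K Φ), contract_integrable μ ν K Ψ,
          contract_integrable μ ν K Φ, Measure.ae_ae_of_ae_prod (Lp.coeFn_add Ψ Φ)]
          with a h1 h2 h3 h4 h5 h6
        rw [h1, Pi.add_apply, h2, h3, ← integral_add h4 h5]
        refine integral_congr_ae ?_
        filter_upwards [h6] with b hb
        rw [hb, Pi.add_apply, mul_add]
      map_smul' := fun c Ψ => by
        ext1
        refine (MemLp.coeFn_toLp _).trans ?_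
        filter_upwards [Lp.coeFn_smul c ((contract_memLp μ ν K Ψ).toLp _),
          MemLp.coeFn_toLp (contract_memLp μ ν K Ψ),
          Measure.ae_ae_of_ae_prod (Lp.coeFn_smul c Ψ)] with a h1 h2 h6
        rw [RingHom.id_apply, h1, Pi.smul_apply, h2, smul_eq_mul, ← integral_const_mul]
        refine integral_congr_ae ?_
        filter_upwards [h6] with b hb
        rw [hb, Pi.smul_apply, smul_eq_mul]
        ring }
    ‖K‖ (fun Ψ => by
      simp only [LinearMap.coe_mk, AddHom.coe_mk, Lp.norm_toLp]
      rw [Lp.norm_def, Lp.norm_def, ← ENNReal.toReal_mul]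
      exact ENNReal.toReal_mono
        (ENNReal.mul_lt_top (Lp.memLp K).2 (Lp.memLp Ψ).2).ne (contract_bound μ ν K Ψ))

end L2

/-! ### Many-particle spaces

The one-particle space is `L²(μ)`, for a σ-finite measure `μ` on a space `X`. -/

section ManyBody

variable {X : Type*} [MeasurableSpace X] (μ : Measure X) [SigmaFinite μ]

/-- `L²(X^m)`. -/
abbrev L2N (m : ℕ) : Type _ := L2 (Measure.pi fun _ : Fin m => μ)

theorem measurePreserving_perm (m : ℕ) (σ : Equiv.Perm (Fin m)) :
    MeasurePreserving (fun (x : Fin m → X) i => x (σ i))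
      (Measure.pi fun _ : Fin m => μ) (Measure.pi fun _ : Fin m => μ) := by
  have h := measurePreserving_piCongrLeft (fun _ : Fin m => μ) σ.symm
  convert h using 1
  funext x i
  have := Equiv.piCongrLeft_apply_apply (fun _ : Fin m => X) σ.symm x (σ i)
  rw [Equiv.symm_apply_apply] at this
  exact this.symm

theorem measurePreserving_snoc (m : ℕ) :
    MeasurePreserving (fun p : (Fin m → X) × X => (Fin.snoc p.1 p.2 : Fin (m + 1) → X))
      ((Measure.pi fun _ : Fin m => μ).prod μ) (Measure.pi fun _ : Fin (m + 1) => μ) := by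
  have h := (measurePreserving_piFinSuccAbove (fun _ : Fin (m + 1) => μ) (Fin.last m)).symm
  have h2 := h.comp (Measure.measurePreserving_swap (μ := Measure.pi fun _ : Fin m => μ) (ν := μ))
  convert h2 using 1
  funext p
  exact (Fin.insertNth_last' p.2 p.1).symm

theorem measurePreserving_snoc_snoc (m : ℕ) :
    MeasurePreserving
      (fun p : (Fin m → X) × (X × X) =>
        (Fin.snoc (Fin.snoc p.1 p.2.1 : Fin (m + 1) → X) p.2.2 : Fin (m + 2) → X))
      ((Measure.pi fun _ : Fin m => μ).prod (μ.prod μ))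
      (Measure.pi fun _ : Fin (m + 2) => μ) := by
  have h1 := (measurePreserving_prodAssoc (Measure.pi fun _ : Fin m => μ) μ μ).symm
  have h2 := (measurePreserving_snoc μ m).prod (MeasurePreserving.id μ)
  exact (measurePreserving_snoc μ (m + 1)).comp (h2.comp h1)

/-- The permutation operator `(σ Ψ)(x) = Ψ(x_{σ(1)}, …, x_{σ(m)})`. -/
def permute (m : ℕ) (σ : Equiv.Perm (Fin m)) : L2N μ m →L[ℂ] L2N μ m :=
  (Lp.compMeasurePreservingₗᵢ ℂ _ (measurePreserving_perm μ m σ)).toContinuousLinearMap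

/-- The space of `m` bosons: the permutation-symmetric functions in `L²(X^m)`. -/
def sym (m : ℕ) : Submodule ℂ (L2N μ m) :=
  ⨅ σ : Equiv.Perm (Fin m), (permute μ m σ - ContinuousLinearMap.id ℂ _).ker

theorem isClosed_sym (m : ℕ) : IsClosed (sym μ m : Set (L2N μ m)) := by
  rw [sym, Submodule.coe_iInf]
  exact isClosed_iInter fun σ => ContinuousLinearMap.isClosed_ker _

instance (m : ℕ) : CompleteSpace (sym μ m) := (isClosed_sym μ m).completeSpace_coe

/-- The annihilation operator `a(f)` from `m + 1` to `m` particles: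
`(a(f) Ψ)(x₁,…,x_m) = √(m+1) ∫ conj f(y) Ψ(x₁,…,x_m,y) dy`. -/
def annihilate (f : L2 μ) (m : ℕ) : L2N μ (m + 1) →L[ℂ] L2N μ m :=
  ((√(m + 1 : ℝ) : ℝ) : ℂ) • (contract (Measure.pi fun _ : Fin m => μ) μ f ∘L
    (Lp.compMeasurePreservingₗᵢ ℂ _ (measurePreserving_snoc μ m)).toContinuousLinearMap)

/-- Annihilation of a pair with wave function `K`, from `m + 2` to `m` particles:
`Ψ ↦ √((m+1)(m+2)) ∬ conj K(y,z) Ψ(x₁,…,x_m,y,z) dy dz`.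
In terms of an orthonormal basis this is `∑_{i,j} ⟨K, u_i ⊗ u_j⟩ a(u_i) a(u_j)`. -/
def annihilatePair (K : L2 (μ.prod μ)) (m : ℕ) : L2N μ (m + 2) →L[ℂ] L2N μ m :=
  ((√((m + 1 : ℝ) * (m + 2)) : ℝ) : ℂ) •
    (contract (Measure.pi fun _ : Fin m => μ) (μ.prod μ) K ∘L
      (Lp.compMeasurePreservingₗᵢ ℂ _ (measurePreserving_snoc_snoc μ m)).toContinuousLinearMap)

/-- The operator `∑_{i=1}^m A_i` on `L²(X^m)`, where `A_i` is the one-particle operator `A` acting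
on the `i`-th variable: the closure of the sum defined on the linear span of the products
`f₁ ⊗ ⋯ ⊗ f_m` with `f_i ∈ D(A)`. -/
def sumOp (A : L2 μ →ₗ.[ℂ] L2 μ) (m : ℕ) : L2N μ m →ₗ.[ℂ] L2N μ m :=
  (Submodule.span ℂ {p : L2N μ m × L2N μ m | ∃ f : Fin m → A.domain,
    (p.1 =ᵐ[Measure.pi fun _ : Fin m => μ] fun x => ∏ i, (f i : L2 μ) (x i)) ∧
    (p.2 =ᵐ[Measure.pi fun _ : Fin m => μ] fun x =>
      ∑ i, (A (f i)) (x i) * ∏ j ∈ Finset.univ.erase i, (f j : L2 μ) (x j))}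
    ).topologicalClosure.toLinearPMap

/-- The kinetic energy `∑_{i=1}^m T_i` of `m` bosons. -/
def kinetic (T : L2 μ →ₗ.[ℂ] L2 μ) (m : ℕ) : sym μ m →ₗ.[ℂ] sym μ m :=
  compress (sym μ m) (sumOp μ T m)

/-- The interaction energy `∑_{i<j} W(x_i,x_j)` of `m` bosons, a multiplication operator. -/
def interaction (W : X → X → ℝ) (m : ℕ) : sym μ m →ₗ.[ℂ] sym μ m :=
  compress (sym μ m) (mulOp (Measure.pi fun _ : Fin m => μ) fun x =>
    ∑ i, ∑ j ∈ Finset.Ioi i, W (x i) (x j))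

/-- The `N`-particle Hamiltonian `H_N = ∑ T_i + (N-1)⁻¹ ∑_{i<j} W(x_i,x_j)`. -/
def hamiltonian (T : L2 μ →ₗ.[ℂ] L2 μ) (W : X → X → ℝ) (N : ℕ) : sym μ N →ₗ.[ℂ] sym μ N :=
  kinetic μ T N + (((1 / ((N : ℝ) - 1) : ℝ)) : ℂ) • interaction μ W N

/-! ### Hartree theory -/

variable (W : X → X → ℝ) (u : L2 μ)

/-- The mean-field potential `x ↦ ∫ |u(y)|² W(x,y) dy`. -/
def meanField (x : X) : ℝ := ∫ y, ‖u y‖ ^ 2 * W x y ∂μ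

/-- The Hartree energy of `u`, where `t` is the kinetic energy `⟨u, T u⟩`. -/
def hartreeEnergy (t : ℝ) : ℝ :=
  t + 1 / 2 * ∫ x, ∫ y, ‖u x‖ ^ 2 * W x y * ‖u y‖ ^ 2 ∂μ ∂μ

/-- The Hartree equation `(T + |u|² * W - μ₀) u = 0`, tested against vectors in the domain
of `T`. -/
def SolvesHartree (T : L2 μ →ₗ.[ℂ] L2 μ) (μ₀ : ℝ) : Prop :=
  ∀ v : T.domain, inner ℂ (T v) u +
    (∫ x, conj ((v : L2 μ) x) * ((meanField μ W u x : ℂ) * u x) ∂μ) =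
      (μ₀ : ℂ) * inner ℂ (v : L2 μ) u

/-- The projection `Q = 1 - |u⟩⟨u|` onto the orthogonal complement of `u`, for `‖u‖ = 1`. -/
def Q : L2 μ →L[ℂ] L2 μ := (Submodule.span ℂ {u})ᗮ.starProjection

/-- The operator `Q T Q`. -/
def QTQ (T : L2 μ →ₗ.[ℂ] L2 μ) : L2 μ →ₗ.[ℂ] L2 μ := sandwich (Q μ u) T

/-- The operator `h = T + |u|² * W - μ₀`. -/
def hOp (T : L2 μ →ₗ.[ℂ] L2 μ) (μ₀ : ℝ) : L2 μ →ₗ.[ℂ] L2 μ :=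
  T + mulOp μ (meanField μ W u) - (μ₀ : ℂ) • everywhere (ContinuousLinearMap.id ℂ (L2 μ))

/-- The operator `K₁ = Q k₁ Q`, where `k₁` has the kernel `u(x) W(x,y) conj u(y)`. -/
def K₁ : L2 μ →ₗ.[ℂ] L2 μ :=
  sandwich (Q μ u) (kernelOp μ fun x y => u x * W x y * conj (u y))

/-- The two-particle function `K₂(x,y) = u(x) W(x,y) u(y)`. -/
def K₂ : L2 (μ.prod μ) := ofFun (μ.prod μ) fun p => u p.1 * W p.1 p.2 * u p.2

/-! ### The excited Fock space -/

/-- The space of `m` bosons in the orthogonal complement of `u`: the symmetric functions `Ψ` with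
`∫ conj u(y) Ψ(…,y) dy = 0`. -/
def symPlus : (m : ℕ) → Submodule ℂ (L2N μ m)
  | 0 => sym μ 0
  | m + 1 => sym μ (m + 1) ⊓ (annihilate μ u m).ker

theorem isClosed_symPlus (m : ℕ) : IsClosed (symPlus μ u m : Set (L2N μ m)) := by
  cases m with
  | zero => exact isClosed_sym μ 0
  | succ m => exact (isClosed_sym μ (m + 1)).inter (ContinuousLinearMap.isClosed_ker _)

instance (m : ℕ) : CompleteSpace (symPlus μ u m) := (isClosed_symPlus μ u m).completeSpace_coe

/-- The excited Fock space `𝓕₊`, the Hilbert sum of the spaces of `m` excited bosons. -/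
abbrev Fock : Type _ := lp (fun m : ℕ => symPlus μ u m) 2

/-- The space `𝓕₊^{≤N}` of vectors with at most `N` particles. -/
def FockLE (N : ℕ) : Submodule ℂ (Fock μ u) :=
  ⨅ m : {m : ℕ // N < m}, (lp.evalCLM ℂ (fun m : ℕ => symPlus μ u m) 2 m.1).ker

theorem isClosed_FockLE (N : ℕ) : IsClosed (FockLE μ u N : Set (Fock μ u)) := by
  rw [FockLE, Submodule.coe_iInf]
  exact isClosed_iInter fun m => ContinuousLinearMap.isClosed_ker _

instance (N : ℕ) : CompleteSpace (FockLE μ u N) := (isClosed_FockLE μ u N).completeSpace_coe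

instance (N : ℕ) : InnerProductSpace ℂ (FockLE μ u N) := inferInstance

/-- The second quantization `dΓ(A) = ⊕_m ∑_{i=1}^m A_i` on `𝓕₊`, with its natural domain, for an
operator `A` that leaves the orthogonal complement of `u` invariant. -/
def dGamma (A : L2 μ →ₗ.[ℂ] L2 μ) : Fock μ u →ₗ.[ℂ] Fock μ u :=
  Submodule.toLinearPMap
    { carrier := {p | ∀ m, (p.1 m, p.2 m) ∈ (compress (symPlus μ u m) (sumOp μ A m)).graph}
      zero_mem' := fun _ => Submodule.zero_mem _
      add_mem' := fun hp hq m => Submodule.add_mem _ (hp m) (hq m)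
      smul_mem' := fun c _ hp m => Submodule.smul_mem _ c (hp m) }

/-- The particle number operator `𝓝₊ = dΓ(Q)` on `𝓕₊`. -/
def number : Fock μ u →ₗ.[ℂ] Fock μ u := dGamma μ u (everywhere (Q μ u))

/-- Annihilation of a pair of excited particles, from `m + 2` to `m` particles. -/
def pairPlus (K : L2 (μ.prod μ)) (m : ℕ) : symPlus μ u (m + 2) →L[ℂ] symPlus μ u m :=
  (symPlus μ u m).orthogonalProjectionOnto ∘L annihilatePair μ K m ∘L (symPlus μ u (m + 2)).subtypeL

/-- The operator `∑_{m,n≥1} ⟨K, u_m ⊗ u_n⟩ a_m a_n` on `𝓕₊`, with its natural domain. -/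
def annihilation (K : L2 (μ.prod μ)) : Fock μ u →ₗ.[ℂ] Fock μ u :=
  Submodule.toLinearPMap
    { carrier := {p | ∀ m, p.2 m = pairPlus μ u K m (p.1 (m + 2))}
      zero_mem' := fun m => by simp
      add_mem' := fun {p q} hp hq m => by
        simp only [Prod.fst_add, Prod.snd_add, lp.coeFn_add, Pi.add_apply, map_add]
        rw [hp m, hq m]
      smul_mem' := fun c p hp m => by
        simp only [Prod.smul_fst, Prod.smul_snd, lp.coeFn_smul, Pi.smul_apply, map_smul]
        rw [hp m] }

/-- The operator `∑_{m,n≥1} ⟨u_m ⊗ u_n, K⟩ a†_m a†_n` on `𝓕₊`, with its natural domain; from `m`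
to `m + 2` particles it is the adjoint of the annihilation of a pair. -/
def creation (K : L2 (μ.prod μ)) : Fock μ u →ₗ.[ℂ] Fock μ u :=
  Submodule.toLinearPMap
    { carrier := {p | p.2 0 = 0 ∧ p.2 1 = 0 ∧
        ∀ m, p.2 (m + 2) = ContinuousLinearMap.adjoint (pairPlus μ u K m) (p.1 m)}
      zero_mem' := by simp
      add_mem' := fun {p q} hp hq => by
        refine ⟨?_, ?_, fun m => ?_⟩
        · simp [hp.1, hq.1]
        · simp [hp.2.1, hq.2.1]
        · simp only [Prod.fst_add, Prod.snd_add, lp.coeFn_add, Pi.add_apply, map_add]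
          rw [hp.2.2 m, hq.2.2 m]
      smul_mem' := fun c p hp => by
        refine ⟨?_, ?_, fun m => ?_⟩
        · simp [hp.1]
        · simp [hp.2.1]
        · simp only [Prod.smul_fst, Prod.smul_snd, lp.coeFn_smul, Pi.smul_apply, map_smul]
          rw [hp.2.2 m] }

/-- The Bogoliubov Hamiltonian
`ℍ = dΓ(h + K₁) + ½ ∑_{m,n≥1} (⟨u_m ⊗ u_n, K₂⟩ a†_m a†_n + ⟨K₂, u_m ⊗ u_n⟩ a_m a_n)` on `𝓕₊`. -/
def bogoliubov (T : L2 μ →ₗ.[ℂ] L2 μ) (μ₀ : ℝ) : Fock μ u →ₗ.[ℂ] Fock μ u :=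
  dGamma μ u (hOp μ W u T μ₀ + K₁ μ W u) +
    (1 / 2 : ℂ) • (creation μ u (K₂ μ W u) + annihilation μ u (K₂ μ W u))

/-! ### The excitation map -/

/-- The power `a(u)^k`, from `m + k` to `m` particles. -/
def annihilatePow (m : ℕ) : (k : ℕ) → (L2N μ (m + k) →L[ℂ] L2N μ m)
  | 0 => ContinuousLinearMap.id ℂ _
  | k + 1 => annihilatePow m k ∘L annihilate μ u (m + k)

/-- The component `Q^{⊗j} (a(u)^{N-j} / √(N-j)!) Ψ` of `U_N Ψ` with `j ≤ N` particles. On symmetric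
functions, `Q^{⊗j}` is the orthogonal projection onto the space of `j` excited bosons. -/
def excitationComponent (N j : ℕ) (hj : j ≤ N) : sym μ N →L[ℂ] symPlus μ u j :=
  (((√((N - j).factorial : ℝ))⁻¹ : ℝ) : ℂ) • ((symPlus μ u j).orthogonalProjectionOnto ∘L
    ((Nat.add_sub_of_le hj ▸ annihilatePow μ u j (N - j) : L2N μ N →L[ℂ] L2N μ j) ∘L
      (sym μ N).subtypeL))

/-- The excitation map `U_N Ψ = ⊕_{j=0}^N Q^{⊗j} (a(u)^{N-j} / √(N-j)!) Ψ`, from the `N`-particle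
space to `𝓕₊^{≤N}`. -/
def excitationMap (N : ℕ) : sym μ N →L[ℂ] FockLE μ u N :=
  (FockLE μ u N).orthogonalProjectionOnto ∘L
    ∑ j : Fin (N + 1), lp.singleContinuousLinearMap ℂ (fun m : ℕ => symPlus μ u m) 2 (j : ℕ) ∘L
      excitationComponent μ u N j (Nat.lt_succ_iff.1 j.2)

/-! ### The operators on `𝓕₊^{≤N}` -/

/-- The identity operator on `𝓕₊^{≤N}`. -/
def idLE (N : ℕ) : FockLE μ u N →ₗ.[ℂ] FockLE μ u N :=
  everywhere (ContinuousLinearMap.id ℂ (FockLE μ u N))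

/-- The operator `U_N H_N U_N†` on `𝓕₊^{≤N}`. -/
def excitationHamiltonian (T : L2 μ →ₗ.[ℂ] L2 μ) (N : ℕ) :
    FockLE μ u N →ₗ.[ℂ] FockLE μ u N :=
  sandwich (excitationMap μ u N) (hamiltonian μ T W N)

/-- The truncated Bogoliubov Hamiltonian `1^{≤N} ℍ 1^{≤N}` on `𝓕₊^{≤N}`. -/
def truncatedBogoliubov (T : L2 μ →ₗ.[ℂ] L2 μ) (μ₀ : ℝ) (N : ℕ) :
    FockLE μ u N →ₗ.[ℂ] FockLE μ u N :=
  compress (FockLE μ u N) (bogoliubov μ W u T μ₀)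

/-- The operator `1^{≤N} dΓ(QTQ) 1^{≤N}` on `𝓕₊^{≤N}`. -/
def truncatedKinetic (T : L2 μ →ₗ.[ℂ] L2 μ) (N : ℕ) : FockLE μ u N →ₗ.[ℂ] FockLE μ u N :=
  compress (FockLE μ u N) (dGamma μ u (QTQ μ u T))

/-- The particle number operator `𝓝₊` on `𝓕₊^{≤N}`. -/
def truncatedNumber (N : ℕ) : FockLE μ u N →ₗ.[ℂ] FockLE μ u N :=
  compress (FockLE μ u N) (number μ u)

end ManyBody

/-- The Lebesgue measure on a subset `Ω` of `ℝ^d`. -/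
abbrev lebesgueOn {d : ℕ} (Ω : Set (EuclideanSpace ℝ (Fin d))) :
    Measure (EuclideanSpace ℝ (Fin d)) := volume.restrict Ω

/-- The interaction `(x, y) ↦ w(x - y)`. -/
def pairInteraction {d : ℕ} (w : EuclideanSpace ℝ (Fin d) → ℝ)
    (x y : EuclideanSpace ℝ (Fin d)) : ℝ := w (x - y)

end MeanField

end

open MeanField

/-!
Let `u` solve the Hartree equation. Everything is computed on the pure powers `f ⊗ ⋯ ⊗ f`, where
`f ∈ D(T)` is orthogonal to `u`. Their span over the sectors with at most `N` particles (`core`) is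
a core of the truncated kinetic energy `K` (`IsSystem.hasCore_kinetic`). Indeed polarization shows
that pure powers are total in the symmetric space, and a vector orthogonal to the range of `K + r`
on the core is orthogonal to every pure power: along the semigroup `e^{-sQTQ}`, which maps pure
powers to pure powers, its inner product with a pure power is a multiple of `e^{rs}`; being
bounded, it vanishes (`inner_pw_eq_zero_of_semigroup`).

*The interaction.* The hypothesis bounds `W²` by the kinetic energy of two particles. The Schur
product theorem (`qform_mul_gram_nonneg`) transports this bound to the matrix elements between pure
powers of any order, since these are products of a two-particle kernel and a power of the Gram
kernel `⟨g, f⟩`. This gives all the bounds of the interaction by the quadratic form `kinForm` of the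
kinetic energy. The hypothesis also makes `W (u ⊗ u)` square-integrable
(`IsSystem.pairMem_of_hasFormValue`), so that the Hartree equation puts `u` in the domain of `T`.

*Self-adjointness.* On the core, the Bogoliubov Hamiltonian and `U_N H_N U_N†` both differ from `K`
by an operator that is bounded relative to `√K`, with constants depending on `N`. A symmetric
operator of this kind, whose graph contains the closure of its restriction to the core, is
self-adjoint with the domain of `K` (`IsPerturbation.isSelfAdjoint`, `IsPerturbation.domain_eq`),
by the argument of Kato and Rellich.

*The error.* The excitation map sends the `N`-th power of `α u + f` to the vector with components
`α^{N-j} √(N choose j) f ⊗ ⋯ ⊗ f`. Hence the matrix elements of `H_N` between the powers of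
`x u + g` and `y u + f` are polynomials in `conj x` and `y`, whose coefficients are the matrix
elements of `U_N H_N U_N†` between pure powers (`IsSystem.exists_hasMatrix_excitationHamiltonian`).
Subtracting those of `N E_H(u) + ℍ`, the terms of order `N` cancel by the definition of the energy,
and the linear terms by the Hartree equation (`IsSystem.hasMatrix_error`). What is left changes the
particle number by at most two, and in each of its five diagonals the interaction carries a
coefficient that is small: the square of the block acting on sector `j` is at most
`C₀ (1 + t) / N` times `j³ kinForm + normForm`, up to a numerical constant
(`IsSystem.norm_form_error_sq_le`). Here `kinForm` is the kinetic energy of one of the `j`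
particles, so that `j³ kinForm` is the form of `K 𝒩₊²`, because `𝒩₊` is `j` on that sector. The
bound on the core extends to the domain of `K` by continuity in the graph norm for fixed `N`
(`IsSystem.exists_errorOp_bound`), and reads as an operator inequality in `IsSystem.sqLE_errorOp`.
-/

noncomputable section

namespace MeanField

/-! ### Product functions -/

section Tensor

variable {α β : Type*} [MeasurableSpace α] [MeasurableSpace β]

theorem inner_L2 {μ : Measure α} (f g : L2 μ) :
    inner ℂ f g = ∫ x, conj (f x) * g x ∂μ := by
  rw [L2.inner_def]
  simp only [RCLike.inner_apply, mul_comm]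

variable {X : Type*} [MeasurableSpace X] (μ : Measure X) [SigmaFinite μ]

theorem ae_eval {m : ℕ} (i : Fin m) {p : X → Prop} (h : ∀ᵐ x ∂μ, p x) :
    ∀ᵐ x ∂(Measure.pi fun _ : Fin m => μ), p (x i) :=
  (Measure.quasiMeasurePreserving_eval (μ := fun _ : Fin m => μ) i).ae h

theorem memLp_tens {m : ℕ} (f : Fin m → L2 μ) :
    MemLp (fun x : Fin m → X => ∏ i, f i (x i)) 2 (Measure.pi fun _ : Fin m => μ) := by
  have hm : AEStronglyMeasurable (fun x : Fin m → X => ∏ i, f i (x i))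
      (Measure.pi fun _ : Fin m => μ) := by
    refine Finset.aestronglyMeasurable_fun_prod _ fun i _ => ?_
    exact (Lp.aestronglyMeasurable (f i)).comp_quasiMeasurePreserving
      (Measure.quasiMeasurePreserving_eval (μ := fun _ : Fin m => μ) i)
  rw [memLp_two_iff_integrable_sq_norm hm]
  have h : ∀ i, Integrable (fun x => ‖f i x‖ ^ 2) μ := fun i =>
    (memLp_two_iff_integrable_sq_norm (Lp.aestronglyMeasurable _)).1 (Lp.memLp (f i))
  have := Integrable.fintype_prod (μ := fun _ : Fin m => μ) (f := fun i x => ‖f i x‖ ^ 2) h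
  simpa only [norm_prod, Finset.prod_pow] using this

/-- The product function `f₁ ⊗ ⋯ ⊗ f_m`. -/
def tensFun {m : ℕ} (f : Fin m → L2 μ) : L2N μ m := (memLp_tens μ f).toLp _

theorem coeFn_tensFun {m : ℕ} (f : Fin m → L2 μ) :
    tensFun μ f =ᵐ[Measure.pi fun _ : Fin m => μ] fun x => ∏ i, f i (x i) :=
  MemLp.coeFn_toLp _

theorem inner_tensFun {m : ℕ} (f g : Fin m → L2 μ) :
    inner ℂ (tensFun μ f) (tensFun μ g) = ∏ i, inner ℂ (f i) (g i) := by
  rw [inner_L2]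
  simp only [inner_L2]
  rw [← integral_fintype_prod_eq_prod (μ := fun _ : Fin m => μ)
    (fun i x => conj (f i x) * g i x)]
  refine integral_congr_ae ?_
  filter_upwards [coeFn_tensFun μ f, coeFn_tensFun μ g] with x h1 h2
  rw [h1, h2, map_prod, Finset.prod_mul_distrib]

theorem norm_tensFun {m : ℕ} (f : Fin m → L2 μ) : ‖tensFun μ f‖ = ∏ i, ‖f i‖ := by
  have h := inner_tensFun μ f f
  simp only [inner_self_eq_norm_sq_to_K] at h
  have h2 : ‖tensFun μ f‖ ^ 2 = (∏ i, ‖f i‖) ^ 2 := by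
    rw [← Finset.prod_pow]
    exact_mod_cast h
  exact (pow_left_inj₀ (norm_nonneg _) (Finset.prod_nonneg fun _ _ => norm_nonneg _)
    two_ne_zero).1 h2

/-- The continuous multilinear map `(f₁, …, f_m) ↦ f₁ ⊗ ⋯ ⊗ f_m`. -/
def tens (m : ℕ) : ContinuousMultilinearMap ℂ (fun _ : Fin m => L2 μ) (L2N μ m) :=
  MultilinearMap.mkContinuous
    { toFun := tensFun μ
      map_update_add' := fun {_} f i a b => by
        rename_i inst
        obtain rfl : inst = instDecidableEqFin m := Subsingleton.elim _ _
        ext1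
        filter_upwards [coeFn_tensFun μ (Function.update f i (a + b)),
          coeFn_tensFun μ (Function.update f i a), coeFn_tensFun μ (Function.update f i b),
          Lp.coeFn_add (tensFun μ (Function.update f i a)) (tensFun μ (Function.update f i b)),
          ae_eval μ i (Lp.coeFn_add a b)] with x h1 h2 h3 h4 h5
        rw [h4, Pi.add_apply, h1, h2, h3]
        have hr : ∀ c : L2 μ, ∏ j, (Function.update f i c j) (x j) =
            c (x i) * ∏ j ∈ Finset.univ.erase i, f j (x j) := fun c => by
          rw [← Finset.mul_prod_erase _ _ (Finset.mem_univ i), Function.update_self]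
          congr 1
          refine Finset.prod_congr rfl fun j hj => ?_
          rw [Function.update_of_ne (Finset.ne_of_mem_erase hj)]
        rw [hr, hr, hr, h5, Pi.add_apply, add_mul]
      map_update_smul' := fun {_} f i c a => by
        rename_i inst
        obtain rfl : inst = instDecidableEqFin m := Subsingleton.elim _ _
        ext1
        filter_upwards [coeFn_tensFun μ (Function.update f i (c • a)),
          coeFn_tensFun μ (Function.update f i a),
          Lp.coeFn_smul c (tensFun μ (Function.update f i a)),
          ae_eval μ i (Lp.coeFn_smul c a)] with x h1 h2 h4 h5
        rw [h4, Pi.smul_apply, h1, h2]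
        have hr : ∀ c : L2 μ, ∏ j, (Function.update f i c j) (x j) =
            c (x i) * ∏ j ∈ Finset.univ.erase i, f j (x j) := fun c => by
          rw [← Finset.mul_prod_erase _ _ (Finset.mem_univ i), Function.update_self]
          congr 1
          refine Finset.prod_congr rfl fun j hj => ?_
          rw [Function.update_of_ne (Finset.ne_of_mem_erase hj)]
        rw [hr, hr, h5, Pi.smul_apply, smul_eq_mul, smul_eq_mul, mul_assoc] }
    1 (fun f => by
      rw [one_mul]
      exact (norm_tensFun μ f).le)

theorem tens_apply {m : ℕ} (f : Fin m → L2 μ) : tens μ m f = tensFun μ f := rfl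

theorem coeFn_tens {m : ℕ} (f : Fin m → L2 μ) :
    tens μ m f =ᵐ[Measure.pi fun _ : Fin m => μ] fun x => ∏ i, f i (x i) :=
  coeFn_tensFun μ f

theorem inner_tens {m : ℕ} (f g : Fin m → L2 μ) :
    inner ℂ (tens μ m f) (tens μ m g) = ∏ i, inner ℂ (f i) (g i) := inner_tensFun μ f g

/-- The pure power `f ⊗ ⋯ ⊗ f`. -/
def pw (m : ℕ) (f : L2 μ) : L2N μ m := tens μ m fun _ => f

theorem coeFn_pw (m : ℕ) (f : L2 μ) :
    pw μ m f =ᵐ[Measure.pi fun _ : Fin m => μ] fun x => ∏ i, f (x i) := coeFn_tens μ _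

theorem inner_pw (m : ℕ) (f g : L2 μ) :
    inner ℂ (pw μ m f) (pw μ m g) = inner ℂ f g ^ m := by
  rw [pw, pw, inner_tens, Finset.prod_const, Finset.card_univ, Fintype.card_fin]

theorem permute_tens {m : ℕ} (σ : Equiv.Perm (Fin m)) (f : Fin m → L2 μ) :
    permute μ m σ (tens μ m f) = tens μ m fun i => f (σ.symm i) := by
  ext1
  have h1 : permute μ m σ (tens μ m f) =ᵐ[_] tens μ m f ∘ fun x i => x (σ i) :=
    Lp.coeFn_compMeasurePreserving _ (measurePreserving_perm μ m σ)
  have h2 := (measurePreserving_perm μ m σ).quasiMeasurePreserving.ae (coeFn_tens μ f)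
  filter_upwards [h1, h2, coeFn_tens μ fun i => f (σ.symm i)] with x h1 h2 h3
  rw [h1, Function.comp_apply, h2, h3]
  exact Fintype.prod_equiv σ _ _ fun i => by simp

theorem mem_sym_iff {m : ℕ} (Φ : L2N μ m) : Φ ∈ sym μ m ↔ ∀ σ, permute μ m σ Φ = Φ := by
  simp [sym, Submodule.mem_iInf, sub_eq_zero]

theorem pw_mem_sym (m : ℕ) (f : L2 μ) : pw μ m f ∈ sym μ m :=
  (mem_sym_iff μ _).2 fun σ => permute_tens μ σ _

theorem inner_permute {m : ℕ} (σ : Equiv.Perm (Fin m)) (Φ Ψ : L2N μ m) :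
    inner ℂ (permute μ m σ Φ) (permute μ m σ Ψ) = inner ℂ Φ Ψ :=
  (Lp.compMeasurePreservingₗᵢ ℂ _ (measurePreserving_perm μ m σ)).inner_map_map Φ Ψ

/-! ### Totality of the product functions -/

theorem ae_eq_zero_of_setIntegral_box {m : ℕ} (φ : (Fin m → X) → ℂ)
    (h : ∀ s : Fin m → Set X, (∀ i, MeasurableSet (s i)) → (∀ i, μ (s i) < ∞) →
      IntegrableOn φ (Set.univ.pi s) (Measure.pi fun _ : Fin m => μ) ∧
      ∫ x in Set.univ.pi s, φ x ∂(Measure.pi fun _ : Fin m => μ) = 0) :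
    φ =ᵐ[Measure.pi fun _ : Fin m => μ] 0 := by
  set ν := Measure.pi fun _ : Fin m => μ
  set B : ℕ → Set (Fin m → X) := fun n => Set.univ.pi fun _ => spanningSets μ n with hB
  have hBm : ∀ n, MeasurableSet (B n) := fun n =>
    MeasurableSet.univ_pi fun _ => measurableSet_spanningSets μ n
  have hBU : ⋃ n, B n = Set.univ := by
    refine Set.eq_univ_of_forall fun x => ?_
    choose k hk using fun i => Set.mem_iUnion.1 ((iUnion_spanningSets μ).symm ▸ Set.mem_univ (x i))
    refine Set.mem_iUnion.2 ⟨Finset.univ.sup k, fun i _ => ?_⟩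
    exact monotone_spanningSets μ (Finset.le_sup (Finset.mem_univ i)) (hk i)
  have hint : ∀ n, IntegrableOn φ (B n) ν := fun n =>
    (h _ (fun _ => measurableSet_spanningSets μ n) fun _ => measure_spanningSets_lt_top μ n).1
  have key : ∀ n, ∀ s, MeasurableSet s → ∫ x in s ∩ B n, φ x ∂ν = 0 := by
    intro n s hs
    induction s, hs using MeasurableSpace.induction_on_inter
      (generateFrom_pi (α := fun _ : Fin m => X)).symm isPiSystem_pi with
    | empty => simp
    | basic t ht =>
      obtain ⟨s, hs, rfl⟩ := ht
      have hs' : ∀ i, MeasurableSet (s i) := fun i => hs i (Set.mem_univ i)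
      rw [hB, ← Set.pi_inter_distrib]
      exact (h _ (fun i => (hs' i).inter (measurableSet_spanningSets μ n)) fun i =>
        (measure_mono Set.inter_subset_right).trans_lt (measure_spanningSets_lt_top μ n)).2
    | compl t ht ih =>
      have h1 := integral_inter_add_sdiff ht (hint n)
      rw [Set.inter_comm, ih, zero_add] at h1
      have h2 : tᶜ ∩ B n = B n \ t := by rw [Set.inter_comm, Set.sdiff_eq]
      rw [h2, h1]
      exact (h _ (fun _ => measurableSet_spanningSets μ n)
        fun _ => measure_spanningSets_lt_top μ n).2
    | iUnion f hd hf ih =>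
      rw [Set.iUnion_inter, integral_iUnion (fun i => (hf i).inter (hBm n))
        (fun i j hij => (hd hij).mono Set.inter_subset_left Set.inter_subset_left)
        ((hint n).mono_set (Set.iUnion_subset fun i => Set.inter_subset_right))]
      simp [ih]
  have hz : ∀ n, φ =ᵐ[ν.restrict (B n)] 0 := fun n => by
    refine Integrable.ae_eq_zero_of_forall_setIntegral_eq_zero (hint n) fun s hs _ => ?_
    rw [Measure.restrict_restrict hs]
    exact key n s hs
  rw [← Measure.restrict_univ (μ := ν), ← hBU]
  exact (ae_restrict_iUnion_iff _ _).2 hz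

theorem eq_zero_of_inner_tens {m : ℕ} (Φ : L2N μ m)
    (h : ∀ f : Fin m → L2 μ, inner ℂ (tens μ m f) Φ = 0) : Φ = 0 := by
  refine (Lp.eq_zero_iff_ae_eq_zero).2 (ae_eq_zero_of_setIntegral_box μ _ fun s hs hs' => ?_)
  have hfin : (Measure.pi fun _ : Fin m => μ) (Set.univ.pi s) ≠ ∞ := by
    rw [Measure.pi_pi]
    exact (ENNReal.prod_lt_top fun i _ => hs' i).ne
  have hmem : MeasurableSet (Set.univ.pi s) := MeasurableSet.univ_pi hs
  refine ⟨?_, ?_⟩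
  · have : IsFiniteMeasure ((Measure.pi fun _ : Fin m => μ).restrict (Set.univ.pi s)) :=
      ⟨by rw [Measure.restrict_apply_univ]; exact hfin.lt_top⟩
    exact ((Lp.memLp Φ).restrict _).integrable (by norm_num)
  · rw [← h fun i => indicatorConstLp 2 (hs i) (hs' i).ne (1 : ℂ), inner_L2,
      ← integral_indicator hmem]
    refine integral_congr_ae ?_
    filter_upwards [coeFn_tens μ fun i => indicatorConstLp 2 (hs i) (hs' i).ne (1 : ℂ),
      ae_all_iff.2 fun i => ae_eval μ i (indicatorConstLp_coeFn (p := 2) (hs := hs i)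
        (hμs := (hs' i).ne) (c := (1 : ℂ)))] with x h1 h2
    rw [h1]
    simp only [h2]
    by_cases hx : x ∈ Set.univ.pi s
    · rw [Set.indicator_of_mem hx]
      rw [Finset.prod_congr rfl fun i _ => Set.indicator_of_mem (hx i (Set.mem_univ i)) _]
      simp
    · rw [Set.indicator_of_notMem hx]
      obtain ⟨i, hi⟩ : ∃ i, x i ∉ s i := by simpa [Set.mem_pi] using hx
      rw [Finset.prod_eq_zero (Finset.mem_univ i) (Set.indicator_of_notMem hi _)]
      simp

end Tensor

/-! ### Polarization -/

section Polarization

variable {E F : Type*} [NormedAddCommGroup E] [NormedSpace ℂ E] [NormedAddCommGroup F]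
  [NormedSpace ℂ F]

/-- The product rule for a multilinear map along a curve. -/
theorem hasDerivWithinAt_multilinear {m : ℕ} (G : ContinuousMultilinearMap ℂ (fun _ : Fin m => E) F)
    (f : ℝ → Fin m → E) (f' : Fin m → E) (S : Set ℝ) (s : ℝ)
    (h : ∀ i, HasDerivWithinAt (fun r => f r i) (f' i) S s) :
    HasDerivWithinAt (fun r => G (f r))
      (∑ i, G (Function.update (f s) i (f' i))) S s := by
  have h1 : HasFDerivAt (G.restrictScalars ℝ) ((G.restrictScalars ℝ).linearDeriv (f s)) (f s) :=
    (G.restrictScalars ℝ).hasFDerivAt (f s)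
  have h2 := h1.comp_hasDerivWithinAt s (hasDerivWithinAt_pi.2 h)
  rw [ContinuousMultilinearMap.linearDeriv_apply] at h2
  exact h2

/-- Polarization: a symmetric multilinear map that vanishes on the diagonal is zero. -/
theorem multilinear_eq_zero_of_diag {m : ℕ}
    (G : ContinuousMultilinearMap ℂ (fun _ : Fin m => E) F)
    (hsymm : ∀ (σ : Equiv.Perm (Fin m)) v, G (fun i => v (σ i)) = G v)
    (hdiag : ∀ f, G (fun _ => f) = 0) (v : Fin m → E) : G v = 0 := by
  have key : ∀ k : ℕ, k ≤ m → ∀ (v : Fin m → E) (f : E),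
      G (fun i : Fin m => if (i : ℕ) < k then v i else f) = 0 := by
    intro k
    induction k with
    | zero => intro _ v f; simpa using hdiag f
    | succ k ih =>
      intro hk v f
      set w := v ⟨k, hk⟩
      set b : Fin m → E := fun i => if (i : ℕ) < k then v i else f with hb
      set y : Fin m → E := fun i => if (i : ℕ) < k then 0 else w with hy
      -- the derivative of the vanishing function `r ↦ G (v₁, …, v_k, f + r w, …, f + r w)`
      have h1 := hasDerivWithinAt_multilinear G
        (fun r i => if (i : ℕ) < k then v i else f + r • w) y Set.univ 0 (fun i => by
          by_cases hi : (i : ℕ) < k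
          · simp only [hi, hy, if_true]
            exact hasDerivWithinAt_const _ _ _
          · simp only [hi, hy, if_false]
            simpa using ((hasDerivWithinAt_id (0 : ℝ) Set.univ).smul_const w).const_add f)
      have h0 : (fun r : ℝ => G (fun i : Fin m => if (i : ℕ) < k then v i else f + r • w)) =
          fun _ => 0 := funext fun r => ih (by omega) v (f + r • w)
      rw [h0] at h1
      have h2 := (uniqueDiffWithinAt_univ (𝕜 := ℝ) (x := (0 : ℝ))).eq_deriv Set.univ h1
        (hasDerivWithinAt_const _ _ _)
      simp only [zero_smul, add_zero] at h2
      have h3 : ∀ i : Fin m, G (Function.update b i (y i)) =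
          if (i : ℕ) < k then 0 else G (Function.update b ⟨k, hk⟩ w) := by
        intro i
        by_cases hi : (i : ℕ) < k
        · simp only [hi, hy, if_true]
          exact G.map_coord_zero i (by simp)
        · simp only [hi, hy, if_false]
          rw [← hsymm (Equiv.swap i ⟨k, hk⟩)]
          congr 1
          funext j
          by_cases h1 : j = i
          · subst h1
            by_cases h2 : j = ⟨k, hk⟩
            · subst h2; rw [Equiv.swap_self]; simp
            · simp [Function.update_of_ne h2, hb, hi, Ne.symm h2]
          · by_cases h2 : j = ⟨k, hk⟩
            · subst h2; simp
            · rw [Equiv.swap_apply_of_ne_of_ne h1 h2, Function.update_of_ne h1,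
                Function.update_of_ne h2]
      rw [Finset.sum_congr rfl fun i _ => h3 i, Finset.sum_ite, Finset.sum_const_zero, zero_add,
        Finset.sum_const, ← Nat.cast_smul_eq_nsmul ℂ] at h2
      have hne : (Finset.univ.filter fun i : Fin m => ¬ (i : ℕ) < k).card ≠ 0 := by
        rw [Finset.card_ne_zero]
        exact ⟨⟨k, hk⟩, by simp⟩
      have h4 := (smul_eq_zero.1 h2).resolve_left (Nat.cast_ne_zero.2 hne)
      rw [← h4]
      congr 1
      funext i
      by_cases hi : i = ⟨k, hk⟩
      · subst hi; simp [w]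
      · have : (i : ℕ) ≠ k := fun h => hi (Fin.ext h)
        rw [Function.update_of_ne hi, hb]
        have : (i : ℕ) < k + 1 ↔ (i : ℕ) < k := by omega
        simp only [this]
  have := key m le_rfl v 0
  simpa using this

end Polarization

/-! ### Pure powers -/

section PurePowers

variable {X : Type*} [MeasurableSpace X] (μ : Measure X) [SigmaFinite μ]

/-- The multilinear functional `f ↦ ⟨Φ, f₁ ⊗ ⋯ ⊗ f_m⟩`. -/
def tensFunctional {m : ℕ} (Φ : L2N μ m) : ContinuousMultilinearMap ℂ (fun _ : Fin m => L2 μ) ℂ :=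
  (innerSL ℂ Φ).compContinuousMultilinearMap (tens μ m)

theorem tensFunctional_apply {m : ℕ} (Φ : L2N μ m) (f : Fin m → L2 μ) :
    tensFunctional μ Φ f = inner ℂ Φ (tens μ m f) := rfl

theorem tensFunctional_perm {m : ℕ} {Φ : L2N μ m} (hΦ : Φ ∈ sym μ m) (σ : Equiv.Perm (Fin m))
    (f : Fin m → L2 μ) : inner ℂ Φ (tens μ m fun i => f (σ i)) = inner ℂ Φ (tens μ m f) := by
  have h := permute_tens μ σ.symm f
  rw [Equiv.symm_symm] at h
  rw [← h]
  conv_lhs => rw [← (mem_sym_iff μ Φ).1 hΦ σ.symm]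
  exact inner_permute μ _ _ _

theorem inner_tens_eq_zero {m : ℕ} {Φ : L2N μ m} (hΦ : Φ ∈ sym μ m) (M : Submodule ℂ (L2 μ))
    (h : ∀ f ∈ M, inner ℂ Φ (pw μ m f) = 0) (f : Fin m → L2 μ) (hf : ∀ i, f i ∈ M) :
    inner ℂ Φ (tens μ m f) = 0 := by
  have := multilinear_eq_zero_of_diag
    ((tensFunctional μ Φ).compContinuousLinearMap fun _ => M.subtypeL)
    (fun σ v => tensFunctional_perm μ hΦ σ fun i => (v i : L2 μ))
    (fun f => h f f.2) (fun i => ⟨f i, hf i⟩)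
  exact this

theorem eq_zero_of_inner_pw {m : ℕ} {Φ : L2N μ m} (hΦ : Φ ∈ sym μ m)
    (h : ∀ f, inner ℂ Φ (pw μ m f) = 0) : Φ = 0 :=
  eq_zero_of_inner_tens μ Φ fun f => by
    rw [← inner_conj_symm, inner_tens_eq_zero μ hΦ ⊤ (fun f _ => h f) f fun _ => trivial, map_zero]

/-! ### Product of two functions, contraction -/

variable {α β : Type*} [MeasurableSpace α] [MeasurableSpace β] (κ : Measure α) (ν : Measure β)
  [SigmaFinite κ] [SigmaFinite ν]

theorem memLp_mul (a : L2 κ) (b : L2 ν) :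
    MemLp (fun p : α × β => a p.1 * b p.2) 2 (κ.prod ν) := by
  have hm : AEStronglyMeasurable (fun p : α × β => a p.1 * b p.2) (κ.prod ν) :=
    (Lp.aestronglyMeasurable a).comp_fst.mul (Lp.aestronglyMeasurable b).comp_snd
  rw [memLp_two_iff_integrable_sq_norm hm]
  have := Integrable.mul_prod (μ := κ) (ν := ν)
    ((memLp_two_iff_integrable_sq_norm (Lp.aestronglyMeasurable _)).1 (Lp.memLp a))
    ((memLp_two_iff_integrable_sq_norm (Lp.aestronglyMeasurable _)).1 (Lp.memLp b))
  simpa only [norm_mul, mul_pow] using this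

/-- The product function `a ⊗ b`. -/
def prodMul (a : L2 κ) (b : L2 ν) : L2 (κ.prod ν) := (memLp_mul κ ν a b).toLp _

theorem coeFn_prodMul (a : L2 κ) (b : L2 ν) :
    prodMul κ ν a b =ᵐ[κ.prod ν] fun p => a p.1 * b p.2 := MemLp.coeFn_toLp _

theorem inner_prodMul (a a' : L2 κ) (b b' : L2 ν) :
    inner ℂ (prodMul κ ν a b) (prodMul κ ν a' b') = inner ℂ a a' * inner ℂ b b' := by
  rw [inner_L2, inner_L2, inner_L2, ← integral_prod_mul]
  refine integral_congr_ae ?_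
  filter_upwards [coeFn_prodMul κ ν a b, coeFn_prodMul κ ν a' b'] with p h1 h2
  rw [h1, h2, map_mul]
  ring

theorem coeFn_contract (K : L2 ν) (Ψ : L2 (κ.prod ν)) :
    contract κ ν K Ψ =ᵐ[κ] fun a => ∫ b, conj (K b) * Ψ (a, b) ∂ν :=
  MemLp.coeFn_toLp (contract_memLp κ ν K Ψ)

theorem inner_contract (K : L2 ν) (Ψ : L2 (κ.prod ν)) (a : L2 κ) :
    inner ℂ a (contract κ ν K Ψ) = inner ℂ (prodMul κ ν a K) Ψ := by
  have hi : Integrable (fun p => conj (prodMul κ ν a K p) * Ψ p) (κ.prod ν) :=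
    (Lp.memLp (prodMul κ ν a K)).star.integrable_mul (Lp.memLp Ψ)
  rw [inner_L2, inner_L2, integral_prod _ hi]
  refine integral_congr_ae ?_
  filter_upwards [coeFn_contract κ ν K Ψ, Measure.ae_ae_of_ae_prod (coeFn_prodMul κ ν a K)]
    with x h1 h2
  rw [h1, ← integral_const_mul]
  refine integral_congr_ae ?_
  filter_upwards [h2] with y h3
  rw [h3, map_mul]
  ring

theorem contract_prodMul (K b : L2 ν) (a : L2 κ) :
    contract κ ν K (prodMul κ ν a b) = (inner ℂ K b : ℂ) • a := by
  refine ext_inner_left ℂ fun c => ?_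
  rw [inner_contract, inner_prodMul, inner_smul_right, mul_comm]

theorem comp_snoc_tens (m : ℕ) (f : Fin (m + 1) → L2 μ) :
    Lp.compMeasurePreservingₗᵢ ℂ _ (measurePreserving_snoc μ m) (tens μ (m + 1) f) =
      prodMul _ μ (tens μ m fun i => f i.castSucc) (f (Fin.last m)) := by
  ext1
  have h1 := Lp.coeFn_compMeasurePreserving (tens μ (m + 1) f) (measurePreserving_snoc μ m)
  have h2 := (measurePreserving_snoc μ m).quasiMeasurePreserving.ae (coeFn_tens μ f)
  have h3 := Measure.quasiMeasurePreserving_fst (μ := Measure.pi fun _ : Fin m => μ) (ν := μ) |>.ae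
    (coeFn_tens μ fun i : Fin m => f i.castSucc)
  refine Filter.EventuallyEq.trans h1 ?_
  filter_upwards [h2, h3, coeFn_prodMul _ μ (tens μ m fun i => f i.castSucc) (f (Fin.last m))]
    with p h2 h3 h4
  rw [Function.comp_apply, h2, h4, h3, Fin.prod_univ_castSucc]
  simp

theorem comp_snoc_snoc_tens (m : ℕ) (f : Fin (m + 2) → L2 μ) :
    Lp.compMeasurePreservingₗᵢ ℂ _ (measurePreserving_snoc_snoc μ m) (tens μ (m + 2) f) =
      prodMul _ (μ.prod μ) (tens μ m fun i => f i.castSucc.castSucc)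
        (prodMul μ μ (f (Fin.last m).castSucc) (f (Fin.last (m + 1)))) := by
  ext1
  have h1 := Lp.coeFn_compMeasurePreserving (tens μ (m + 2) f) (measurePreserving_snoc_snoc μ m)
  have h2 := (measurePreserving_snoc_snoc μ m).quasiMeasurePreserving.ae (coeFn_tens μ f)
  have h3 := Measure.quasiMeasurePreserving_fst (μ := Measure.pi fun _ : Fin m => μ)
    (ν := μ.prod μ) |>.ae (coeFn_tens μ fun i : Fin m => f i.castSucc.castSucc)
  have h5 := Measure.quasiMeasurePreserving_snd (μ := Measure.pi fun _ : Fin m => μ)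
    (ν := μ.prod μ) |>.ae (coeFn_prodMul μ μ (f (Fin.last m).castSucc) (f (Fin.last (m + 1))))
  refine Filter.EventuallyEq.trans h1 ?_
  filter_upwards [h2, h3, coeFn_prodMul _ (μ.prod μ) (tens μ m fun i => f i.castSucc.castSucc)
    (prodMul μ μ (f (Fin.last m).castSucc) (f (Fin.last (m + 1)))), h5] with p h2 h3 h4 h5
  rw [Function.comp_apply, h2, h4, h3, h5, Fin.prod_univ_castSucc, Fin.prod_univ_castSucc]
  simp [mul_assoc]

theorem annihilate_tens (u : L2 μ) (m : ℕ) (f : Fin (m + 1) → L2 μ) :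
    annihilate μ u m (tens μ (m + 1) f) =
      ((√(m + 1 : ℝ) : ℝ) : ℂ) • (inner ℂ u (f (Fin.last m)) : ℂ) •
        tens μ m fun i => f i.castSucc := by
  rw [annihilate, _root_.smul_apply, ContinuousLinearMap.comp_apply]
  congr 1
  rw [← contract_prodMul, ← comp_snoc_tens]
  rfl

theorem annihilate_pw (u : L2 μ) (m : ℕ) (f : L2 μ) :
    annihilate μ u m (pw μ (m + 1) f) =
      ((√(m + 1 : ℝ) : ℝ) : ℂ) • (inner ℂ u f : ℂ) • pw μ m f := annihilate_tens μ u m _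

theorem annihilatePair_pw (K : L2 (μ.prod μ)) (m : ℕ) (f : L2 μ) :
    annihilatePair μ K m (pw μ (m + 2) f) =
      ((√((m + 1 : ℝ) * (m + 2)) : ℝ) : ℂ) • (inner ℂ K (prodMul μ μ f f) : ℂ) • pw μ m f := by
  rw [annihilatePair, _root_.smul_apply, ContinuousLinearMap.comp_apply]
  congr 1
  rw [← contract_prodMul]
  congr 1
  exact comp_snoc_snoc_tens μ m _

end PurePowers

/-! ### The symmetric tensor powers of the complement of a vector -/

section SymPlus

variable {X : Type*} [MeasurableSpace X] (μ : Measure X) [SigmaFinite μ] (u : L2 μ)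

theorem symPlus_le_sym (m : ℕ) : symPlus μ u m ≤ sym μ m := by
  cases m with
  | zero => exact le_rfl
  | succ m => exact inf_le_left

theorem inner_tens_of_mem_symPlus {m : ℕ} {Φ : L2N μ m} (hΦ : Φ ∈ symPlus μ u m)
    (f : Fin m → L2 μ) (i : Fin m) (hi : f i = u) : inner ℂ Φ (tens μ m f) = 0 := by
  cases m with
  | zero => exact i.elim0
  | succ m =>
    have h1 : annihilate μ u m Φ = 0 := hΦ.2
    rw [← tensFunctional_perm μ hΦ.1 (Equiv.swap i (Fin.last m)) f]
    set g : Fin (m + 1) → L2 μ := fun j => f (Equiv.swap i (Fin.last m) j) with hg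
    have hlast : g (Fin.last m) = u := by simp [hg, hi]
    have h2 : ((√(m + 1 : ℝ) : ℝ) : ℂ) • contract (Measure.pi fun _ : Fin m => μ) μ u
        (Lp.compMeasurePreservingₗᵢ ℂ _ (measurePreserving_snoc μ m) Φ) = 0 := h1
    have hne : ((√(m + 1 : ℝ) : ℝ) : ℂ) ≠ 0 := by
      rw [Complex.ofReal_ne_zero]
      positivity
    have h3 := (smul_eq_zero.1 h2).resolve_left hne
    have h4 := inner_contract (Measure.pi fun _ : Fin m => μ) μ u
      (Lp.compMeasurePreservingₗᵢ ℂ _ (measurePreserving_snoc μ m) Φ)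
      (tens μ m fun i => g i.castSucc)
    rw [h3, inner_zero_right, ← hlast, ← comp_snoc_tens, LinearIsometry.inner_map_map] at h4
    rw [← inner_conj_symm, ← h4, map_zero]

theorem pw_mem_symPlus (m : ℕ) {f : L2 μ} (hf : inner ℂ u f = 0) : pw μ m f ∈ symPlus μ u m := by
  cases m with
  | zero => exact pw_mem_sym μ 0 f
  | succ m =>
    refine ⟨pw_mem_sym μ _ f, ?_⟩
    change annihilate μ u m (pw μ (m + 1) f) = 0
    rw [annihilate_pw, hf, zero_smul, smul_zero]

/-- Vectors of `symPlus` only see the components of `f₁, …, f_m` orthogonal to `u`. -/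
theorem inner_tens_sub_smul {m : ℕ} {Φ : L2N μ m} (hΦ : Φ ∈ symPlus μ u m)
    (f : Fin m → L2 μ) (c : Fin m → ℂ) :
    inner ℂ Φ (tens μ m fun i => c i • u + f i) = inner ℂ Φ (tens μ m f) := by
  have h := (tensFunctional μ Φ).map_add_univ (fun i => c i • u) f
  have h0 : ∀ s : Finset (Fin m), s ≠ ∅ →
      tensFunctional μ Φ (s.piecewise (fun i => c i • u) f) = 0 := by
    intro s hs
    obtain ⟨i, hi⟩ := Finset.nonempty_iff_ne_empty.2 hs
    have h1 : s.piecewise (fun i => c i • u) f =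
        Function.update (s.piecewise (fun i => c i • u) f) i (c i • u) := by
      rw [eq_comm, Function.update_eq_self_iff, Finset.piecewise_eq_of_mem _ _ _ hi]
    rw [h1, ContinuousMultilinearMap.map_update_smul, tensFunctional_apply,
      inner_tens_of_mem_symPlus μ u hΦ _ i (Function.update_self ..), smul_zero]
  rw [Finset.sum_eq_single ∅ (fun s _ hs => h0 s hs) (by simp), Finset.piecewise_empty] at h
  exact h

theorem eq_zero_of_mem_symPlus {m : ℕ} {Φ : L2N μ m} (hu : ‖u‖ = 1) (hΦ : Φ ∈ symPlus μ u m)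
    (h : ∀ f, inner ℂ u f = 0 → inner ℂ Φ (pw μ m f) = 0) : Φ = 0 := by
  refine eq_zero_of_inner_pw μ (symPlus_le_sym μ u m hΦ) fun f => ?_
  have h1 := inner_tens_sub_smul μ u hΦ (fun _ => f) (fun _ => -inner ℂ u f)
  rw [pw, ← h1]
  refine h _ ?_
  rw [inner_add_right, inner_smul_right, inner_self_eq_norm_sq_to_K, hu]
  simp

theorem Q_apply (hu : ‖u‖ = 1) (f : L2 μ) : Q μ u f = f - (inner ℂ u f : ℂ) • u := by
  rw [Q, Submodule.starProjection_orthogonal_val, Submodule.starProjection_unit_singleton ℂ hu]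

theorem inner_Q (hu : ‖u‖ = 1) (f : L2 μ) : inner ℂ u (Q μ u f) = 0 := by
  rw [Q_apply μ u hu, inner_sub_right, inner_smul_right, inner_self_eq_norm_sq_to_K, hu]
  simp

theorem Q_of_inner_eq_zero (hu : ‖u‖ = 1) {f : L2 μ} (hf : inner ℂ u f = 0) : Q μ u f = f := by
  rw [Q_apply μ u hu, hf, zero_smul, sub_zero]

theorem adjoint_Q : ContinuousLinearMap.adjoint (Q μ u) = Q μ u :=
  (isSelfAdjoint_starProjection _)

theorem inner_Q_left (f g : L2 μ) : inner ℂ (Q μ u f) g = inner ℂ f (Q μ u g) := by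
  conv_lhs => rw [← adjoint_Q, ContinuousLinearMap.adjoint_inner_left]

/-- The projection of `f ⊗ ⋯ ⊗ f` onto the excited space is `Qf ⊗ ⋯ ⊗ Qf`. -/
theorem projection_pw (hu : ‖u‖ = 1) (m : ℕ) (f : L2 μ) :
    (symPlus μ u m).orthogonalProjectionOnto (pw μ m f) =
      ⟨pw μ m (Q μ u f), pw_mem_symPlus μ u m (inner_Q μ u hu f)⟩ := by
  refine ext_inner_left ℂ fun Φ => ?_
  rw [Submodule.inner_orthogonalProjectionOnto_eq_of_mem_left, Submodule.coe_inner]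
  have h := inner_tens_sub_smul μ u Φ.2 (fun _ => Q μ u f) (fun _ => inner ℂ u f)
  change inner ℂ (Φ : L2N μ m) (tens μ m fun _ => f) =
    inner ℂ (Φ : L2N μ m) (tens μ m fun _ => Q μ u f)
  rw [← h]
  congr 3
  funext i
  rw [Q_apply μ u hu]
  abel

theorem continuous_pw (m : ℕ) : Continuous (pw μ m) :=
  (tens μ m).cont.comp (continuous_pi fun _ => continuous_id)

end SymPlus

/-! ### Unbounded operators -/

section UnboundedOperators

variable {E F : Type*} [NormedAddCommGroup E] [InnerProductSpace ℂ E]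
  [NormedAddCommGroup F] [InnerProductSpace ℂ F]

theorem apply_eq_of_mem_graph {A : E →ₗ.[ℂ] E} {x y : E} (h : (x, y) ∈ A.graph)
    (hx : x ∈ A.domain) : A ⟨x, hx⟩ = y :=
  A.mem_graph_snd_inj (A.mem_graph ⟨x, hx⟩) h rfl

theorem mem_graph_mk {A : E →ₗ.[ℂ] E} {x y : E} (hx : x ∈ A.domain) (h : A ⟨x, hx⟩ = y) :
    (x, y) ∈ A.graph := h ▸ A.mem_graph ⟨x, hx⟩

theorem inner_eq_of_mem_graph {A : E →ₗ.[ℂ] E} (hA : A.IsFormalAdjoint A) {x y x' y' : E}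
    (h : (x, y) ∈ A.graph) (h' : (x', y') ∈ A.graph) : inner ℂ y x' = inner ℂ x y' := by
  have hx := A.mem_domain_of_mem_graph h
  have hx' := A.mem_domain_of_mem_graph h'
  rw [← apply_eq_of_mem_graph h hx, ← apply_eq_of_mem_graph h' hx']
  exact hA ⟨x, hx⟩ ⟨x', hx'⟩

theorem isFormalAdjoint_of_graph {A : E →ₗ.[ℂ] E} (h : ∀ p ∈ A.graph, ∀ q ∈ A.graph,
    inner ℂ p.2 q.1 = inner ℂ p.1 q.2) : A.IsFormalAdjoint A := fun x y =>
  h _ (A.mem_graph x) _ (A.mem_graph y)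

theorem inner_eq_on_closure {g : Submodule ℂ (E × E)}
    (h : ∀ p ∈ g, ∀ q ∈ g, inner ℂ p.2 q.1 = inner ℂ p.1 q.2) :
    ∀ p ∈ g.topologicalClosure, ∀ q ∈ g.topologicalClosure,
      inner ℂ p.2 q.1 = inner ℂ p.1 q.2 := by
  have h1 : ∀ p ∈ g, ∀ q ∈ g.topologicalClosure, inner ℂ p.2 q.1 = inner ℂ p.1 q.2 := by
    intro p hp q hq
    have hc : IsClosed {q : E × E | inner ℂ p.2 q.1 = inner ℂ p.1 q.2} :=
      isClosed_eq (by fun_prop) (by fun_prop)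
    exact closure_minimal (h p hp) hc hq
  intro p hp q hq
  have hc : IsClosed {p : E × E | inner ℂ p.2 q.1 = inner ℂ p.1 q.2} :=
    isClosed_eq (by fun_prop) (by fun_prop)
  exact closure_minimal (fun p hp => h1 p hp q hq) hc hp

theorem inner_eq_on_span {s : Set (E × E)}
    (h : ∀ p ∈ s, ∀ q ∈ s, inner ℂ p.2 q.1 = inner ℂ p.1 q.2) :
    ∀ p ∈ Submodule.span ℂ s, ∀ q ∈ Submodule.span ℂ s, inner ℂ p.2 q.1 = inner ℂ p.1 q.2 := by
  intro p hp q hq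
  induction hp, hq using Submodule.span_induction₂ with
  | mem_mem p q hp hq => exact h p hp q hq
  | zero_left q hq => simp
  | zero_right p hp => simp
  | add_left p p' q _ _ _ h1 h2 => simp [h1, h2]
  | add_right p q q' _ _ _ h1 h2 => simp [h1, h2]
  | smul_left c p q _ _ h1 => simp [h1]
  | smul_right c p q _ _ h1 => simp [h1]

/-- A subspace of `E × E` on which the symmetry identity holds is a graph as soon as its projection
to the first factor is dense. -/
theorem toLinearPMap_graph_of_symm {g : Submodule ℂ (E × E)}
    (h : ∀ p ∈ g, ∀ q ∈ g, inner ℂ p.2 q.1 = inner ℂ p.1 q.2)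
    (hd : Dense (Prod.fst '' (g : Set (E × E)))) : g.toLinearPMap.graph = g := by
  refine Submodule.toLinearPMap_graph_eq g fun p hp h0 => ?_
  refine hd.eq_zero_of_inner_left ℂ ?_
  rintro _ ⟨q, hq, rfl⟩
  rw [h p hp q hq, h0, inner_zero_left]

theorem mem_compress_domain [CompleteSpace E] {S : Submodule ℂ E} [CompleteSpace S]
    {A : E →ₗ.[ℂ] E} {x : S} : x ∈ (compress S A).domain ↔ (x : E) ∈ A.domain := by
  change ContinuousLinearMap.adjoint S.orthogonalProjectionOnto x ∈ A.domain ↔ _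
  rw [Submodule.adjoint_orthogonalProjectionOnto]
  rfl

theorem compress_apply [CompleteSpace E] {S : Submodule ℂ E} [CompleteSpace S]
    {A : E →ₗ.[ℂ] E} {x : S} (hx : x ∈ (compress S A).domain) :
    compress S A ⟨x, hx⟩ =
      S.orthogonalProjectionOnto (A ⟨x, mem_compress_domain.1 hx⟩) := by
  refine congrArg (fun y => S.orthogonalProjectionOnto (A y)) (Subtype.ext ?_)
  exact DFunLike.congr_fun (Submodule.adjoint_orthogonalProjectionOnto S) x

theorem mem_compress_graph [CompleteSpace E] {S : Submodule ℂ E} [CompleteSpace S]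
    {A : E →ₗ.[ℂ] E} {x y : S} : (x, y) ∈ (compress S A).graph ↔
      ∃ z, ((x : E), z) ∈ A.graph ∧ S.orthogonalProjectionOnto z = y := by
  constructor
  · intro h
    have hx := (compress S A).mem_domain_of_mem_graph h
    refine ⟨_, A.mem_graph ⟨x, mem_compress_domain.1 hx⟩, ?_⟩
    rw [← compress_apply hx, apply_eq_of_mem_graph h]
  · rintro ⟨z, hz, rfl⟩
    have hx := A.mem_domain_of_mem_graph hz
    refine mem_graph_mk (mem_compress_domain.2 hx) ?_
    rw [compress_apply, apply_eq_of_mem_graph hz]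

theorem mem_compress_graph_of_mem [CompleteSpace E] {S : Submodule ℂ E} [CompleteSpace S]
    {A : E →ₗ.[ℂ] E} {x y : S} (h : ((x : E), (y : E)) ∈ A.graph) :
    (x, y) ∈ (compress S A).graph :=
  mem_compress_graph.2 ⟨y, h, Submodule.orthogonalProjectionOnto_mem_subspace_eq_self y⟩

theorem isFormalAdjoint_compress [CompleteSpace E] (S : Submodule ℂ E) [CompleteSpace S]
    {A : E →ₗ.[ℂ] E} (hA : A.IsFormalAdjoint A) :
    (compress S A).IsFormalAdjoint (compress S A) := by
  refine isFormalAdjoint_of_graph ?_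
  rintro ⟨x, y⟩ hp ⟨x', y'⟩ hq
  obtain ⟨z, hz, rfl⟩ := mem_compress_graph.1 hp
  obtain ⟨z', hz', rfl⟩ := mem_compress_graph.1 hq
  simp only [Submodule.inner_orthogonalProjectionOnto_eq_of_mem_left,
    Submodule.inner_orthogonalProjectionOnto_eq_of_mem_right]
  exact inner_eq_of_mem_graph hA hz hz'

theorem mem_sandwich_graph [CompleteSpace E] [CompleteSpace F] {B : E →L[ℂ] F}
    {A : E →ₗ.[ℂ] E} {x y : F} : (x, y) ∈ (sandwich B A).graph ↔
      ∃ z, (ContinuousLinearMap.adjoint B x, z) ∈ A.graph ∧ B z = y := by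
  constructor
  · intro h
    have hx := (sandwich B A).mem_domain_of_mem_graph h
    exact ⟨_, A.mem_graph ⟨_, hx⟩, apply_eq_of_mem_graph h hx⟩
  · rintro ⟨z, hz, rfl⟩
    have hx := A.mem_domain_of_mem_graph hz
    refine mem_graph_mk (A := sandwich B A) hx ?_
    change B (A _) = _
    rw [apply_eq_of_mem_graph hz]

theorem isFormalAdjoint_sandwich [CompleteSpace E] [CompleteSpace F] (B : E →L[ℂ] F)
    {A : E →ₗ.[ℂ] E} (hA : A.IsFormalAdjoint A) :
    (sandwich B A).IsFormalAdjoint (sandwich B A) := by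
  refine isFormalAdjoint_of_graph ?_
  rintro ⟨x, y⟩ hp ⟨x', y'⟩ hq
  obtain ⟨z, hz, rfl⟩ := mem_sandwich_graph.1 hp
  obtain ⟨z', hz', rfl⟩ := mem_sandwich_graph.1 hq
  simp only
  rw [← ContinuousLinearMap.adjoint_inner_right B z x',
    ← ContinuousLinearMap.adjoint_inner_left B z' x]
  exact inner_eq_of_mem_graph hA hz hz'

theorem add_mem_graph {A B : E →ₗ.[ℂ] E} {x y z : E} (hA : (x, y) ∈ A.graph)
    (hB : (x, z) ∈ B.graph) : (x, y + z) ∈ (A + B).graph := by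
  have h1 := A.mem_domain_of_mem_graph hA
  have h2 := B.mem_domain_of_mem_graph hB
  refine mem_graph_mk (A := A + B) (Submodule.mem_inf.2 ⟨h1, h2⟩) ?_
  rw [LinearPMap.add_apply, apply_eq_of_mem_graph hA, apply_eq_of_mem_graph hB]

theorem exists_of_mem_add_graph {A B : E →ₗ.[ℂ] E} {x y : E} (h : (x, y) ∈ (A + B).graph) :
    ∃ a b, (x, a) ∈ A.graph ∧ (x, b) ∈ B.graph ∧ a + b = y := by
  have hx := (A + B).mem_domain_of_mem_graph h
  exact ⟨_, _, A.mem_graph ⟨x, hx.1⟩, B.mem_graph ⟨x, hx.2⟩,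
    (LinearPMap.add_apply A B ⟨x, hx⟩).symm.trans (apply_eq_of_mem_graph h hx)⟩

theorem smul_mem_graph {A : E →ₗ.[ℂ] E} {x y : E} (c : ℂ) (h : (x, y) ∈ A.graph) :
    (x, c • y) ∈ (c • A).graph := by
  have hx := A.mem_domain_of_mem_graph h
  refine mem_graph_mk (A := c • A) hx ?_
  rw [LinearPMap.smul_apply]
  exact congrArg _ (apply_eq_of_mem_graph h hx)

theorem exists_of_mem_smul_graph {A : E →ₗ.[ℂ] E} {x y : E} {c : ℂ}
    (h : (x, y) ∈ (c • A).graph) : ∃ a, (x, a) ∈ A.graph ∧ c • a = y := by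
  have hx := (c • A).mem_domain_of_mem_graph h
  exact ⟨_, A.mem_graph ⟨x, hx⟩,
    (LinearPMap.smul_apply c A ⟨x, hx⟩).symm.trans (apply_eq_of_mem_graph h hx)⟩

theorem sub_mem_graph {A B : E →ₗ.[ℂ] E} {x y z : E} (hA : (x, y) ∈ A.graph)
    (hB : (x, z) ∈ B.graph) : (x, y - z) ∈ (A - B).graph := by
  have h1 := A.mem_domain_of_mem_graph hA
  have h2 := B.mem_domain_of_mem_graph hB
  refine mem_graph_mk (A := A - B) (Submodule.mem_inf.2 ⟨h1, h2⟩) ?_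
  rw [LinearPMap.sub_apply, apply_eq_of_mem_graph hA, apply_eq_of_mem_graph hB]

theorem exists_of_mem_sub_graph {A B : E →ₗ.[ℂ] E} {x y : E} (h : (x, y) ∈ (A - B).graph) :
    ∃ a b, (x, a) ∈ A.graph ∧ (x, b) ∈ B.graph ∧ a - b = y := by
  have hx := (A - B).mem_domain_of_mem_graph h
  exact ⟨_, _, A.mem_graph ⟨x, hx.1⟩, B.mem_graph ⟨x, hx.2⟩,
    (LinearPMap.sub_apply A B ⟨x, hx⟩).symm.trans (apply_eq_of_mem_graph h hx)⟩

theorem mem_everywhere_graph (B : E →L[ℂ] E) (x : E) : (x, B x) ∈ (everywhere B).graph :=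
  mem_graph_mk (A := everywhere B) trivial rfl

theorem eq_of_mem_everywhere_graph {B : E →L[ℂ] E} {x y : E}
    (h : (x, y) ∈ (everywhere B).graph) : y = B x :=
  (everywhere B).mem_graph_snd_inj h (mem_everywhere_graph B x) rfl

theorem isFormalAdjoint_add {A B : E →ₗ.[ℂ] E} (hA : A.IsFormalAdjoint A)
    (hB : B.IsFormalAdjoint B) : (A + B).IsFormalAdjoint (A + B) := by
  refine isFormalAdjoint_of_graph ?_
  rintro ⟨x, y⟩ hp ⟨x', y'⟩ hq
  obtain ⟨a, b, ha, hb, rfl⟩ := exists_of_mem_add_graph hp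
  obtain ⟨a', b', ha', hb', rfl⟩ := exists_of_mem_add_graph hq
  simp only [inner_add_left, inner_add_right]
  rw [inner_eq_of_mem_graph hA ha ha', inner_eq_of_mem_graph hB hb hb']

theorem isFormalAdjoint_smul {A : E →ₗ.[ℂ] E} (hA : A.IsFormalAdjoint A) {c : ℂ}
    (hc : conj c = c) : (c • A).IsFormalAdjoint (c • A) := by
  refine isFormalAdjoint_of_graph ?_
  rintro ⟨x, y⟩ hp ⟨x', y'⟩ hq
  obtain ⟨a, ha, rfl⟩ := exists_of_mem_smul_graph hp
  obtain ⟨a', ha', rfl⟩ := exists_of_mem_smul_graph hq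
  simp only [inner_smul_left, inner_smul_right, hc]
  rw [inner_eq_of_mem_graph hA ha ha']

theorem isFormalAdjoint_everywhere {B : E →L[ℂ] E}
    (hB : ∀ x y, inner ℂ (B x) y = inner ℂ x (B y)) :
    (everywhere B).IsFormalAdjoint (everywhere B) := fun x y => hB x y

theorem isFormalAdjoint_of_isSelfAdjoint [CompleteSpace E] {A : E →ₗ.[ℂ] E}
    (hA : IsSelfAdjoint A) : A.IsFormalAdjoint A := by
  have h := LinearPMap.adjoint_isFormalAdjoint hA.dense_domain
  rwa [LinearPMap.isSelfAdjoint_def.1 hA] at h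

end UnboundedOperators

/-! ### Sums of one-body operators -/

section SumOp

variable {X : Type*} [MeasurableSpace X] (μ : Measure X) [SigmaFinite μ]

/-- The derivative of `f ↦ f ⊗ ⋯ ⊗ f` in the direction `g`. -/
def dpw (m : ℕ) (f g : L2 μ) : L2N μ m :=
  ∑ i, tens μ m (Function.update (fun _ => f) i g)

theorem inner_tens_update {m : ℕ} (g f : Fin m → L2 μ) (i : Fin m) (h : L2 μ) :
    inner ℂ (tens μ m g) (tens μ m (Function.update f i h)) =
      inner ℂ (g i) h * ∏ j ∈ Finset.univ.erase i, inner ℂ (g j) (f j) := by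
  rw [inner_tens, ← Finset.mul_prod_erase _ _ (Finset.mem_univ i), Function.update_self]
  congr 1
  refine Finset.prod_congr rfl fun j hj => ?_
  rw [Function.update_of_ne (Finset.ne_of_mem_erase hj)]

theorem inner_pw_dpw (m : ℕ) (g f h : L2 μ) :
    inner ℂ (pw μ m g) (dpw μ m f h) = m * inner ℂ g h * inner ℂ g f ^ (m - 1) := by
  rw [pw, dpw, inner_sum]
  simp only [inner_tens_update, Finset.prod_const, Finset.card_erase_of_mem (Finset.mem_univ _),
    Finset.card_univ, Fintype.card_fin, Finset.sum_const, nsmul_eq_mul, mul_assoc]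

theorem dpw_mem_sym (m : ℕ) (f g : L2 μ) : dpw μ m f g ∈ sym μ m := by
  refine (mem_sym_iff μ _).2 fun σ => ?_
  rw [dpw, map_sum]
  refine Fintype.sum_equiv σ _ _ fun i => ?_
  rw [permute_tens]
  congr 1
  funext j
  by_cases h : j = σ i
  · subst h; simp
  · have : σ.symm j ≠ i := fun h' => h (by rw [← h', Equiv.apply_symm_apply])
    rw [Function.update_of_ne this, Function.update_of_ne h]

theorem dpw_mem_symPlus (u : L2 μ) (m : ℕ) {f g : L2 μ} (hf : inner ℂ u f = 0)
    (hg : inner ℂ u g = 0) : dpw μ m f g ∈ symPlus μ u m := by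
  cases m with
  | zero => exact dpw_mem_sym μ 0 f g
  | succ m =>
    refine ⟨dpw_mem_sym μ _ f g, ?_⟩
    change annihilate μ u m (dpw μ (m + 1) f g) = 0
    rw [dpw, map_sum]
    refine Finset.sum_eq_zero fun i _ => ?_
    rw [annihilate_tens]
    have : inner ℂ u (Function.update (fun _ : Fin (m + 1) => f) i g (Fin.last m)) = 0 := by
      rw [Function.update_apply]
      split_ifs
      · exact hg
      · exact hf
    rw [this, zero_smul, smul_zero]

variable (A : L2 μ →ₗ.[ℂ] L2 μ) (m : ℕ)

/-- The graph of `∑ A_i` on the span of the product functions. -/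
def sumGraph : Submodule ℂ (L2N μ m × L2N μ m) :=
  Submodule.span ℂ (Set.range fun f : Fin m → A.domain =>
    (tens μ m fun i => (f i : L2 μ),
      ∑ i, tens μ m (Function.update (fun i => (f i : L2 μ)) i (A (f i)))))

theorem sumOp_eq : sumOp μ A m = (sumGraph μ A m).topologicalClosure.toLinearPMap := by
  rw [sumOp, sumGraph]
  congr 3
  ext ⟨p, q⟩
  have hsum : ∀ f : Fin m → A.domain,
      (∑ i, tens μ m (Function.update (fun i => (f i : L2 μ)) i (A (f i))) : L2N μ m)
      =ᵐ[Measure.pi fun _ : Fin m => μ] fun x =>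
        ∑ i, (A (f i)) (x i) * ∏ j ∈ Finset.univ.erase i, (f j : L2 μ) (x j) := by
    intro f
    have h1 := Lp.coeFn_finsetSum (E := ℂ) (p := 2) (μ := Measure.pi fun _ : Fin m => μ)
      Finset.univ (fun i => tens μ m (Function.update (fun i => (f i : L2 μ)) i (A (f i))))
    have h2 := ae_all_iff.2 fun i =>
      coeFn_tens μ (Function.update (fun i => (f i : L2 μ)) i (A (f i)))
    filter_upwards [h1, h2] with x h1 h2
    rw [h1, Finset.sum_apply]
    refine Finset.sum_congr rfl fun i _ => ?_
    rw [h2, ← Finset.mul_prod_erase _ _ (Finset.mem_univ i), Function.update_self]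
    congr 1
    refine Finset.prod_congr rfl fun j hj => ?_
    rw [Function.update_of_ne (Finset.ne_of_mem_erase hj)]
  constructor
  · rintro ⟨f, h1, h2⟩
    refine ⟨f, Prod.ext ?_ ?_⟩
    · ext1
      exact (coeFn_tens μ _).trans h1.symm
    · ext1
      exact (hsum f).trans h2.symm
  · rintro ⟨f, h⟩
    obtain ⟨rfl, rfl⟩ := Prod.ext_iff.1 h
    exact ⟨f, coeFn_tens μ _, hsum f⟩

variable {A} (hA : A.IsFormalAdjoint A) (hd : Dense (A.domain : Set (L2 μ)))

include hA in
theorem inner_sumGraph : ∀ p ∈ (sumGraph μ A m).topologicalClosure,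
    ∀ q ∈ (sumGraph μ A m).topologicalClosure, inner ℂ p.2 q.1 = inner ℂ p.1 q.2 := by
  refine inner_eq_on_closure (inner_eq_on_span ?_)
  rintro _ ⟨f, rfl⟩ _ ⟨g, rfl⟩
  simp only [sum_inner, inner_sum]
  refine Finset.sum_congr rfl fun i _ => ?_
  rw [inner_tens_update, ← inner_conj_symm, inner_tens_update, map_mul, inner_conj_symm, map_prod,
    hA (f i) (g i)]
  simp only [inner_conj_symm]

include hd in
theorem dense_sumGraph :
    Dense (Prod.fst '' ((sumGraph μ A m).topologicalClosure : Set (L2N μ m × L2N μ m))) := by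
  have h1 : Dense ((Submodule.span ℂ (Set.range fun f : Fin m → A.domain =>
      tens μ m fun i => (f i : L2 μ))) : Set (L2N μ m)) := by
    rw [Submodule.dense_iff_topologicalClosure_eq_top, Submodule.topologicalClosure_eq_top_iff,
      Submodule.eq_bot_iff]
    intro Φ hΦ
    refine eq_zero_of_inner_tens μ Φ fun f => ?_
    have hc : IsClosed {f : Fin m → L2 μ | inner ℂ (tens μ m f) Φ = 0} :=
      isClosed_eq ((tens μ m).cont.inner continuous_const) continuous_const
    have hD : Dense (Set.univ.pi fun _ : Fin m => (A.domain : Set (L2 μ))) :=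
      dense_pi _ fun _ _ => hd
    have hsub : (Set.univ.pi fun _ : Fin m => (A.domain : Set (L2 μ))) ⊆
        {f : Fin m → L2 μ | inner ℂ (tens μ m f) Φ = 0} := by
      intro f hf
      exact (Submodule.mem_orthogonal _ _).1 hΦ _
        (Submodule.subset_span ⟨fun i => ⟨f i, hf i (Set.mem_univ i)⟩, rfl⟩)
    exact closure_minimal hsub hc (hD f)
  refine h1.mono ?_
  have h2 : (Submodule.span ℂ (Set.range fun f : Fin m → A.domain =>
      tens μ m fun i => (f i : L2 μ))) ≤
      (sumGraph μ A m).topologicalClosure.map (LinearMap.fst ℂ _ _) := by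
    rw [Submodule.span_le]
    rintro _ ⟨f, rfl⟩
    exact ⟨_, Submodule.le_topologicalClosure _ (Submodule.subset_span ⟨f, rfl⟩), rfl⟩
  exact h2

include hA hd in
theorem sumOp_graph : (sumOp μ A m).graph = (sumGraph μ A m).topologicalClosure := by
  rw [sumOp_eq]
  exact toLinearPMap_graph_of_symm (inner_sumGraph μ m hA) (dense_sumGraph μ m hd)

include hA hd in
theorem isFormalAdjoint_sumOp : (sumOp μ A m).IsFormalAdjoint (sumOp μ A m) := by
  refine isFormalAdjoint_of_graph ?_
  rw [sumOp_graph μ m hA hd]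
  exact inner_sumGraph μ m hA

include hA hd in
theorem isClosed_sumOp_graph : IsClosed ((sumOp μ A m).graph : Set (L2N μ m × L2N μ m)) := by
  rw [sumOp_graph μ m hA hd]
  exact Submodule.isClosed_topologicalClosure _

include hA hd in
theorem pw_mem_sumOp_graph {f g : L2 μ} (h : (f, g) ∈ A.graph) :
    (pw μ m f, dpw μ m f g) ∈ (sumOp μ A m).graph := by
  rw [sumOp_graph μ m hA hd]
  refine Submodule.le_topologicalClosure _ (Submodule.subset_span
    ⟨fun _ => ⟨f, A.mem_domain_of_mem_graph h⟩, ?_⟩)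
  simp only [apply_eq_of_mem_graph h]
  rfl

end SumOp

/-! ### Perturbation of an operator with a core -/

section KatoRellich

open Filter Topology

variable {E : Type*} [NormedAddCommGroup E] [InnerProductSpace ℂ E]

/-- The graph of the restriction of `H` to `C`. -/
def coreGraph (H : E →ₗ.[ℂ] E) (C : Submodule ℂ E) : Submodule ℂ (E × E) :=
  H.graph ⊓ C.comap (LinearMap.fst ℂ E E)

/-- A symmetric operator `K` that is nonnegative on a subspace `C` of its domain, contains the
closure of its restriction to `C`, and for which `(K + r) C` is dense for every `r > 0`. Such an
operator is self-adjoint, and `C` is a core. -/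
structure HasCore (K : E →ₗ.[ℂ] E) (C : Submodule ℂ E) : Prop where
  symm : K.IsFormalAdjoint K
  le : C ≤ K.domain
  nonneg : ∀ x : C, 0 ≤ (inner ℂ (x : E) (K ⟨x, le x.2⟩)).re
  total : ∀ r : ℝ, 0 < r → ∀ y : E,
    (∀ x : C, inner ℂ y (K ⟨x, le x.2⟩ + (r : ℂ) • (x : E)) = 0) → y = 0
  closed : (coreGraph K C).topologicalClosure ≤ K.graph

/-- A symmetric operator `H` that differs from `K` on the core `C` by an operator which is small
relative to the square root of `K`. -/
structure IsPerturbation (K H : E →ₗ.[ℂ] E) (C : Submodule ℂ E) (hC : C ≤ K.domain) : Prop where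
  symm : H.IsFormalAdjoint H
  le : C ≤ H.domain
  closed : (coreGraph H C).topologicalClosure ≤ H.graph
  bound : ∃ c : ℝ, 0 ≤ c ∧ ∀ x : C, ‖H ⟨x, le x.2⟩ - K ⟨x, hC x.2⟩‖ ^ 2 ≤
    c * ((inner ℂ (x : E) (K ⟨x, hC x.2⟩)).re + ‖(x : E)‖ ^ 2)

theorem mem_closure_coreGraph {H : E →ₗ.[ℂ] E} {C : Submodule ℂ E} (hC : C ≤ H.domain)
    {x : ℕ → C} {y z : E} (h1 : Tendsto (fun n => (x n : E)) atTop (𝓝 y))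
    (h2 : Tendsto (fun n => H ⟨x n, hC (x n).2⟩) atTop (𝓝 z)) :
    (y, z) ∈ (coreGraph H C).topologicalClosure := by
  refine mem_closure_of_tendsto (h1.prodMk_nhds h2) (Eventually.of_forall fun n => ?_)
  exact ⟨H.mem_graph ⟨x n, hC (x n).2⟩, (x n).2⟩

theorem norm_add_smul_sq (x y : E) (r : ℝ) :
    ‖y + (r : ℂ) • x‖ ^ 2 = ‖y‖ ^ 2 + 2 * r * (inner ℂ x y).re + r ^ 2 * ‖x‖ ^ 2 := by
  rw [@norm_add_sq ℂ, inner_smul_right, norm_smul, mul_pow, Complex.norm_real, Real.norm_eq_abs,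
    sq_abs]
  have h : (inner ℂ y x).re = (inner ℂ x y).re := inner_re_symm (𝕜 := ℂ) y x
  rw [RCLike.re_eq_complex_re, Complex.re_ofReal_mul, h]
  ring

variable {K H : E →ₗ.[ℂ] E} {C : Submodule ℂ E}

theorem HasCore.isPerturbation (hK : HasCore K C) : IsPerturbation K K C hK.le :=
  ⟨hK.symm, hK.le, hK.closed, 0, le_rfl, fun x => by simp⟩

variable [CompleteSpace E]

/-- Convergence in the graph norm of `K` along the core implies convergence in the graph norm
of `H`. -/
theorem IsPerturbation.tendsto (hK : HasCore K C) (hH : IsPerturbation K H C hK.le)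
    {x : ℕ → C} {y z : E} (h1 : Tendsto (fun n => (x n : E)) atTop (𝓝 y))
    (h2 : Tendsto (fun n => K ⟨x n, hK.le (x n).2⟩) atTop (𝓝 z)) :
    ∃ h, (y, h) ∈ H.graph ∧ Tendsto (fun n => H ⟨x n, hH.le (x n).2⟩) atTop (𝓝 h) := by
  obtain ⟨c, hc, hb⟩ := hH.bound
  set D : ℕ → E := fun n => H ⟨x n, hH.le (x n).2⟩ - K ⟨x n, hK.le (x n).2⟩ with hD
  have hCauchy : CauchySeq D := by
    rw [Metric.cauchySeq_iff']
    intro ε hε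
    have hsub : Tendsto (fun p : ℕ × ℕ => c * ((inner ℂ ((x p.1 : E) - x p.2)
        (K ⟨x p.1, hK.le (x p.1).2⟩ - K ⟨x p.2, hK.le (x p.2).2⟩)).re
        + ‖((x p.1 : E) - x p.2)‖ ^ 2)) atTop (𝓝 0) := by
      rw [← prod_atTop_atTop_eq]
      have a1 := (h1.comp (tendsto_fst (f := atTop) (g := atTop (α := ℕ)))).sub
        (h1.comp (tendsto_snd (f := atTop (α := ℕ)) (g := atTop)))
      have a2 := (h2.comp (tendsto_fst (f := atTop) (g := atTop (α := ℕ)))).sub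
        (h2.comp (tendsto_snd (f := atTop (α := ℕ)) (g := atTop)))
      have a3 := ((((Complex.continuous_re.tendsto _).comp (a1.inner (𝕜 := ℂ) a2))).add
        (a1.norm.pow 2)).const_mul c
      have e : c * (Complex.re (inner ℂ (y - y) (z - z)) + ‖y - y‖ ^ 2) = 0 := by simp
      rw [e] at a3
      exact a3
    have hev := hsub.eventually (gt_mem_nhds (show (0 : ℝ) < ε ^ 2 by positivity))
    rw [← prod_atTop_atTop_eq, eventually_prod_iff] at hev
    obtain ⟨p, hp, q, hq, hpq⟩ := hev
    obtain ⟨n₀, hn₀⟩ := eventually_atTop.1 (hp.and hq)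
    refine ⟨n₀, fun n hn => ?_⟩
    have h3 := hpq (hn₀ n hn).1 (hn₀ n₀ le_rfl).2
    have h4 := hb (x n - x n₀)
    have e1 : H ⟨((x n - x n₀ : C) : E), hH.le (x n - x n₀).2⟩ =
        H ⟨x n, hH.le (x n).2⟩ - H ⟨x n₀, hH.le (x n₀).2⟩ := by
      rw [← LinearPMap.map_sub]; rfl
    have e2 : K ⟨((x n - x n₀ : C) : E), hK.le (x n - x n₀).2⟩ =
        K ⟨x n, hK.le (x n).2⟩ - K ⟨x n₀, hK.le (x n₀).2⟩ := by
      rw [← LinearPMap.map_sub]; rfl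
    rw [e1, e2] at h4
    have h5 : ‖D n - D n₀‖ ^ 2 < ε ^ 2 := by
      refine lt_of_le_of_lt (le_of_eq ?_) (lt_of_le_of_lt h4 h3)
      congr 2
      simp only [hD]
      abel
    rw [dist_eq_norm]
    exact lt_of_pow_lt_pow_left₀ 2 hε.le h5
  obtain ⟨d, hd⟩ := cauchySeq_tendsto_of_complete hCauchy
  have h3 : Tendsto (fun n => H ⟨x n, hH.le (x n).2⟩) atTop (𝓝 (d + z)) := by
    refine (hd.add h2).congr fun n => ?_
    simp [hD]
  exact ⟨d + z, hH.closed (mem_closure_coreGraph hH.le h1 h3), h3⟩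

/-- For `r = 2c + 1` the difference `H - K` is at most half as large as `K + r` on the core. Since
`K + r` is onto, so is `H + r`, by a Neumann series; the preimage is reached along the core, in the
graph norm of `K`. -/
theorem IsPerturbation.surj_of_bound (hK : HasCore K C) (hH : IsPerturbation K H C hK.le)
    {c r : ℝ} (hc : 0 ≤ c) (hr : r = 2 * c + 1)
    (hb : ∀ x : C, ‖H ⟨x, hH.le x.2⟩ - K ⟨x, hK.le x.2⟩‖ ^ 2 ≤
      c * ((inner ℂ (x : E) (K ⟨x, hK.le x.2⟩)).re + ‖(x : E)‖ ^ 2)) (y : E) :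
    ∃ (x : ℕ → C) (a h k : E), (a, h) ∈ H.graph ∧ (a, k) ∈ K.graph ∧
      h + (r : ℂ) • a = y ∧ Tendsto (fun n => (x n : E)) atTop (𝓝 a) ∧
      Tendsto (fun n => K ⟨x n, hK.le (x n).2⟩) atTop (𝓝 k) := by
  have hr0 : 0 < r := by rw [hr]; positivity
  have hKr : ∀ x : C, r * ‖(x : E)‖ ≤ ‖K ⟨x, hK.le x.2⟩ + (r : ℂ) • (x : E)‖ := by
    intro x
    refine le_of_sq_le_sq ?_ (norm_nonneg _)
    rw [norm_add_smul_sq, mul_pow]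
    have := hK.nonneg x
    have : 0 ≤ 2 * r * (inner ℂ (x : E) (K ⟨x, hK.le x.2⟩)).re := by positivity
    nlinarith [sq_nonneg ‖K ⟨x, hK.le x.2⟩‖]
  have hD : ∀ x : C, ‖H ⟨x, hH.le x.2⟩ - K ⟨x, hK.le x.2⟩‖ ≤
      1 / 2 * ‖K ⟨x, hK.le x.2⟩ + (r : ℂ) • (x : E)‖ := by
    intro x
    refine le_of_sq_le_sq ?_ (by positivity)
    refine (hb x).trans ?_
    rw [mul_pow, norm_add_smul_sq]
    have h0 := hK.nonneg x
    set q := (inner ℂ (x : E) (K ⟨x, hK.le x.2⟩)).re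
    have h1 : c * q ≤ r / 2 * q := mul_le_mul_of_nonneg_right (by rw [hr]; linarith) h0
    have h2 : c * ‖(x : E)‖ ^ 2 ≤ r ^ 2 / 4 * ‖(x : E)‖ ^ 2 :=
      mul_le_mul_of_nonneg_right (by rw [hr]; nlinarith) (sq_nonneg _)
    nlinarith [sq_nonneg ‖K ⟨x, hK.le x.2⟩‖]
  -- the ranges of `K + r` and `H + r` on the core, as submodules
  set RK : Submodule ℂ E := LinearMap.range
    ((K.toFun ∘ₗ Submodule.inclusion hK.le) + (r : ℂ) • C.subtype) with hRK
  set RH : Submodule ℂ E := LinearMap.range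
    ((H.toFun ∘ₗ Submodule.inclusion hH.le) + (r : ℂ) • C.subtype) with hRH
  have hRKd : RK.topologicalClosure = ⊤ := by
    rw [Submodule.topologicalClosure_eq_top_iff, Submodule.eq_bot_iff]
    intro y hy
    refine hK.total r hr0 y fun x => ?_
    rw [← inner_conj_symm]
    exact (congrArg _ ((Submodule.mem_orthogonal _ _).1 hy _ ⟨x, rfl⟩)).trans (map_zero _)
  have hRHd : RH.topologicalClosure = ⊤ := by
    rw [Submodule.topologicalClosure_eq_top_iff, Submodule.eq_bot_iff]
    intro y hy
    have hyd : y ∈ closure (RK : Set E) := by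
      have : y ∈ RK.topologicalClosure := hRKd ▸ Submodule.mem_top
      exact this
    obtain ⟨z, hz, hzy⟩ := mem_closure_iff_seq_limit.1 hyd
    have hle : ∀ n, ‖inner ℂ y (z n)‖ ≤ ‖y‖ * (1 / 2 * ‖z n‖) := by
      intro n
      obtain ⟨x, hx⟩ := hz n
      have e0 : inner ℂ y (H ⟨x, hH.le x.2⟩ + (r : ℂ) • (x : E)) = 0 := by
        rw [← inner_conj_symm]
        exact (congrArg _ ((Submodule.mem_orthogonal _ _).1 hy _ ⟨x, rfl⟩)).trans (map_zero _)
      have e1 : z n = K ⟨x, hK.le x.2⟩ + (r : ℂ) • (x : E) := hx.symm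
      have e2 : inner ℂ y (z n) = -inner ℂ y (H ⟨x, hH.le x.2⟩ - K ⟨x, hK.le x.2⟩) := by
        rw [inner_add_right] at e0
        rw [e1, inner_add_right, inner_sub_right]
        linear_combination e0
      rw [e2, norm_neg]
      refine (norm_inner_le_norm _ _).trans ?_
      rw [e1]
      exact mul_le_mul_of_nonneg_left (hD x) (norm_nonneg _)
    have hlim : ‖inner ℂ y y‖ ≤ ‖y‖ * (1 / 2 * ‖y‖) :=
      le_of_tendsto_of_tendsto (tendsto_const_nhds.inner hzy).norm
        ((hzy.norm.const_mul _).const_mul _) (Eventually.of_forall hle)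
    rw [inner_self_eq_norm_sq_to_K] at hlim
    have h5 : ‖y‖ ^ 2 ≤ ‖y‖ * (1 / 2 * ‖y‖) := by simpa using hlim
    have : ‖y‖ = 0 := by nlinarith [norm_nonneg y]
    exact norm_eq_zero.1 this
  have hyd : y ∈ closure (RH : Set E) := by
    have : y ∈ RH.topologicalClosure := hRHd ▸ Submodule.mem_top
    exact this
  obtain ⟨z, hz, hzy⟩ := mem_closure_iff_seq_limit.1 hyd
  choose x hx using hz
  have hxz : ∀ n, z n = H ⟨x n, hH.le (x n).2⟩ + (r : ℂ) • (x n : E) := fun n => (hx n).symm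
  have hest : ∀ x : C, ‖K ⟨x, hK.le x.2⟩ + (r : ℂ) • (x : E)‖ ≤
      2 * ‖H ⟨x, hH.le x.2⟩ + (r : ℂ) • (x : E)‖ := by
    intro x
    have h1 := hD x
    have h2 : K ⟨x, hK.le x.2⟩ + (r : ℂ) • (x : E) = (H ⟨x, hH.le x.2⟩ + (r : ℂ) • (x : E)) -
      (H ⟨x, hH.le x.2⟩ - K ⟨x, hK.le x.2⟩) := by abel
    have h3 := norm_sub_le (H ⟨x, hH.le x.2⟩ + (r : ℂ) • (x : E))
      (H ⟨x, hH.le x.2⟩ - K ⟨x, hK.le x.2⟩)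
    rw [← h2] at h3
    linarith
  have hdist : ∀ n m, ‖(K ⟨x n, hK.le (x n).2⟩ + (r : ℂ) • (x n : E)) -
      (K ⟨x m, hK.le (x m).2⟩ + (r : ℂ) • (x m : E))‖ ≤ 2 * ‖z n - z m‖ ∧
      r * ‖(x n : E) - x m‖ ≤ 2 * ‖z n - z m‖ := by
    intro n m
    have h1 := hest (x n - x m)
    have h2 := hKr (x n - x m)
    have e1 : H ⟨((x n - x m : C) : E), hH.le (x n - x m).2⟩ =
        H ⟨x n, hH.le (x n).2⟩ - H ⟨x m, hH.le (x m).2⟩ := by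
      rw [← LinearPMap.map_sub]; rfl
    have e2 : K ⟨((x n - x m : C) : E), hK.le (x n - x m).2⟩ =
        K ⟨x n, hK.le (x n).2⟩ - K ⟨x m, hK.le (x m).2⟩ := by
      rw [← LinearPMap.map_sub]; rfl
    rw [e2] at h2
    rw [e1, e2] at h1
    have e3 : ((x n - x m : C) : E) = (x n : E) - x m := rfl
    rw [e3] at h1 h2
    have e4 : K ⟨x n, hK.le (x n).2⟩ - K ⟨x m, hK.le (x m).2⟩ + (r : ℂ) • ((x n : E) - x m) =
        (K ⟨x n, hK.le (x n).2⟩ + (r : ℂ) • (x n : E)) -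
          (K ⟨x m, hK.le (x m).2⟩ + (r : ℂ) • (x m : E)) := by
      rw [smul_sub]; abel
    have e5 : H ⟨x n, hH.le (x n).2⟩ - H ⟨x m, hH.le (x m).2⟩ + (r : ℂ) • ((x n : E) - x m) =
        z n - z m := by
      rw [hxz, hxz, smul_sub]; abel
    rw [e4, e5] at h1
    rw [e4] at h2
    exact ⟨h1, h2.trans h1⟩
  have hzc := hzy.cauchySeq
  have hxc : CauchySeq fun n => (x n : E) := by
    rw [Metric.cauchySeq_iff'] at hzc ⊢
    intro ε hε
    obtain ⟨n₀, hn₀⟩ := hzc (r * ε / 2) (by positivity)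
    refine ⟨n₀, fun n hn => ?_⟩
    have h1 := hn₀ n hn
    rw [dist_eq_norm] at h1 ⊢
    have h2 := (hdist n n₀).2
    have h3 : r * ‖(x n : E) - x n₀‖ < r * ε := by linarith
    exact lt_of_mul_lt_mul_left h3 hr0.le
  have hkc : CauchySeq fun n => K ⟨x n, hK.le (x n).2⟩ + (r : ℂ) • (x n : E) := by
    rw [Metric.cauchySeq_iff'] at hzc ⊢
    intro ε hε
    obtain ⟨n₀, hn₀⟩ := hzc (ε / 2) (by positivity)
    refine ⟨n₀, fun n hn => ?_⟩
    have h1 := hn₀ n hn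
    rw [dist_eq_norm] at h1 ⊢
    have h2 := (hdist n n₀).1
    linarith
  obtain ⟨a, ha⟩ := cauchySeq_tendsto_of_complete hxc
  obtain ⟨b, hb⟩ := cauchySeq_tendsto_of_complete hkc
  have hk : Tendsto (fun n => K ⟨x n, hK.le (x n).2⟩) atTop (𝓝 (b - (r : ℂ) • a)) := by
    refine (hb.sub (ha.const_smul (r : ℂ))).congr fun n => ?_
    rw [add_sub_cancel_right]
  have hh : Tendsto (fun n => H ⟨x n, hH.le (x n).2⟩) atTop (𝓝 (y - (r : ℂ) • a)) := by
    refine (hzy.sub (ha.const_smul (r : ℂ))).congr fun n => ?_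
    rw [hxz, add_sub_cancel_right]
  exact ⟨x, a, _, _, hH.closed (mem_closure_coreGraph hH.le ha hh),
    hK.closed (mem_closure_coreGraph hK.le ha hk), sub_add_cancel _ _, ha, hk⟩

theorem IsPerturbation.surj (hK : HasCore K C) (hH : IsPerturbation K H C hK.le) :
    ∃ r : ℝ, ∀ y : E, ∃ (x : ℕ → C) (a h k : E), (a, h) ∈ H.graph ∧ (a, k) ∈ K.graph ∧
      h + (r : ℂ) • a = y ∧ Tendsto (fun n => (x n : E)) atTop (𝓝 a) ∧
      Tendsto (fun n => K ⟨x n, hK.le (x n).2⟩) atTop (𝓝 k) := by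
  obtain ⟨c, hc, hb⟩ := hH.bound
  exact ⟨_, hH.surj_of_bound hK hc rfl hb⟩

/-- On the domain of `H`, the core is dense in the graph norm of `K`. -/
theorem IsPerturbation.approx (hK : HasCore K C) (hH : IsPerturbation K H C hK.le)
    {a : E} (ha : a ∈ H.domain) : ∃ (x : ℕ → C) (k : E), (a, k) ∈ K.graph ∧
      Tendsto (fun n => (x n : E)) atTop (𝓝 a) ∧
      Tendsto (fun n => K ⟨x n, hK.le (x n).2⟩) atTop (𝓝 k) := by
  obtain ⟨r, hr⟩ := hH.surj hK
  obtain ⟨x, b, h, k, hbh, hbk, hsum, hx, hk⟩ := hr (H ⟨a, ha⟩ + (r : ℂ) • a)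
  have hab : a - b = 0 := by
    obtain ⟨_, v, v', -, hv, -, hvs, -, -⟩ := hr (a - b)
    have h1 := inner_eq_of_mem_graph hH.symm (H.mem_graph ⟨a, ha⟩) hv
    have h2 := inner_eq_of_mem_graph hH.symm hbh hv
    have h3 : inner ℂ (a - b) (a - b) = 0 := by
      conv_lhs => arg 3; rw [← hvs]
      rw [inner_add_right, inner_sub_left]
      simp only at h1
      rw [← h1, ← h2, ← inner_sub_left]
      have : H ⟨a, ha⟩ - h = -((r : ℂ) • (a - b)) := by
        rw [smul_sub]
        rw [eq_neg_iff_add_eq_zero]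
        rw [← sub_eq_zero] at hsum
        rw [← neg_eq_zero, ← hsum]
        abel
      rw [this, inner_neg_left, inner_smul_left, inner_smul_right]
      simp
    exact inner_self_eq_zero.1 h3
  rw [sub_eq_zero] at hab
  subst hab
  exact ⟨x, k, hbk, hx, hk⟩

/-- Both domains are the closure of the core in the graph norm, and the graph norms of `H` and `K`
are equivalent on the core. -/
theorem IsPerturbation.domain_eq (hK : HasCore K C) (hH : IsPerturbation K H C hK.le) :
    H.domain = K.domain := by
  refine le_antisymm (fun a ha => ?_) fun a ha => ?_
  · obtain ⟨x, k, hk, -⟩ := hH.approx hK ha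
    exact K.mem_domain_of_mem_graph hk
  · obtain ⟨x, k, hk, h1, h2⟩ := hK.isPerturbation.approx hK ha
    obtain ⟨h, hh, -⟩ := hH.tendsto hK h1 h2
    exact H.mem_domain_of_mem_graph hh

/-- A symmetric operator `H` with `H + r` onto, for a real `r`, is self-adjoint. -/
theorem IsPerturbation.isSelfAdjoint (hK : HasCore K C) (hH : IsPerturbation K H C hK.le) :
    IsSelfAdjoint H := by
  obtain ⟨r, hr⟩ := hH.surj hK
  have hd : Dense (H.domain : Set E) := by
    rw [Submodule.dense_iff_topologicalClosure_eq_top, Submodule.topologicalClosure_eq_top_iff,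
      Submodule.eq_bot_iff]
    intro y hy
    obtain ⟨_, a, h, -, hah, -, hs, -, -⟩ := hr y
    obtain ⟨_, b, k, -, hbk, -, hs', -, -⟩ := hr a
    have h1 : inner ℂ a a = 0 := by
      conv_lhs => arg 3; rw [← hs']
      rw [inner_add_right, ← inner_eq_of_mem_graph hH.symm hah hbk, inner_smul_right]
      have h2 : inner ℂ y b = 0 := by
        rw [← inner_conj_symm, (Submodule.mem_orthogonal _ _).1 hy _
          (H.mem_domain_of_mem_graph hbk), map_zero]
      rw [← hs, inner_add_left, inner_smul_left, Complex.conj_ofReal] at h2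
      exact h2
    have h0 : a = 0 := inner_self_eq_zero.1 h1
    subst h0
    have : h = 0 := H.graph_fst_eq_zero_snd hah rfl
    rw [← hs, this, smul_zero, add_zero]
  rw [LinearPMap.isSelfAdjoint_def]
  have hle := LinearPMap.IsFormalAdjoint.le_adjoint hd hH.symm
  refine (LinearPMap.eq_of_le_of_domain_eq hle (le_antisymm hle.1 fun y hy => ?_)).symm
  obtain ⟨_, a, h, -, hah, -, hs, -, -⟩ := hr (LinearPMap.adjoint H ⟨y, hy⟩ + (r : ℂ) • y)
  obtain ⟨_, b, k, -, hbk, -, hs', -, -⟩ := hr (y - a)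
  have h0 : inner ℂ (y - a) (y - a) = 0 := by
    conv_lhs => arg 3; rw [← hs']
    have hb := H.mem_domain_of_mem_graph hbk
    have e1 := LinearPMap.adjoint_isFormalAdjoint hd ⟨y, hy⟩ ⟨b, hb⟩
    rw [apply_eq_of_mem_graph hbk hb] at e1
    have e2 := inner_eq_of_mem_graph hH.symm hah hbk
    simp only at e1
    rw [inner_add_right, inner_sub_left, ← e1, ← e2, ← inner_sub_left]
    have : LinearPMap.adjoint H ⟨y, hy⟩ - h = -((r : ℂ) • (y - a)) := by
      rw [smul_sub]
      rw [eq_neg_iff_add_eq_zero]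
      rw [← sub_eq_zero] at hs
      rw [← neg_eq_zero, ← hs]
      abel
    rw [this, inner_neg_left, inner_smul_left, inner_smul_right]
    simp
  have : y = a := sub_eq_zero.1 (inner_self_eq_zero.1 h0)
  rw [this]
  exact H.mem_domain_of_mem_graph hah

/-- A nonnegative self-adjoint operator has its own domain as a core. -/
theorem hasCore_domain (hK : IsSelfAdjoint K)
    (h0 : ∀ x : K.domain, 0 ≤ (inner ℂ (x : E) (K x)).re) : HasCore K K.domain where
  symm := isFormalAdjoint_of_isSelfAdjoint hK
  le := le_rfl
  nonneg := h0
  total r hr y hy := by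
    have hmem : y ∈ (LinearPMap.adjoint K).domain := by
      refine LinearPMap.mem_adjoint_domain_of_exists y ⟨-((r : ℂ) • y), fun x => ?_⟩
      have := hy x
      rw [inner_add_right, inner_smul_right] at this
      rw [inner_neg_left, inner_smul_left, Complex.conj_ofReal]
      linear_combination -this
    rw [LinearPMap.isSelfAdjoint_def.1 hK] at hmem
    have h1 := hy ⟨y, hmem⟩
    rw [inner_add_right, inner_smul_right, inner_self_eq_norm_sq_to_K] at h1
    have h2 := congrArg Complex.re h1
    have h3 := h0 ⟨y, hmem⟩
    have h4 : (inner ℂ y (K ⟨y, hmem⟩)).re + r * ‖y‖ ^ 2 = 0 := by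
      have e : ((r : ℂ) * ((‖y‖ : ℂ)) ^ 2).re = r * ‖y‖ ^ 2 := by
        rw [← Complex.ofReal_pow, ← Complex.ofReal_mul, Complex.ofReal_re]
      rw [← e]
      simpa using h2
    have h5 : r * ‖y‖ ^ 2 ≤ 0 := by
      simp only at h3
      linarith
    have h6 : ‖y‖ ^ 2 ≤ 0 := by
      by_contra hcon
      push Not at hcon
      nlinarith [mul_pos hr hcon]
    have : ‖y‖ = 0 := by nlinarith [norm_nonneg y]
    exact norm_eq_zero.1 this
  closed := by
    have h1 : coreGraph K K.domain ≤ K.graph := inf_le_left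
    have h2 : IsClosed (K.graph : Set (E × E)) := hK.isClosed
    exact Submodule.topologicalClosure_minimal _ h1 h2

end KatoRellich

/-! ### The semigroup of a nonnegative self-adjoint operator -/

section Semigroup

open Filter Topology Set

/-- `x^k e^{-s (1/x - 1)}`; evaluated at `x = (A + 1)⁻¹`, this is `(A + 1)^{-k} e^{-s A}`. -/
def heat (k : ℕ) (s x : ℝ) : ℝ := x ^ k * Real.exp (-(s * (x⁻¹ - 1)))

theorem heat_zero {k : ℕ} (hk : k ≠ 0) (s : ℝ) : heat k s 0 = 0 := by
  rw [heat, zero_pow hk, zero_mul]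

theorem inv_sub_one_nonneg {x : ℝ} (h0 : 0 < x) (h1 : x ≤ 1) : 0 ≤ x⁻¹ - 1 :=
  sub_nonneg.2 ((one_le_inv₀ h0).2 h1)

theorem heat_le {k : ℕ} {s x : ℝ} (hs : 0 ≤ s) (h0 : 0 ≤ x) (h1 : x ≤ 1) (hk : k ≠ 0) :
    heat k s x ≤ x ^ k := by
  rcases h0.eq_or_lt with rfl | h0
  · rw [heat_zero hk, zero_pow hk]
  · refine mul_le_of_le_one_right (by positivity) (Real.exp_le_one_iff.2 ?_)
    have := mul_nonneg hs (inv_sub_one_nonneg h0 h1)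
    linarith

theorem heat_nonneg (k : ℕ) (s : ℝ) {x : ℝ} (h0 : 0 ≤ x) : 0 ≤ heat k s x :=
  mul_nonneg (pow_nonneg h0 _) (Real.exp_pos _).le

theorem continuousOn_heat {k : ℕ} {s : ℝ} (hs : 0 ≤ s) (hk : k ≠ 0) :
    ContinuousOn (heat k s) (Icc 0 1) := by
  intro x hx
  rcases hx.1.eq_or_lt with rfl | h0
  · rw [ContinuousWithinAt, heat_zero hk]
    have h1 : Tendsto (fun x : ℝ => x ^ k) (𝓝[Icc 0 1] 0) (𝓝 0) := by
      have : ContinuousWithinAt (fun x : ℝ => x ^ k) (Icc 0 1) 0 :=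
        (continuous_pow k).continuousWithinAt
      simpa [ContinuousWithinAt, zero_pow hk] using this
    refine squeeze_zero' ?_ ?_ h1
    · filter_upwards [self_mem_nhdsWithin] with y hy using heat_nonneg k s hy.1
    · filter_upwards [self_mem_nhdsWithin] with y hy using heat_le hs hy.1 hy.2 hk
  · refine ContinuousAt.continuousWithinAt ?_
    have : x ≠ 0 := h0.ne'
    unfold heat
    fun_prop (disch := assumption)

theorem heat_shift (k : ℕ) (s h x : ℝ) :
    heat k (s + h) x = heat k s x * Real.exp (-(h * (x⁻¹ - 1))) := by
  rw [heat, heat, mul_assoc, ← Real.exp_add]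
  congr 2
  ring

theorem exp_neg_le_quadratic {y : ℝ} (hy : 0 ≤ y) : Real.exp (-y) ≤ 1 - y + y ^ 2 := by
  by_cases h : y ≤ 1
  · have := Real.abs_exp_sub_one_sub_id_le (x := -y) (by rwa [abs_neg, abs_of_nonneg hy])
    have := (abs_le.1 this).2
    nlinarith
  · push Not at h
    have : Real.exp (-y) ≤ 1 := Real.exp_le_one_iff.2 (by linarith)
    nlinarith

/-- First-order Taylor expansion of the semigroup, uniformly in the spectral variable. -/
theorem heat_taylor {s h x : ℝ} (hs : 0 ≤ s) (hh : 0 ≤ h) (h0 : 0 ≤ x) (h1 : x ≤ 1) :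
    ‖heat 3 (s + h) x - heat 3 s x + h * (heat 2 s x - heat 3 s x)‖ ≤ h ^ 2 := by
  rcases h0.eq_or_lt with rfl | h0
  · rw [heat_zero (by norm_num), heat_zero (by norm_num), heat_zero (by norm_num)]
    simp
    positivity
  · set a := x⁻¹ - 1 with ha
    have ha0 : 0 ≤ a := inv_sub_one_nonneg h0 h1
    have h2 : heat 2 s x - heat 3 s x = heat 3 s x * a := by
      rw [heat, heat, ha]
      field_simp
    have h3 : heat 3 s x ≤ x ^ 3 := heat_le hs h0.le h1 (by norm_num)
    have h3' := heat_nonneg 3 s h0.le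
    rw [heat_shift, h2, ← ha]
    have e : heat 3 s x * Real.exp (-(h * a)) - heat 3 s x + h * (heat 3 s x * a) =
        heat 3 s x * (Real.exp (-(h * a)) - 1 + h * a) := by ring
    have hl : 0 ≤ Real.exp (-(h * a)) - 1 + h * a := by
      have := Real.add_one_le_exp (-(h * a))
      linarith
    have hu : Real.exp (-(h * a)) - 1 + h * a ≤ (h * a) ^ 2 := by
      have := exp_neg_le_quadratic (mul_nonneg hh ha0)
      linarith
    rw [e, Real.norm_of_nonneg (mul_nonneg h3' hl)]
    calc heat 3 s x * (Real.exp (-(h * a)) - 1 + h * a) ≤ x ^ 3 * (h * a) ^ 2 :=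
          mul_le_mul h3 hu hl (by positivity)
      _ = h ^ 2 * (x * (1 - x) ^ 2) := by
          rw [ha]
          field_simp
      _ ≤ h ^ 2 * 1 := by
          refine mul_le_mul_of_nonneg_left ?_ (sq_nonneg _)
          exact mul_le_one₀ h1 (sq_nonneg _) (by nlinarith)
      _ = h ^ 2 := mul_one _

variable {E : Type*} [NormedAddCommGroup E] [InnerProductSpace ℂ E] [CompleteSpace E]

/-- The resolvent `(A + 1)⁻¹` of a nonnegative self-adjoint operator. -/
theorem exists_resolvent {A : E →ₗ.[ℂ] E} (hA : IsSelfAdjoint A)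
    (h0 : ∀ x : A.domain, 0 ≤ (inner ℂ (x : E) (A x)).re) :
    ∃ R : E →L[ℂ] E, IsSelfAdjoint R ∧ (∀ x ∈ spectrum ℝ R, x ∈ Icc (0 : ℝ) 1) ∧
      (∀ v, (R v, v - R v) ∈ A.graph) ∧ (∀ u v, (u, v) ∈ A.graph → R (u + v) = u) := by
  have hK := hasCore_domain hA h0
  have hs := hK.isPerturbation.surj_of_bound hK (c := 0) (r := 1) le_rfl (by norm_num)
    (fun x => by simp)
  have hinj : ∀ a h, (a, h) ∈ A.graph → ‖a‖ ^ 2 ≤ (inner ℂ a (h + a)).re := by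
    intro a h hah
    have hd := A.mem_domain_of_mem_graph hah
    have h1 := h0 ⟨a, hd⟩
    rw [apply_eq_of_mem_graph hah hd] at h1
    rw [inner_add_right, inner_self_eq_norm_sq_to_K]
    have : (((‖a‖ : ℂ)) ^ 2).re = ‖a‖ ^ 2 := by rw [← Complex.ofReal_pow, Complex.ofReal_re]
    simp only [Complex.add_re, Complex.coe_algebraMap, this]
    simpa using h1
  have huniq : ∀ a h a' h', (a, h) ∈ A.graph → (a', h') ∈ A.graph → h + a = h' + a' → a = a' := by
    intro a h a' h' h1 h2 h3
    have h4 := hinj _ _ (A.graph.sub_mem h1 h2)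
    have h5 : h - h' + (a - a') = 0 := by
      rw [← sub_eq_zero] at h3
      rw [← h3]
      abel
    simp only at h4
    rw [h5, inner_zero_right, Complex.zero_re] at h4
    have : ‖a - a'‖ = 0 := by nlinarith [norm_nonneg (a - a')]
    exact sub_eq_zero.1 (norm_eq_zero.1 this)
  have hex : ∀ y, ∃ a, (a, y - a) ∈ A.graph := by
    intro y
    obtain ⟨_, a, h, -, hah, -, hsum, -, -⟩ := hs y
    refine ⟨a, ?_⟩
    rw [← hsum]
    simpa using hah
  choose R hR using hex
  have hnorm : ∀ y, ‖R y‖ ≤ 1 * ‖y‖ := by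
    intro y
    have h1 := hinj _ _ (hR y)
    rw [sub_add_cancel] at h1
    have h2 : (inner ℂ (R y) y).re ≤ ‖R y‖ * ‖y‖ :=
      (Complex.re_le_norm _).trans (norm_inner_le_norm _ _)
    rw [one_mul]
    by_contra hcon
    push Not at hcon
    nlinarith [norm_nonneg y, norm_nonneg (R y)]
  let Rc : E →L[ℂ] E := LinearMap.mkContinuous
    { toFun := R
      map_add' := fun x y => huniq _ _ _ _ (hR (x + y)) (A.graph.add_mem (hR x) (hR y))
        (by dsimp only; abel)
      map_smul' := fun c x => huniq _ _ _ _ (hR (c • x)) (A.graph.smul_mem c (hR x))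
        (by dsimp only; rw [RingHom.id_apply, smul_sub]; abel) } 1 hnorm
  have hRc : ∀ v, Rc v = R v := fun v => rfl
  have hsymm : ∀ x y, inner ℂ (R x) y = inner ℂ x (R y) := by
    intro x y
    have h1 := inner_eq_of_mem_graph (isFormalAdjoint_of_isSelfAdjoint hA) (hR x) (hR y)
    rw [inner_sub_left, inner_sub_right] at h1
    linear_combination -h1
  have hsa : IsSelfAdjoint Rc := ContinuousLinearMap.isSelfAdjoint_iff_isSymmetric.2 hsymm
  have hpos : 0 ≤ Rc := by
    rw [ContinuousLinearMap.nonneg_iff_isPositive]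
    refine ContinuousLinearMap.isPositive_def.2 ⟨hsymm, fun x => ?_⟩
    rw [ContinuousLinearMap.reApplyInnerSelf]
    have h1 := hinj _ _ (hR x)
    rw [sub_add_cancel] at h1
    exact (sq_nonneg _).trans h1
  refine ⟨Rc, hsa, fun x hx => ⟨spectrum_nonneg_of_nonneg hpos hx, ?_⟩, fun v => hR v,
    fun u v huv => huniq _ _ _ _ (hR _) huv (by rw [hRc, sub_add_cancel, add_comm])⟩
  refine (le_abs_self x).trans ?_
  have h1 := spectrum.norm_le_norm_mul_of_mem hx
  have h2 : ‖Rc‖ ≤ 1 := LinearMap.mkContinuous_norm_le _ zero_le_one _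
  have h3 : ‖(1 : E →L[ℂ] E)‖ ≤ 1 := ContinuousLinearMap.norm_id_le
  rw [Real.norm_eq_abs] at h1
  nlinarith [norm_nonneg Rc, norm_nonneg (1 : E →L[ℂ] E)]

/-- The regularized semigroup `e s = (A + 1)⁻³ e^{-s A}`, and `d s = A (A + 1)⁻³ e^{-s A}`. -/
theorem exists_semigroup {A : E →ₗ.[ℂ] E} (hA : IsSelfAdjoint A)
    (h0 : ∀ x : A.domain, 0 ≤ (inner ℂ (x : E) (A x)).re) :
    ∃ e d : ℝ → E →L[ℂ] E, (∀ s, 0 ≤ s → ‖e s‖ ≤ 1) ∧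
      (∀ s, 0 ≤ s → ∀ v, (e s v, d s v) ∈ A.graph) ∧
      (∀ s, 0 ≤ s → ∀ h, 0 ≤ h → ‖e (s + h) - e s + h • d s‖ ≤ h ^ 2) ∧
      (∀ s, 0 ≤ s → ‖d s‖ ≤ 1) ∧
      (∀ u, (u, 0) ∈ A.graph → e 0 u = u) ∧ (∀ v w, inner ℂ (e 0 v) w = inner ℂ v (e 0 w)) ∧
      (∀ v, e 0 v = 0 → v = 0) := by
  obtain ⟨R, hR, hsp, hRA, hRu⟩ := exists_resolvent hA h0
  have hcont : ∀ k s, k ≠ 0 → 0 ≤ s → ContinuousOn (heat k s) (spectrum ℝ R) :=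
    fun k s hk hs => (continuousOn_heat hs hk).mono hsp
  have h30 : cfc (heat 3 0) R = R ^ 3 := by
    have : heat 3 0 = fun x => x ^ 3 := by
      funext x
      simp [heat]
    rw [this, cfc_pow_id R 3]
  refine ⟨fun s => cfc (heat 3 s) R, fun s => cfc (fun x => heat 2 s x - heat 3 s x) R,
    fun s hs => ?_, fun s hs v => ?_, fun s hs h hh => ?_, fun s hs => ?_, fun u hu => ?_,
    fun v w => ?_, fun v hv => ?_⟩
  · refine norm_cfc_le zero_le_one fun x hx => ?_
    rw [Real.norm_of_nonneg (heat_nonneg 3 s (hsp x hx).1)]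
    exact (heat_le hs (hsp x hx).1 (hsp x hx).2 (by norm_num)).trans
      (pow_le_one₀ (hsp x hx).1 (hsp x hx).2)
  · have h1 : cfc (heat 3 s) R = R * cfc (heat 2 s) R := by
      conv_rhs => arg 1; rw [← cfc_id ℝ R]
      rw [← cfc_mul (id : ℝ → ℝ) (heat 2 s) R continuousOn_id (hcont 2 s (by norm_num) hs)]
      congr 1
      funext x
      simp only [heat, id]
      ring
    have h2 : cfc (fun x => heat 2 s x - heat 3 s x) R =
        cfc (heat 2 s) R - R * cfc (heat 2 s) R := by
      rw [← h1, cfc_sub (heat 2 s) (heat 3 s) R (hcont 2 s (by norm_num) hs)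
        (hcont 3 s (by norm_num) hs)]
    simp only [h1, h2]
    exact hRA (cfc (heat 2 s) R v)
  · have c2 := hcont 2 s (by norm_num) hs
    have c3 := hcont 3 s (by norm_num) hs
    have c4 := hcont 3 (s + h) (by norm_num) (by positivity)
    have h1 : cfc (heat 3 (s + h)) R - cfc (heat 3 s) R +
        h • cfc (fun x => heat 2 s x - heat 3 s x) R =
        cfc (fun x => heat 3 (s + h) x - heat 3 s x + h * (heat 2 s x - heat 3 s x)) R := by
      rw [cfc_add R (fun x => heat 3 (s + h) x - heat 3 s x)
        (fun x => h * (heat 2 s x - heat 3 s x)) (c4.sub c3)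
        (continuousOn_const.mul (c2.sub c3)), cfc_sub _ _ R c4 c3,
        cfc_const_mul h (fun x => heat 2 s x - heat 3 s x) R (c2.sub c3)]
    simp only [h1]
    exact norm_cfc_le (sq_nonneg _) fun x hx => heat_taylor hs hh (hsp x hx).1 (hsp x hx).2
  · refine norm_cfc_le zero_le_one fun x hx => ?_
    have h2 := heat_le (k := 2) hs (hsp x hx).1 (hsp x hx).2 (by norm_num)
    have h3 := heat_le (k := 3) hs (hsp x hx).1 (hsp x hx).2 (by norm_num)
    have h2' := heat_nonneg 2 s (hsp x hx).1
    have h3' := heat_nonneg 3 s (hsp x hx).1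
    have h4 := pow_le_one₀ (n := 2) (hsp x hx).1 (hsp x hx).2
    have h5 := pow_le_one₀ (n := 3) (hsp x hx).1 (hsp x hx).2
    rw [Real.norm_eq_abs, abs_le]
    constructor <;> linarith
  · have h1 := hRu u 0 hu
    rw [add_zero] at h1
    simp only [h30]
    change (R ^ 3) u = u
    rw [pow_succ, pow_succ, pow_one]
    simp [h1]
  · simp only [h30]
    exact ContinuousLinearMap.isSelfAdjoint_iff_isSymmetric.1 (hR.pow 3) v w
  · simp only [h30] at hv
    have hinj : ∀ v, R v = 0 → v = 0 := fun v hv => by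
      have := hRA v
      rw [hv, sub_zero] at this
      exact A.graph_fst_eq_zero_snd this rfl
    rw [pow_succ, pow_succ, pow_one] at hv
    exact hinj _ (hinj _ (hinj _ hv))

end Semigroup

/-! ### Pure powers and the semigroup -/

section SemigroupTensor

open Filter Topology Set

variable {X : Type*} [MeasurableSpace X] (μ : Measure X) [SigmaFinite μ]

theorem norm_pw (m : ℕ) (f : L2 μ) : ‖pw μ m f‖ = ‖f‖ ^ m := by
  rw [pw, tens_apply, norm_tensFun, Finset.prod_const, Finset.card_univ, Fintype.card_fin]

theorem hasDerivWithinAt_of_quadratic {E : Type*} [NormedAddCommGroup E] [NormedSpace ℝ E]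
    {f : ℝ → E} {s : ℝ} {d : E} {c : ℝ}
    (h : ∀ r, 0 ≤ r → ‖f (s + r) - f s + r • d‖ ≤ c * r ^ 2) :
    HasDerivWithinAt f (-d) (Ici s) s := by
  rw [hasDerivWithinAt_iff_isLittleO]
  have h1 : (fun x => f x - f s - (x - s) • -d) =O[𝓝[Ici s] s] fun x => (x - s) ^ 2 := by
    refine Asymptotics.IsBigO.of_bound c ?_
    filter_upwards [self_mem_nhdsWithin] with x hx
    have h2 := h (x - s) (sub_nonneg.2 hx)
    rw [add_sub_cancel] at h2
    rw [smul_neg, sub_neg_eq_add, Real.norm_of_nonneg (sq_nonneg (x - s))]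
    exact h2
  refine h1.trans_isLittleO ?_
  have h3 : (fun x : ℝ => (x - s) ^ 2) =o[𝓝 s] fun x => x - s := by
    have h4 : (fun x : ℝ => x - s) =o[𝓝 s] fun _ => (1 : ℝ) := by
      rw [Asymptotics.isLittleO_one_iff]
      have : Tendsto (fun x : ℝ => x - s) (𝓝 s) (𝓝 (s - s)) := tendsto_id.sub tendsto_const_nhds
      rwa [sub_self] at this
    have h5 := h4.mul_isBigO (Asymptotics.isBigO_refl (fun x : ℝ => x - s) (𝓝 s))
    simpa [pow_two] using h5
  exact h3.mono nhdsWithin_le_nhds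

/-- If `A ≥ 0` is self-adjoint, `A u = 0` and `r > 0`, a vector orthogonal to all
`(∑ A_i + r) f ⊗ ⋯ ⊗ f` with `f ∈ D(A)`, `f ⊥ u`, is orthogonal to all `f ⊗ ⋯ ⊗ f` with `f ⊥ u`:
the function `s ↦ e^{-rs} ⟨Φ, e^{-sA} f ⊗ ⋯ ⊗ e^{-sA} f⟩` is constant and tends to `0`. -/
theorem inner_pw_eq_zero_of_semigroup {A : L2 μ →ₗ.[ℂ] L2 μ} (hA : IsSelfAdjoint A)
    (h0 : ∀ x : A.domain, 0 ≤ (inner ℂ (x : L2 μ) (A x)).re) {u : L2 μ} (hu : (u, 0) ∈ A.graph)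
    (hu1 : ‖u‖ = 1) {m : ℕ} (Φ : L2N μ m) {r : ℝ} (hr : 0 < r)
    (hΦ : ∀ f g, (f, g) ∈ A.graph → inner ℂ u f = 0 →
      inner ℂ Φ (dpw μ m f g + (r : ℂ) • pw μ m f) = 0)
    (f : L2 μ) (hf : inner ℂ u f = 0) : inner ℂ Φ (pw μ m f) = 0 := by
  obtain ⟨e, d, he1, hed, htay, hd1, heu, hesymm, heinj⟩ := exists_semigroup hA h0
  -- the claim for vectors in the range of `e 0`
  have key : ∀ v, inner ℂ u v = 0 → inner ℂ Φ (pw μ m (e 0 v)) = 0 := by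
    intro v hv
    have hAsymm := isFormalAdjoint_of_isSelfAdjoint hA
    have hlip : ∀ s t, 0 ≤ s → s ≤ t → ‖e t - e s‖ ≤ (t - s) + (t - s) ^ 2 := by
      intro s t hs hst
      have h1 := htay s hs (t - s) (sub_nonneg.2 hst)
      rw [add_sub_cancel] at h1
      have h2 : e t - e s = (e t - e s + (t - s) • d s) - (t - s) • d s := by abel
      rw [h2]
      refine (norm_sub_le _ _).trans ?_
      rw [norm_smul, Real.norm_of_nonneg (sub_nonneg.2 hst)]
      have h3 := mul_le_mul_of_nonneg_left (hd1 s hs) (sub_nonneg.2 hst)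
      rw [mul_one] at h3
      exact (add_le_add h1 h3).trans (add_comm _ _).le
    have hcont : ∀ b, ContinuousOn (fun s => e s v) (Icc 0 b) := by
      intro b s hs
      have h1 : Tendsto (fun t => |t - s| + |t - s| ^ 2) (𝓝[Icc 0 b] s) (𝓝 0) := by
        have : ContinuousAt (fun t : ℝ => |t - s| + |t - s| ^ 2) s := by fun_prop
        have h2 := this.tendsto
        simp only [sub_self, abs_zero, zero_pow two_ne_zero, add_zero] at h2
        exact h2.mono_left nhdsWithin_le_nhds
      have h2 : Tendsto e (𝓝[Icc 0 b] s) (𝓝 (e s)) := by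
        rw [tendsto_iff_norm_sub_tendsto_zero]
        refine squeeze_zero' (Eventually.of_forall fun _ => norm_nonneg _) ?_ h1
        filter_upwards [self_mem_nhdsWithin] with t ht
        rcases le_total s t with h | h
        · rw [abs_of_nonneg (sub_nonneg.2 h)]
          exact hlip s t hs.1 h
        · rw [norm_sub_rev, abs_of_nonpos (sub_nonpos.2 h), neg_sub]
          exact hlip t s ht.1 h
      exact ((ContinuousLinearMap.apply ℂ (L2 μ) v).continuous.tendsto (e s)).comp h2
    have hder : ∀ s, 0 ≤ s → HasDerivWithinAt (fun s => e s v) (-(d s v)) (Ici s) s := by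
      intro s hs
      refine hasDerivWithinAt_of_quadratic (c := ‖v‖) fun h hh => ?_
      have h1 := (e (s + h) - e s + h • d s).le_of_opNorm_le (htay s hs h hh) v
      rw [mul_comm] at h1
      exact h1
    have horth : ∀ s, 0 ≤ s → inner ℂ u (e s v) = 0 := by
      intro s hs
      have h1 := constant_of_has_deriv_right_zero (f := fun s => inner ℂ u (e s v)) (a := 0)
        (b := s) (continuousOn_const.inner (hcont s)) (fun t ht => by
          have h2 := (((innerSL ℂ u).restrictScalars ℝ).hasFDerivAt).comp_hasDerivWithinAt t
            (hder t ht.1)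
          have h3 := inner_eq_of_mem_graph hAsymm hu (hed t ht.1 v)
          rw [inner_zero_left] at h3
          have h4 : ((innerSL ℂ u).restrictScalars ℝ) (-(d t v)) = 0 := by
            change inner ℂ u (-(d t v)) = 0
            rw [inner_neg_right, ← h3, neg_zero]
          rw [h4] at h2
          exact h2) s ⟨hs, le_rfl⟩
      exact h1.trans (by rw [← hesymm, heu u hu, hv])
    set G : ℝ → ℂ := fun s => (Real.exp (-(r * s)) : ℂ) * inner ℂ Φ (pw μ m (e s v)) with hG
    have hGc : ∀ b, 0 ≤ b → G b = G 0 := by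
      intro b hb
      refine constant_of_has_deriv_right_zero (a := 0) (b := b) ?_ ?_ b ⟨hb, le_rfl⟩
      · refine ContinuousOn.mul (by fun_prop) ?_
        exact continuousOn_const.inner ((continuous_pw μ m).comp_continuousOn (hcont b))
      · intro s hs
        have h1 : HasDerivWithinAt (fun s : ℝ => (Real.exp (-(r * s)) : ℂ))
            (((-r) * Real.exp (-(r * s)) : ℝ) : ℂ) (Ici s) s := by
          have h2 : HasDerivAt (fun s : ℝ => Real.exp (-(r * s))) (-r * Real.exp (-(r * s))) s := by
            have h3 := (((hasDerivAt_id s).const_mul r).neg).exp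
            have h4 : Real.exp (-(r * s)) * -(r * 1) = -r * Real.exp (-(r * s)) := by ring
            rw [← h4]
            exact h3
          exact h2.ofReal_comp.hasDerivWithinAt
        have h2 := hasDerivWithinAt_multilinear (tensFunctional μ Φ) (fun s _ => e s v)
          (fun _ => -(d s v)) (Ici s) s (fun _ => hder s hs.1)
        have h3 : (∑ i, tensFunctional μ Φ (Function.update (fun _ : Fin m => e s v) i
            (-(d s v)))) = -inner ℂ Φ (dpw μ m (e s v) (d s v)) := by
          rw [dpw, inner_sum, ← Finset.sum_neg_distrib]
          refine Finset.sum_congr rfl fun i _ => ?_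
          have h5 := (tensFunctional μ Φ).map_update_smul (fun _ : Fin m => e s v) i (-1)
            (d s v)
          rw [neg_one_smul, neg_one_smul] at h5
          exact h5
        rw [h3] at h2
        have h4 := h1.mul h2
        have h5 := hΦ _ _ (hed s hs.1 v) (horth s hs.1)
        rw [inner_add_right, inner_smul_right] at h5
        have h6 : ((-r * Real.exp (-(r * s)) : ℝ) : ℂ) * tensFunctional μ Φ (fun _ => e s v) +
            (Real.exp (-(r * s)) : ℂ) * -inner ℂ Φ (dpw μ m (e s v) (d s v)) = 0 := by
          rw [tensFunctional_apply]
          change _ * inner ℂ Φ (pw μ m (e s v)) + _ = 0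
          push_cast
          linear_combination (-(Complex.exp (-(r * s)))) * h5
        rw [h6] at h4
        exact h4
    have hbound : ∀ b, 0 ≤ b → ‖G 0‖ ≤ Real.exp (-(r * b)) * (‖Φ‖ * ‖v‖ ^ m) := by
      intro b hb
      rw [← hGc b hb, hG]
      simp only [norm_mul, Complex.norm_real, Real.norm_of_nonneg (Real.exp_pos _).le]
      refine mul_le_mul_of_nonneg_left ((norm_inner_le_norm _ _).trans ?_) (Real.exp_pos _).le
      rw [norm_pw]
      refine mul_le_mul_of_nonneg_left (pow_le_pow_left₀ (norm_nonneg _) ?_ _) (norm_nonneg _)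
      simpa using (e b).le_of_opNorm_le (he1 b hb) v
    have hlim : Tendsto (fun b => Real.exp (-(r * b)) * (‖Φ‖ * ‖v‖ ^ m)) atTop (𝓝 0) := by
      have h1 : Tendsto (fun b => Real.exp (-(r * b))) atTop (𝓝 0) :=
        Real.tendsto_exp_neg_atTop_nhds_zero.comp (tendsto_id.const_mul_atTop hr)
      simpa using h1.mul_const (‖Φ‖ * ‖v‖ ^ m)
    have hz : ‖G 0‖ ≤ 0 := ge_of_tendsto hlim (by
      filter_upwards [eventually_ge_atTop 0] with b hb using hbound b hb)
    have hG0 : G 0 = 0 := norm_le_zero_iff.1 hz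
    simpa [hG] using hG0
  -- vectors `e 0 v` with `v ⊥ u` are dense in the complement of `u`
  have hdense : f ∈ closure (range (e 0)) := by
    have h1 : (LinearMap.range (e 0).toLinearMap).topologicalClosure = ⊤ := by
      rw [Submodule.topologicalClosure_eq_top_iff, Submodule.eq_bot_iff]
      intro y hy
      refine heinj y (ext_inner_left ℂ fun w => ?_)
      rw [← hesymm, inner_zero_right]
      exact (Submodule.mem_orthogonal _ _).1 hy _ ⟨w, rfl⟩
    have h2 : f ∈ (LinearMap.range (e 0).toLinearMap).topologicalClosure := h1 ▸ Submodule.mem_top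
    exact h2
  obtain ⟨y, hy, hyf⟩ := mem_closure_iff_seq_limit.1 hdense
  choose v hv using hy
  have h1 : ∀ n, e 0 (Q μ u (v n)) = Q μ u (y n) := by
    intro n
    rw [Q_apply μ u hu1, Q_apply μ u hu1, map_sub, map_smul, heu u hu, hv, ← hv n]
    congr 2
    rw [← hesymm, heu u hu]
  have h2 : Tendsto (fun n => inner ℂ Φ (pw μ m (Q μ u (y n)))) atTop
      (𝓝 (inner ℂ Φ (pw μ m (Q μ u f)))) :=
    tendsto_const_nhds.inner (((continuous_pw μ m).tendsto _).comp
      (((Q μ u).continuous.tendsto f).comp hyf))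
  rw [Q_of_inner_eq_zero μ u hu1 hf] at h2
  refine tendsto_nhds_unique h2 (tendsto_const_nhds.congr fun n => ?_)
  rw [← h1, key _ (inner_Q μ u hu1 _)]

end SemigroupTensor

/-! ### Multiplication operators -/

section Multiplication

open Filter Topology

variable {α : Type*} [MeasurableSpace α] {κ : Measure α} {g : α → ℝ}

theorem mem_mulOp_graph {Φ Ψ : L2 κ} : (Φ, Ψ) ∈ (mulOp κ g).graph ↔
    Ψ =ᵐ[κ] fun x => (g x : ℂ) * Φ x := by
  rw [mulOp, Submodule.toLinearPMap_graph_eq]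
  · exact Iff.rfl
  · rintro ⟨Φ, Ψ⟩ (h : Ψ =ᵐ[κ] _) (rfl : Φ = 0)
    refine (Lp.eq_zero_iff_ae_eq_zero).2 ?_
    filter_upwards [h, Lp.coeFn_zero ℂ 2 κ] with x h1 h2
    rw [h1, h2, Pi.zero_apply, mul_zero]

theorem isFormalAdjoint_mulOp : (mulOp κ g).IsFormalAdjoint (mulOp κ g) := by
  refine isFormalAdjoint_of_graph ?_
  rintro ⟨Φ, Ψ⟩ hp ⟨Φ', Ψ'⟩ hq
  rw [mem_mulOp_graph] at hp hq
  simp only [inner_L2]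
  refine integral_congr_ae ?_
  filter_upwards [hp, hq] with x h1 h2
  rw [h1, h2, map_mul, Complex.conj_ofReal]
  ring

/-- A subsequence of a convergent sequence in `L²` converges almost everywhere. -/
theorem exists_subseq_tendsto_ae {f : ℕ → L2 κ} {h : L2 κ} (hf : Tendsto f atTop (𝓝 h)) :
    ∃ ns : ℕ → ℕ, StrictMono ns ∧ ∀ᵐ x ∂κ, Tendsto (fun i => f (ns i) x) atTop (𝓝 (h x)) :=
  (tendstoInMeasure_of_tendsto_Lp hf).exists_seq_tendsto_ae

theorem isClosed_mulOp_graph : IsClosed ((mulOp κ g).graph : Set (L2 κ × L2 κ)) := by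
  refine isClosed_of_closure_subset fun p hp => ?_
  obtain ⟨q, hq, hqp⟩ := mem_closure_iff_seq_limit.1 hp
  have h1 : Tendsto (fun n => (q n).1) atTop (𝓝 p.1) := (continuous_fst.tendsto p).comp hqp
  have h2 : Tendsto (fun n => (q n).2) atTop (𝓝 p.2) := (continuous_snd.tendsto p).comp hqp
  obtain ⟨ns, hns, h3⟩ := exists_subseq_tendsto_ae h1
  obtain ⟨ms, hms, h4⟩ := exists_subseq_tendsto_ae (h2.comp hns.tendsto_atTop)
  refine mem_mulOp_graph.2 ?_
  have h5 := ae_all_iff.2 fun n => mem_mulOp_graph.1 (hq n)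
  filter_upwards [h3, h4, h5] with x h3 h4 h5
  refine tendsto_nhds_unique h4 ?_
  refine ((h3.comp hms.tendsto_atTop).const_mul (g x : ℂ)).congr fun n => ?_
  exact (h5 _).symm

end Multiplication

/-! ### The interaction of two particles -/

section Interaction

variable {X : Type*} [MeasurableSpace X] (μ : Measure X) [SigmaFinite μ] {W : X → X → ℝ}

theorem two_mul_pairSum (hW : ∀ x y, W x y = W y x) {m : ℕ} (x : Fin m → X) :
    2 * ∑ i, ∑ j ∈ Finset.Ioi i, W (x i) (x j) =
      ∑ i, ∑ j, if i = j then 0 else W (x i) (x j) := by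
  have h1 : ∑ i, ∑ j ∈ Finset.Ioi i, W (x i) (x j) =
      ∑ i, ∑ j, if i < j then W (x i) (x j) else 0 := by
    refine Finset.sum_congr rfl fun i _ => ?_
    rw [← Finset.sum_filter]
    refine Finset.sum_congr ?_ fun _ _ => rfl
    ext j
    simp
  have h2 : ∑ i, ∑ j ∈ Finset.Ioi i, W (x i) (x j) =
      ∑ i, ∑ j, if j < i then W (x i) (x j) else 0 := by
    rw [h1, Finset.sum_comm]
    refine Finset.sum_congr rfl fun i _ => Finset.sum_congr rfl fun j _ => ?_
    rw [hW]
  rw [two_mul]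
  nth_rewrite 1 [h1]
  rw [h2, ← Finset.sum_add_distrib]
  refine Finset.sum_congr rfl fun i _ => ?_
  rw [← Finset.sum_add_distrib]
  refine Finset.sum_congr rfl fun j _ => ?_
  rcases lt_trichotomy i j with h | h | h
  · simp [h, h.ne, h.not_gt]
  · simp [h]
  · simp [h, h.ne', h.not_gt]

theorem pairSum_perm (hW : ∀ x y, W x y = W y x) {m : ℕ} (σ : Equiv.Perm (Fin m))
    (x : Fin m → X) : ∑ i, ∑ j ∈ Finset.Ioi i, W (x (σ i)) (x (σ j)) =
      ∑ i, ∑ j ∈ Finset.Ioi i, W (x i) (x j) := by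
  have h1 := two_mul_pairSum hW x
  have h2 := two_mul_pairSum hW fun i => x (σ i)
  have h3 : (∑ i, ∑ j, if i = j then 0 else W (x (σ i)) (x (σ j))) =
      ∑ i, ∑ j, if i = j then 0 else W (x i) (x j) := by
    refine Fintype.sum_equiv σ _ _ fun i => Fintype.sum_equiv σ _ _ fun j => ?_
    simp
  linarith

/-- A symmetric interaction maps symmetric functions to symmetric functions. -/
theorem mem_sym_of_mem_mulOp_graph (hW : ∀ x y, W x y = W y x) {m : ℕ} {Φ Ψ : L2N μ m}
    (hΦ : Φ ∈ sym μ m) (h : (Φ, Ψ) ∈ (mulOp (Measure.pi fun _ : Fin m => μ) fun x =>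
      ∑ i, ∑ j ∈ Finset.Ioi i, W (x i) (x j)).graph) : Ψ ∈ sym μ m := by
  refine (mem_sym_iff μ Ψ).2 fun σ => ?_
  rw [mem_mulOp_graph] at h
  ext1
  have h1 : permute μ m σ Ψ =ᵐ[_] Ψ ∘ fun x i => x (σ i) :=
    Lp.coeFn_compMeasurePreserving Ψ (measurePreserving_perm μ m σ)
  have h2 : permute μ m σ Φ =ᵐ[_] Φ ∘ fun x i => x (σ i) :=
    Lp.coeFn_compMeasurePreserving Φ (measurePreserving_perm μ m σ)
  rw [(mem_sym_iff μ Φ).1 hΦ σ] at h2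
  have h3 := (measurePreserving_perm μ m σ).quasiMeasurePreserving.ae h
  filter_upwards [h1, h2, h3, h] with x h1 h2 h3 h
  rw [h1, Function.comp_apply, h3, h, h2, Function.comp_apply, pairSum_perm hW]

theorem mem_interaction_graph (hW : ∀ x y, W x y = W y x) {m : ℕ} {Φ Ψ : sym μ m} :
    (Φ, Ψ) ∈ (interaction μ W m).graph ↔ (Ψ : L2N μ m) =ᵐ[Measure.pi fun _ : Fin m => μ]
      fun x => ((∑ i, ∑ j ∈ Finset.Ioi i, W (x i) (x j) : ℝ) : ℂ) * (Φ : L2N μ m) x := by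
  rw [← mem_mulOp_graph (g := fun x : Fin m → X => ∑ i, ∑ j ∈ Finset.Ioi i, W (x i) (x j)),
    interaction]
  constructor
  · intro h
    obtain ⟨z, hz, rfl⟩ := mem_compress_graph.1 h
    rw [Submodule.coe_orthogonalProjectionOnto_apply,
      Submodule.starProjection_eq_self_iff.2 (mem_sym_of_mem_mulOp_graph μ hW Φ.2 hz)]
    exact hz
  · exact mem_compress_graph_of_mem

theorem pw_mem_kinetic_graph {T : L2 μ →ₗ.[ℂ] L2 μ} (hT : IsSelfAdjoint T) (m : ℕ) {f g : L2 μ}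
    (h : (f, g) ∈ T.graph) : ((⟨pw μ m f, pw_mem_sym μ m f⟩ : sym μ m),
      (⟨dpw μ m f g, dpw_mem_sym μ m f g⟩ : sym μ m)) ∈ (kinetic μ T m).graph :=
  mem_compress_graph_of_mem
    (pw_mem_sumOp_graph μ m (isFormalAdjoint_of_isSelfAdjoint hT) hT.dense_domain h)

/-- The product of the interaction with `f ⊗ g`, as an element of `L²(X × X)` (`0` if this is not
square-integrable). -/
def pairMul (W : X → X → ℝ) (f g : L2 μ) : L2 (μ.prod μ) :=
  ofFun (μ.prod μ) fun p => (W p.1 p.2 : ℂ) * (f p.1 * g p.2)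

/-- The product of the interaction with `f ⊗ g` is square-integrable. -/
def PairMem (W : X → X → ℝ) (f g : L2 μ) : Prop :=
  MemLp (fun p : X × X => (W p.1 p.2 : ℂ) * (f p.1 * g p.2)) 2 (μ.prod μ)

variable {μ}

theorem PairMem.coeFn {f g : L2 μ} (h : PairMem μ W f g) :
    pairMul μ W f g =ᵐ[μ.prod μ] fun p => (W p.1 p.2 : ℂ) * (f p.1 * g p.2) := by
  have h' : MemLp (fun p : X × X => (W p.1 p.2 : ℂ) * (f p.1 * g p.2)) 2 (μ.prod μ) := h
  rw [pairMul, ofFun, dif_pos h']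
  exact MemLp.coeFn_toLp h'

theorem measurePreserving_pair :
    MeasurePreserving (fun (p : X × X) => (![p.1, p.2] : Fin 2 → X)) (μ.prod μ)
      (Measure.pi fun _ : Fin 2 => μ) := by
  have h := (measurePreserving_piFinTwo (fun _ : Fin 2 => μ)).symm
  convert h using 1
  funext p i
  fin_cases i <;> rfl

/-- A function of two variables as a function of a pair. -/
def toPair : L2N μ 2 →ₗᵢ[ℂ] L2 (μ.prod μ) :=
  Lp.compMeasurePreservingₗᵢ ℂ _ measurePreserving_pair

theorem coeFn_toPair (Φ : L2N μ 2) : toPair Φ =ᵐ[μ.prod μ] fun p => Φ ![p.1, p.2] :=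
  Lp.coeFn_compMeasurePreserving Φ measurePreserving_pair

theorem toPair_pw (f : L2 μ) : toPair (pw μ 2 f) = prodMul μ μ f f := by
  ext1
  filter_upwards [coeFn_toPair (pw μ 2 f), coeFn_prodMul μ μ f f,
    measurePreserving_pair.quasiMeasurePreserving.ae (coeFn_pw μ 2 f)] with p h1 h2 h3
  rw [h1, h2, h3]
  simp

/-- The relative bound of the interaction by the kinetic energy, on linear combinations of squares
`f ⊗ f`. -/
theorem norm_interaction_le {T : L2 μ →ₗ.[ℂ] L2 μ} {C₀ : ℝ}
    (hW : ∀ x y, W x y = W y x)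
    (hb : SqLE (interaction μ W 2) ((C₀ : ℂ) • kinetic μ T 2)) {Φ K : sym μ 2}
    (h : (Φ, K) ∈ (kinetic μ T 2).graph) :
    ∃ Ψ : L2 (μ.prod μ), (Ψ =ᵐ[μ.prod μ] fun p => (W p.1 p.2 : ℂ) * toPair (Φ : L2N μ 2) p) ∧
      ‖Ψ‖ ^ 2 ≤ C₀ * (inner ℂ Φ K).re := by
  have h1 := smul_mem_graph (C₀ : ℂ) h
  have hx := LinearPMap.mem_domain_of_mem_graph h1
  obtain ⟨hy, hle⟩ := hb ⟨Φ, hx⟩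
  rw [apply_eq_of_mem_graph h1 hx, inner_smul_right, Complex.re_ofReal_mul] at hle
  have h2 := (interaction μ W 2).mem_graph ⟨Φ, hy⟩
  rw [mem_interaction_graph μ hW] at h2
  refine ⟨toPair (interaction μ W 2 ⟨Φ, hy⟩ : L2N μ 2), ?_, ?_⟩
  · filter_upwards [coeFn_toPair (interaction μ W 2 ⟨Φ, hy⟩ : L2N μ 2),
      coeFn_toPair (Φ : L2N μ 2), measurePreserving_pair.quasiMeasurePreserving.ae h2]
      with p h3 h4 h5
    rw [h3, h5, h4]
    congr 2
    have : Finset.Ioi (1 : Fin 2) = ∅ := by decide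
    have h0 : Finset.Ioi (0 : Fin 2) = {1} := by decide
    simp [Fin.sum_univ_two, this, h0]
  · rw [LinearIsometry.norm_map]
    exact hle

end Interaction

/-! ### Form domains -/

section FormDomain

open Filter Topology

variable {E : Type*} [NormedAddCommGroup E] [InnerProductSpace ℂ E] [CompleteSpace E]

/-- If `u` lies in the domain of `T`, the value of the closed form at `u` is `⟨u, T u⟩`. -/
theorem HasFormValue.eq_inner {T : E →ₗ.[ℂ] E} (hT : T.IsFormalAdjoint T)
    (h0 : ∀ f : T.domain, 0 ≤ (inner ℂ (f : E) (T f)).re) {u : E} {t : ℝ}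
    (h : HasFormValue T u t) (hu : u ∈ T.domain) : t = (inner ℂ u (T ⟨u, hu⟩)).re := by
  obtain ⟨v, hv, hc, ht⟩ := h
  set u' : T.domain := ⟨u, hu⟩
  have hre : ∀ x y : T.domain, (inner ℂ (y : E) (T x)).re = (inner ℂ (x : E) (T y)).re := by
    intro x y
    rw [← hT, ← inner_conj_symm, Complex.conj_re]
  have hexp : ∀ x y : T.domain, (inner ℂ ((x - y : T.domain) : E) (T (x - y))).re =
      (inner ℂ (x : E) (T x)).re - 2 * (inner ℂ (y : E) (T x)).re +
        (inner ℂ (y : E) (T y)).re := by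
    intro x y
    rw [LinearPMap.map_sub, Submodule.coe_sub, inner_sub_left, inner_sub_right, inner_sub_right,
      Complex.sub_re, Complex.sub_re, Complex.sub_re, hre x y]
    ring
  -- the form of `v n - u` tends to zero
  have h1 : Tendsto (fun n => (inner ℂ ((v n - u' : T.domain) : E) (T (v n - u'))).re)
      atTop (𝓝 0) := by
    rw [Metric.tendsto_atTop]
    intro ε hε
    obtain ⟨n₀, hn₀⟩ := hc (ε / 2) (by positivity)
    refine ⟨n₀, fun n hn => ?_⟩
    rw [Real.dist_eq, sub_zero, abs_of_nonneg (h0 _)]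
    have h2 : Tendsto (fun m => ε / 2 + 2 *
        (inner ℂ ((v m - u' : T.domain) : E) (T (v n - u'))).re) atTop (𝓝 (ε / 2)) := by
      have h3 : Tendsto (fun m => ((v m - u' : T.domain) : E)) atTop (𝓝 (u - u)) :=
        hv.sub tendsto_const_nhds
      have h4 := (((Complex.continuous_re.tendsto _).comp
        (h3.inner (𝕜 := ℂ) (tendsto_const_nhds (x := T (v n - u'))))).const_mul 2).const_add (ε / 2)
      rw [sub_self, inner_zero_left] at h4
      simp only [Complex.zero_re, mul_zero, add_zero] at h4
      exact h4
    have h5 : (inner ℂ ((v n - u' : T.domain) : E) (T (v n - u'))).re ≤ ε / 2 := by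
      refine ge_of_tendsto h2 ?_
      filter_upwards [eventually_ge_atTop n₀] with m hm
      have h6 := hn₀ n hn m hm
      have h7 := hexp (v n - u') (v m - u')
      rw [sub_sub_sub_cancel_right] at h7
      have h8 := h0 (v m - u')
      have h9 := (abs_lt.1 h6).2
      linarith
    linarith
  have h2 : Tendsto (fun n => (inner ℂ ((v n - u' : T.domain) : E) (T (v n - u'))).re)
      atTop (𝓝 (t - 2 * (inner ℂ u (T u')).re + (inner ℂ u (T u')).re)) := by
    simp only [hexp, hre _ u']
    have h3 : Tendsto (fun n => (inner ℂ (v n : E) (T u')).re) atTop (𝓝 (inner ℂ u (T u')).re) :=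
      (Complex.continuous_re.tendsto _).comp (hv.inner (𝕜 := ℂ) tendsto_const_nhds)
    exact (ht.sub (h3.const_mul 2)).add tendsto_const_nhds
  have := tendsto_nhds_unique h1 h2
  linarith

end FormDomain

/-! ### The setting -/

section Setting

open Filter Topology

variable {X : Type*} [MeasurableSpace X] (μ : Measure X) [SigmaFinite μ]

/-- The assumptions on the one-particle operator `T` and on the interaction `W`: `T ≥ 1` is
self-adjoint, `W` is symmetric and measurable, and `W² ≤ C₀ (T ⊗ 1 + 1 ⊗ T)` for two bosons. -/
structure IsSystem (T : L2 μ →ₗ.[ℂ] L2 μ) (W : X → X → ℝ) (C₀ : ℝ) : Prop where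
  sa : IsSelfAdjoint T
  one_le : ∀ f : T.domain, ‖(f : L2 μ)‖ ^ 2 ≤ (inner ℂ (f : L2 μ) (T f)).re
  pos : 0 < C₀
  meas : Measurable (Function.uncurry W)
  symm : ∀ x y, W x y = W y x
  bound : SqLE (interaction μ W 2) ((C₀ : ℂ) • kinetic μ T 2)

variable {μ} {T : L2 μ →ₗ.[ℂ] L2 μ} {W : X → X → ℝ} {C₀ : ℝ}

theorem aesm_pair (hW : Measurable (Function.uncurry W)) (f g : L2 μ) :
    AEStronglyMeasurable (fun p : X × X => (W p.1 p.2 : ℂ) * (f p.1 * g p.2)) (μ.prod μ) :=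
  (Complex.measurable_ofReal.comp hW).aestronglyMeasurable.mul
    ((Lp.aestronglyMeasurable f).comp_fst.mul (Lp.aestronglyMeasurable g).comp_snd)

theorem pairMul_eq {f g : L2 μ} {Ψ : L2 (μ.prod μ)}
    (h : Ψ =ᵐ[μ.prod μ] fun p => (W p.1 p.2 : ℂ) * (f p.1 * g p.2)) :
    PairMem μ W f g ∧ pairMul μ W f g = Ψ := by
  have h1 : PairMem μ W f g := (memLp_congr_ae h).1 (Lp.memLp Ψ)
  refine ⟨h1, ?_⟩
  ext1
  exact h1.coeFn.trans h.symm

namespace IsSystem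

variable (hS : IsSystem μ T W C₀)
include hS

/-- The two-body bound on `f ⊗ f`. -/
theorem pairMul_self {f g : L2 μ} (h : (f, g) ∈ T.graph) : PairMem μ W f f ∧
    ‖pairMul μ W f f‖ ^ 2 ≤ 2 * C₀ * ((inner ℂ f g).re * ‖f‖ ^ 2) := by
  obtain ⟨Ψ, h1, h2⟩ := norm_interaction_le hS.symm hS.bound (pw_mem_kinetic_graph μ hS.sa 2 h)
  rw [toPair_pw] at h1
  have h3 : Ψ =ᵐ[μ.prod μ] fun p => (W p.1 p.2 : ℂ) * (f p.1 * f p.2) := by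
    filter_upwards [h1, coeFn_prodMul μ μ f f] with p h1 h2
    rw [h1, h2]
  obtain ⟨h4, rfl⟩ := pairMul_eq h3
  refine ⟨h4, h2.trans (le_of_eq ?_)⟩
  rw [Submodule.coe_inner]
  simp only
  rw [inner_pw_dpw, inner_self_eq_norm_sq_to_K]
  have : (((2 : ℕ) : ℂ) * inner ℂ f g * ((‖f‖ : ℂ) ^ 2) ^ (2 - 1)) =
      (((2 * ‖f‖ ^ 2 : ℝ)) : ℂ) * inner ℂ f g := by push_cast; ring
  erw [this]
  rw [Complex.re_ofReal_mul]
  ring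

/-- For `u` in the form domain of `T`, the function `W(x,y) u(x) u(y)` is square-integrable:
Fatou's lemma, along an approximating sequence in the domain that converges almost everywhere. -/
theorem pairMem_of_hasFormValue {u : L2 μ} {t : ℝ} (h : HasFormValue T u t) :
    PairMem μ W u u := by
  obtain ⟨v, hv, -, ht⟩ := h
  obtain ⟨ns, hns, hae⟩ := exists_subseq_tendsto_ae hv
  have hm : ∀ n, PairMem μ W (v n) (v n) := fun n => (hS.pairMul_self (T.mem_graph (v n))).1
  obtain ⟨B, hB⟩ : ∃ B : ℝ, ∀ n, ‖pairMul μ W (v n) (v n)‖ ≤ B := by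
    have h1 : Tendsto (fun n => 2 * C₀ * ((inner ℂ (v n : L2 μ) (T (v n))).re *
        ‖(v n : L2 μ)‖ ^ 2)) atTop (𝓝 (2 * C₀ * (t * ‖u‖ ^ 2))) :=
      (ht.mul (hv.norm.pow 2)).const_mul _
    obtain ⟨B, hB⟩ := h1.bddAbove_range
    refine ⟨√B, fun n => Real.le_sqrt_of_sq_le ?_⟩
    exact (hS.pairMul_self (T.mem_graph (v n))).2.trans (hB ⟨n, rfl⟩)
  refine ⟨aesm_pair hS.meas u u, ?_⟩
  have h1 : ∀ᵐ p ∂(μ.prod μ), Tendsto (fun i => (W p.1 p.2 : ℂ) *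
      ((v (ns i) : L2 μ) p.1 * (v (ns i) : L2 μ) p.2)) atTop
        (𝓝 ((W p.1 p.2 : ℂ) * (u p.1 * u p.2))) := by
    filter_upwards [Measure.quasiMeasurePreserving_fst.ae hae,
      Measure.quasiMeasurePreserving_snd.ae hae] with p h1 h2
    exact (h1.mul h2).const_mul _
  refine (Lp.eLpNorm_lim_le_liminf_eLpNorm (p := 2)
    (fun i => aesm_pair hS.meas (v (ns i) : L2 μ) (v (ns i) : L2 μ)) _ h1).trans_lt ?_
  have h2 : ∀ i, eLpNorm (fun p : X × X => (W p.1 p.2 : ℂ) *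
      ((v (ns i) : L2 μ) p.1 * (v (ns i) : L2 μ) p.2)) 2 (μ.prod μ) ≤ ENNReal.ofReal B := by
    intro i
    rw [← eLpNorm_congr_ae (hm (ns i)).coeFn, ← Lp.enorm_def, ← ofReal_norm]
    exact ENNReal.ofReal_le_ofReal (hB _)
  refine lt_of_le_of_lt ?_ (ENNReal.ofReal_lt_top (r := B))
  refine (liminf_le_liminf (Eventually.of_forall h2)).trans ?_
  simp

end IsSystem

/-- Multiplication of `f` by the mean-field potential of `u`, as a partial integral. -/
theorem coeFn_contract_pairMul {u f : L2 μ} (h : PairMem μ W f u) :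
    contract μ μ u (pairMul μ W f u) =ᵐ[μ] fun x => (meanField μ W u x : ℂ) * f x := by
  filter_upwards [coeFn_contract μ μ u (pairMul μ W f u), Measure.ae_ae_of_ae_prod h.coeFn]
    with x h1 h2
  rw [h1, meanField, ← integral_complex_ofReal, ← integral_mul_const]
  refine integral_congr_ae ?_
  filter_upwards [h2] with y h3
  rw [h3]
  have : conj (u y) * u y = ((‖u y‖ ^ 2 : ℝ) : ℂ) := by
    rw [Complex.conj_mul']; norm_cast
  push_cast at this ⊢
  linear_combination (W x y : ℂ) * f x * this

theorem inner_contract_pairMul {u f g : L2 μ} (h : PairMem μ W f u) :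
    inner ℂ g (contract μ μ u (pairMul μ W f u)) =
      ∫ x, conj (g x) * ((meanField μ W u x : ℂ) * f x) ∂μ := by
  rw [inner_L2]
  refine integral_congr_ae ?_
  filter_upwards [coeFn_contract_pairMul h] with x hx
  rw [hx]

variable (T W) in
/-- The assumptions on the solution `u` of the Hartree equation. -/
structure IsHartree (u : L2 μ) (t μ₀ : ℝ) : Prop where
  norm : ‖u‖ = 1
  form : HasFormValue T u t
  eqn : SolvesHartree μ W u T μ₀

/-- A solution of the Hartree equation in the form domain lies in the domain of `T`. -/
theorem IsHartree.mem_graph (hS : IsSystem μ T W C₀) {u : L2 μ} {t μ₀ : ℝ}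
    (hu : IsHartree T W u t μ₀) :
    (u, (μ₀ : ℂ) • u - contract μ μ u (pairMul μ W u u)) ∈ T.graph := by
  have hm := hS.pairMem_of_hasFormValue hu.form
  have h1 : ∀ v : T.domain, inner ℂ ((μ₀ : ℂ) • u - contract μ μ u (pairMul μ W u u)) (v : L2 μ) =
      inner ℂ u (T v) := by
    intro v
    have h2 := hu.eqn v
    rw [← inner_contract_pairMul hm] at h2
    rw [← inner_conj_symm, ← inner_conj_symm u, inner_sub_right, inner_smul_right]
    congr 1
    linear_combination -h2
  have h2 := LinearPMap.mem_adjoint_domain_of_exists (T := T) u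
    ⟨(μ₀ : ℂ) • u - contract μ μ u (pairMul μ W u u), h1⟩
  have h3 := LinearPMap.adjoint_apply_eq (T := T) hS.sa.dense_domain ⟨u, h2⟩ h1
  have h4 : (u, (μ₀ : ℂ) • u - contract μ μ u (pairMul μ W u u)) ∈
      (LinearPMap.adjoint T).graph := mem_graph_mk h2 h3
  rwa [LinearPMap.isSelfAdjoint_def.1 hS.sa] at h4

end Setting

/-! ### Bounds for the interaction of a pair -/

section PairBounds

variable {X : Type*} [MeasurableSpace X] {μ : Measure X} [SigmaFinite μ] {W : X → X → ℝ}

theorem norm_sq_L2 {α : Type*} [MeasurableSpace α] {κ : Measure α} (F : L2 κ) :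
    ‖F‖ ^ 2 = ∫ x, ‖F x‖ ^ 2 ∂κ := by
  have h := inner_L2 F F
  rw [inner_self_eq_norm_sq_to_K] at h
  have h1 : ∀ x, conj (F x) * F x = ((‖F x‖ ^ 2 : ℝ) : ℂ) := fun x => by
    rw [Complex.conj_mul']; norm_cast
  simp only [h1] at h
  rw [integral_complex_ofReal] at h
  refine Complex.ofReal_injective ?_
  rw [← h]
  simp

theorem integrable_norm_sq_L2 {α : Type*} [MeasurableSpace α] {κ : Measure α} (F : L2 κ) :
    Integrable (fun x => ‖F x‖ ^ 2) κ :=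
  (memLp_two_iff_integrable_sq_norm (Lp.memLp F).1).1 (Lp.memLp F)

/-- A mixed product is controlled by squares of the two vectors, of their sum and of their
difference. -/
theorem norm_mul_sq_le_squares (a b c d : ℂ) : ‖a * d‖ ^ 2 ≤ ‖a * b‖ ^ 2 + ‖c * d‖ ^ 2 +
    1 / 2 * (‖(a + c) * (b + d)‖ ^ 2 + ‖(a - c) * (b - d)‖ ^ 2) := by
  set s := a * d + c * b with hs
  have h1 : ‖s‖ ^ 2 ≤ 1 / 2 * (‖(a + c) * (b + d)‖ ^ 2 + ‖(a - c) * (b - d)‖ ^ 2) := by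
    have e : 2 * s = (a + c) * (b + d) - (a - c) * (b - d) := by rw [hs]; ring
    have h2 := norm_sub_le ((a + c) * (b + d)) ((a - c) * (b - d))
    rw [← e, norm_mul, Complex.norm_ofNat] at h2
    nlinarith [sq_nonneg (‖(a + c) * (b + d)‖ - ‖(a - c) * (b - d)‖), norm_nonneg s,
      norm_nonneg ((a + c) * (b + d)), norm_nonneg ((a - c) * (b - d))]
  have h2 : ‖a * d‖ ≤ ‖s‖ + ‖c * b‖ := by
    have := norm_sub_le s (c * b)
    rwa [hs, add_sub_cancel_right] at this
  have h3 : ‖a * d‖ * ‖c * b‖ = ‖a * b‖ * ‖c * d‖ := by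
    simp only [norm_mul]; ring
  have h4 := mul_le_mul_of_nonneg_left h2 (norm_nonneg (a * d))
  nlinarith [sq_nonneg (‖a * d‖ - ‖s‖), sq_nonneg (‖a * b‖ - ‖c * d‖)]

theorem PairMem.of_squares (hW : Measurable (Function.uncurry W)) {f g : L2 μ}
    (h1 : PairMem μ W f f) (h2 : PairMem μ W g g) (h3 : PairMem μ W (f + g) (f + g))
    (h4 : PairMem μ W (f - g) (f - g)) : PairMem μ W f g ∧
      ‖pairMul μ W f g‖ ^ 2 ≤ ‖pairMul μ W f f‖ ^ 2 + ‖pairMul μ W g g‖ ^ 2 +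
        1 / 2 * (‖pairMul μ W (f + g) (f + g)‖ ^ 2 + ‖pairMul μ W (f - g) (f - g)‖ ^ 2) := by
  have hpt : ∀ᵐ p ∂(μ.prod μ), ‖(W p.1 p.2 : ℂ) * (f p.1 * g p.2)‖ ^ 2 ≤
      ‖pairMul μ W f f p‖ ^ 2 + ‖pairMul μ W g g p‖ ^ 2 +
        1 / 2 * (‖pairMul μ W (f + g) (f + g) p‖ ^ 2 + ‖pairMul μ W (f - g) (f - g) p‖ ^ 2) := by
    have ha := Lp.coeFn_add f g
    have hs := Lp.coeFn_sub f g
    filter_upwards [h1.coeFn, h2.coeFn, h3.coeFn, h4.coeFn,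
      Measure.quasiMeasurePreserving_fst.ae ha, Measure.quasiMeasurePreserving_snd.ae ha,
      Measure.quasiMeasurePreserving_fst.ae hs, Measure.quasiMeasurePreserving_snd.ae hs]
      with p e1 e2 e3 e4 e5 e6 e7 e8
    rw [e1, e2, e3, e4, e5, e6, e7, e8]
    simp only [Pi.add_apply, Pi.sub_apply]
    have := mul_le_mul_of_nonneg_left (norm_mul_sq_le_squares (f p.1) (f p.2) (g p.1) (g p.2))
      (sq_nonneg ‖(W p.1 p.2 : ℂ)‖)
    simp only [norm_mul, mul_pow] at this ⊢
    linarith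
  have hint : Integrable (fun p => ‖pairMul μ W f f p‖ ^ 2 + ‖pairMul μ W g g p‖ ^ 2 +
        1 / 2 * (‖pairMul μ W (f + g) (f + g) p‖ ^ 2 + ‖pairMul μ W (f - g) (f - g) p‖ ^ 2))
        (μ.prod μ) :=
    ((integrable_norm_sq_L2 _).add (integrable_norm_sq_L2 _)).add
      (((integrable_norm_sq_L2 _).add (integrable_norm_sq_L2 _)).const_mul _)
  have hm : PairMem μ W f g := by
    refine (memLp_two_iff_integrable_sq_norm (aesm_pair hW f g)).2 ?_
    refine hint.mono' ((aesm_pair hW f g).norm.pow 2) ?_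
    filter_upwards [hpt] with p hp
    rwa [Real.norm_of_nonneg (sq_nonneg _)]
  refine ⟨hm, ?_⟩
  simp only [norm_sq_L2 (pairMul μ W _ _)]
  have i1 : Integrable (fun p => ‖pairMul μ W f f p‖ ^ 2 + ‖pairMul μ W g g p‖ ^ 2) (μ.prod μ) :=
    (integrable_norm_sq_L2 _).add (integrable_norm_sq_L2 _)
  have i2 : Integrable (fun p => ‖pairMul μ W (f + g) (f + g) p‖ ^ 2 +
      ‖pairMul μ W (f - g) (f - g) p‖ ^ 2) (μ.prod μ) :=
    (integrable_norm_sq_L2 _).add (integrable_norm_sq_L2 _)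
  rw [← integral_add (integrable_norm_sq_L2 _) (integrable_norm_sq_L2 _),
    ← integral_add (integrable_norm_sq_L2 _) (integrable_norm_sq_L2 _), ← integral_const_mul,
    ← integral_add i1 (i2.const_mul _)]
  refine integral_mono_ae (integrable_norm_sq_L2 _) hint ?_
  filter_upwards [hpt, hm.coeFn] with p hp h
  rw [h]
  exact hp

theorem PairMem.add_left {f f' g : L2 μ} (h : PairMem μ W f g) (h' : PairMem μ W f' g) :
    PairMem μ W (f + f') g ∧
      pairMul μ W (f + f') g = pairMul μ W f g + pairMul μ W f' g := by
  refine pairMul_eq ?_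
  filter_upwards [Lp.coeFn_add (pairMul μ W f g) (pairMul μ W f' g), h.coeFn, h'.coeFn,
    Measure.quasiMeasurePreserving_fst.ae (Lp.coeFn_add f f')] with p h1 h2 h3 h4
  rw [h1, Pi.add_apply, h2, h3, h4, Pi.add_apply]
  ring

theorem PairMem.smul_left {f g : L2 μ} (h : PairMem μ W f g) (c : ℂ) :
    PairMem μ W (c • f) g ∧ pairMul μ W (c • f) g = c • pairMul μ W f g := by
  refine pairMul_eq ?_
  filter_upwards [Lp.coeFn_smul c (pairMul μ W f g), h.coeFn,
    Measure.quasiMeasurePreserving_fst.ae (Lp.coeFn_smul c f)] with p h1 h2 h4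
  rw [h1, Pi.smul_apply, h2, h4, Pi.smul_apply, smul_eq_mul, smul_eq_mul]
  ring

/-- Exchange of the two variables. -/
def swapPair : L2 (μ.prod μ) →ₗᵢ[ℂ] L2 (μ.prod μ) :=
  Lp.compMeasurePreservingₗᵢ ℂ _ (Measure.measurePreserving_swap (μ := μ) (ν := μ))

theorem swapPair_prodMul (f g : L2 μ) : swapPair (prodMul μ μ f g) = prodMul μ μ g f := by
  ext1
  have h1 : swapPair (prodMul μ μ f g) =ᵐ[_] prodMul μ μ f g ∘ Prod.swap :=
    Lp.coeFn_compMeasurePreserving _ Measure.measurePreserving_swap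
  filter_upwards [h1, coeFn_prodMul μ μ g f,
    Measure.measurePreserving_swap.quasiMeasurePreserving.ae (coeFn_prodMul μ μ f g)]
    with p h1 h2 h3
  rw [h1, Function.comp_apply, h3, h2, mul_comm]
  rfl

theorem PairMem.swap (hW : ∀ x y, W x y = W y x) {f g : L2 μ} (h : PairMem μ W f g) :
    PairMem μ W g f ∧ pairMul μ W g f = swapPair (pairMul μ W f g) := by
  refine pairMul_eq ?_
  have h1 : swapPair (pairMul μ W f g) =ᵐ[_] pairMul μ W f g ∘ Prod.swap :=
    Lp.coeFn_compMeasurePreserving _ Measure.measurePreserving_swap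
  filter_upwards [h1, Measure.measurePreserving_swap.quasiMeasurePreserving.ae h.coeFn]
    with p h1 h3
  rw [h1, Function.comp_apply, h3, Prod.fst_swap, Prod.snd_swap, hW, mul_comm (f p.2)]

theorem PairMem.add_right {f g g' : L2 μ} (h : PairMem μ W f g) (h' : PairMem μ W f g') :
    PairMem μ W f (g + g') ∧
      pairMul μ W f (g + g') = pairMul μ W f g + pairMul μ W f g' := by
  refine pairMul_eq ?_
  filter_upwards [Lp.coeFn_add (pairMul μ W f g) (pairMul μ W f g'), h.coeFn, h'.coeFn,
    Measure.quasiMeasurePreserving_snd.ae (Lp.coeFn_add g g')] with p h1 h2 h3 h4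
  rw [h1, Pi.add_apply, h2, h3, h4, Pi.add_apply]
  ring

theorem PairMem.smul_right {f g : L2 μ} (h : PairMem μ W f g) (c : ℂ) :
    PairMem μ W f (c • g) ∧ pairMul μ W f (c • g) = c • pairMul μ W f g := by
  refine pairMul_eq ?_
  filter_upwards [Lp.coeFn_smul c (pairMul μ W f g), h.coeFn,
    Measure.quasiMeasurePreserving_snd.ae (Lp.coeFn_smul c g)] with p h1 h2 h4
  rw [h1, Pi.smul_apply, h2, h4, Pi.smul_apply, smul_eq_mul, smul_eq_mul]
  ring

theorem inner_prodMul_pairMul_swap (hW : ∀ x y, W x y = W y x) {f g : L2 μ}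
    (h : PairMem μ W f g) (a b : L2 μ) :
    inner ℂ (prodMul μ μ a b) (pairMul μ W f g) = inner ℂ (prodMul μ μ b a) (pairMul μ W g f) := by
  rw [((h.swap hW).1.swap hW).2, ← swapPair_prodMul, LinearIsometry.inner_map_map]

theorem inner_pairMul_left {a b f g : L2 μ} (h : PairMem μ W a b) (h' : PairMem μ W f g) :
    inner ℂ (pairMul μ W a b) (prodMul μ μ f g) = inner ℂ (prodMul μ μ a b) (pairMul μ W f g) := by
  rw [inner_L2, inner_L2]
  refine integral_congr_ae ?_
  filter_upwards [h.coeFn, h'.coeFn, coeFn_prodMul μ μ a b, coeFn_prodMul μ μ f g]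
    with p h1 h2 h3 h4
  rw [h1, h2, h3, h4, map_mul, Complex.conj_ofReal]
  ring

namespace IsSystem

variable {T : L2 μ →ₗ.[ℂ] L2 μ} {C₀ : ℝ} (hS : IsSystem μ T W C₀)
include hS

theorem pairMem {f g : L2 μ} (hf : f ∈ T.domain) (hg : g ∈ T.domain) : PairMem μ W f g := by
  have h : ∀ {v}, v ∈ T.domain → PairMem μ W v v :=
    fun hv => (hS.pairMul_self (T.mem_graph ⟨_, hv⟩)).1
  exact (PairMem.of_squares hS.meas (h hf) (h hg) (h (T.domain.add_mem hf hg))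
    (h (T.domain.sub_mem hf hg))).1

theorem nonneg {f g : L2 μ} (h : (f, g) ∈ T.graph) : ‖f‖ ^ 2 ≤ (inner ℂ f g).re := by
  have := hS.one_le ⟨f, T.mem_domain_of_mem_graph h⟩
  rwa [apply_eq_of_mem_graph h] at this

/-- The interaction is bounded relative to the square root of the kinetic energy of the two
particles, also for different one-particle states. -/
theorem norm_pairMul_sq_le {f f' g g' : L2 μ} (hf : (f, f') ∈ T.graph) (hg : (g, g') ∈ T.graph) :
    ‖pairMul μ W f g‖ ^ 2 ≤
      10 * C₀ * ((inner ℂ f f').re * ‖g‖ ^ 2 + (inner ℂ g g').re * ‖f‖ ^ 2) := by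
  have hC := hS.pos
  -- for normalized vectors, `W f ⊗ g` is controlled by the squares of `f`, `g`, `f + g`, `f - g`
  have key : ∀ {f f' g g' : L2 μ}, (f, f') ∈ T.graph → (g, g') ∈ T.graph → ‖f‖ = 1 → ‖g‖ = 1 →
      ‖pairMul μ W f g‖ ^ 2 ≤ 10 * C₀ * ((inner ℂ f f').re + (inner ℂ g g').re) := by
    intro f f' g g' hf hg hf1 hg1
    have h1 := hS.pairMul_self hf
    have h2 := hS.pairMul_self hg
    have hp : (f + g, f' + g') ∈ T.graph := T.graph.add_mem hf hg
    have hm : (f - g, f' - g') ∈ T.graph := T.graph.sub_mem hf hg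
    have h3 := hS.pairMul_self hp
    have h4 := hS.pairMul_self hm
    have h5 := (PairMem.of_squares hS.meas h1.1 h2.1 h3.1 h4.1).2
    have n1 : ‖f + g‖ ≤ 2 := by
      have := norm_add_le f g
      linarith
    have n2 : ‖f - g‖ ≤ 2 := by
      have := norm_sub_le f g
      linarith
    have p3 : 0 ≤ (inner ℂ (f + g) (f' + g')).re := (sq_nonneg _).trans (hS.nonneg hp)
    have p4 : 0 ≤ (inner ℂ (f - g) (f' - g')).re := (sq_nonneg _).trans (hS.nonneg hm)
    have q3 := mul_le_mul_of_nonneg_left (pow_le_pow_left₀ (norm_nonneg _) n1 2) p3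
    have q4 := mul_le_mul_of_nonneg_left (pow_le_pow_left₀ (norm_nonneg _) n2 2) p4
    have e : (inner ℂ (f + g) (f' + g')).re + (inner ℂ (f - g) (f' - g')).re =
        2 * ((inner ℂ f f').re + (inner ℂ g g').re) := by
      simp only [inner_add_left, inner_add_right, inner_sub_left, inner_sub_right,
        Complex.add_re, Complex.sub_re]
      ring
    rw [hf1] at h1
    rw [hg1] at h2
    have h6 : 2 * C₀ * ((inner ℂ (f + g) (f' + g')).re * ‖f + g‖ ^ 2) +
        2 * C₀ * ((inner ℂ (f - g) (f' - g')).re * ‖f - g‖ ^ 2) ≤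
        2 * C₀ * (8 * ((inner ℂ f f').re + (inner ℂ g g').re)) := by
      rw [← mul_add]
      refine mul_le_mul_of_nonneg_left ?_ (by positivity)
      linarith
    linarith [h1.2, h2.2, h3.2, h4.2]
  have hz : ∀ {v v' : L2 μ}, (v, v') ∈ T.graph → v ≠ 0 →
      ((((‖v‖⁻¹ : ℝ) : ℂ) • v, ((‖v‖⁻¹ : ℝ) : ℂ) • v') ∈ T.graph) ∧
      ‖((‖v‖⁻¹ : ℝ) : ℂ) • v‖ = 1 ∧ v = ((‖v‖ : ℝ) : ℂ) • (((‖v‖⁻¹ : ℝ) : ℂ) • v) ∧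
      (inner ℂ (((‖v‖⁻¹ : ℝ) : ℂ) • v) (((‖v‖⁻¹ : ℝ) : ℂ) • v')).re * ‖v‖ ^ 2 =
        (inner ℂ v v').re := by
    intro v v' h h0
    have h1 : ‖v‖ ≠ 0 := norm_ne_zero_iff.2 h0
    refine ⟨T.graph.smul_mem _ h, ?_, ?_, ?_⟩
    · rw [norm_smul, Complex.norm_real, Real.norm_of_nonneg (by positivity), inv_mul_cancel₀ h1]
    · rw [smul_smul, ← Complex.ofReal_mul, mul_inv_cancel₀ h1, Complex.ofReal_one, one_smul]
    · rw [inner_smul_left, inner_smul_right, Complex.conj_ofReal, Complex.re_ofReal_mul,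
        Complex.re_ofReal_mul]
      field_simp
  by_cases hf0 : f = 0
  · subst hf0
    have : pairMul μ W 0 g = 0 := by
      have h := ((hS.pairMem (T.mem_domain_of_mem_graph hf)
        (T.mem_domain_of_mem_graph hg)).smul_left 0).2
      rwa [zero_smul, zero_smul] at h
    rw [this]
    simp
  by_cases hg0 : g = 0
  · subst hg0
    have : pairMul μ W f 0 = 0 := by
      have h := ((hS.pairMem (T.mem_domain_of_mem_graph hf)
        (T.mem_domain_of_mem_graph hg)).smul_right 0).2
      rwa [zero_smul, zero_smul] at h
    rw [this]
    simp
  obtain ⟨a1, a2, a3, a4⟩ := hz hf hf0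
  obtain ⟨b1, b2, b3, b4⟩ := hz hg hg0
  have h1 := key a1 b1 a2 b2
  have h2 : pairMul μ W f g = ((‖f‖ : ℝ) : ℂ) • ((‖g‖ : ℝ) : ℂ) •
      pairMul μ W (((‖f‖⁻¹ : ℝ) : ℂ) • f) (((‖g‖⁻¹ : ℝ) : ℂ) • g) := by
    have m1 := hS.pairMem (T.mem_domain_of_mem_graph a1) (T.mem_domain_of_mem_graph b1)
    rw [← (m1.smul_right _).2, ← ((m1.smul_right _).1.smul_left _).2, ← a3, ← b3]
  rw [h2, norm_smul, norm_smul, Complex.norm_real, Complex.norm_real, norm_norm, norm_norm,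
    mul_pow, mul_pow, ← a4, ← b4]
  have := mul_le_mul_of_nonneg_left h1 (show 0 ≤ ‖f‖ ^ 2 * ‖g‖ ^ 2 by positivity)
  linarith

end IsSystem

end PairBounds

/-! ### The one-body operators -/

section OneBody

variable {X : Type*} [MeasurableSpace X] {μ : Measure X} [SigmaFinite μ] {W : X → X → ℝ}

theorem mem_kernelOp_graph {α : Type*} [MeasurableSpace α] {κ : Measure α} {k : α → α → ℂ}
    {f g : L2 κ} : (f, g) ∈ (kernelOp κ k).graph ↔
      ∀ᵐ x ∂κ, Integrable (fun y => k x y * f y) κ ∧ g x = ∫ y, k x y * f y ∂κ := by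
  rw [kernelOp, Submodule.toLinearPMap_graph_eq]
  · exact Iff.rfl
  · rintro ⟨f, g⟩ h (rfl : f = 0)
    refine (Lp.eq_zero_iff_ae_eq_zero).2 ?_
    have h0 := Lp.coeFn_zero ℂ 2 κ
    have h' : ∀ᵐ x ∂κ, Integrable (fun y => k x y * (0 : L2 κ) y) κ ∧
      g x = ∫ y, k x y * (0 : L2 κ) y ∂κ := h
    filter_upwards [h'] with x hx
    have h1 : (fun y => k x y * (0 : L2 κ) y) =ᵐ[κ] fun _ => (0 : ℂ) := by
      filter_upwards [h0] with y hy
      rw [hy, Pi.zero_apply, mul_zero]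
    rw [hx.2, integral_congr_ae h1]
    simp

/-- The matrix element `⟨a ⊗ b, W f ⊗ g⟩` of the interaction. -/
def pairInner (W : X → X → ℝ) (a b f g : L2 μ) : ℂ :=
  inner ℂ (prodMul μ μ a b) (pairMul μ W f g)

/-- Multiplication of `f` by the mean-field potential of `u`, for `W f ⊗ u` in `L²`. -/
def meanOp (W : X → X → ℝ) (u f : L2 μ) : L2 μ := contract μ μ u (pairMul μ W f u)

/-- The exchange operator with kernel `u(x) W(x,y) conj u(y)`, applied to `f`, for `W u ⊗ f`
in `L²`. -/
def exchangeOp (W : X → X → ℝ) (u f : L2 μ) : L2 μ := contract μ μ u (pairMul μ W u f)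

theorem inner_meanOp (u f g : L2 μ) : inner ℂ g (meanOp W u f) = pairInner W g u f u :=
  inner_contract _ _ _ _ _

theorem inner_exchangeOp (u f g : L2 μ) : inner ℂ g (exchangeOp W u f) = pairInner W g u u f :=
  inner_contract _ _ _ _ _

theorem PairMem.mem_mulOp_graph {u f : L2 μ} (h : PairMem μ W f u) :
    (f, meanOp W u f) ∈ (mulOp μ (meanField μ W u)).graph :=
  MeanField.mem_mulOp_graph.2 (coeFn_contract_pairMul h)

theorem PairMem.mem_kernelOp_graph {u f : L2 μ} (h : PairMem μ W u f) :
    (f, exchangeOp W u f) ∈ (kernelOp μ fun x y => u x * W x y * conj (u y)).graph := by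
  refine MeanField.mem_kernelOp_graph.2 ?_
  filter_upwards [coeFn_contract μ μ u (pairMul μ W u f), Measure.ae_ae_of_ae_prod h.coeFn,
    contract_integrable μ μ u (pairMul μ W u f)] with x h1 h2 h3
  have h4 : (fun y => conj (u y) * pairMul μ W u f (x, y)) =ᵐ[μ]
      fun y => u x * W x y * conj (u y) * f y := by
    filter_upwards [h2] with y h5
    rw [h5]
    ring
  exact ⟨(integrable_congr h4).1 h3, h1.trans (integral_congr_ae h4)⟩

namespace IsSystem

variable {T : L2 μ →ₗ.[ℂ] L2 μ} {C₀ : ℝ} (hS : IsSystem μ T W C₀)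
include hS

theorem formal : T.IsFormalAdjoint T := isFormalAdjoint_of_isSelfAdjoint hS.sa

theorem dense : Dense (T.domain : Set (L2 μ)) := hS.sa.dense_domain

theorem pairInner_swap {a b f g : L2 μ} (hf : f ∈ T.domain) (hg : g ∈ T.domain) :
    pairInner W a b f g = pairInner W b a g f :=
  inner_prodMul_pairMul_swap hS.symm (hS.pairMem hf hg) a b

theorem conj_pairInner {a b f g : L2 μ} (ha : a ∈ T.domain) (hb : b ∈ T.domain)
    (hf : f ∈ T.domain) (hg : g ∈ T.domain) :
    conj (pairInner W a b f g) = pairInner W f g a b := by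
  rw [pairInner, inner_conj_symm, inner_pairMul_left (hS.pairMem hf hg) (hS.pairMem ha hb),
    pairInner]

variable {u : L2 μ} {t μ₀ : ℝ} (hu : IsHartree T W u t μ₀)
include hu

theorem mem_domain : u ∈ T.domain := T.mem_domain_of_mem_graph (hu.mem_graph hS)

theorem apply_u : (u, (μ₀ : ℂ) • u - meanOp W u u) ∈ T.graph := hu.mem_graph hS

/-- The kinetic energy of `u` is `⟨u, T u⟩ = μ₀ - ⟨u ⊗ u, W u ⊗ u⟩`. -/
theorem inner_u_apply_u : (t : ℂ) = μ₀ - pairInner W u u u u := by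
  have h1 := hS.apply_u hu
  have hd := hS.mem_domain hu
  have h2 := hu.form.eq_inner hS.formal (fun f => (sq_nonneg _).trans (hS.one_le f)) hd
  rw [apply_eq_of_mem_graph h1 hd] at h2
  have h3 : inner ℂ u ((μ₀ : ℂ) • u - meanOp W u u) = μ₀ - pairInner W u u u u := by
    rw [inner_sub_right, inner_smul_right, inner_self_eq_norm_sq_to_K, hu.norm, inner_meanOp]
    simp
  have h4 : conj (pairInner W u u u u) = pairInner W u u u u := hS.conj_pairInner hd hd hd hd
  obtain ⟨r, hr⟩ := Complex.conj_eq_iff_real.1 h4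
  rw [h3, hr, ← Complex.ofReal_sub, Complex.ofReal_re] at h2
  rw [hr, h2, Complex.ofReal_sub]

theorem one_le_t : 1 ≤ t := by
  have hd := hS.mem_domain hu
  have h2 := hu.form.eq_inner hS.formal (fun f => (sq_nonneg _).trans (hS.one_le f)) hd
  have h3 := hS.one_le ⟨u, hd⟩
  rw [← h2] at h3
  simpa [hu.norm] using h3

theorem hartreeEnergy_eq :
    ((hartreeEnergy μ W u t : ℝ) : ℂ) = t + 1 / 2 * pairInner W u u u u := by
  have hd := hS.mem_domain hu
  have hm := hS.pairMem hd hd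
  rw [hartreeEnergy, pairInner, inner_L2, integral_prod _
    (by simpa only [RCLike.inner_apply, mul_comm] using
      L2.integrable_inner (𝕜 := ℂ) (prodMul μ μ u u) (pairMul μ W u u))]
  push_cast
  rw [← integral_complex_ofReal]
  congr 2
  refine integral_congr_ae ?_
  filter_upwards [Measure.ae_ae_of_ae_prod hm.coeFn,
    Measure.ae_ae_of_ae_prod (coeFn_prodMul μ μ u u)] with x h1 h2
  rw [← integral_complex_ofReal]
  refine integral_congr_ae ?_
  filter_upwards [h1, h2] with y h1 h2
  rw [h1, h2]
  push_cast
  rw [← Complex.conj_mul', ← Complex.conj_mul', map_mul]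
  ring

theorem Q_mem_domain {f : L2 μ} (hf : f ∈ T.domain) : Q μ u f ∈ T.domain := by
  rw [Q_apply μ u hu.norm]
  exact T.domain.sub_mem hf (T.domain.smul_mem _ (hS.mem_domain hu))

/-- The values of `h + K₁` on the complement of `u`. -/
def _root_.MeanField.bogApply (W : X → X → ℝ) (u : L2 μ) (μ₀ : ℝ) (f f' : L2 μ) : L2 μ :=
  f' + meanOp W u f - (μ₀ : ℂ) • f + Q μ u (exchangeOp W u (Q μ u f))

theorem mem_hOp_graph {f f' : L2 μ} (h : (f, f') ∈ T.graph) :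
    (f, bogApply W u μ₀ f f') ∈ (hOp μ W u T μ₀ + K₁ μ W u).graph := by
  have hd := T.mem_domain_of_mem_graph h
  have hud := hS.mem_domain hu
  refine add_mem_graph (sub_mem_graph (add_mem_graph h
    (hS.pairMem hd hud).mem_mulOp_graph) (smul_mem_graph _ (mem_everywhere_graph _ f))) ?_
  refine mem_sandwich_graph.2 ⟨_, ?_, rfl⟩
  rw [adjoint_Q]
  exact (hS.pairMem hud (hS.Q_mem_domain hu hd)).mem_kernelOp_graph

theorem exists_of_mem_hOp_graph {f g : L2 μ} (h : (f, g) ∈ (hOp μ W u T μ₀ + K₁ μ W u).graph) :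
    ∃ f', (f, f') ∈ T.graph ∧ g = bogApply W u μ₀ f f' := by
  obtain ⟨a, -, ha, -, -⟩ := exists_of_mem_add_graph h
  obtain ⟨b, -, hb, -, -⟩ := exists_of_mem_sub_graph ha
  obtain ⟨f', -, hf', -, -⟩ := exists_of_mem_add_graph hb
  have h1 := hS.mem_hOp_graph hu hf'
  have hd := LinearPMap.mem_domain_of_mem_graph h1
  exact ⟨f', hf', (apply_eq_of_mem_graph h hd).symm.trans (apply_eq_of_mem_graph h1 hd)⟩

theorem inner_bogApply {f f' : L2 μ} (g : L2 μ) :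
    inner ℂ g (bogApply W u μ₀ f f') = inner ℂ g f' + pairInner W g u f u - μ₀ * inner ℂ g f +
      pairInner W (Q μ u g) u u (Q μ u f) := by
  rw [bogApply, inner_add_right, inner_sub_right, inner_add_right, inner_smul_right, inner_meanOp,
    ← inner_Q_left, inner_exchangeOp]

theorem isFormalAdjoint_hOp :
    (hOp μ W u T μ₀ + K₁ μ W u).IsFormalAdjoint (hOp μ W u T μ₀ + K₁ μ W u) := by
  refine isFormalAdjoint_of_graph ?_
  rintro ⟨f, g⟩ hp ⟨f₂, g₂⟩ hq
  obtain ⟨f', hf, rfl⟩ := hS.exists_of_mem_hOp_graph hu hp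
  obtain ⟨f₂', hf₂, rfl⟩ := hS.exists_of_mem_hOp_graph hu hq
  have hd := T.mem_domain_of_mem_graph hf
  have hd₂ := T.mem_domain_of_mem_graph hf₂
  have hud := hS.mem_domain hu
  have hq := hS.Q_mem_domain hu hd
  have hq₂ := hS.Q_mem_domain hu hd₂
  simp only
  rw [← inner_conj_symm, hS.inner_bogApply hu, hS.inner_bogApply hu, map_add, map_sub, map_add,
    map_mul, inner_conj_symm, inner_conj_symm, hS.conj_pairInner hd₂ hud hd hud,
    hS.conj_pairInner hq₂ hud hud hq, Complex.conj_ofReal, inner_eq_of_mem_graph hS.formal hf hf₂,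
    hS.pairInner_swap hq₂ hud]

theorem dense_hOp : Dense ((hOp μ W u T μ₀ + K₁ μ W u).domain : Set (L2 μ)) := by
  refine hS.dense.mono fun f hf => ?_
  exact LinearPMap.mem_domain_of_mem_graph (hS.mem_hOp_graph hu (T.mem_graph ⟨f, hf⟩))

/-- `h + K₁` leaves the complement of `u` invariant, by the Hartree equation. -/
theorem inner_u_bogApply {f f' : L2 μ} (h : (f, f') ∈ T.graph) (hf : inner ℂ u f = 0) :
    inner ℂ u (bogApply W u μ₀ f f') = 0 := by
  have hd := T.mem_domain_of_mem_graph h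
  have hud := hS.mem_domain hu
  have hQ : Q μ u u = 0 := by
    rw [Q_apply μ u hu.norm, inner_self_eq_norm_sq_to_K, hu.norm]
    simp
  have h0 : pairInner W (0 : L2 μ) u u (Q μ u f) = 0 := by
    rw [← inner_exchangeOp, inner_zero_left]
  rw [hS.inner_bogApply hu, hQ, h0, hf, mul_zero, sub_zero, add_zero,
    ← inner_eq_of_mem_graph hS.formal (hS.apply_u hu) h, inner_sub_left, inner_smul_left, hf, mul_zero, zero_sub, ← inner_conj_symm, inner_meanOp,
    hS.conj_pairInner hd hud hud hud, neg_add_cancel]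

/-! ### The operator `Q T Q` -/

theorem mem_QTQ_graph {f f' : L2 μ} (h : (f, f') ∈ T.graph) (hf : inner ℂ u f = 0) :
    (f, Q μ u f') ∈ (QTQ μ u T).graph := by
  refine mem_sandwich_graph.2 ⟨f', ?_, rfl⟩
  rw [adjoint_Q, Q_of_inner_eq_zero μ u hu.norm hf]
  exact h

theorem exists_of_mem_QTQ_graph {f g : L2 μ} (h : (f, g) ∈ (QTQ μ u T).graph)
    (hf : inner ℂ u f = 0) : ∃ f', (f, f') ∈ T.graph ∧ g = Q μ u f' := by
  obtain ⟨f', h1, h2⟩ := mem_sandwich_graph.1 h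
  rw [adjoint_Q, Q_of_inner_eq_zero μ u hu.norm hf] at h1
  exact ⟨f', h1, h2.symm⟩

theorem QTQ_u : (u, 0) ∈ (QTQ μ u T).graph := by
  refine mem_sandwich_graph.2 ⟨0, ?_, map_zero _⟩
  rw [adjoint_Q, Q_apply μ u hu.norm, inner_self_eq_norm_sq_to_K, hu.norm]
  simp

theorem mem_QTQ_graph_iff (f g : L2 μ) : (f, g) ∈ (QTQ μ u T).graph ↔
    (f, g + ((inner ℂ u f : ℂ) • ((μ₀ : ℂ) • u - meanOp W u u) +
      inner ℂ ((μ₀ : ℂ) • u - meanOp W u u) f • u - ((t : ℂ) * inner ℂ u f) • u)) ∈ T.graph := by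
  have hT := hS.apply_u hu
  set u' := (μ₀ : ℂ) • u - meanOp W u u with hu'
  have hut : inner ℂ u' u = (t : ℂ) := by
    rw [hS.inner_u_apply_u hu, hu', inner_sub_left, inner_smul_left, inner_self_eq_norm_sq_to_K,
      hu.norm, ← inner_conj_symm, inner_meanOp, hS.conj_pairInner (hS.mem_domain hu)
      (hS.mem_domain hu) (hS.mem_domain hu) (hS.mem_domain hu)]
    simp
  have key : ∀ z, (Q μ u f, z) ∈ T.graph →
      inner ℂ u z = inner ℂ u' f - t * inner ℂ u f := by
    intro z hz
    have := inner_eq_of_mem_graph hS.formal hT hz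
    rw [← this, Q_apply μ u hu.norm, inner_sub_right, inner_smul_right, hut, mul_comm]
  have hQ : ∀ z, (Q μ u f, z) ∈ T.graph → Q μ u z +
      ((inner ℂ u f : ℂ) • u' + inner ℂ u' f • u - ((t : ℂ) * inner ℂ u f) • u) =
      z + (inner ℂ u f : ℂ) • u' := by
    intro z hz
    rw [Q_apply μ u hu.norm z, key z hz, sub_smul]
    abel
  constructor
  · intro h
    obtain ⟨z, hz, rfl⟩ := mem_sandwich_graph.1 h
    rw [adjoint_Q] at hz
    rw [hQ z hz]
    have h1 := T.graph.add_mem hz (T.graph.smul_mem (inner ℂ u f) hT)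
    have e : f = Q μ u f + (inner ℂ u f : ℂ) • u := by rw [Q_apply μ u hu.norm, sub_add_cancel]
    have h2 : (Q μ u f + (inner ℂ u f : ℂ) • u, z + (inner ℂ u f : ℂ) • u') ∈ T.graph := h1
    rwa [← e] at h2
  · intro h
    have h1 := T.graph.sub_mem h (T.graph.smul_mem (inner ℂ u f) hT)
    have h2 : (Q μ u f, g + (inner ℂ u' f • u - ((t : ℂ) * inner ℂ u f) • u)) ∈ T.graph := by
      have h2 : (f - (inner ℂ u f : ℂ) • u, g + ((inner ℂ u f : ℂ) • u' + inner ℂ u' f • u -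
        ((t : ℂ) * inner ℂ u f) • u) - (inner ℂ u f : ℂ) • u') ∈ T.graph := h1
      have e : g + ((inner ℂ u f : ℂ) • u' + inner ℂ u' f • u - ((t : ℂ) * inner ℂ u f) • u) -
          (inner ℂ u f : ℂ) • u' = g + (inner ℂ u' f • u - ((t : ℂ) * inner ℂ u f) • u) := by abel
      rwa [e, ← Q_apply μ u hu.norm] at h2
    refine mem_sandwich_graph.2 ⟨_, by rw [adjoint_Q]; exact h2, ?_⟩
    have h3 := hQ _ h2
    have h4 : ∀ a b c d : L2 μ, a + (b + c - d) = g + (c - d) + b → a = g := by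
      intro a b c d h
      have : a + (b + c - d) = a + (c - d) + b := by abel
      rw [this] at h
      exact add_right_cancel (add_right_cancel h)
    exact h4 _ _ _ _ h3

theorem isSelfAdjoint_QTQ : IsSelfAdjoint (QTQ μ u T) := by
  have hK := hasCore_domain hS.sa fun x => (sq_nonneg _).trans (hS.one_le x)
  set u' := (μ₀ : ℂ) • u - meanOp W u u with hu'
  set B : L2 μ →L[ℂ] L2 μ := (innerSL ℂ u).smulRight u' + (innerSL ℂ u').smulRight u -
    (innerSL ℂ u).smulRight ((t : ℂ) • u) with hB
  have hBa : ∀ f, B f = (inner ℂ u f : ℂ) • u' + inner ℂ u' f • u -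
      ((t : ℂ) * inner ℂ u f) • u := by
    intro f
    rw [mul_comm, mul_smul]
    rfl
  have hg : ∀ f g, (f, g) ∈ (QTQ μ u T).graph ↔ (f, g + B f) ∈ T.graph := by
    intro f g
    rw [hBa]
    exact hS.mem_QTQ_graph_iff hu f g
  have hgr : ∀ f : T.domain, ((f : L2 μ), T f - B f) ∈ (QTQ μ u T).graph := fun f => by
    rw [hg, sub_add_cancel]
    exact T.mem_graph f
  have hle : T.domain ≤ (QTQ μ u T).domain := fun f hf =>
    LinearPMap.mem_domain_of_mem_graph (hgr ⟨f, hf⟩)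
  have hP : IsPerturbation T (QTQ μ u T) T.domain hK.le := by
    refine ⟨isFormalAdjoint_sandwich _ hS.formal, hle, ?_, ‖B‖ ^ 2, sq_nonneg _, fun x => ?_⟩
    · refine Submodule.topologicalClosure_minimal _ inf_le_left ?_
      have hc : IsClosed (T.graph : Set (L2 μ × L2 μ)) := by
        have := LinearPMap.adjoint_isClosed (T := T) hS.dense
        rwa [LinearPMap.isSelfAdjoint_def.1 hS.sa] at this
      have : ((QTQ μ u T).graph : Set (L2 μ × L2 μ)) =
          (fun p : L2 μ × L2 μ => (p.1, p.2 + B p.1)) ⁻¹' T.graph := by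
        ext ⟨f, g⟩
        exact hg f g
      rw [this]
      exact hc.preimage (by fun_prop)
    · rw [apply_eq_of_mem_graph (hgr x)]
      have h1 : T x - B x - T ⟨x, hK.le x.2⟩ = -(B x) := by
        change T x - B x - T x = _
        abel
      rw [h1, norm_neg]
      have h2 := pow_le_pow_left₀ (norm_nonneg _) (B.le_opNorm x) 2
      rw [mul_pow] at h2
      refine h2.trans (mul_le_mul_of_nonneg_left ?_ (sq_nonneg _))
      have := hK.nonneg x
      linarith
  exact hP.isSelfAdjoint hK

theorem nonneg_QTQ (x : (QTQ μ u T).domain) : 0 ≤ (inner ℂ (x : L2 μ) (QTQ μ u T x)).re := by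
  obtain ⟨z, hz, h⟩ := mem_sandwich_graph.1 ((QTQ μ u T).mem_graph x)
  rw [← h, ← inner_Q_left]
  rw [adjoint_Q] at hz
  exact (sq_nonneg _).trans (hS.nonneg hz)

end IsSystem

end OneBody

/-! ### Kernels and their quadratic forms -/

section Kernels

variable {ι κ E F : Type*} [NormedAddCommGroup E] [InnerProductSpace ℂ E]
  [NormedAddCommGroup F] [InnerProductSpace ℂ F]

/-- The sesquilinear form `∑_{ij} conj a_i b_j K(i,j)` of a kernel. -/
def form (K : ι → κ → ℂ) (a : ι →₀ ℂ) (b : κ →₀ ℂ) : ℂ :=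
  a.sum fun i α => b.sum fun j β => conj α * β * K i j

theorem inner_linearCombination (x : ι → E) (y : κ → E) (a : ι →₀ ℂ) (b : κ →₀ ℂ) :
    inner ℂ (Finsupp.linearCombination ℂ x a) (Finsupp.linearCombination ℂ y b) =
      form (fun i j => inner ℂ (x i) (y j)) a b := by
  rw [Finsupp.linearCombination_apply, Finsupp.linearCombination_apply, form, Finsupp.sum,
    sum_inner]
  refine Finset.sum_congr rfl fun i _ => ?_
  rw [Finsupp.sum, inner_sum]
  refine Finset.sum_congr rfl fun j _ => ?_
  rw [inner_smul_left, inner_smul_right]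
  ring

theorem form_add (K L : ι → κ → ℂ) (a : ι →₀ ℂ) (b : κ →₀ ℂ) :
    form (fun i j => K i j + L i j) a b = form K a b + form L a b := by
  simp only [form, mul_add, Finsupp.sum_add]

theorem form_sub (K L : ι → κ → ℂ) (a : ι →₀ ℂ) (b : κ →₀ ℂ) :
    form (fun i j => K i j - L i j) a b = form K a b - form L a b := by
  simp only [form, mul_sub, Finsupp.sum_sub]

theorem form_const_mul (c : ℂ) (K : ι → κ → ℂ) (a : ι →₀ ℂ) (b : κ →₀ ℂ) :
    form (fun i j => c * K i j) a b = c * form K a b := by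
  simp only [form, Finsupp.sum, Finset.mul_sum]
  refine Finset.sum_congr rfl fun i _ => Finset.sum_congr rfl fun j _ => ?_
  ring

theorem form_zero (a : ι →₀ ℂ) (b : κ →₀ ℂ) : form (fun (_ : ι) (_ : κ) => 0) a b = 0 := by
  simp [form]

theorem form_eq_sum (K : ι → κ → ℂ) {a : ι →₀ ℂ} {b : κ →₀ ℂ} {s : Finset ι} {t : Finset κ}
    (hs : a.support ⊆ s) (ht : b.support ⊆ t) :
    form K a b = ∑ i ∈ s, ∑ j ∈ t, conj (a i) * b j * K i j := by
  rw [form, Finsupp.sum_of_support_subset a hs _ (by simp)]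
  refine Finset.sum_congr rfl fun i _ => ?_
  rw [Finsupp.sum_of_support_subset b ht _ (by simp)]

/-- The real quadratic form of a kernel. -/
def qform (K : ι → ι → ℂ) (a : ι →₀ ℂ) : ℝ := (form K a a).re

theorem norm_linearCombination_sq (x : ι → E) (a : ι →₀ ℂ) :
    ‖Finsupp.linearCombination ℂ x a‖ ^ 2 = qform (fun i j => inner ℂ (x i) (x j)) a := by
  rw [qform, ← inner_linearCombination, inner_self_eq_norm_sq_to_K]
  norm_cast

/-- Schur product theorem: the product of a nonnegative kernel and of a Gram kernel is
nonnegative. -/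
theorem qform_mul_gram_nonneg {K : ι → ι → ℂ} (hK : ∀ a, 0 ≤ qform K a) (x : ι → E) (a : ι →₀ ℂ) :
    0 ≤ qform (fun i j => K i j * inner ℂ (x i) (x j)) a := by
  classical
  set S : Submodule ℂ E := Submodule.span ℂ (a.support.image x : Set E)
  have hmem : ∀ i ∈ a.support, x i ∈ S := fun i hi =>
    Submodule.subset_span (Finset.mem_coe.2 (Finset.mem_image_of_mem x hi))
  have : FiniteDimensional ℂ S := FiniteDimensional.span_finset ℂ _
  set b := stdOrthonormalBasis ℂ S
  -- expansion of the Gram kernel in an orthonormal basis of the span of the vectors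
  have hexp : ∀ i ∈ a.support, ∀ j ∈ a.support, inner ℂ (x i) (x j) =
      ∑ k, inner ℂ (x i) (b k : E) * inner ℂ (b k : E) (x j) := by
    intro i hi j hj
    have h := b.sum_inner_mul_inner ⟨x i, hmem i hi⟩ ⟨x j, hmem j hj⟩
    simpa only [Submodule.coe_inner] using h.symm
  have h1 : form (fun i j => K i j * inner ℂ (x i) (x j)) a a =
      ∑ k, form K ((fun i => inner ℂ (b k : E) (x i)) • a)
        ((fun i => inner ℂ (b k : E) (x i)) • a) := by
    have hsub : ∀ g : ι → ℂ, (g • a).support ⊆ a.support := fun g i hi => by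
      rw [Finsupp.mem_support_iff, Finsupp.coe_pointwise_smul] at hi
      exact Finsupp.mem_support_iff.2 (right_ne_zero_of_mul hi)
    simp only [form_eq_sum _ (hsub _) (hsub _), form_eq_sum _ subset_rfl subset_rfl]
    symm
    rw [Finset.sum_comm]
    refine Finset.sum_congr rfl fun i hi => ?_
    rw [Finset.sum_comm]
    refine Finset.sum_congr rfl fun j hj => ?_
    rw [hexp i hi j hj, Finset.mul_sum, Finset.mul_sum]
    refine Finset.sum_congr rfl fun k _ => ?_
    simp only [Finsupp.coe_pointwise_smul, Pi.smul_apply', smul_eq_mul, map_mul, inner_conj_symm]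
    ring
  rw [qform, h1, Complex.re_sum]
  exact Finset.sum_nonneg fun k _ => hK _

theorem qform_add (K L : ι → ι → ℂ) (a : ι →₀ ℂ) :
    qform (fun i j => K i j + L i j) a = qform K a + qform L a := by
  simp only [qform, form_add, Complex.add_re]

theorem qform_sub (K L : ι → ι → ℂ) (a : ι →₀ ℂ) :
    qform (fun i j => K i j - L i j) a = qform K a - qform L a := by
  simp only [qform, form_sub, Complex.sub_re]

theorem qform_const_mul (c : ℝ) (K : ι → ι → ℂ) (a : ι →₀ ℂ) :
    qform (fun i j => (c : ℂ) * K i j) a = c * qform K a := by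
  simp only [qform, form_const_mul, Complex.re_ofReal_mul]

theorem linearCombination_mem_graph {G : Submodule ℂ (E × F)} {x : ι → E} {y : ι → F}
    (h : ∀ i, (x i, y i) ∈ G) (a : ι →₀ ℂ) :
    (Finsupp.linearCombination ℂ x a, Finsupp.linearCombination ℂ y a) ∈ G := by
  have h1 : Finsupp.linearCombination ℂ (fun i => (x i, y i)) a ∈ G := by
    rw [Finsupp.linearCombination_apply]
    exact G.sum_mem fun i _ => G.smul_mem (a i) (h i)
  have h2 : Finsupp.linearCombination ℂ (fun i => (x i, y i)) a =
      (Finsupp.linearCombination ℂ x a, Finsupp.linearCombination ℂ y a) := by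
    refine Prod.ext ?_ ?_
    · exact Finsupp.apply_linearCombination ℂ (LinearMap.fst ℂ E F) _ a
    · exact Finsupp.apply_linearCombination ℂ (LinearMap.snd ℂ E F) _ a
  rwa [h2] at h1


end Kernels

/-! ### The forms of the kinetic energy and of the interaction -/

section InteractionForms

variable {X : Type*} [MeasurableSpace X] {μ : Measure X} [SigmaFinite μ] {W : X → X → ℝ}

/-- The one-particle states orthogonal to `u` in the domain of `T`, as pairs `(f, T f)`. -/
abbrev ExcDom (T : L2 μ →ₗ.[ℂ] L2 μ) (u : L2 μ) : Type _ :=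
  {p : L2 μ × L2 μ // p ∈ T.graph ∧ inner ℂ u p.1 = 0}

variable {T : L2 μ →ₗ.[ℂ] L2 μ} {C₀ : ℝ} {u : L2 μ} {t μ₀ : ℝ}

variable (T u) in
/-- The squared norm of `∑ a_f f ⊗ ⋯ ⊗ f`. -/
def normForm (n : ℕ) (a : ExcDom T u →₀ ℂ) : ℝ :=
  qform (fun g f => inner ℂ g.1.1 f.1.1 ^ n) a

variable (T u) in
/-- The kinetic energy per particle of `∑ a_f f ⊗ ⋯ ⊗ f` (with `n + 1` factors). -/
def kinForm (n : ℕ) (a : ExcDom T u →₀ ℂ) : ℝ :=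
  qform (fun g f => inner ℂ g.1.1 f.1.2 * inner ℂ g.1.1 f.1.1 ^ n) a

theorem norm_lc_pw_sq (n : ℕ) (a : ExcDom T u →₀ ℂ) :
    ‖Finsupp.linearCombination ℂ (fun f : ExcDom T u => pw μ n f.1.1) a‖ ^ 2 =
      normForm T u n a := by
  simp only [norm_linearCombination_sq, inner_pw, normForm]

theorem normForm_nonneg (n : ℕ) (a : ExcDom T u →₀ ℂ) : 0 ≤ normForm T u n a := by
  rw [← norm_lc_pw_sq]
  exact sq_nonneg _

theorem qform_mul_pow_nonneg {K : ExcDom T u → ExcDom T u → ℂ} (hK : ∀ a, 0 ≤ qform K a) (n : ℕ)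
    (a : ExcDom T u →₀ ℂ) : 0 ≤ qform (fun g f => K g f * inner ℂ g.1.1 f.1.1 ^ n) a := by
  simpa only [inner_pw] using qform_mul_gram_nonneg hK (fun f => pw μ n f.1.1) a

/-- The vector `∑ a_f (f ⊗ ⋯ ⊗ f) ⊗ Y_f`, with `n` factors `f` and a two-particle function. -/
def lcProd (n : ℕ) (Y : ExcDom T u → L2 (μ.prod μ)) (a : ExcDom T u →₀ ℂ) :
    L2 ((Measure.pi fun _ : Fin n => μ).prod (μ.prod μ)) :=
  Finsupp.linearCombination ℂ
    (fun f : ExcDom T u => prodMul (Measure.pi fun _ : Fin n => μ) (μ.prod μ)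
      (pw μ n f.1.1) (Y f)) a

theorem inner_lcProd (n : ℕ) (Y Z : ExcDom T u → L2 (μ.prod μ)) (a b : ExcDom T u →₀ ℂ) :
    inner ℂ (lcProd n Y a) (lcProd n Z b) =
      form (fun g f => inner ℂ (Y g) (Z f) * inner ℂ g.1.1 f.1.1 ^ n) a b := by
  rw [lcProd, lcProd, inner_linearCombination]
  simp only [inner_prodMul, inner_pw, mul_comm]

theorem norm_lcProd_sq (n : ℕ) (Y : ExcDom T u → L2 (μ.prod μ)) (a : ExcDom T u →₀ ℂ) :
    ‖lcProd n Y a‖ ^ 2 =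
      qform (fun g f => inner ℂ (Y g) (Y f) * inner ℂ g.1.1 f.1.1 ^ n) a := by
  rw [qform, ← inner_lcProd, inner_self_eq_norm_sq_to_K]
  norm_cast

theorem norm_form_sq_le (n : ℕ) (Y Z : ExcDom T u → L2 (μ.prod μ)) (a b : ExcDom T u →₀ ℂ) :
    ‖form (fun g f => inner ℂ (Y g) (Z f) * inner ℂ g.1.1 f.1.1 ^ n) a b‖ ^ 2 ≤
      ‖lcProd n Y a‖ ^ 2 * ‖lcProd n Z b‖ ^ 2 := by
  rw [← inner_lcProd, ← mul_pow]
  exact pow_le_pow_left₀ (norm_nonneg _) (norm_inner_le_norm _ _) 2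

theorem norm_lcProd_two (n : ℕ) (a : ExcDom T u →₀ ℂ) :
    ‖lcProd n (fun f : ExcDom T u => prodMul μ μ f.1.1 f.1.1) a‖ ^ 2 = normForm T u (n + 2) a := by
  rw [norm_lcProd_sq, normForm]
  congr 1
  funext g f
  rw [inner_prodMul]
  ring

theorem norm_lcProd_one (hu : ‖u‖ = 1) (n : ℕ) (a : ExcDom T u →₀ ℂ) :
    ‖lcProd n (fun f : ExcDom T u => prodMul μ μ f.1.1 u) a‖ ^ 2 = normForm T u (n + 1) a := by
  rw [norm_lcProd_sq, normForm]
  congr 1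
  funext g f
  rw [inner_prodMul, inner_self_eq_norm_sq_to_K, hu]
  simp only [RCLike.ofReal_one, one_pow]
  ring

theorem norm_lcProd_one' (hu : ‖u‖ = 1) (n : ℕ) (a : ExcDom T u →₀ ℂ) :
    ‖lcProd n (fun f : ExcDom T u => prodMul μ μ u f.1.1) a‖ ^ 2 = normForm T u (n + 1) a := by
  rw [norm_lcProd_sq, normForm]
  congr 1
  funext g f
  rw [inner_prodMul, inner_self_eq_norm_sq_to_K, hu]
  simp only [RCLike.ofReal_one, one_pow]
  ring

theorem norm_lcProd_const (Y : L2 (μ.prod μ)) (n : ℕ) (a : ExcDom T u →₀ ℂ) :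
    ‖lcProd n (fun _ : ExcDom T u => Y) a‖ ^ 2 = ‖Y‖ ^ 2 * normForm T u n a := by
  rw [norm_lcProd_sq, normForm, ← qform_const_mul]
  congr 1
  funext g f
  rw [inner_self_eq_norm_sq_to_K]
  push_cast
  rfl

namespace IsSystem

variable (hS : IsSystem μ T W C₀)
include hS

theorem excDom_mem (f : ExcDom T u) : f.1.1 ∈ T.domain := T.mem_domain_of_mem_graph f.2.1

theorem lc_mem_graph (a : ExcDom T u →₀ ℂ) :
    (Finsupp.linearCombination ℂ (fun f : ExcDom T u => f.1.1) a,
      Finsupp.linearCombination ℂ (fun f : ExcDom T u => f.1.2) a) ∈ T.graph :=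
  linearCombination_mem_graph (fun f : ExcDom T u => f.2.1) a

theorem inner_sub_nonneg (a : ExcDom T u →₀ ℂ) :
    0 ≤ qform (fun g f => inner ℂ g.1.1 f.1.2 - inner ℂ g.1.1 f.1.1) a := by
  have h := hS.nonneg (hS.lc_mem_graph a)
  rw [norm_linearCombination_sq, inner_linearCombination] at h
  rw [qform_sub]
  exact sub_nonneg.2 h

theorem normForm_le_kinForm (n : ℕ) (a : ExcDom T u →₀ ℂ) :
    normForm T u (n + 1) a ≤ kinForm T u n a := by
  have h := qform_mul_pow_nonneg hS.inner_sub_nonneg n a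
  simp only [sub_mul, qform_sub] at h
  rw [kinForm, normForm]
  simp only [pow_succ']
  linarith

theorem kinForm_nonneg (n : ℕ) (a : ExcDom T u →₀ ℂ) : 0 ≤ kinForm T u n a :=
  (normForm_nonneg _ a).trans (hS.normForm_le_kinForm n a)

/-- The bound of the interaction energy of excited particles among themselves: the two-body bound
on squares `f ⊗ f`, multiplied by a power of the Gram kernel. -/
theorem norm_lcProd_pairMul_sq_le (n : ℕ) (a : ExcDom T u →₀ ℂ) :
    ‖lcProd n (fun f : ExcDom T u => pairMul μ W f.1.1 f.1.1) a‖ ^ 2 ≤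
      2 * C₀ * kinForm T u (n + 1) a := by
  have key : ∀ a : ExcDom T u →₀ ℂ, 0 ≤ qform (fun g f =>
      ((2 * C₀ : ℝ) : ℂ) * (inner ℂ g.1.1 f.1.2 * inner ℂ g.1.1 f.1.1) -
        inner ℂ (pairMul μ W g.1.1 g.1.1) (pairMul μ W f.1.1 f.1.1)) a := by
    intro a
    have h1 := linearCombination_mem_graph (fun f : ExcDom T u =>
      pw_mem_kinetic_graph μ hS.sa 2 f.2.1) a
    obtain ⟨Ψ, h2, h3⟩ := norm_interaction_le hS.symm hS.bound h1
    have h4 := linearCombination_mem_graph (G := (mulOp (μ.prod μ) (Function.uncurry W)).graph)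
      (x := fun f : ExcDom T u => toPair (pw μ 2 f.1.1))
      (y := fun f : ExcDom T u => pairMul μ W f.1.1 f.1.1) (fun f => by
        rw [mem_mulOp_graph, toPair_pw]
        filter_upwards [(hS.pairMem (hS.excDom_mem f) (hS.excDom_mem f)).coeFn,
          coeFn_prodMul μ μ f.1.1 f.1.1] with p e1 e2
        rw [e1, e2]
        rfl) a
    have h5 : toPair ((Finsupp.linearCombination ℂ (fun f : ExcDom T u =>
        (⟨pw μ 2 f.1.1, pw_mem_sym μ 2 f.1.1⟩ : sym μ 2)) a : sym μ 2) : L2N μ 2) =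
        Finsupp.linearCombination ℂ (fun f : ExcDom T u => toPair (pw μ 2 f.1.1)) a :=
      Finsupp.apply_linearCombination ℂ (toPair.toLinearMap ∘ₗ (sym μ 2).subtype) _ a
    have h6 := (mem_mulOp_graph (g := Function.uncurry W)).2 h2
    rw [h5] at h6
    have hd := LinearPMap.mem_domain_of_mem_graph h4
    have h7 := (apply_eq_of_mem_graph h6 hd).symm.trans (apply_eq_of_mem_graph h4 hd)
    rw [h7, norm_linearCombination_sq, inner_linearCombination] at h3
    rw [qform_sub, qform_const_mul]
    refine sub_nonneg.2 (h3.trans (le_of_eq ?_))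
    have h8 : (fun (i j : ExcDom T u) => inner ℂ (⟨pw μ 2 i.1.1, pw_mem_sym μ 2 i.1.1⟩ : sym μ 2)
        (⟨dpw μ 2 j.1.1 j.1.2, dpw_mem_sym μ 2 j.1.1 j.1.2⟩ : sym μ 2)) =
        fun i j => ((2 : ℝ) : ℂ) * (inner ℂ i.1.1 j.1.2 * inner ℂ i.1.1 j.1.1) := by
      funext i j
      rw [Submodule.coe_inner]
      simp only
      rw [inner_pw_dpw]
      push_cast
      ring
    rw [h8]
    change C₀ * qform _ a = _
    rw [qform_const_mul]
    ring
  have h := qform_mul_pow_nonneg key n a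
  rw [norm_lcProd_sq, kinForm, ← qform_const_mul]
  simp only [sub_mul, qform_sub] at h
  refine (sub_nonneg.1 h).trans (le_of_eq ?_)
  congr 1
  funext g f
  ring

variable (hu : IsHartree T W u t μ₀)
include hu

/-- The bound of the interaction energy of an excited particle with a particle in the state `u`. -/
theorem norm_lcProd_pairMul_u_sq_le (n : ℕ) (a : ExcDom T u →₀ ℂ) :
    ‖lcProd n (fun f : ExcDom T u => pairMul μ W f.1.1 u) a‖ ^ 2 ≤
      10 * C₀ * (kinForm T u n a + t * normForm T u (n + 1) a) := by
  have hud := hS.mem_domain hu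
  have key : ∀ a : ExcDom T u →₀ ℂ, 0 ≤ qform (fun g f =>
      ((10 * C₀ : ℝ) : ℂ) * (inner ℂ g.1.1 f.1.2 + (t : ℂ) * inner ℂ g.1.1 f.1.1) -
        inner ℂ (pairMul μ W g.1.1 u) (pairMul μ W f.1.1 u)) a := by
    intro a
    have h1 := hS.lc_mem_graph a
    have h2 := hS.norm_pairMul_sq_le h1 (hS.apply_u hu)
    have h3 : (inner ℂ u ((μ₀ : ℂ) • u - meanOp W u u)).re = t := by
      have := hu.form.eq_inner hS.formal (fun f => (sq_nonneg _).trans (hS.one_le f)) hud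
      rw [apply_eq_of_mem_graph (hS.apply_u hu) hud] at this
      exact this.symm
    have h4 : pairMul μ W (Finsupp.linearCombination ℂ (fun f : ExcDom T u => f.1.1) a) u =
        Finsupp.linearCombination ℂ (fun f : ExcDom T u => pairMul μ W f.1.1 u) a := by
      let L : T.domain →ₗ[ℂ] L2 (μ.prod μ) :=
        { toFun := fun f => pairMul μ W f u
          map_add' := fun f g => ((hS.pairMem f.2 hud).add_left (hS.pairMem g.2 hud)).2
          map_smul' := fun c f => ((hS.pairMem f.2 hud).smul_left c).2 }
      have h5 : Finsupp.linearCombination ℂ (fun f : ExcDom T u => f.1.1) a =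
          ((Finsupp.linearCombination ℂ (fun f : ExcDom T u =>
            (⟨f.1.1, hS.excDom_mem f⟩ : T.domain)) a : T.domain) : L2 μ) :=
        (Finsupp.apply_linearCombination ℂ T.domain.subtype
          (fun f : ExcDom T u => (⟨f.1.1, hS.excDom_mem f⟩ : T.domain)) a).symm
      rw [h5]
      exact Finsupp.apply_linearCombination ℂ L _ a
    rw [h4, norm_linearCombination_sq, norm_linearCombination_sq, inner_linearCombination, h3,
      hu.norm] at h2
    rw [qform_sub, qform_const_mul, qform_add, qform_const_mul]
    refine sub_nonneg.2 (h2.trans (le_of_eq ?_))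
    rw [one_pow, mul_one]
    rfl
  have h := qform_mul_pow_nonneg key n a
  rw [norm_lcProd_sq, kinForm, normForm, ← qform_const_mul, ← qform_add, ← qform_const_mul]
  simp only [sub_mul, qform_sub] at h
  refine (sub_nonneg.1 h).trans (le_of_eq ?_)
  congr 1
  funext g f
  ring

theorem norm_lcProd_u_pairMul_sq_le (n : ℕ) (a : ExcDom T u →₀ ℂ) :
    ‖lcProd n (fun f : ExcDom T u => pairMul μ W u f.1.1) a‖ ^ 2 ≤
      10 * C₀ * (kinForm T u n a + t * normForm T u (n + 1) a) := by
  refine le_trans (le_of_eq ?_) (hS.norm_lcProd_pairMul_u_sq_le hu n a)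
  have hud := hS.mem_domain hu
  rw [norm_lcProd_sq, norm_lcProd_sq]
  congr 1
  funext g f
  rw [((hS.pairMem (hS.excDom_mem g) hud).swap hS.symm).2,
    ((hS.pairMem (hS.excDom_mem f) hud).swap hS.symm).2, LinearIsometry.inner_map_map]

theorem norm_pairMul_u_u_sq_le : ‖pairMul μ W u u‖ ^ 2 ≤ 2 * C₀ * t := by
  have hud := hS.mem_domain hu
  have h := (hS.pairMul_self (hS.apply_u hu)).2
  have h3 := hu.form.eq_inner hS.formal (fun f => (sq_nonneg _).trans (hS.one_le f)) hud
  rw [apply_eq_of_mem_graph (hS.apply_u hu) hud] at h3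
  rw [hu.norm] at h
  rw [h3]
  linarith

/-! ### Bounds for the matrix elements of the interaction -/

variable (n : ℕ) (a b : ExcDom T u →₀ ℂ)

theorem form_gg_ff : ‖form (fun g f => pairInner W g.1.1 g.1.1 f.1.1 f.1.1 *
    inner ℂ g.1.1 f.1.1 ^ n) a b‖ ^ 2 ≤ normForm T u (n + 2) a * (2 * C₀ * kinForm T u (n + 1) b) := by
  rw [← norm_lcProd_two]
  exact (norm_form_sq_le n _ _ a b).trans
    (mul_le_mul_of_nonneg_left (hS.norm_lcProd_pairMul_sq_le n b) (sq_nonneg _))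

theorem form_gu_fu : ‖form (fun g f => pairInner W g.1.1 u f.1.1 u *
    inner ℂ g.1.1 f.1.1 ^ n) a b‖ ^ 2 ≤ normForm T u (n + 1) a *
      (10 * C₀ * (kinForm T u n b + t * normForm T u (n + 1) b)) := by
  rw [← norm_lcProd_one hu.norm n a]
  exact (norm_form_sq_le n _ _ a b).trans
    (mul_le_mul_of_nonneg_left (hS.norm_lcProd_pairMul_u_sq_le hu n b) (sq_nonneg _))

theorem form_gu_uf : ‖form (fun g f => pairInner W g.1.1 u u f.1.1 *
    inner ℂ g.1.1 f.1.1 ^ n) a b‖ ^ 2 ≤ normForm T u (n + 1) a *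
      (10 * C₀ * (kinForm T u n b + t * normForm T u (n + 1) b)) := by
  rw [← norm_lcProd_one hu.norm n a]
  exact (norm_form_sq_le n _ _ a b).trans
    (mul_le_mul_of_nonneg_left (hS.norm_lcProd_u_pairMul_sq_le hu n b) (sq_nonneg _))

theorem form_gg_uf : ‖form (fun g f => pairInner W g.1.1 g.1.1 u f.1.1 *
    inner ℂ g.1.1 f.1.1 ^ n) a b‖ ^ 2 ≤ normForm T u (n + 2) a *
      (10 * C₀ * (kinForm T u n b + t * normForm T u (n + 1) b)) := by
  rw [← norm_lcProd_two]
  exact (norm_form_sq_le n _ _ a b).trans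
    (mul_le_mul_of_nonneg_left (hS.norm_lcProd_u_pairMul_sq_le hu n b) (sq_nonneg _))

theorem form_gu_uu : ‖form (fun g f => pairInner W g.1.1 u u u *
    inner ℂ g.1.1 f.1.1 ^ n) a b‖ ^ 2 ≤ normForm T u (n + 1) a *
      (2 * C₀ * t * normForm T u n b) := by
  rw [← norm_lcProd_one hu.norm n a]
  refine (norm_form_sq_le n _ (fun _ => pairMul μ W u u) a b).trans
    (mul_le_mul_of_nonneg_left ?_ (sq_nonneg _))
  rw [norm_lcProd_const]
  exact mul_le_mul_of_nonneg_right (hS.norm_pairMul_u_u_sq_le hu) (normForm_nonneg _ _)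

theorem form_ug_ff : ‖form (fun g f => pairInner W u g.1.1 f.1.1 f.1.1 *
    inner ℂ g.1.1 f.1.1 ^ n) a b‖ ^ 2 ≤ normForm T u (n + 1) a *
      (2 * C₀ * kinForm T u (n + 1) b) := by
  rw [← norm_lcProd_one' hu.norm n a]
  exact (norm_form_sq_le n _ _ a b).trans
    (mul_le_mul_of_nonneg_left (hS.norm_lcProd_pairMul_sq_le n b) (sq_nonneg _))

theorem normForm_eq_lcProd : normForm T u n a =
    ‖lcProd n (fun _ : ExcDom T u => prodMul μ μ u u) a‖ ^ 2 := by
  have h : ‖prodMul μ μ u u‖ ^ 2 = 1 := by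
    have h1 := inner_prodMul μ μ u u u u
    rw [inner_self_eq_norm_sq_to_K, inner_self_eq_norm_sq_to_K, hu.norm] at h1
    have h2 : ((‖prodMul μ μ u u‖ ^ 2 : ℝ) : ℂ) = 1 := by
      push_cast
      refine h1.trans ?_
      simp
    exact_mod_cast h2
  rw [norm_lcProd_const, h, one_mul]

theorem form_uu_fu : ‖form (fun g f => pairInner W u u f.1.1 u *
    inner ℂ g.1.1 f.1.1 ^ n) a b‖ ^ 2 ≤ normForm T u n a *
      (10 * C₀ * (kinForm T u n b + t * normForm T u (n + 1) b)) := by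
  rw [hS.normForm_eq_lcProd hu n a]
  exact (norm_form_sq_le n (fun _ => prodMul μ μ u u) _ a b).trans
    (mul_le_mul_of_nonneg_left (hS.norm_lcProd_pairMul_u_sq_le hu n b) (sq_nonneg _))

theorem form_gg_uu : ‖form (fun g f => pairInner W g.1.1 g.1.1 u u *
    inner ℂ g.1.1 f.1.1 ^ n) a b‖ ^ 2 ≤ normForm T u (n + 2) a *
      (2 * C₀ * t * normForm T u n b) := by
  rw [← norm_lcProd_two]
  refine (norm_form_sq_le n _ (fun _ => pairMul μ W u u) a b).trans
    (mul_le_mul_of_nonneg_left ?_ (sq_nonneg _))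
  rw [norm_lcProd_const]
  exact mul_le_mul_of_nonneg_right (hS.norm_pairMul_u_u_sq_le hu) (normForm_nonneg _ _)

theorem form_uu_ff : ‖form (fun g f => pairInner W u u f.1.1 f.1.1 *
    inner ℂ g.1.1 f.1.1 ^ n) a b‖ ^ 2 ≤ normForm T u n a *
      (2 * C₀ * kinForm T u (n + 1) b) := by
  rw [hS.normForm_eq_lcProd hu n a]
  exact (norm_form_sq_le n (fun _ => prodMul μ μ u u) _ a b).trans
    (mul_le_mul_of_nonneg_left (hS.norm_lcProd_pairMul_sq_le n b) (sq_nonneg _))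

omit hS hu in
theorem form_pow : ‖form (fun g f : ExcDom T u => inner ℂ g.1.1 f.1.1 ^ n) a b‖ ^ 2 ≤
    normForm T u n a * normForm T u n b := by
  have h : form (fun g f : ExcDom T u => inner ℂ g.1.1 f.1.1 ^ n) a b =
      inner ℂ (Finsupp.linearCombination ℂ (fun f : ExcDom T u => pw μ n f.1.1) a)
        (Finsupp.linearCombination ℂ (fun f : ExcDom T u => pw μ n f.1.1) b) := by
    simp only [inner_linearCombination, inner_pw]
  rw [h, ← norm_lc_pw_sq, ← norm_lc_pw_sq, ← mul_pow]
  exact pow_le_pow_left₀ (norm_nonneg _) (norm_inner_le_norm _ _) 2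

end IsSystem

end InteractionForms

/-! ### Matrix elements -/

section MatrixElements

variable {ι E : Type*} [NormedAddCommGroup E] [InnerProductSpace ℂ E]

/-- The linear combinations `∑_{j ≤ N} ∑_f a_{j,f} ξ_{j,f}` of a doubly indexed family. -/
def combination (N : ℕ) (ξ : ℕ → ι → E) : (ℕ → ι →₀ ℂ) →ₗ[ℂ] E :=
  ∑ j ∈ Finset.range (N + 1), Finsupp.linearCombination ℂ (ξ j) ∘ₗ LinearMap.proj j

theorem combination_apply (N : ℕ) (ξ : ℕ → ι → E) (a : ℕ → ι →₀ ℂ) :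
    combination N ξ a = ∑ j ∈ Finset.range (N + 1), Finsupp.linearCombination ℂ (ξ j) (a j) := by
  rw [combination, LinearMap.sum_apply]
  rfl

theorem mem_range_combination {N j : ℕ} (ξ : ℕ → ι → E) (hj : j ≤ N) (f : ι) :
    ξ j f ∈ LinearMap.range (combination N ξ) := by
  classical
  refine ⟨Pi.single j (Finsupp.single f 1), ?_⟩
  rw [combination_apply, Finset.sum_eq_single j]
  · simp
  · intro i _ hi
    rw [Pi.single_eq_of_ne hi, map_zero]
  · intro h
    exact absurd (Finset.mem_range.2 (Nat.lt_succ_of_le hj)) h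

/-- The matrix elements `⟨ξ_{i,g}, O ξ_{j,f}⟩ = e_{ij}(g,f)` of an operator. -/
def HasMatrix (N : ℕ) (ξ : ℕ → ι → E) (O : E →ₗ.[ℂ] E) (e : ℕ → ℕ → ι → ι → ℂ) : Prop :=
  ∀ j ≤ N, ∀ f, ∃ h, (ξ j f, h) ∈ O.graph ∧ ∀ i ≤ N, ∀ g, inner ℂ (ξ i g) h = e i j g f

variable {N : ℕ} {ξ : ℕ → ι → E} {O O' : E →ₗ.[ℂ] E} {e e' : ℕ → ℕ → ι → ι → ℂ}

theorem HasMatrix.le_domain (h : HasMatrix N ξ O e) :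
    LinearMap.range (combination N ξ) ≤ O.domain := by
  rintro _ ⟨a, rfl⟩
  rw [combination_apply]
  refine Submodule.sum_mem _ fun j hj => ?_
  rw [Finsupp.linearCombination_apply]
  refine Submodule.sum_mem _ fun f _ => Submodule.smul_mem _ _ ?_
  obtain ⟨y, hy, -⟩ := h j (Nat.lt_succ_iff.1 (Finset.mem_range.1 hj)) f
  exact O.mem_domain_of_mem_graph hy

theorem HasMatrix.inner_eq (h : HasMatrix N ξ O e) {a b : ℕ → ι →₀ ℂ} {y : E}
    (hy : (combination N ξ b, y) ∈ O.graph) : inner ℂ (combination N ξ a) y =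
      ∑ i ∈ Finset.range (N + 1), ∑ j ∈ Finset.range (N + 1), form (e i j) (a i) (b j) := by
  classical
  have hc : ∀ j, ∃ z : ι → E, j ∈ Finset.range (N + 1) → ∀ f, (ξ j f, z f) ∈ O.graph ∧
      ∀ i ≤ N, ∀ g, inner ℂ (ξ i g) (z f) = e i j g f := by
    intro j
    by_cases hj : j ∈ Finset.range (N + 1)
    · choose z hz using h j (Nat.lt_succ_iff.1 (Finset.mem_range.1 hj))
      exact ⟨z, fun _ => hz⟩
    · exact ⟨fun _ => 0, fun h => absurd h hj⟩
  choose z hz using hc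
  have h1 : (combination N ξ b, ∑ j ∈ Finset.range (N + 1),
      Finsupp.linearCombination ℂ (z j) (b j)) ∈ O.graph := by
    have h2 : ∑ j ∈ Finset.range (N + 1), (Finsupp.linearCombination ℂ (ξ j) (b j),
        Finsupp.linearCombination ℂ (z j) (b j)) ∈ O.graph :=
      O.graph.sum_mem fun j hj => linearCombination_mem_graph (fun f => (hz j hj f).1) (b j)
    rw [combination_apply]
    convert h2 using 1
    exact Prod.ext (by simp [Prod.fst_sum]) (by simp [Prod.snd_sum])
  have hd := O.mem_domain_of_mem_graph h1
  have h3 := (apply_eq_of_mem_graph hy hd).symm.trans (apply_eq_of_mem_graph h1 hd)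
  rw [h3, combination_apply, sum_inner]
  refine Finset.sum_congr rfl fun i hi => ?_
  rw [inner_sum]
  refine Finset.sum_congr rfl fun j hj => ?_
  rw [inner_linearCombination]
  congr 1
  funext g f
  exact (hz j hj f).2 i (Nat.lt_succ_iff.1 (Finset.mem_range.1 hi)) g

theorem HasMatrix.add (h : HasMatrix N ξ O e) (h' : HasMatrix N ξ O' e') :
    HasMatrix N ξ (O + O') fun i j g f => e i j g f + e' i j g f := by
  intro j hj f
  obtain ⟨y, hy, hy'⟩ := h j hj f
  obtain ⟨z, hz, hz'⟩ := h' j hj f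
  refine ⟨y + z, add_mem_graph hy hz, fun i hi g => ?_⟩
  rw [inner_add_right, hy' i hi, hz' i hi]

theorem HasMatrix.sub (h : HasMatrix N ξ O e) (h' : HasMatrix N ξ O' e') :
    HasMatrix N ξ (O - O') fun i j g f => e i j g f - e' i j g f := by
  intro j hj f
  obtain ⟨y, hy, hy'⟩ := h j hj f
  obtain ⟨z, hz, hz'⟩ := h' j hj f
  refine ⟨y - z, sub_mem_graph hy hz, fun i hi g => ?_⟩
  rw [inner_sub_right, hy' i hi, hz' i hi]

theorem HasMatrix.smul (h : HasMatrix N ξ O e) (c : ℂ) :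
    HasMatrix N ξ (c • O) fun i j g f => c * e i j g f := by
  intro j hj f
  obtain ⟨y, hy, hy'⟩ := h j hj f
  refine ⟨c • y, smul_mem_graph c hy, fun i hi g => ?_⟩
  rw [inner_smul_right, hy' i hi]

theorem HasMatrix.congr (h : HasMatrix N ξ O e)
    (he : ∀ i ≤ N, ∀ j ≤ N, ∀ g f, e i j g f = e' i j g f) : HasMatrix N ξ O e' := by
  intro j hj f
  obtain ⟨y, hy, hy'⟩ := h j hj f
  exact ⟨y, hy, fun i hi g => (hy' i hi g).trans (he i hi j hj g f)⟩

/-- The norm of a vector can be computed by testing it against a dense subspace. -/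
theorem norm_sq_le_of_dense {S : Submodule ℂ E} (hS : Dense (S : Set E)) {Φ : E} {B : ℝ}
    (hB : 0 ≤ B) (h : ∀ x ∈ S, ‖inner ℂ x Φ‖ ^ 2 ≤ ‖x‖ ^ 2 * B) : ‖Φ‖ ^ 2 ≤ B := by
  obtain ⟨x, hx, hxΦ⟩ := mem_closure_iff_seq_limit.1 (hS Φ)
  have h1 : ‖inner ℂ Φ Φ‖ ^ 2 ≤ ‖Φ‖ ^ 2 * B :=
    le_of_tendsto_of_tendsto ((hxΦ.inner (𝕜 := ℂ) tendsto_const_nhds).norm.pow 2)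
      ((hxΦ.norm.pow 2).mul_const B) (Filter.Eventually.of_forall fun n => h _ (hx n))
  have h2 : ‖inner ℂ Φ Φ‖ = ‖Φ‖ ^ 2 := by
    rw [inner_self_eq_norm_sq_to_K]
    simp
  rw [h2] at h1
  by_cases h0 : ‖Φ‖ = 0
  · rw [h0]; simpa using hB
  · have h4 : 0 < ‖Φ‖ ^ 2 := by positivity
    nlinarith

end MatrixElements

/-! ### The truncated Fock space -/

section FockSpace

open Filter Topology

variable {X : Type*} [MeasurableSpace X] {μ : Measure X} [SigmaFinite μ] {T : L2 μ →ₗ.[ℂ] L2 μ} {u : L2 μ}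

theorem mem_FockLE {N : ℕ} {Φ : Fock μ u} : Φ ∈ FockLE μ u N ↔ ∀ m, N < m → Φ m = 0 := by
  rw [FockLE, Submodule.mem_iInf]
  exact ⟨fun h m hm => h ⟨m, hm⟩, fun h m => h m.1 m.2⟩

/-- The inner product of `𝓕₊^{≤N}`, declared separately so that instance search finds it first. -/
instance (N : ℕ) : Inner ℂ (FockLE μ u N) := InnerProductSpace.toInner

variable (μ u) in
/-- The embedding of the space of `j` excited particles into `𝓕₊^{≤N}` (zero for `j > N`). -/
def toSector (N j : ℕ) : symPlus μ u j →L[ℂ] FockLE μ u N :=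
  (FockLE μ u N).orthogonalProjectionOnto ∘L
    lp.singleContinuousLinearMap ℂ (fun m : ℕ => symPlus μ u m) 2 j

theorem coe_toSector {N j : ℕ} (hj : j ≤ N) (x : symPlus μ u j) :
    (toSector μ u N j x : Fock μ u) = lp.single 2 j x := by
  have h : lp.single 2 j x ∈ FockLE μ u N :=
    mem_FockLE.2 fun m hm => lp.single_apply_ne (E := fun m : ℕ => symPlus μ u m) 2 j x
      (hj.trans_lt hm).ne'
  exact Submodule.starProjection_eq_self_iff.2 h

theorem toSector_self {N j : ℕ} (hj : j ≤ N) (x : symPlus μ u j) :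
    (toSector μ u N j x : Fock μ u) j = x := by
  rw [coe_toSector hj]
  exact lp.single_apply_self (E := fun m : ℕ => symPlus μ u m) 2 j x

theorem toSector_ne {N j m : ℕ} (hm : m ≠ j) (x : symPlus μ u j) :
    (toSector μ u N j x : Fock μ u) m = 0 := by
  rcases le_or_gt j N with hj | hj
  · rw [coe_toSector hj]
    exact lp.single_apply_ne (E := fun m : ℕ => symPlus μ u m) 2 j x hm
  · have : toSector μ u N j x = 0 := by
      refine ext_inner_left ℂ fun Φ => ?_
      rw [toSector, ContinuousLinearMap.comp_apply,
        Submodule.inner_orthogonalProjectionOnto_eq_of_mem_left]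
      have h1 := lp.inner_single_right (𝕜 := ℂ) j x (Φ : Fock μ u)
      rw [mem_FockLE.1 Φ.2 j hj, inner_zero_left] at h1
      rw [inner_zero_right]
      exact h1
    rw [this]
    rfl

theorem inner_toSector_left {N : ℕ} (j : ℕ) (x : symPlus μ u j) (Φ : FockLE μ u N) :
    inner ℂ (toSector μ u N j x) Φ = inner ℂ x ((Φ : Fock μ u) j) := by
  rw [toSector, ContinuousLinearMap.comp_apply,
    Submodule.inner_orthogonalProjectionOnto_eq_of_mem_right]
  have h := lp.inner_single_left (𝕜 := ℂ) j x (Φ : Fock μ u)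
  exact h

theorem inner_toSector_right {N : ℕ} (j : ℕ) (x : symPlus μ u j) (Φ : FockLE μ u N) :
    inner ℂ Φ (toSector μ u N j x) = inner ℂ ((Φ : Fock μ u) j) x := by
  rw [← inner_conj_symm, inner_toSector_left]
  exact inner_conj_symm (𝕜 := ℂ) ((Φ : Fock μ u) j) x

theorem inner_FockLE {N : ℕ} (Φ Ψ : FockLE μ u N) :
    inner ℂ Φ Ψ = ∑ j ∈ Finset.range (N + 1),
      inner ℂ ((Φ : Fock μ u) j) ((Ψ : Fock μ u) j) := by
  refine (lp.inner_eq_tsum (𝕜 := ℂ) (Φ : Fock μ u) (Ψ : Fock μ u)).trans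
    (tsum_eq_sum fun m hm => ?_)
  have h : (Φ : Fock μ u) m = 0 :=
    mem_FockLE.1 Φ.2 m (by rw [Finset.mem_range] at hm; omega)
  rw [h, inner_zero_left]

theorem norm_FockLE_sq {N : ℕ} (Φ : FockLE μ u N) :
    ‖Φ‖ ^ 2 = ∑ j ∈ Finset.range (N + 1), ‖(Φ : Fock μ u) j‖ ^ 2 := by
  have h := congrArg Complex.re (inner_FockLE Φ Φ)
  rw [Complex.re_sum] at h
  refine (norm_sq_eq_re_inner (𝕜 := ℂ) (Φ : Fock μ u)).trans (h.trans ?_)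
  exact Finset.sum_congr rfl fun j _ =>
    (norm_sq_eq_re_inner (𝕜 := ℂ) ((Φ : Fock μ u) j)).symm

theorem FockLE_ext {N : ℕ} {Φ Ψ : FockLE μ u N}
    (h : ∀ j ≤ N, (Φ : Fock μ u) j = (Ψ : Fock μ u) j) : Φ = Ψ := by
  refine Subtype.ext (lp.ext (funext fun j => ?_))
  rcases le_or_gt j N with hj | hj
  · exact h j hj
  · rw [mem_FockLE.1 Φ.2 j hj, mem_FockLE.1 Ψ.2 j hj]

/-- The map `Φ ↦ Φ_m` on `𝓕₊^{≤N}`. -/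
def component (N m : ℕ) : FockLE μ u N →L[ℂ] symPlus μ u m :=
  lp.evalCLM ℂ (fun m : ℕ => symPlus μ u m) 2 m ∘L (FockLE μ u N).subtypeL

theorem component_apply {N : ℕ} (m : ℕ) (Φ : FockLE μ u N) :
    component N m Φ = (Φ : Fock μ u) m := rfl

/-! ### The core spanned by the pure powers -/

/-- The state `f ⊗ ⋯ ⊗ f` of `j` excited particles. -/
def pwPlus (j : ℕ) (f : ExcDom T u) : symPlus μ u j :=
  ⟨pw μ j f.1.1, pw_mem_symPlus μ u j f.2.2⟩

theorem inner_pwPlus (j : ℕ) (g f : ExcDom T u) :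
    inner ℂ (pwPlus j g) (pwPlus j f) = inner ℂ g.1.1 f.1.1 ^ j :=
  inner_pw μ j _ _

/-- The state of `j` particles in `f`, as an element of `𝓕₊^{≤N}`. -/
def pureVec (N j : ℕ) (f : ExcDom T u) : FockLE μ u N := toSector μ u N j (pwPlus j f)

variable (T u) in
/-- The vector `⊕_{j ≤ N} ∑_f a_{j,f} f ⊗ ⋯ ⊗ f`. -/
def coreVec (N : ℕ) : (ℕ → ExcDom T u →₀ ℂ) →ₗ[ℂ] FockLE μ u N :=
  combination N (pureVec N)

variable (T u) in
/-- The span of the states of `j ≤ N` particles in the same state of `D(T)`. -/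
def core (N : ℕ) : Submodule ℂ (FockLE μ u N) := LinearMap.range (coreVec T u N)

theorem component_coreVec {N j : ℕ} (hj : j ≤ N) (a : ℕ → ExcDom T u →₀ ℂ) :
    (coreVec T u N a : Fock μ u) j = Finsupp.linearCombination ℂ (pwPlus j) (a j) := by
  change component N j (coreVec T u N a) = _
  rw [coreVec, combination_apply, map_sum, Finset.sum_eq_single j]
  · have h := Finsupp.apply_linearCombination ℂ (component N j).toLinearMap
      (pureVec N j : ExcDom T u → _) (a j)
    refine h.trans (congrArg (fun x => Finsupp.linearCombination ℂ x (a j)) (funext fun f => ?_))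
    exact toSector_self hj _
  · intro i _ hi
    have h := Finsupp.apply_linearCombination ℂ (component N j).toLinearMap
      (pureVec N i : ExcDom T u → _) (a i)
    refine h.trans ?_
    have : ((component N j).toLinearMap : FockLE μ u N → _) ∘ (pureVec N i : ExcDom T u → _) =
        fun _ => 0 := funext fun f => toSector_ne hi.symm _
    rw [this]
    simp [Finsupp.linearCombination_apply]
  · intro h
    exact absurd (Finset.mem_range.2 (Nat.lt_succ_of_le hj)) h

theorem norm_coreVec_sq (N : ℕ) (a : ℕ → ExcDom T u →₀ ℂ) :
    ‖coreVec T u N a‖ ^ 2 = ∑ j ∈ Finset.range (N + 1), normForm T u j (a j) := by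
  rw [norm_FockLE_sq]
  refine Finset.sum_congr rfl fun j hj => ?_
  rw [component_coreVec (Nat.lt_succ_iff.1 (Finset.mem_range.1 hj)), norm_linearCombination_sq,
    normForm]
  simp only [inner_pwPlus]

variable {N : ℕ}

theorem inner_pureVec {i j : ℕ} (hi : i ≤ N) (g f : ExcDom T u) :
    inner ℂ (pureVec N i g) (pureVec N j f) =
      if i = j then inner ℂ g.1.1 f.1.1 ^ j else 0 := by
  rw [pureVec, inner_toSector_left]
  split_ifs with h
  · subst h
    rw [pureVec, toSector_self hi, inner_pwPlus]
  · rw [pureVec, toSector_ne h, inner_zero_right]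

theorem hasMatrix_idLE : HasMatrix N (pureVec N) (idLE μ u N)
    fun i j (g f : ExcDom T u) => if i = j then inner ℂ g.1.1 f.1.1 ^ j else 0 :=
  fun j _ f => ⟨pureVec N j f, mem_everywhere_graph _ _, fun _ hi g => inner_pureVec hi g f⟩

/-- A matrix with five nonzero diagonals defines a bounded operator if its entries are bounded. -/
theorem norm_sum_form_sq_le {D : ℕ → ℕ → ExcDom T u → ExcDom T u → ℂ}
    (a b : ℕ → ExcDom T u →₀ ℂ) (β : ℕ → ℝ) (hβ : ∀ j, 0 ≤ β j)
    (hD : ∀ i j, (i + 2 < j ∨ j + 2 < i) → form (D i j) (a i) (b j) = 0)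
    (hb : ∀ i ≤ N, ∀ j ≤ N, ‖form (D i j) (a i) (b j)‖ ^ 2 ≤ normForm T u i (a i) * β j) :
    ‖∑ i ∈ Finset.range (N + 1), ∑ j ∈ Finset.range (N + 1), form (D i j) (a i) (b j)‖ ^ 2 ≤
      ‖coreVec T u N a‖ ^ 2 * (25 * ∑ j ∈ Finset.range (N + 1), β j) := by
  set P := (Finset.range (N + 1) ×ˢ Finset.range (N + 1)).filter
    fun p : ℕ × ℕ => p.1 ≤ p.2 + 2 ∧ p.2 ≤ p.1 + 2 with hP
  have h1 : ∑ i ∈ Finset.range (N + 1), ∑ j ∈ Finset.range (N + 1), form (D i j) (a i) (b j) =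
      ∑ p ∈ P, form (D p.1 p.2) (a p.1) (b p.2) := by
    rw [← Finset.sum_product', hP, Finset.sum_filter]
    refine Finset.sum_congr rfl fun p _ => ?_
    split_ifs with h
    · rfl
    · exact hD _ _ (by omega)
  have h2 : ‖∑ p ∈ P, form (D p.1 p.2) (a p.1) (b p.2)‖ ≤
      ∑ p ∈ P, √(normForm T u p.1 (a p.1)) * √(β p.2) := by
    refine (norm_sum_le _ _).trans (Finset.sum_le_sum fun p hp => ?_)
    rw [← Real.sqrt_mul (normForm_nonneg _ _)]
    rw [hP, Finset.mem_filter, Finset.mem_product, Finset.mem_range, Finset.mem_range] at hp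
    exact Real.le_sqrt_of_sq_le (hb _ (by omega) _ (by omega))
  have hcard : ∀ k : ℕ, ((Finset.range (N + 1)).filter fun j => k ≤ j + 2 ∧ j ≤ k + 2).card ≤ 5 := by
    intro k
    have : ((Finset.range (N + 1)).filter fun j => k ≤ j + 2 ∧ j ≤ k + 2) ⊆
        Finset.Icc (k - 2) (k + 2) := by
      intro j hj
      rw [Finset.mem_filter] at hj
      rw [Finset.mem_Icc]
      omega
    refine (Finset.card_le_card this).trans ?_
    rw [Nat.card_Icc]
    omega
  have h3 : ∑ p ∈ P, √(normForm T u p.1 (a p.1)) ^ 2 ≤ 5 * ‖coreVec T u N a‖ ^ 2 := by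
    rw [norm_coreVec_sq, hP, Finset.sum_filter, Finset.sum_product, Finset.mul_sum]
    refine Finset.sum_le_sum fun i _ => ?_
    simp only
    rw [← Finset.sum_filter, Finset.sum_const, nsmul_eq_mul, Real.sq_sqrt (normForm_nonneg _ _)]
    exact mul_le_mul_of_nonneg_right (by exact_mod_cast hcard i) (normForm_nonneg _ _)
  have h4 : ∑ p ∈ P, √(β p.2) ^ 2 ≤ 5 * ∑ j ∈ Finset.range (N + 1), β j := by
    rw [hP, Finset.sum_filter, Finset.sum_product, Finset.sum_comm, Finset.mul_sum]
    refine Finset.sum_le_sum fun j _ => ?_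
    simp only
    rw [← Finset.sum_filter, Finset.sum_const, nsmul_eq_mul, Real.sq_sqrt (hβ _)]
    refine mul_le_mul_of_nonneg_right ?_ (hβ _)
    have := hcard j
    simp only [and_comm] at this ⊢
    exact_mod_cast this
  rw [h1]
  calc _ ≤ (∑ p ∈ P, √(normForm T u p.1 (a p.1)) * √(β p.2)) ^ 2 :=
        pow_le_pow_left₀ (norm_nonneg _) h2 2
    _ ≤ (∑ p ∈ P, √(normForm T u p.1 (a p.1)) ^ 2) * ∑ p ∈ P, √(β p.2) ^ 2 :=
        Finset.sum_mul_sq_le_sq_mul_sq _ _ _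
    _ ≤ (5 * ‖coreVec T u N a‖ ^ 2) * (5 * ∑ j ∈ Finset.range (N + 1), β j) :=
        mul_le_mul h3 h4 (Finset.sum_nonneg fun _ _ => sq_nonneg _) (by positivity)
    _ = _ := by ring

section Density

variable {W : X → X → ℝ} {C₀ t μ₀ : ℝ} (hS : IsSystem μ T W C₀) (hu : IsHartree T W u t μ₀)
include hS hu

/-- The pure powers of the vectors of `D(T)` orthogonal to `u` are total. -/
theorem eq_zero_of_inner_excDom {m : ℕ} {Φ : L2N μ m} (hΦ : Φ ∈ symPlus μ u m)
    (h : ∀ f : ExcDom T u, inner ℂ Φ (pw μ m f.1.1) = 0) : Φ = 0 := by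
  refine eq_zero_of_mem_symPlus μ u hu.norm hΦ fun f hf => ?_
  obtain ⟨y, hy, hyf⟩ := mem_closure_iff_seq_limit.1 (hS.dense f)
  have h1 : Tendsto (fun n => inner ℂ Φ (pw μ m (Q μ u (y n)))) atTop
      (𝓝 (inner ℂ Φ (pw μ m (Q μ u f)))) :=
    tendsto_const_nhds.inner (((continuous_pw μ m).tendsto _).comp
      (((Q μ u).continuous.tendsto f).comp hyf))
  rw [Q_of_inner_eq_zero μ u hu.norm hf] at h1
  refine tendsto_nhds_unique h1 (tendsto_const_nhds.congr fun n => (h ⟨(Q μ u (y n), _),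
    T.mem_graph ⟨_, hS.Q_mem_domain hu (hy n)⟩, inner_Q μ u hu.norm _⟩).symm)

theorem eq_zero_of_inner_pureVec {Φ : FockLE μ u N}
    (h : ∀ j ≤ N, ∀ f : ExcDom T u, inner ℂ (pureVec N j f) Φ = 0) : Φ = 0 := by
  refine FockLE_ext fun j hj => Subtype.ext ?_
  refine eq_zero_of_inner_excDom hS hu ((Φ : Fock μ u) j).2 fun f => ?_
  have h2 := h j hj f
  rw [pureVec, inner_toSector_left] at h2
  rw [← inner_conj_symm]
  exact (congrArg _ h2).trans (map_zero _)

theorem dense_core : Dense (core T u N : Set (FockLE μ u N)) := by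
  rw [Submodule.dense_iff_topologicalClosure_eq_top, Submodule.topologicalClosure_eq_top_iff,
    Submodule.eq_bot_iff]
  intro y hy
  exact eq_zero_of_inner_pureVec hS hu fun j hj f =>
    (Submodule.mem_orthogonal _ _).1 hy _ (mem_range_combination (pureVec N) hj f)

end Density

end FockSpace

/-! ### Second quantization on the truncated Fock space -/

section SecondQuantization

open Filter Topology

variable {X : Type*} [MeasurableSpace X] {μ : Measure X} [SigmaFinite μ]
  {T A : L2 μ →ₗ.[ℂ] L2 μ} {u : L2 μ} {N : ℕ}

theorem mem_dGamma_graph {Φ Ψ : Fock μ u} : (Φ, Ψ) ∈ (dGamma μ u A).graph ↔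
    ∀ m, (Φ m, Ψ m) ∈ (compress (symPlus μ u m) (sumOp μ A m)).graph := by
  rw [dGamma, Submodule.toLinearPMap_graph_eq]
  · exact Iff.rfl
  · rintro ⟨Φ, Ψ⟩ h (h0 : Φ = 0)
    subst h0
    refine lp.ext (funext fun m => ?_)
    exact LinearPMap.graph_fst_eq_zero_snd _ (h m) rfl

theorem isFormalAdjoint_dGamma (hA : A.IsFormalAdjoint A) (hd : Dense (A.domain : Set (L2 μ))) :
    (dGamma μ u A).IsFormalAdjoint (dGamma μ u A) := by
  refine isFormalAdjoint_of_graph ?_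
  rintro ⟨Φ, Ψ⟩ hp ⟨Φ', Ψ'⟩ hq
  rw [mem_dGamma_graph] at hp hq
  refine (lp.inner_eq_tsum (𝕜 := ℂ) Ψ Φ').trans
    (Eq.trans (tsum_congr fun m => ?_) (lp.inner_eq_tsum (𝕜 := ℂ) Φ Ψ').symm)
  exact inner_eq_of_mem_graph (isFormalAdjoint_compress _ (isFormalAdjoint_sumOp μ m hA hd))
    (hp m) (hq m)

variable (u A N) in
/-- The compression of `dΓ(A)` to `𝓕₊^{≤N}`. -/
def truncGamma : FockLE μ u N →ₗ.[ℂ] FockLE μ u N := compress (FockLE μ u N) (dGamma μ u A)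

/-- The graph of the compression of `dΓ(A)` contains the pairs whose components lie in the graphs
of `∑ A_i`. -/
theorem mem_truncGamma_graph_of_components {Φ Ψ : FockLE μ u N}
    (h : ∀ m, (((Φ : Fock μ u) m : L2N μ m), ((Ψ : Fock μ u) m : L2N μ m)) ∈
      (sumOp μ A m).graph) : (Φ, Ψ) ∈ (truncGamma A u N).graph :=
  mem_compress_graph_of_mem (mem_dGamma_graph.2 fun m => mem_compress_graph_of_mem (h m))

section

variable (hA : A.IsFormalAdjoint A) (hd : Dense (A.domain : Set (L2 μ)))
  {img : ExcDom T u → L2 μ} (hg : ∀ f, (f.1.1, img f) ∈ A.graph)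
  (hi : ∀ f, inner ℂ u (img f) = 0)
include hA hd hg

theorem pureVec_components {j : ℕ} (hj : j ≤ N) (f : ExcDom T u) (m : ℕ) :
    (((pureVec N j f : Fock μ u) m : L2N μ m),
      ((toSector μ u N j ⟨dpw μ j f.1.1 (img f), dpw_mem_symPlus μ u j f.2.2 (hi f)⟩ :
        Fock μ u) m : L2N μ m)) ∈ (sumOp μ A m).graph := by
  by_cases h : m = j
  · subst h
    rw [pureVec, toSector_self hj, toSector_self hj]
    exact pw_mem_sumOp_graph μ m hA hd (hg f)
  · rw [pureVec, toSector_ne h, toSector_ne h]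
    exact (sumOp μ A m).graph.zero_mem

include hi in
theorem hasMatrix_truncGamma : HasMatrix N (pureVec N) (truncGamma A u N)
    fun i j (g f : ExcDom T u) =>
      if i = j then j * inner ℂ g.1.1 (img f) * inner ℂ g.1.1 f.1.1 ^ (j - 1) else 0 := by
  intro j hj f
  refine ⟨_, mem_truncGamma_graph_of_components (pureVec_components hA hd hg hi hj f), ?_⟩
  intro i hii g
  rw [pureVec, inner_toSector_left]
  beta_reduce
  split_ifs with h
  · subst h
    rw [toSector_self hj]
    exact inner_pw_dpw μ i _ _ _
  · rw [toSector_ne h, inner_zero_right]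

include hi in
theorem closure_coreGraph_truncGamma :
    (coreGraph (truncGamma A u N) (core T u N)).topologicalClosure ≤ (truncGamma A u N).graph := by
  let L : ∀ m, FockLE μ u N →L[ℂ] L2N μ m := fun m => (symPlus μ u m).subtypeL ∘L component N m
  let G : Submodule ℂ (FockLE μ u N × FockLE μ u N) :=
    ⨅ m, (sumOp μ A m).graph.comap ((L m).prodMap (L m)).toLinearMap
  have hGmem : ∀ p, p ∈ G ↔ ∀ m, (L m p.1, L m p.2) ∈ (sumOp μ A m).graph := fun p => by
    rw [Submodule.mem_iInf]
    rfl
  have hGc : IsClosed (G : Set (FockLE μ u N × FockLE μ u N)) := by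
    have : (G : Set (FockLE μ u N × FockLE μ u N)) =
        ⋂ m, (fun p => (L m p.1, L m p.2)) ⁻¹' ((sumOp μ A m).graph : Set _) := by
      ext p
      rw [Set.mem_iInter]
      exact hGmem p
    rw [this]
    refine isClosed_iInter fun m => (isClosed_sumOp_graph μ m hA hd).preimage ?_
    exact ((L m).continuous.comp continuous_fst).prodMk ((L m).continuous.comp continuous_snd)
  have hGg : G ≤ (truncGamma A u N).graph := fun p hp =>
    mem_truncGamma_graph_of_components ((hGmem p).1 hp)
  refine (Submodule.topologicalClosure_minimal _ ?_ hGc).trans hGg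
  rintro ⟨x, y⟩ ⟨hxy, a, ha⟩
  change coreVec T u N a = x at ha
  subst ha
  have h1 : (coreVec T u N a, ∑ j ∈ Finset.range (N + 1), Finsupp.linearCombination ℂ
      (fun f => toSector μ u N j ⟨dpw μ j f.1.1 (img f), dpw_mem_symPlus μ u j f.2.2 (hi f)⟩)
        (a j)) ∈ G := by
    have h2 : ∑ j ∈ Finset.range (N + 1), (Finsupp.linearCombination ℂ (pureVec N j) (a j),
        Finsupp.linearCombination ℂ (fun f => toSector μ u N j ⟨dpw μ j f.1.1 (img f),
          dpw_mem_symPlus μ u j f.2.2 (hi f)⟩) (a j)) ∈ G :=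
      G.sum_mem fun j hj => linearCombination_mem_graph (fun f => (hGmem _).2
        (pureVec_components hA hd hg hi (Nat.lt_succ_iff.1 (Finset.mem_range.1 hj)) f)) (a j)
    rw [coreVec, combination_apply]
    convert h2 using 1
    exact Prod.ext (by simp [Prod.fst_sum]) (by simp [Prod.snd_sum])
  have h2 := hGg h1
  have hdm := LinearPMap.mem_domain_of_mem_graph h2
  have h3 := (apply_eq_of_mem_graph hxy hdm).symm.trans (apply_eq_of_mem_graph h2 hdm)
  change (coreVec T u N a, y) ∈ G
  rw [h3]
  exact h1

end

theorem sum_form_diag {ι : Type*} (K : ℕ → ι → ι → ℂ) (a b : ℕ → ι →₀ ℂ) (N : ℕ) :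
    ∑ i ∈ Finset.range (N + 1), ∑ j ∈ Finset.range (N + 1),
      form (fun g f => if i = j then K j g f else 0) (a i) (b j) =
      ∑ j ∈ Finset.range (N + 1), form (K j) (a j) (b j) := by
  refine Finset.sum_congr rfl fun i hi => ?_
  rw [Finset.sum_eq_single i]
  · simp
  · intro j _ hj
    simp only [hj.symm, if_false, form_zero]
  · intro h
    exact absurd hi h

namespace IsSystem

variable {W : X → X → ℝ} {C₀ t μ₀ : ℝ} (hS : IsSystem μ T W C₀) (hu : IsHartree T W u t μ₀)
include hS hu

theorem hasMatrix_kinetic : HasMatrix N (pureVec N) (truncatedKinetic μ u T N)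
    fun i j (g f : ExcDom T u) =>
      if i = j then j * (inner ℂ g.1.1 f.1.2 * inner ℂ g.1.1 f.1.1 ^ (j - 1)) else 0 := by
  have hsa := hS.isSelfAdjoint_QTQ hu
  refine (hasMatrix_truncGamma (isFormalAdjoint_of_isSelfAdjoint hsa) hsa.dense_domain
    (img := fun f : ExcDom T u => Q μ u f.1.2) (fun f => hS.mem_QTQ_graph hu f.2.1 f.2.2)
    (fun f => inner_Q μ u hu.norm _)).congr fun i _ j _ g f => ?_
  rw [← inner_Q_left, Q_of_inner_eq_zero μ u hu.norm g.2.2, mul_assoc]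

theorem core_le_kinetic : core T u N ≤ (truncatedKinetic μ u T N).domain :=
  (hS.hasMatrix_kinetic hu).le_domain

theorem re_inner_kinetic {a : ℕ → ExcDom T u →₀ ℂ} {y : FockLE μ u N}
    (h : (coreVec T u N a, y) ∈ (truncatedKinetic μ u T N).graph) :
    (inner ℂ (coreVec T u N a) y).re =
      ∑ j ∈ Finset.range (N + 1), j * kinForm T u (j - 1) (a j) := by
  have h1 := (hS.hasMatrix_kinetic hu).inner_eq (a := a) h
  rw [sum_form_diag (fun j (g f : ExcDom T u) =>
    (j : ℂ) * (inner ℂ g.1.1 f.1.2 * inner ℂ g.1.1 f.1.1 ^ (j - 1)))] at h1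
  refine (congrArg Complex.re h1).trans ?_
  rw [Complex.re_sum]
  refine Finset.sum_congr rfl fun j _ => ?_
  rw [kinForm, ← qform_const_mul, qform]
  norm_cast

/-- The truncated kinetic energy is self-adjoint with the pure powers as a core. -/
theorem hasCore_kinetic : HasCore (truncatedKinetic μ u T N) (core T u N) := by
  have hsa := hS.isSelfAdjoint_QTQ hu
  have hfa := isFormalAdjoint_of_isSelfAdjoint hsa
  have hg := fun f : ExcDom T u => hS.mem_QTQ_graph hu f.2.1 f.2.2
  have hi := fun f : ExcDom T u => inner_Q μ u hu.norm f.1.2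
  refine ⟨isFormalAdjoint_compress _ (isFormalAdjoint_dGamma hfa hsa.dense_domain),
    hS.core_le_kinetic hu, ?_, ?_, closure_coreGraph_truncGamma hfa hsa.dense_domain hg hi⟩
  · rintro ⟨_, a, rfl⟩
    have h := hS.re_inner_kinetic hu (LinearPMap.mem_graph (truncatedKinetic μ u T N)
      ⟨coreVec T u N a, hS.core_le_kinetic hu ⟨a, rfl⟩⟩)
    refine le_of_le_of_eq (Finset.sum_nonneg fun j _ => ?_) h.symm
    exact mul_nonneg (Nat.cast_nonneg j) (hS.kinForm_nonneg _ _)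
  · intro r hr y hy
    refine FockLE_ext fun j hj => Subtype.ext ?_
    refine eq_zero_of_mem_symPlus μ u hu.norm ((y : Fock μ u) j).2
      (inner_pw_eq_zero_of_semigroup μ hsa (hS.nonneg_QTQ hu) (hS.QTQ_u hu) hu.norm _ hr
        fun f g hfg hf => ?_)
    obtain ⟨f', hf', rfl⟩ := hS.exists_of_mem_QTQ_graph hu hfg hf
    let f₀ : ExcDom T u := ⟨(f, f'), hf', hf⟩
    have h1 := mem_truncGamma_graph_of_components (pureVec_components hfa hsa.dense_domain hg hi
      hj f₀)
    have hmem : pureVec N j f₀ ∈ core T u N := mem_range_combination (pureVec N) hj f₀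
    have h2 := hy ⟨_, hmem⟩
    have h3 := apply_eq_of_mem_graph (A := truncatedKinetic μ u T N) h1
      (hS.core_le_kinetic hu hmem)
    have h4 : inner ℂ y (toSector μ u N j (⟨dpw μ j f₀.1.1 (Q μ u f₀.1.2),
        dpw_mem_symPlus μ u j f₀.2.2 (hi f₀)⟩ + (r : ℂ) • pwPlus j f₀)) = 0 := by
      rw [map_add, map_smul]
      refine Eq.trans (congrArg (fun z => inner ℂ y (z + (r : ℂ) • pureVec N j f₀)) h3.symm) h2
    exact (inner_toSector_right j _ y).symm.trans h4

end IsSystem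

end SecondQuantization

/-! ### Creation and annihilation of pairs -/

section Bogoliubov

open Filter Topology

section Perturbation

variable {E : Type*} [NormedAddCommGroup E] [InnerProductSpace ℂ E] [CompleteSpace E]
  {K H : E →ₗ.[ℂ] E} {C : Submodule ℂ E} {hC : C ≤ K.domain}

/-- Bounded symmetric operators can be added to a perturbation. -/
theorem IsPerturbation.add_everywhere (hH : IsPerturbation K H C hC)
    (h0 : ∀ x : C, 0 ≤ (inner ℂ (x : E) (K ⟨x, hC x.2⟩)).re) {B : E →L[ℂ] E}
    (hB : ∀ x y, inner ℂ (B x) y = inner ℂ x (B y)) :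
    IsPerturbation K (H + everywhere B) C hC := by
  have hle : C ≤ (H + everywhere B).domain := fun x hx => ⟨hH.le hx, trivial⟩
  refine ⟨isFormalAdjoint_add hH.symm (isFormalAdjoint_everywhere hB), hle, ?_, ?_⟩
  · let L : E × E →L[ℂ] E × E := (ContinuousLinearMap.fst ℂ E E).prod
      (ContinuousLinearMap.snd ℂ E E - B ∘L ContinuousLinearMap.fst ℂ E E)
    have hmap : ∀ p ∈ coreGraph (H + everywhere B) C, L p ∈ coreGraph H C := by
      rintro ⟨x, y⟩ ⟨h, hx⟩
      obtain ⟨a, b, ha, hb, rfl⟩ := exists_of_mem_add_graph h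
      rw [eq_of_mem_everywhere_graph hb]
      refine ⟨?_, hx⟩
      change (x, a + B x - B x) ∈ H.graph
      rwa [add_sub_cancel_right]
    rintro ⟨x, y⟩ hp
    have h1 : L (x, y) ∈ H.graph :=
      hH.closed (map_mem_closure L.continuous hp hmap)
    have h2 : (x, y - B x + B x) ∈ (H + everywhere B).graph :=
      add_mem_graph (B := everywhere B) h1 (mem_everywhere_graph B x)
    rwa [sub_add_cancel] at h2
  · obtain ⟨c, hc, hb⟩ := hH.bound
    refine ⟨2 * c + 2 * ‖B‖ ^ 2, by positivity, fun x => ?_⟩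
    have h1 : (H + everywhere B) ⟨x, hle x.2⟩ - K ⟨x, hC x.2⟩ =
        (H ⟨x, hH.le x.2⟩ - K ⟨x, hC x.2⟩) + B x := by
      have := apply_eq_of_mem_graph (add_mem_graph (H.mem_graph ⟨x, hH.le x.2⟩)
        (mem_everywhere_graph B (x : E))) (hle x.2)
      rw [this]
      abel
    have h2 : ‖B x‖ ^ 2 ≤ ‖B‖ ^ 2 * ‖(x : E)‖ ^ 2 := by
      rw [← mul_pow]
      exact pow_le_pow_left₀ (norm_nonneg _) (B.le_opNorm _) 2
    rw [h1]
    have h3 := norm_add_le (H ⟨x, hH.le x.2⟩ - K ⟨x, hC x.2⟩) (B x)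
    have h4 := pow_le_pow_left₀ (norm_nonneg _) h3 2
    have h5 := hb x
    have h6 := h0 x
    nlinarith [sq_nonneg (‖H ⟨x, hH.le x.2⟩ - K ⟨x, hC x.2⟩‖ - ‖B x‖), sq_nonneg ‖B‖,
      mul_nonneg (sq_nonneg ‖B‖) h6]

theorem inner_half_adjoint_add (A : E →L[ℂ] E) (x y : E) :
    inner ℂ (((1 / 2 : ℂ) • (ContinuousLinearMap.adjoint A + A)) x) y =
      inner ℂ x (((1 / 2 : ℂ) • (ContinuousLinearMap.adjoint A + A)) y) := by
  simp only [_root_.smul_apply, _root_.add_apply, inner_smul_left, inner_smul_right,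
    inner_add_left, inner_add_right, ContinuousLinearMap.adjoint_inner_left,
    ContinuousLinearMap.adjoint_inner_right]
  rw [map_div₀, map_one, map_ofNat, add_comm (inner ℂ (A x) y)]

end Perturbation

variable {X : Type*} [MeasurableSpace X] {μ : Measure X} [SigmaFinite μ]
  {T : L2 μ →ₗ.[ℂ] L2 μ} {u : L2 μ} {N : ℕ}

variable (u N) in
/-- The annihilation of a pair of excited particles on `𝓕₊^{≤N}`. -/
def annihilateLE (K : L2 (μ.prod μ)) : FockLE μ u N →L[ℂ] FockLE μ u N :=
  ∑ m ∈ Finset.range (N + 1), toSector μ u N m ∘L pairPlus μ u K m ∘L component N (m + 2)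

theorem annihilateLE_apply (K : L2 (μ.prod μ)) (x : FockLE μ u N) {m : ℕ} (hm : m ≤ N) :
    (annihilateLE u N K x : Fock μ u) m = pairPlus μ u K m ((x : Fock μ u) (m + 2)) := by
  change component N m (annihilateLE u N K x) = _
  rw [annihilateLE, _root_.sum_apply, map_sum, Finset.sum_eq_single m]
  · exact toSector_self hm _
  · intro i _ hi
    exact toSector_ne hi.symm _
  · intro h
    exact absurd (Finset.mem_range.2 (Nat.lt_succ_of_le hm)) h

theorem annihilateLE_mem_graph (K : L2 (μ.prod μ)) (x : FockLE μ u N) :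
    ((x : Fock μ u), (annihilateLE u N K x : Fock μ u)) ∈ (annihilation μ u K).graph := by
  rw [annihilation, Submodule.toLinearPMap_graph_eq]
  · intro m
    rcases le_or_gt m N with hm | hm
    · exact annihilateLE_apply K x hm
    · have h1 := mem_FockLE.1 (annihilateLE u N K x).2 m hm
      have h2 := mem_FockLE.1 x.2 (m + 2) (by omega)
      simp only [h1, h2, map_zero]
  · rintro ⟨Φ, Ψ⟩ h (h0 : Φ = 0)
    subst h0
    refine lp.ext (funext fun m => ?_)
    rw [h m]
    simp

theorem mem_creation_graph {K : L2 (μ.prod μ)} {Φ Ψ : Fock μ u} :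
    (Φ, Ψ) ∈ (creation μ u K).graph ↔ Ψ 0 = 0 ∧ Ψ 1 = 0 ∧
      ∀ m, Ψ (m + 2) = ContinuousLinearMap.adjoint (pairPlus μ u K m) (Φ m) := by
  rw [creation, Submodule.toLinearPMap_graph_eq]
  · exact Iff.rfl
  · rintro ⟨Φ, Ψ⟩ h (h0 : Φ = 0)
    subst h0
    refine lp.ext (funext fun m => ?_)
    match m with
    | 0 => exact h.1
    | 1 => exact h.2.1
    | m + 2 => rw [h.2.2 m]; simp

theorem exists_creation (K : L2 (μ.prod μ)) (x : FockLE μ u N) :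
    ∃ Ψ, ((x : Fock μ u), Ψ) ∈ (creation μ u K).graph := by
  refine ⟨∑ m ∈ Finset.range (N + 1), lp.single 2 (m + 2)
    (ContinuousLinearMap.adjoint (pairPlus μ u K m) ((x : Fock μ u) m)), ?_⟩
  have key : ∀ k, (∑ m ∈ Finset.range (N + 1), lp.single (E := fun m : ℕ => symPlus μ u m) 2 (m + 2)
      (ContinuousLinearMap.adjoint (pairPlus μ u K m) ((x : Fock μ u) m))) k =
      ∑ m ∈ Finset.range (N + 1), (lp.single (E := fun m : ℕ => symPlus μ u m) 2 (m + 2)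
      (ContinuousLinearMap.adjoint (pairPlus μ u K m) ((x : Fock μ u) m)) : Fock μ u) k := by
    intro k
    rw [lp.coeFn_sum, Finset.sum_apply]
  refine mem_creation_graph.2 ⟨?_, ?_, fun m => ?_⟩
  · rw [key]
    exact Finset.sum_eq_zero fun m _ =>
      lp.single_apply_ne (E := fun m : ℕ => symPlus μ u m) 2 (m + 2) _ (by omega)
  · rw [key]
    exact Finset.sum_eq_zero fun m _ =>
      lp.single_apply_ne (E := fun m : ℕ => symPlus μ u m) 2 (m + 2) _ (by omega)
  · rw [key, Finset.sum_eq_single m]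
    · exact lp.single_apply_self (E := fun m : ℕ => symPlus μ u m) 2 (m + 2) _
    · intro k _ hk
      exact lp.single_apply_ne (E := fun m : ℕ => symPlus μ u m) 2 (k + 2) _ (by omega)
    · intro h
      rw [mem_FockLE.1 x.2 m (by rw [Finset.mem_range] at h; omega), map_zero]
      simp

/-- The truncation of the creation of a pair is the adjoint of the annihilation of a pair. -/
theorem projection_creation {K : L2 (μ.prod μ)} {x : FockLE μ u N} {Ψ : Fock μ u}
    (h : ((x : Fock μ u), Ψ) ∈ (creation μ u K).graph) :
    (FockLE μ u N).orthogonalProjectionOnto Ψ =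
      ContinuousLinearMap.adjoint (annihilateLE u N K) x := by
  obtain ⟨h0, h1, h2⟩ := mem_creation_graph.1 h
  refine ext_inner_left ℂ fun Φ => ?_
  rw [ContinuousLinearMap.adjoint_inner_right,
    Submodule.inner_orthogonalProjectionOnto_eq_of_mem_left]
  have h3 : inner ℂ (Φ : Fock μ u) Ψ = ∑ j ∈ Finset.range (N + 1 + 2),
      inner ℂ ((Φ : Fock μ u) j) (Ψ j) := by
    refine (lp.inner_eq_tsum (𝕜 := ℂ) (Φ : Fock μ u) Ψ).trans (tsum_eq_sum fun m hm => ?_)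
    rw [mem_FockLE.1 Φ.2 m (by rw [Finset.mem_range] at hm; omega), inner_zero_left]
  refine h3.trans (Eq.trans ?_ (inner_FockLE (annihilateLE u N K Φ) x).symm)
  rw [Finset.sum_range_succ', Finset.sum_range_succ', h0, h1, inner_zero_right, inner_zero_right,
    add_zero, add_zero]
  refine Finset.sum_congr rfl fun m hm => ?_
  rw [annihilateLE_apply K Φ (Nat.lt_succ_iff.1 (Finset.mem_range.1 hm))]
  refine (congrArg (inner ℂ ((Φ : Fock μ u) (m + 2))) (h2 m)).trans ?_
  exact ContinuousLinearMap.adjoint_inner_right _ _ _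

variable (u N) in
/-- The part of the truncated Bogoliubov Hamiltonian that changes the particle number. -/
def pairOp (K : L2 (μ.prod μ)) : FockLE μ u N →L[ℂ] FockLE μ u N :=
  (1 / 2 : ℂ) • (ContinuousLinearMap.adjoint (annihilateLE u N K) + annihilateLE u N K)

theorem inner_pairOp (K : L2 (μ.prod μ)) (x y : FockLE μ u N) :
    inner ℂ (pairOp u N K x) y = inner ℂ x (pairOp u N K y) := by
  exact inner_half_adjoint_add (annihilateLE u N K) x y

theorem truncatedBogoliubov_eq (W : X → X → ℝ) (μ₀ : ℝ) : truncatedBogoliubov μ W u T μ₀ N =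
    truncGamma (hOp μ W u T μ₀ + K₁ μ W u) u N + everywhere (pairOp u N (K₂ μ W u)) := by
  refine LinearPMap.eq_of_eq_graph (Submodule.ext ?_)
  rintro ⟨x, y⟩
  constructor
  · intro h
    obtain ⟨z, hz, rfl⟩ := mem_compress_graph.1 h
    obtain ⟨a, b, ha, hb, rfl⟩ := exists_of_mem_add_graph hz
    obtain ⟨c, hc, rfl⟩ := exists_of_mem_smul_graph hb
    obtain ⟨d, e, hd, he, rfl⟩ := exists_of_mem_add_graph hc
    have he' := LinearPMap.mem_graph_snd_inj _ he (annihilateLE_mem_graph (K₂ μ W u) x) rfl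
    rw [map_add, map_smul, map_add, projection_creation hd]
    rw [he', Submodule.orthogonalProjectionOnto_mem_subspace_eq_self]
    exact add_mem_graph (mem_compress_graph.2 ⟨a, ha, rfl⟩)
      (mem_everywhere_graph (pairOp u N (K₂ μ W u)) x)
  · intro h
    obtain ⟨a, b, ha, hb, rfl⟩ := exists_of_mem_add_graph h
    obtain ⟨a', ha', rfl⟩ := mem_compress_graph.1 ha
    obtain ⟨c, hc⟩ := exists_creation (K₂ μ W u) x
    refine mem_compress_graph.2 ⟨_, add_mem_graph ha' (smul_mem_graph (1 / 2 : ℂ)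
      (add_mem_graph hc (annihilateLE_mem_graph (K₂ μ W u) x))), ?_⟩
    rw [eq_of_mem_everywhere_graph hb, map_add, map_smul, map_add, projection_creation hc,
      Submodule.orthogonalProjectionOnto_mem_subspace_eq_self]
    rfl

theorem inner_annihilateLE_pureVec (hu : ‖u‖ = 1) (K : L2 (μ.prod μ)) {i j : ℕ} (hi : i ≤ N)
    (hj : j ≤ N) (g f : ExcDom T u) : inner ℂ (pureVec N i g) (annihilateLE u N K (pureVec N j f)) =
      if j = i + 2 then (√((i + 1 : ℝ) * (i + 2)) : ℂ) * (inner ℂ K (prodMul μ μ f.1.1 f.1.1) *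
        inner ℂ g.1.1 f.1.1 ^ i) else 0 := by
  rw [pureVec, inner_toSector_left, annihilateLE_apply K _ hi]
  split_ifs with h
  · subst h
    rw [pureVec, toSector_self hj, pairPlus, ContinuousLinearMap.comp_apply,
      ContinuousLinearMap.comp_apply]
    change inner ℂ _ ((symPlus μ u i).orthogonalProjectionOnto
      (annihilatePair μ K i (pw μ (i + 2) f.1.1))) = _
    rw [annihilatePair_pw, map_smul, map_smul, projection_pw μ u hu, inner_smul_right,
      inner_smul_right]
    congr 2
    have h1 := inner_pwPlus i g f
    refine Eq.trans ?_ h1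
    congr 1
    refine Subtype.ext ?_
    exact congrArg (pw μ i) (Q_of_inner_eq_zero μ u hu f.2.2)
  · have h1 : (pureVec N j f : Fock μ u) (i + 2) = 0 := toSector_ne (Ne.symm h) _
    rw [h1, map_zero, inner_zero_right]

theorem K₂_eq (W : X → X → ℝ) : K₂ μ W u = pairMul μ W u u := by
  rw [K₂, pairMul]
  congr 1
  funext p
  ring

theorem hasMatrix_pairOp (hu : ‖u‖ = 1) (W : X → X → ℝ) :
    HasMatrix N (pureVec N) (everywhere (pairOp u N (K₂ μ W u))) fun i j (g f : ExcDom T u) =>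
      1 / 2 * ((if i = j + 2 then (√((j + 1 : ℝ) * (j + 2)) : ℂ) * (pairInner W g.1.1 g.1.1 u u *
        inner ℂ g.1.1 f.1.1 ^ j) else 0) +
      if j = i + 2 then (√((i + 1 : ℝ) * (i + 2)) : ℂ) *
        (conj (pairInner W f.1.1 f.1.1 u u) * inner ℂ g.1.1 f.1.1 ^ i) else 0) := by
  intro j hj f
  refine ⟨_, mem_everywhere_graph _ _, fun i hi g => ?_⟩
  have h1 := inner_annihilateLE_pureVec hu (K₂ μ W u) hi hj g f
  have h2 := inner_annihilateLE_pureVec hu (K₂ μ W u) hj hi f g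
  have h3 : inner ℂ (pureVec N i g) (ContinuousLinearMap.adjoint (annihilateLE u N (K₂ μ W u))
      (pureVec N j f)) = conj (inner ℂ (pureVec N j f)
        (annihilateLE u N (K₂ μ W u) (pureVec N i g))) :=
    (ContinuousLinearMap.adjoint_inner_right _ _ _).trans (inner_conj_symm _ _).symm
  have h4 : inner ℂ (pureVec N i g) (pairOp u N (K₂ μ W u) (pureVec N j f)) = 1 / 2 *
      (inner ℂ (pureVec N i g) (ContinuousLinearMap.adjoint (annihilateLE u N (K₂ μ W u))
        (pureVec N j f)) + inner ℂ (pureVec N i g)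
          (annihilateLE u N (K₂ μ W u) (pureVec N j f))) := by
    rw [← inner_add_right, ← inner_smul_right]
    rfl
  rw [h4, h3, h2, h1]
  congr 2
  · split_ifs with h
    · rw [map_mul, map_mul, map_pow, inner_conj_symm, inner_conj_symm, Complex.conj_ofReal, K₂_eq]
      rfl
    · exact map_zero _
  · split_ifs with h
    · rw [K₂_eq, pairInner, inner_conj_symm]
    · rfl

/-- The norm of `O Φ`, for `Φ` in the core, from bounds on the matrix elements of `O`. -/
theorem norm_sq_le_of_hasMatrix {W : X → X → ℝ} {C₀ t μ₀ : ℝ} (hS : IsSystem μ T W C₀)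
    (hu : IsHartree T W u t μ₀) {O : FockLE μ u N →ₗ.[ℂ] FockLE μ u N}
    {e : ℕ → ℕ → ExcDom T u → ExcDom T u → ℂ} (hO : HasMatrix N (pureVec N) O e)
    (he : ∀ i j, (i + 2 < j ∨ j + 2 < i) → ∀ g f, e i j g f = 0)
    {b : ℕ → ExcDom T u →₀ ℂ} {β : ℕ → ℝ} (hβ : ∀ j, 0 ≤ β j)
    (hb : ∀ i ≤ N, ∀ j ≤ N, ∀ a, ‖form (e i j) a (b j)‖ ^ 2 ≤ normForm T u i a * β j)
    {y : FockLE μ u N} (hy : (coreVec T u N b, y) ∈ O.graph) :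
    ‖y‖ ^ 2 ≤ 25 * ∑ j ∈ Finset.range (N + 1), β j := by
  refine norm_sq_le_of_dense (dense_core hS hu) (mul_nonneg (by norm_num)
    (Finset.sum_nonneg fun j _ => hβ j)) ?_
  rintro _ ⟨a, rfl⟩
  rw [coreVec, hO.inner_eq hy]
  refine norm_sum_form_sq_le a b β hβ (fun i j hij => ?_) fun i hi j hj => hb i hi j hj (a i)
  have : e i j = fun _ _ => 0 := funext fun g => funext fun f => he i j hij g f
  rw [this, form_zero]

end Bogoliubov

/-! ### The Bogoliubov Hamiltonian -/

section BogoliubovPerturbation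

open Filter Topology

variable {X : Type*} [MeasurableSpace X] {μ : Measure X} [SigmaFinite μ]
  {T : L2 μ →ₗ.[ℂ] L2 μ} {u : L2 μ} {N : ℕ}

theorem norm_add_sq_le_two {E : Type*} [SeminormedAddCommGroup E] (x y : E) :
    ‖x + y‖ ^ 2 ≤ 2 * (‖x‖ ^ 2 + ‖y‖ ^ 2) := by
  nlinarith [pow_le_pow_left₀ (norm_nonneg _) (norm_add_le x y) 2, sq_nonneg (‖x‖ - ‖y‖)]

theorem norm_sub_sq_le_two {E : Type*} [SeminormedAddCommGroup E] (x y : E) :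
    ‖x - y‖ ^ 2 ≤ 2 * (‖x‖ ^ 2 + ‖y‖ ^ 2) := by
  nlinarith [pow_le_pow_left₀ (norm_nonneg _) (norm_sub_le x y) 2, sq_nonneg (‖x‖ - ‖y‖)]

namespace IsSystem

variable {W : X → X → ℝ} {C₀ t μ₀ : ℝ} (hS : IsSystem μ T W C₀) (hu : IsHartree T W u t μ₀)
include hS hu

theorem hasMatrix_hOp : HasMatrix N (pureVec N) (truncGamma (hOp μ W u T μ₀ + K₁ μ W u) u N)
    fun i j (g f : ExcDom T u) => if i = j then
      j * ((inner ℂ g.1.1 f.1.2 + pairInner W g.1.1 u f.1.1 u - μ₀ * inner ℂ g.1.1 f.1.1 +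
        pairInner W g.1.1 u u f.1.1) * inner ℂ g.1.1 f.1.1 ^ (j - 1)) else 0 := by
  refine (hasMatrix_truncGamma (hS.isFormalAdjoint_hOp hu) (hS.dense_hOp hu)
    (img := fun f : ExcDom T u => bogApply W u μ₀ f.1.1 f.1.2)
    (fun f => hS.mem_hOp_graph hu f.2.1)
    (fun f => hS.inner_u_bogApply hu f.2.1 f.2.2)).congr fun i _ j _ g f => ?_
  rw [hS.inner_bogApply hu, Q_of_inner_eq_zero μ u hu.norm g.2.2,
    Q_of_inner_eq_zero μ u hu.norm f.2.2, mul_assoc]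

theorem t_nonneg : 0 ≤ t := zero_le_one.trans (hS.one_le_t hu)

theorem norm_hOp_sub_kinetic_sq_le (n : ℕ) (a b : ExcDom T u →₀ ℂ) :
    ‖form (fun g f : ExcDom T u => (pairInner W g.1.1 u f.1.1 u - μ₀ * inner ℂ g.1.1 f.1.1 +
        pairInner W g.1.1 u u f.1.1) * inner ℂ g.1.1 f.1.1 ^ n) a b‖ ^ 2 ≤
      normForm T u (n + 1) a *
        ((60 * C₀ * (1 + t) + 4 * μ₀ ^ 2) * kinForm T u n b) := by
  have h1 := hS.form_gu_fu hu n a b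
  have h2 := hS.form_gu_uf hu n a b
  have h3 := IsSystem.form_pow (n + 1) a b
  have h4 := hS.normForm_le_kinForm (u := u) n b
  have h5 : form (fun g f : ExcDom T u => (pairInner W g.1.1 u f.1.1 u -
      μ₀ * inner ℂ g.1.1 f.1.1 + pairInner W g.1.1 u u f.1.1) * inner ℂ g.1.1 f.1.1 ^ n) a b =
      form (fun g f : ExcDom T u => pairInner W g.1.1 u f.1.1 u * inner ℂ g.1.1 f.1.1 ^ n) a b -
      μ₀ * form (fun g f : ExcDom T u => inner ℂ g.1.1 f.1.1 ^ (n + 1)) a b +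
      form (fun g f : ExcDom T u => pairInner W g.1.1 u u f.1.1 * inner ℂ g.1.1 f.1.1 ^ n) a b := by
    rw [← form_const_mul, ← form_sub, ← form_add]
    congr 1
    funext g f
    ring
  rw [h5]
  set x := form (fun g f : ExcDom T u => pairInner W g.1.1 u f.1.1 u *
    inner ℂ g.1.1 f.1.1 ^ n) a b
  set z := form (fun g f : ExcDom T u => pairInner W g.1.1 u u f.1.1 *
    inner ℂ g.1.1 f.1.1 ^ n) a b
  set y := form (fun g f : ExcDom T u => inner ℂ g.1.1 f.1.1 ^ (n + 1)) a b
  have h6 := norm_add_sq_le_two (x - μ₀ * y) z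
  have h7 := norm_sub_sq_le_two x (μ₀ * y)
  have h8 : ‖(μ₀ : ℂ) * y‖ ^ 2 = μ₀ ^ 2 * ‖y‖ ^ 2 := by
    rw [norm_mul, mul_pow, Complex.norm_real, Real.norm_eq_abs, sq_abs]
  have hC := hS.pos
  have ht := hS.t_nonneg hu
  have hn := normForm_nonneg (T := T) (u := u) (n + 1) a
  have h9 : 10 * C₀ * (kinForm T u n b + t * normForm T u (n + 1) b) ≤
      10 * C₀ * ((1 + t) * kinForm T u n b) := by
    refine mul_le_mul_of_nonneg_left ?_ (by positivity)
    nlinarith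
  have h10 := mul_le_mul_of_nonneg_left h9 hn
  have h11 := mul_le_mul_of_nonneg_left (mul_le_mul_of_nonneg_left h4 hn) (sq_nonneg μ₀)
  have h12 := mul_le_mul_of_nonneg_left h3 (sq_nonneg μ₀)
  nlinarith

theorem isPerturbation_hOp : IsPerturbation (truncatedKinetic μ u T N)
    (truncGamma (hOp μ W u T μ₀ + K₁ μ W u) u N) (core T u N) (hS.core_le_kinetic hu) := by
  have hle := (hS.hasMatrix_hOp hu (N := N)).le_domain
  refine ⟨isFormalAdjoint_compress _ (isFormalAdjoint_dGamma (hS.isFormalAdjoint_hOp hu)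
    (hS.dense_hOp hu)), hle, ?_, ?_⟩
  · exact closure_coreGraph_truncGamma (hS.isFormalAdjoint_hOp hu) (hS.dense_hOp hu)
      (img := fun f : ExcDom T u => bogApply W u μ₀ f.1.1 f.1.2)
      (fun f => hS.mem_hOp_graph hu f.2.1) (fun f => hS.inner_u_bogApply hu f.2.1 f.2.2)
  · have hC := hS.pos
    have ht := hS.t_nonneg hu
    set c := 60 * C₀ * (1 + t) + 4 * μ₀ ^ 2 with hc
    have hc0 : 0 ≤ c := by positivity
    refine ⟨25 * (N * c), by positivity, ?_⟩
    rintro ⟨_, b, rfl⟩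
    have hK := (truncatedKinetic μ u T N).mem_graph
      ⟨coreVec T u N b, hS.core_le_kinetic hu ⟨b, rfl⟩⟩
    have hH := (truncGamma (hOp μ W u T μ₀ + K₁ μ W u) u N).mem_graph
      ⟨coreVec T u N b, hle ⟨b, rfl⟩⟩
    have h1 := norm_sq_le_of_hasMatrix hS hu
      ((hS.hasMatrix_hOp hu).sub (hS.hasMatrix_kinetic hu)) (b := b)
      (β := fun j => j ^ 2 * (c * kinForm T u (j - 1) (b j))) ?_ ?_ ?_ (sub_mem_graph hH hK)
    · refine h1.trans ?_
      rw [hS.re_inner_kinetic hu hK, mul_assoc]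
      refine mul_le_mul_of_nonneg_left ?_ (by norm_num)
      refine le_trans ?_ (mul_le_mul_of_nonneg_left (le_add_of_nonneg_right (sq_nonneg _))
        (by positivity))
      rw [Finset.mul_sum]
      refine Finset.sum_le_sum fun j hj => ?_
      have hjN : (j : ℝ) ≤ N := by
        exact_mod_cast Nat.lt_succ_iff.1 (Finset.mem_range.1 hj)
      have hk := hS.kinForm_nonneg (u := u) (j - 1) (b j)
      have hj0 : (0 : ℝ) ≤ j := Nat.cast_nonneg j
      calc _ = j * (c * (j * kinForm T u (j - 1) (b j))) := by ring
        _ ≤ N * (c * (j * kinForm T u (j - 1) (b j))) :=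
          mul_le_mul_of_nonneg_right hjN (by positivity)
        _ = _ := by ring
    · intro i j hij g f
      rw [if_neg (by omega), if_neg (by omega), sub_zero]
    · intro j
      have hk := hS.kinForm_nonneg (u := u) (j - 1) (b j)
      positivity
    · intro i _ j _ a
      by_cases hij : i = j
      · subst hij
        simp only [if_true]
        cases i with
        | zero => simp [form_zero]
        | succ n =>
          have h2 := hS.norm_hOp_sub_kinetic_sq_le hu n a (b (n + 1))
          have h3 : form (fun g f : ExcDom T u => ((n + 1 : ℕ) : ℂ) * ((inner ℂ g.1.1 f.1.2 +
              pairInner W g.1.1 u f.1.1 u - μ₀ * inner ℂ g.1.1 f.1.1 +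
              pairInner W g.1.1 u u f.1.1) * inner ℂ g.1.1 f.1.1 ^ (n + 1 - 1)) -
              ((n + 1 : ℕ) : ℂ) * (inner ℂ g.1.1 f.1.2 *
                inner ℂ g.1.1 f.1.1 ^ (n + 1 - 1))) a (b (n + 1)) =
              ((n + 1 : ℕ) : ℂ) * form (fun g f : ExcDom T u => (pairInner W g.1.1 u f.1.1 u -
                μ₀ * inner ℂ g.1.1 f.1.1 + pairInner W g.1.1 u u f.1.1) *
                  inner ℂ g.1.1 f.1.1 ^ n) a (b (n + 1)) := by
            rw [← form_const_mul]
            congr 1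
            funext g f
            rw [Nat.add_sub_cancel]
            ring
          rw [h3, norm_mul, mul_pow, Complex.norm_natCast, Nat.add_sub_cancel]
          refine (mul_le_mul_of_nonneg_left h2 (sq_nonneg _)).trans_eq ?_
          rw [hc]
          ring
      · simp only [if_neg hij, sub_zero, form_zero]
        rw [norm_zero, zero_pow two_ne_zero]
        have hk := hS.kinForm_nonneg (u := u) (j - 1) (b j)
        have hn := normForm_nonneg (T := T) (u := u) i a
        positivity

theorem isPerturbation_bogoliubov : IsPerturbation (truncatedKinetic μ u T N)
    (truncatedBogoliubov μ W u T μ₀ N) (core T u N) (hS.core_le_kinetic hu) := by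
  rw [truncatedBogoliubov_eq]
  exact (hS.isPerturbation_hOp hu).add_everywhere (hS.hasCore_kinetic hu).nonneg
    (inner_pairOp (K₂ μ W u))

theorem hasMatrix_bogoliubov : HasMatrix N (pureVec N) (truncatedBogoliubov μ W u T μ₀ N)
    fun i j (g f : ExcDom T u) => (if i = j then
      j * ((inner ℂ g.1.1 f.1.2 + pairInner W g.1.1 u f.1.1 u - μ₀ * inner ℂ g.1.1 f.1.1 +
        pairInner W g.1.1 u u f.1.1) * inner ℂ g.1.1 f.1.1 ^ (j - 1)) else 0) +
      1 / 2 * ((if i = j + 2 then (√((j + 1 : ℝ) * (j + 2)) : ℂ) * (pairInner W g.1.1 g.1.1 u u *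
        inner ℂ g.1.1 f.1.1 ^ j) else 0) +
      if j = i + 2 then (√((i + 1 : ℝ) * (i + 2)) : ℂ) *
        (pairInner W u u f.1.1 f.1.1 * inner ℂ g.1.1 f.1.1 ^ i) else 0) := by
  rw [truncatedBogoliubov_eq]
  refine ((hS.hasMatrix_hOp hu).add (hasMatrix_pairOp hu.norm W)).congr fun i _ j _ g f => ?_
  have hf := T.mem_domain_of_mem_graph f.2.1
  have hu' := hS.mem_domain hu
  rw [hS.conj_pairInner hf hf hu' hu']

end IsSystem

end BogoliubovPerturbation

/-! ### The excitation map -/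

section ExcitationMap

open Filter Topology

variable {X : Type*} [MeasurableSpace X] {μ : Measure X} [SigmaFinite μ]
  {T : L2 μ →ₗ.[ℂ] L2 μ} {u : L2 μ} {N : ℕ}

/-- The inner product of the `N`-particle space, declared separately so that instance search finds
it first. -/
instance (N : ℕ) : Inner ℂ (sym μ N) := InnerProductSpace.toInner

theorem annihilatePow_pw (u ψ : L2 μ) (m k : ℕ) : annihilatePow μ u m k (pw μ (m + k) ψ) =
    ((√((m + 1).ascFactorial k : ℝ) : ℝ) : ℂ) • inner ℂ u ψ ^ k • pw μ m ψ := by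
  induction k with
  | zero => simp [annihilatePow]
  | succ k ih =>
    rw [annihilatePow, ContinuousLinearMap.comp_apply]
    have h := annihilate_pw μ u (m + k) ψ
    rw [show (annihilate μ u (m + k)) (pw μ (m + (k + 1)) ψ) = _ from h, map_smul, map_smul, ih,
      Nat.ascFactorial_succ, Nat.cast_mul, Real.sqrt_mul (Nat.cast_nonneg _), smul_smul, smul_smul,
      smul_smul, smul_smul]
    congr 1
    push_cast
    rw [show (m : ℝ) + 1 + k = m + k + 1 by ring]
    ring

theorem cast_annihilatePow_pw (u ψ : L2 μ) {m k M : ℕ} (h : m + k = M) :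
    (h ▸ annihilatePow μ u m k : L2N μ M →L[ℂ] L2N μ m) (pw μ M ψ) =
    ((√((m + 1).ascFactorial k : ℝ) : ℝ) : ℂ) • inner ℂ u ψ ^ k • pw μ m ψ := by
  subst h
  exact annihilatePow_pw u ψ m k

variable (μ) in
/-- The state of `N` bosons in the one-particle state `ψ`. -/
def pwSym (N : ℕ) (ψ : L2 μ) : sym μ N := ⟨pw μ N ψ, pw_mem_sym μ N ψ⟩

theorem inner_pwSym (ψ φ : L2 μ) : inner ℂ (pwSym μ N ψ) (pwSym μ N φ) = inner ℂ ψ φ ^ N :=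
  inner_pw μ N ψ φ

theorem excitationComponent_pwSym (hu : ‖u‖ = 1) (ψ : L2 μ) {j : ℕ} (hj : j ≤ N) :
    excitationComponent μ u N j hj (pwSym μ N ψ) =
      (((√(N.choose j : ℝ) : ℝ) : ℂ) * inner ℂ u ψ ^ (N - j)) •
        (⟨pw μ j (Q μ u ψ), pw_mem_symPlus μ u j (inner_Q μ u hu ψ)⟩ : symPlus μ u j) := by
  have h1 : excitationComponent μ u N j hj (pwSym μ N ψ) =
      (((√((N - j).factorial : ℝ))⁻¹ : ℝ) : ℂ) • (symPlus μ u j).orthogonalProjectionOnto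
        ((Nat.add_sub_of_le hj ▸ annihilatePow μ u j (N - j) : L2N μ N →L[ℂ] L2N μ j)
          (pw μ N ψ)) := rfl
  rw [h1, cast_annihilatePow_pw, map_smul, map_smul, projection_pw μ u hu, smul_smul, smul_smul]
  congr 1
  rw [Nat.ascFactorial_eq_factorial_mul_choose, Nat.add_sub_of_le hj, Nat.choose_symm hj,
    Nat.cast_mul, Real.sqrt_mul (Nat.cast_nonneg _), ← Complex.ofReal_mul, ← mul_assoc,
    inv_mul_cancel₀, one_mul]
  exact (Real.sqrt_pos.2 (by exact_mod_cast Nat.factorial_pos _)).ne'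

theorem excitationMap_apply {j : ℕ} (hj : j ≤ N) (Φ : sym μ N) :
    (excitationMap μ u N Φ : Fock μ u) j = excitationComponent μ u N j hj Φ := by
  have h1 : excitationMap μ u N Φ = ∑ i : Fin (N + 1),
      toSector μ u N i (excitationComponent μ u N i (Nat.lt_succ_iff.1 i.2) Φ) := by
    rw [excitationMap, ContinuousLinearMap.comp_apply, _root_.sum_apply, map_sum]
    rfl
  change component N j (excitationMap μ u N Φ) = _
  rw [h1, map_sum, Finset.sum_eq_single (⟨j, Nat.lt_succ_of_le hj⟩ : Fin (N + 1))]
  · exact toSector_self hj _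
  · intro i _ hi
    exact toSector_ne (fun h => hi (Fin.ext h.symm)) _
  · intro h
    exact absurd (Finset.mem_univ _) h

theorem inner_eq_add_inner_Q (hu : ‖u‖ = 1) (ψ φ : L2 μ) :
    inner ℂ ψ φ = conj (inner ℂ u ψ) * inner ℂ u φ + inner ℂ (Q μ u ψ) (Q μ u φ) := by
  rw [inner_Q_left, Q_of_inner_eq_zero μ u hu (inner_Q μ u hu φ), Q_apply μ u hu, inner_sub_right,
    inner_smul_right, inner_conj_symm]
  ring

theorem inner_excitationMap_pwSym (hu : ‖u‖ = 1) (ψ φ : L2 μ) :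
    inner ℂ (excitationMap μ u N (pwSym μ N ψ)) (excitationMap μ u N (pwSym μ N φ)) =
      inner ℂ ψ φ ^ N := by
  rw [inner_FockLE, inner_eq_add_inner_Q hu, add_pow, ← Finset.sum_range_reflect]
  refine Finset.sum_congr rfl fun i hi => ?_
  have hi' : i ≤ N := Nat.lt_succ_iff.1 (Finset.mem_range.1 hi)
  have h1 : N + 1 - 1 - i = N - i := by omega
  rw [h1, excitationMap_apply (Nat.sub_le N i), excitationMap_apply (Nat.sub_le N i),
    excitationComponent_pwSym hu, excitationComponent_pwSym hu]
  refine (inner_smul_left (E := symPlus μ u (N - i)) _ _ _).trans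
    ((congrArg _ (inner_smul_right (E := symPlus μ u (N - i)) _ _ _)).trans ?_)
  have h2 : inner ℂ (⟨pw μ (N - i) (Q μ u ψ), pw_mem_symPlus μ u (N - i) (inner_Q μ u hu ψ)⟩ :
      symPlus μ u (N - i)) (⟨pw μ (N - i) (Q μ u φ), pw_mem_symPlus μ u (N - i)
        (inner_Q μ u hu φ)⟩ : symPlus μ u (N - i)) = inner ℂ (Q μ u ψ) (Q μ u φ) ^ (N - i) :=
    inner_pw μ (N - i) _ _
  refine (congrArg (fun z => _ * (_ * z)) h2).trans ?_
  rw [map_mul, map_pow, Complex.conj_ofReal, Nat.sub_sub_self hi', Nat.choose_symm hi', mul_pow]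
  have h3 : ((√(N.choose i : ℝ) : ℝ) : ℂ) * ((√(N.choose i : ℝ) : ℝ) : ℂ) = (N.choose i : ℂ) := by
    rw [← Complex.ofReal_mul, Real.mul_self_sqrt (Nat.cast_nonneg _), Complex.ofReal_natCast]
  rw [← h3]
  ring

theorem eq_of_inner_pwSym {Φ Ψ : sym μ N}
    (h : ∀ ψ, inner ℂ Φ (pwSym μ N ψ) = inner ℂ Ψ (pwSym μ N ψ)) : Φ = Ψ := by
  have h1 : Φ - Ψ = 0 := by
    refine Subtype.ext (eq_zero_of_inner_pw μ (Φ - Ψ).2 fun f => ?_)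
    have := h f
    rw [← sub_eq_zero, ← inner_sub_left] at this
    exact this
  exact sub_eq_zero.1 h1

theorem adjoint_excitationMap_comp (hu : ‖u‖ = 1) (Φ : sym μ N) :
    ContinuousLinearMap.adjoint (excitationMap μ u N) (excitationMap μ u N Φ) = Φ := by
  have h1 : ∀ ψ, ContinuousLinearMap.adjoint (excitationMap μ u N)
      (excitationMap μ u N (pwSym μ N ψ)) = pwSym μ N ψ := by
    intro ψ
    refine eq_of_inner_pwSym fun φ => ?_
    rw [inner_pwSym, ← inner_excitationMap_pwSym hu]
    exact ContinuousLinearMap.adjoint_inner_left _ _ _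
  refine eq_of_inner_pwSym fun φ => ?_
  have h2 := ContinuousLinearMap.adjoint_inner_left (excitationMap μ u N) (pwSym μ N φ)
    (excitationMap μ u N Φ)
  have h3 := ContinuousLinearMap.adjoint_inner_right (excitationMap μ u N) Φ
    (excitationMap μ u N (pwSym μ N φ))
  rw [h1] at h3
  exact h2.trans h3.symm

/-- If all values of a polynomial with vector coefficients lie in a subspace, so do the
coefficients. -/
theorem coeff_mem_of_forall_sum_pow_smul_mem {E : Type*} [AddCommGroup E] [Module ℂ E]
    {M : Submodule ℂ E} {n : ℕ} {v : ℕ → E}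
    (h : ∀ α : ℂ, ∑ j ∈ Finset.range n, α ^ j • v j ∈ M) {j : ℕ} (hj : j < n) : v j ∈ M := by
  rw [← Submodule.Quotient.mk_eq_zero, ← Module.forall_dual_apply_eq_zero_iff ℂ]
  intro φ
  let p : Polynomial ℂ := ∑ j ∈ Finset.range n,
    Polynomial.monomial j (φ (Submodule.Quotient.mk (v j)))
  have hp : p = 0 := by
    refine Polynomial.funext fun α => ?_
    have h1 := (Submodule.Quotient.mk_eq_zero M).2 (h α)
    rw [← Submodule.mkQ_apply, map_sum] at h1
    have h2 := congrArg φ h1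
    rw [map_sum, map_zero] at h2
    rw [Polynomial.eval_finsetSum, Polynomial.eval_zero, ← h2]
    refine Finset.sum_congr rfl fun i _ => ?_
    rw [Polynomial.eval_monomial, map_smul, map_smul, smul_eq_mul, mul_comm]
    rfl
  have h3 := congrArg (fun q => Polynomial.coeff q j) hp
  simp only [p, Polynomial.finsetSum_coeff, Polynomial.coeff_monomial, Polynomial.coeff_zero] at h3
  rw [Finset.sum_ite_eq' (Finset.range n) j, if_pos (Finset.mem_range.2 hj)] at h3
  exact h3

/-- The excitation map on a pure power, in terms of the pure powers in `𝓕₊^{≤N}`. -/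
theorem excitationMap_pwSym (hu : ‖u‖ = 1) (α : ℂ) (f : ExcDom T u) :
    excitationMap μ u N (pwSym μ N (α • u + f.1.1)) = ∑ j ∈ Finset.range (N + 1),
      α ^ (N - j) • ((√(N.choose j : ℝ) : ℝ) : ℂ) • pureVec N j f := by
  have h1 : inner ℂ u (α • u + f.1.1) = α := by
    rw [inner_add_right, f.2.2, inner_smul_right, inner_self_eq_norm_sq_to_K, hu]
    simp
  have h2 : Q μ u (α • u + f.1.1) = f.1.1 := by
    rw [Q_apply μ u hu, h1, add_sub_cancel_left]
  refine FockLE_ext fun j hj => ?_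
  rw [excitationMap_apply hj, excitationComponent_pwSym hu]
  change _ = component N j _
  rw [map_sum, Finset.sum_eq_single j]
  · rw [map_smul, map_smul, component_apply, pureVec, toSector_self hj, smul_smul, h1, mul_comm]
    congr 1
    exact Subtype.ext (congrArg (pw μ j) h2)
  · intro i _ hi
    rw [map_smul, map_smul, component_apply, pureVec, toSector_ne hi.symm, smul_zero, smul_zero]
  · intro h
    exact absurd (Finset.mem_range.2 (Nat.lt_succ_of_le hj)) h

theorem sqrt_choose_ne_zero {j : ℕ} (hj : j ≤ N) : ((√(N.choose j : ℝ) : ℝ) : ℂ) ≠ 0 :=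
  Complex.ofReal_ne_zero.2 (Real.sqrt_pos.2 (by exact_mod_cast Nat.choose_pos hj)).ne'

/-- The image of the `N`-th power of `α u + f` is a polynomial in `α` whose coefficients are
multiples of the pure vectors, so a subspace containing all these images contains the pure
vectors. -/
theorem pureVec_mem_of_forall (hu : ‖u‖ = 1) {f : ExcDom T u} {M : Submodule ℂ (FockLE μ u N)}
    (h : ∀ α : ℂ, excitationMap μ u N (pwSym μ N (α • u + f.1.1)) ∈ M) {j : ℕ} (hj : j ≤ N) :
    pureVec N j f ∈ M := by
  have h1 := coeff_mem_of_forall_sum_pow_smul_mem (n := N + 1) (M := M) (j := N - j)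
    (v := fun j => ((√(N.choose (N - j) : ℝ) : ℝ) : ℂ) • pureVec N (N - j) f)
    (fun α => by
      have h2 := h α
      rw [excitationMap_pwSym hu, ← Finset.sum_range_reflect] at h2
      convert h2 using 2 with i hi
      have hi' : i ≤ N := Nat.lt_succ_iff.1 (Finset.mem_range.1 hi)
      have h3 : N + 1 - 1 - i = N - i := by omega
      rw [h3, Nat.sub_sub_self hi']) (by omega)
  rw [Nat.sub_sub_self hj] at h1
  exact (Submodule.smul_mem_iff _ (sqrt_choose_ne_zero hj)).1 h1

/-- The excitation map is onto: `U U† - 1` vanishes on the images of pure powers, hence on the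
pure vectors, which span a dense subspace. -/
theorem excitationMap_comp_adjoint {W : X → X → ℝ} {C₀ t μ₀ : ℝ} (hS : IsSystem μ T W C₀)
    (hu : IsHartree T W u t μ₀) (Φ : FockLE μ u N) :
    excitationMap μ u N (ContinuousLinearMap.adjoint (excitationMap μ u N) Φ) = Φ := by
  let D := excitationMap μ u N ∘L ContinuousLinearMap.adjoint (excitationMap μ u N) -
    ContinuousLinearMap.id ℂ _
  have h0 : ∀ Ψ, D (excitationMap μ u N Ψ) = 0 := fun Ψ => by
    change excitationMap μ u N (ContinuousLinearMap.adjoint (excitationMap μ u N)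
      (excitationMap μ u N Ψ)) - excitationMap μ u N Ψ = 0
    rw [adjoint_excitationMap_comp hu.norm, sub_self]
  have h1 : (D.ker : Set (FockLE μ u N)) = Set.univ := by
    refine Set.eq_univ_of_univ_subset ?_
    rw [← (dense_core hS hu).closure_eq]
    refine closure_minimal ?_ (ContinuousLinearMap.isClosed_ker D)
    rintro _ ⟨a, rfl⟩
    rw [coreVec, combination_apply]
    refine Submodule.sum_mem _ fun j hj => ?_
    rw [Finsupp.linearCombination_apply]
    refine Submodule.sum_mem _ fun f _ => Submodule.smul_mem _ _ ?_
    exact pureVec_mem_of_forall hu.norm (fun α => h0 _) (Nat.lt_succ_iff.1 (Finset.mem_range.1 hj))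
  have h2 : Φ ∈ (D.ker : Set (FockLE μ u N)) := by rw [h1]; trivial
  exact sub_eq_zero.1 (show D Φ = 0 from h2)

end ExcitationMap

/-! ### The interaction energy of pure powers -/

section Interaction

open Filter Topology

variable {X : Type*} [MeasurableSpace X] {μ : Measure X} [SigmaFinite μ]

theorem measurePreserving_split (m : ℕ) : MeasurePreserving
    (fun x : Fin (m + 2) → X => ((fun i : Fin m => x i.castSucc.castSucc),
      (x (Fin.last m).castSucc, x (Fin.last (m + 1)))))
    (Measure.pi fun _ : Fin (m + 2) => μ)
    ((Measure.pi fun _ : Fin m => μ).prod (μ.prod μ)) := by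
  have h := measurePreserving_snoc_snoc μ m
  have hm : Measurable (fun x : Fin (m + 2) → X => ((fun i : Fin m => x i.castSucc.castSucc),
      (x (Fin.last m).castSucc, x (Fin.last (m + 1))))) := by fun_prop
  refine ⟨hm, ?_⟩
  rw [← h.map_eq, Measure.map_map hm h.measurable]
  convert Measure.map_id using 2
  funext p
  simp

variable (μ) in
/-- The identification of functions on `X^m × X²` with functions on `X^{m+2}`. -/
def joinPair (m : ℕ) : L2 ((Measure.pi fun _ : Fin m => μ).prod (μ.prod μ)) →ₗᵢ[ℂ] L2N μ (m + 2) :=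
  Lp.compMeasurePreservingₗᵢ ℂ _ (measurePreserving_split m)

theorem coeFn_joinPair (m : ℕ) (Φ : L2 ((Measure.pi fun _ : Fin m => μ).prod (μ.prod μ))) :
    joinPair μ m Φ =ᵐ[Measure.pi fun _ : Fin (m + 2) => μ] fun x =>
      Φ ((fun i : Fin m => x i.castSucc.castSucc),
        (x (Fin.last m).castSucc, x (Fin.last (m + 1)))) :=
  Lp.coeFn_compMeasurePreserving Φ (measurePreserving_split m)

theorem joinPair_pw (m : ℕ) (f : L2 μ) :
    joinPair μ m (prodMul _ _ (pw μ m f) (prodMul μ μ f f)) = pw μ (m + 2) f := by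
  have hq := (measurePreserving_split (μ := μ) m).quasiMeasurePreserving
  ext1
  filter_upwards [coeFn_joinPair m (prodMul _ _ (pw μ m f) (prodMul μ μ f f)),
    coeFn_pw μ (m + 2) f, hq.ae (coeFn_prodMul _ _ (pw μ m f) (prodMul μ μ f f)),
    hq.ae (Measure.quasiMeasurePreserving_fst.ae (coeFn_pw μ m f)),
    hq.ae (Measure.quasiMeasurePreserving_snd.ae (coeFn_prodMul μ μ f f))] with x h1 h2 h3 h4 h5
  rw [h1, h2, h3, h4, h5, Fin.prod_univ_castSucc, Fin.prod_univ_castSucc, mul_assoc]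

variable {W : X → X → ℝ}

variable (μ W) in
/-- The function `W(x_{m+1}, x_{m+2}) f(x_1) ⋯ f(x_{m+2})`. -/
def lastPair (m : ℕ) (f : L2 μ) : L2N μ (m + 2) :=
  joinPair μ m (prodMul _ _ (pw μ m f) (pairMul μ W f f))

theorem coeFn_lastPair (m : ℕ) {f : L2 μ} (hf : PairMem μ W f f) :
    lastPair μ W m f =ᵐ[Measure.pi fun _ : Fin (m + 2) => μ] fun x =>
      (W (x (Fin.last m).castSucc) (x (Fin.last (m + 1))) : ℂ) * ∏ i, f (x i) := by
  have hq := (measurePreserving_split (μ := μ) m).quasiMeasurePreserving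
  filter_upwards [coeFn_joinPair m (prodMul _ _ (pw μ m f) (pairMul μ W f f)),
    hq.ae (coeFn_prodMul _ _ (pw μ m f) (pairMul μ W f f)),
    hq.ae (Measure.quasiMeasurePreserving_fst.ae (coeFn_pw μ m f)),
    hq.ae (Measure.quasiMeasurePreserving_snd.ae hf.coeFn)] with x h1 h3 h4 h5
  rw [lastPair, h1, h3, h4, h5, Fin.prod_univ_castSucc, Fin.prod_univ_castSucc]
  ring

theorem inner_pw_lastPair (m : ℕ) (g f : L2 μ) : inner ℂ (pw μ (m + 2) g) (lastPair μ W m f) =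
    pairInner W g g f f * inner ℂ g f ^ m := by
  rw [← joinPair_pw, lastPair, LinearIsometry.inner_map_map, inner_prodMul, inner_pw, mul_comm]
  rfl

theorem exists_perm_pair {m : ℕ} (i j : Fin (m + 2)) (h : i ≠ j) :
    ∃ σ : Equiv.Perm (Fin (m + 2)), σ (Fin.last m).castSucc = i ∧ σ (Fin.last (m + 1)) = j := by
  let τ := Equiv.swap (Fin.last m).castSucc i
  have h0 : (Fin.last m).castSucc ≠ Fin.last (m + 1) := (Fin.castSucc_lt_last _).ne
  have h1 : τ (Fin.last m).castSucc = i := Equiv.swap_apply_left _ _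
  have h2 : i ≠ τ (Fin.last (m + 1)) := fun h3 => h0 (τ.injective (h1.trans h3))
  refine ⟨τ.trans (Equiv.swap (τ (Fin.last (m + 1))) j), ?_, ?_⟩
  · rw [Equiv.trans_apply, h1, Equiv.swap_apply_of_ne_of_ne h2 h]
  · rw [Equiv.trans_apply, Equiv.swap_apply_left]

/-- A permutation moving the last two of `m + 2` places to `i` and `j`. -/
def pairPerm {m : ℕ} (i j : Fin (m + 2)) : Equiv.Perm (Fin (m + 2)) :=
  open Classical in if h : i ≠ j then (exists_perm_pair i j h).choose else 1

theorem coeFn_permute (m : ℕ) (σ : Equiv.Perm (Fin m)) (Φ : L2N μ m) :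
    permute μ m σ Φ =ᵐ[Measure.pi fun _ : Fin m => μ] fun x => Φ fun i => x (σ i) :=
  Lp.coeFn_compMeasurePreserving Φ (measurePreserving_perm μ m σ)

theorem coeFn_permute_lastPair {m : ℕ} {i j : Fin (m + 2)} (h : i ≠ j) {f : L2 μ}
    (hf : PairMem μ W f f) : permute μ (m + 2) (pairPerm i j) (lastPair μ W m f)
      =ᵐ[Measure.pi fun _ : Fin (m + 2) => μ] fun x => (W (x i) (x j) : ℂ) * ∏ k, f (x k) := by
  have hs := (exists_perm_pair i j h).choose_spec
  have hp : pairPerm i j = (exists_perm_pair i j h).choose := dif_pos h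
  filter_upwards [coeFn_permute (m + 2) (pairPerm i j) (lastPair μ W m f),
    (measurePreserving_perm μ (m + 2) (pairPerm i j)).quasiMeasurePreserving.ae
      (coeFn_lastPair m hf)] with x h1 h2
  rw [h1, h2, hp, hs.1, hs.2]
  congr 1
  exact Equiv.prod_comp _ fun k => f (x k)

variable (μ) in
/-- Summation over all pairs of places, from the last two places. -/
def sumPairs (m : ℕ) : L2N μ (m + 2) →L[ℂ] L2N μ (m + 2) :=
  (1 / 2 : ℂ) • ∑ i, ∑ j ∈ Finset.univ.erase i, permute μ (m + 2) (pairPerm i j)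

theorem sumPairs_apply (m : ℕ) (Φ : L2N μ (m + 2)) : sumPairs μ m Φ =
    (1 / 2 : ℂ) • ∑ i, ∑ j ∈ Finset.univ.erase i, permute μ (m + 2) (pairPerm i j) Φ := by
  simp only [sumPairs, _root_.smul_apply, _root_.sum_apply]

theorem card_pairs (m : ℕ) {M : Type*} [AddCommMonoid M] (c : M) :
    ∑ i : Fin (m + 2), ∑ _j ∈ Finset.univ.erase i, c = ((m + 2) * (m + 1)) • c := by
  simp only [Finset.sum_const, Finset.card_erase_of_mem (Finset.mem_univ _), Finset.card_univ,
    Fintype.card_fin, smul_smul]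
  rfl

theorem inner_pw_sumPairs (m : ℕ) (g f : L2 μ) :
    inner ℂ (pw μ (m + 2) g) (sumPairs μ m (lastPair μ W m f)) =
      (m + 2) * (m + 1) / 2 * (pairInner W g g f f * inner ℂ g f ^ m) := by
  have h : ∀ σ, inner ℂ (pw μ (m + 2) g) (permute μ (m + 2) σ (lastPair μ W m f)) =
      pairInner W g g f f * inner ℂ g f ^ m := fun σ => by
    have h1 : permute μ (m + 2) σ (pw μ (m + 2) g) = pw μ (m + 2) g :=
      permute_tens μ σ fun _ => g
    rw [← inner_pw_lastPair]
    conv_lhs => rw [← h1]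
    exact inner_permute μ σ _ _
  rw [sumPairs_apply, inner_smul_right]
  simp only [inner_sum, h]
  rw [card_pairs, nsmul_eq_mul]
  push_cast
  ring

theorem norm_sumPairs_le (m : ℕ) (Φ : L2N μ (m + 2)) :
    ‖sumPairs μ m Φ‖ ≤ (m + 2) * (m + 1) / 2 * ‖Φ‖ := by
  have h : ∀ σ, ‖permute μ (m + 2) σ Φ‖ = ‖Φ‖ := fun σ =>
    (Lp.compMeasurePreservingₗᵢ ℂ _ (measurePreserving_perm μ (m + 2) σ)).norm_map Φ
  rw [sumPairs_apply, norm_smul]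
  have h1 : ‖∑ i, ∑ j ∈ Finset.univ.erase i, permute μ (m + 2) (pairPerm i j) Φ‖ ≤
      ∑ i : Fin (m + 2), ∑ _j ∈ Finset.univ.erase i, ‖Φ‖ :=
    (norm_sum_le _ _).trans (Finset.sum_le_sum fun i _ => (norm_sum_le _ _).trans
      (Finset.sum_le_sum fun j _ => (h _).le))
  rw [card_pairs, nsmul_eq_mul] at h1
  have h2 : ‖(1 / 2 : ℂ)‖ = 1 / 2 := by norm_num
  rw [h2]
  push_cast at h1
  linarith

/-- The interaction energy on a pure power. -/
theorem pw_mem_mulOp_graph (hW : ∀ x y, W x y = W y x) (m : ℕ) {f : L2 μ}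
    (hf : PairMem μ W f f) : (pw μ (m + 2) f, sumPairs μ m (lastPair μ W m f)) ∈
      (mulOp (Measure.pi fun _ : Fin (m + 2) => μ) fun x =>
        ∑ i, ∑ j ∈ Finset.Ioi i, W (x i) (x j)).graph := by
  rw [mem_mulOp_graph]
  have h1 : ∀ i : Fin (m + 2), ⇑(∑ j ∈ Finset.univ.erase i,
      permute μ (m + 2) (pairPerm i j) (lastPair μ W m f)) =ᵐ[Measure.pi fun _ : Fin (m + 2) => μ]
      fun x => ∑ j ∈ Finset.univ.erase i, (W (x i) (x j) : ℂ) * ∏ k, f (x k) := by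
    intro i
    have h2 : ∀ᵐ x ∂(Measure.pi fun _ : Fin (m + 2) => μ), ∀ j ∈ Finset.univ.erase i,
        permute μ (m + 2) (pairPerm i j) (lastPair μ W m f) x =
          (W (x i) (x j) : ℂ) * ∏ k, f (x k) :=
      (ae_ball_iff (Finset.univ.erase i).countable_toSet).2 fun j hj =>
        coeFn_permute_lastPair (Finset.ne_of_mem_erase hj).symm hf
    filter_upwards [Lp.coeFn_finsetSum (Finset.univ.erase i) fun j =>
      permute μ (m + 2) (pairPerm i j) (lastPair μ W m f), h2] with x h3 h4
    rw [h3, Finset.sum_apply]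
    exact Finset.sum_congr rfl h4
  rw [sumPairs_apply]
  filter_upwards [Lp.coeFn_smul (1 / 2 : ℂ) (∑ i, ∑ j ∈ Finset.univ.erase i,
      permute μ (m + 2) (pairPerm i j) (lastPair μ W m f)),
    Lp.coeFn_finsetSum Finset.univ fun i => ∑ j ∈ Finset.univ.erase i,
      permute μ (m + 2) (pairPerm i j) (lastPair μ W m f), ae_all_iff.2 h1,
    coeFn_pw μ (m + 2) f] with x h2 h3 h4 h5
  rw [h2, Pi.smul_apply, h3, Finset.sum_apply, h5, smul_eq_mul]
  simp only [h4, ← Finset.sum_mul]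
  rw [← mul_assoc]
  congr 1
  have h6 := congrArg (fun r : ℝ => (r : ℂ)) (two_mul_pairSum hW x)
  simp only [Complex.ofReal_mul, Complex.ofReal_sum, Complex.ofReal_ofNat,
    apply_ite Complex.ofReal, Complex.ofReal_zero] at h6
  have h7 : ∀ i : Fin (m + 2), ∑ j ∈ Finset.univ.erase i, (W (x i) (x j) : ℂ) =
      ∑ j, if i = j then 0 else (W (x i) (x j) : ℂ) := by
    intro i
    rw [← Finset.sum_erase_add _ _ (Finset.mem_univ i), if_pos rfl, add_zero]
    exact Finset.sum_congr rfl fun j hj => (if_neg (Finset.ne_of_mem_erase hj).symm).symm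
  simp only [h7]
  push_cast
  rw [← h6]
  ring

end Interaction

/-! ### The Hamiltonian of `N` particles -/

section Hamiltonian

open Filter Topology

section ClosedSum

variable {E F : Type*} [NormedAddCommGroup E] [InnerProductSpace ℂ E] [NormedAddCommGroup F]
  [InnerProductSpace ℂ F] {K V : E →ₗ.[ℂ] E} {C : Submodule ℂ E}

/-- If `K` is bounded relative to `K + V` on `C`, then `K + V` contains the closure of its
restriction to `C` as soon as `K` and `V` do. -/
theorem closure_coreGraph_add {c : ℝ}
    (hK : (coreGraph K C).topologicalClosure ≤ K.graph)
    (hV : (coreGraph V C).topologicalClosure ≤ V.graph)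
    [CompleteSpace E]
    (hb : ∀ x ∈ C, ∀ k v, (x, k) ∈ K.graph → (x, v) ∈ V.graph → ‖k‖ ≤ 2 * ‖k + v‖ + c * ‖x‖) :
    (coreGraph (K + V) C).topologicalClosure ≤ (K + V).graph := by
  rintro ⟨x, y⟩ hp
  obtain ⟨p, hp1, hp2⟩ := mem_closure_iff_seq_limit.1 hp
  have h1 : ∀ n, ∃ k v, ((p n).1, k) ∈ K.graph ∧ ((p n).1, v) ∈ V.graph ∧ k + v = (p n).2 :=
    fun n => exists_of_mem_add_graph (hp1 n).1
  choose k v hk hv hkv using h1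
  have hx : Tendsto (fun n => (p n).1) atTop (𝓝 x) := (continuous_fst.tendsto _).comp hp2
  have hy : Tendsto (fun n => (p n).2) atTop (𝓝 y) := (continuous_snd.tendsto _).comp hp2
  have hc : CauchySeq k := by
    rw [cauchySeq_iff_tendsto_dist_atTop_0]
    have h2 : Tendsto (fun q : ℕ × ℕ => 2 * dist (p q.1).2 (p q.2).2 +
        c * dist (p q.1).1 (p q.2).1) atTop (𝓝 (2 * 0 + c * 0)) :=
      ((cauchySeq_iff_tendsto_dist_atTop_0.1 hy.cauchySeq).const_mul 2).add
        ((cauchySeq_iff_tendsto_dist_atTop_0.1 hx.cauchySeq).const_mul c)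
    rw [mul_zero, mul_zero, add_zero] at h2
    refine squeeze_zero (fun _ => dist_nonneg) (fun q => ?_) h2
    have hk2 := K.graph.sub_mem (hk q.1) (hk q.2)
    have hv2 := V.graph.sub_mem (hv q.1) (hv q.2)
    have h3 := hb ((p q.1).1 - (p q.2).1) (C.sub_mem (hp1 q.1).2 (hp1 q.2).2) _ _ hk2 hv2
    rw [dist_eq_norm, dist_eq_norm, dist_eq_norm, ← hkv, ← hkv]
    refine h3.trans_eq ?_
    congr 3
    abel
  obtain ⟨k', hk'⟩ := cauchySeq_tendsto_of_complete hc
  have hv' : Tendsto v atTop (𝓝 (y - k')) := by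
    refine (hy.sub hk').congr fun n => ?_
    rw [← hkv n, add_sub_cancel_left]
  have h4 : (x, k') ∈ K.graph := hK (mem_closure_of_tendsto (hx.prodMk_nhds hk')
    (Eventually.of_forall fun n => ⟨hk n, (hp1 n).2⟩))
  have h5 : (x, y - k') ∈ V.graph := hV (mem_closure_of_tendsto (hx.prodMk_nhds hv')
    (Eventually.of_forall fun n => ⟨hv n, (hp1 n).2⟩))
  have h6 := add_mem_graph h4 h5
  rwa [add_sub_cancel] at h6

theorem closure_coreGraph_sandwich [CompleteSpace E] [CompleteSpace F] {B : E →L[ℂ] F}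
    (hB : ∀ y, B (ContinuousLinearMap.adjoint B y) = y)
    (hB' : ∀ x, ContinuousLinearMap.adjoint B (B x) = x) {D : Submodule ℂ F}
    (hD : ∀ y ∈ D, ContinuousLinearMap.adjoint B y ∈ C)
    (hK : (coreGraph K C).topologicalClosure ≤ K.graph) :
    (coreGraph (sandwich B K) D).topologicalClosure ≤ (sandwich B K).graph := by
  let L := (ContinuousLinearMap.adjoint B).prodMap (ContinuousLinearMap.adjoint B)
  have hmap : ∀ p ∈ coreGraph (sandwich B K) D, L p ∈ coreGraph K C := by
    rintro ⟨x, y⟩ ⟨h, hx⟩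
    obtain ⟨z, hz, rfl⟩ := mem_sandwich_graph.1 h
    refine ⟨?_, hD _ hx⟩
    change (ContinuousLinearMap.adjoint B x, ContinuousLinearMap.adjoint B (B z)) ∈ K.graph
    rwa [hB']
  rintro ⟨x, y⟩ hp
  have h1 : L (x, y) ∈ K.graph := hK (map_mem_closure L.continuous hp hmap)
  exact mem_sandwich_graph.2 ⟨_, h1, hB y⟩

theorem closure_coreGraph_smul {c : ℂ} (hc : c ≠ 0)
    (hV : (coreGraph V C).topologicalClosure ≤ V.graph) :
    (coreGraph (c • V) C).topologicalClosure ≤ (c • V).graph := by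
  let L : E × E →L[ℂ] E × E := (ContinuousLinearMap.fst ℂ E E).prod
    (c⁻¹ • ContinuousLinearMap.snd ℂ E E)
  have hmap : ∀ p ∈ coreGraph (c • V) C, L p ∈ coreGraph V C := by
    rintro ⟨x, y⟩ ⟨h, hx⟩
    obtain ⟨z, hz, rfl⟩ := exists_of_mem_smul_graph h
    refine ⟨?_, hx⟩
    change (x, c⁻¹ • c • z) ∈ V.graph
    rwa [inv_smul_smul₀ hc]
  rintro ⟨x, y⟩ hp
  have h1 : L (x, y) ∈ V.graph := hV (map_mem_closure L.continuous hp hmap)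
  have h2 : (x, c • c⁻¹ • y) ∈ (c • V).graph := smul_mem_graph c h1
  rwa [smul_inv_smul₀ hc] at h2

end ClosedSum

variable {X : Type*} [MeasurableSpace X] {μ : Measure X} [SigmaFinite μ]
  {W : X → X → ℝ} {T : L2 μ →ₗ.[ℂ] L2 μ} {C₀ : ℝ}

variable (T) in
/-- The span of the states of `N` particles in the same state of `D(T)`, which is the domain of
indices `ExcDom T 0`. -/
def symCore (N : ℕ) : Submodule ℂ (sym μ N) :=
  LinearMap.range (Finsupp.linearCombination ℂ fun f : ExcDom T 0 => pwSym μ N f.1.1)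

namespace IsSystem

variable (hS : IsSystem μ T W C₀)
include hS

theorem isFormalAdjoint_hamiltonian (N : ℕ) :
    (hamiltonian μ T W N).IsFormalAdjoint (hamiltonian μ T W N) :=
  isFormalAdjoint_add (isFormalAdjoint_compress _ (isFormalAdjoint_sumOp μ N hS.formal hS.dense))
    (isFormalAdjoint_smul (isFormalAdjoint_compress _ isFormalAdjoint_mulOp)
      (Complex.conj_ofReal _))

theorem lc_pwSym_mem_sumOp_graph (N : ℕ) (a : ExcDom T 0 →₀ ℂ) :
    ((Finsupp.linearCombination ℂ (fun f : ExcDom T 0 => pwSym μ N f.1.1) a : sym μ N),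
      Finsupp.linearCombination ℂ (fun f : ExcDom T 0 =>
        (⟨dpw μ N f.1.1 f.1.2, dpw_mem_sym μ N f.1.1 f.1.2⟩ : sym μ N)) a) ∈
      (sumOp μ T N).graph.comap ((sym μ N).subtype.prodMap (sym μ N).subtype) :=
  linearCombination_mem_graph
    (G := (sumOp μ T N).graph.comap ((sym μ N).subtype.prodMap (sym μ N).subtype))
    (x := fun f : ExcDom T 0 => pwSym μ N f.1.1)
    (y := fun f => ⟨dpw μ N f.1.1 f.1.2, dpw_mem_sym μ N f.1.1 f.1.2⟩)
    (fun f => pw_mem_sumOp_graph μ N hS.formal hS.dense f.2.1) a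

theorem closure_coreGraph_kinetic (N : ℕ) :
    (coreGraph (kinetic μ T N) (symCore T N)).topologicalClosure ≤ (kinetic μ T N).graph := by
  let G : Submodule ℂ (sym μ N × sym μ N) :=
    (sumOp μ T N).graph.comap ((sym μ N).subtype.prodMap (sym μ N).subtype)
  have hGc : IsClosed (G : Set (sym μ N × sym μ N)) :=
    (isClosed_sumOp_graph μ N hS.formal hS.dense).preimage
      ((sym μ N).subtypeL.prodMap (sym μ N).subtypeL).continuous
  have hGg : G ≤ (kinetic μ T N).graph := fun p hp => mem_compress_graph_of_mem hp
  refine (Submodule.topologicalClosure_minimal _ ?_ hGc).trans hGg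
  rintro ⟨x, y⟩ ⟨hxy, a, rfl⟩
  have h1 := hS.lc_pwSym_mem_sumOp_graph N a
  have h2 := hGg h1
  have hdm := LinearPMap.mem_domain_of_mem_graph h2
  rw [(apply_eq_of_mem_graph hxy hdm).symm.trans (apply_eq_of_mem_graph h2 hdm)]
  exact h1

theorem closure_coreGraph_interaction (N : ℕ) :
    (coreGraph (interaction μ W N) (symCore T N)).topologicalClosure ≤
      (interaction μ W N).graph := by
  refine Submodule.topologicalClosure_minimal _ inf_le_left ?_
  have h : ((interaction μ W N).graph : Set (sym μ N × sym μ N)) =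
      ((sym μ N).subtypeL.prodMap (sym μ N).subtypeL) ⁻¹'
        ((mulOp (Measure.pi fun _ : Fin N => μ) fun x =>
          ∑ i, ∑ j ∈ Finset.Ioi i, W (x i) (x j)).graph : Set (L2N μ N × L2N μ N)) := by
    ext ⟨x, y⟩
    exact (mem_interaction_graph μ hS.symm).trans mem_mulOp_graph.symm
  rw [h]
  exact isClosed_mulOp_graph.preimage ((sym μ N).subtypeL.prodMap (sym μ N).subtypeL).continuous

theorem pwSym_mem_interaction_graph (m : ℕ) {f : L2 μ} (hf : f ∈ T.domain) :
    ∃ y : sym μ (m + 2), (y : L2N μ (m + 2)) = sumPairs μ m (lastPair μ W m f) ∧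
      (pwSym μ (m + 2) f, y) ∈ (interaction μ W (m + 2)).graph := by
  have h := pw_mem_mulOp_graph hS.symm m (hS.pairMem hf hf)
  have h1 := mem_sym_of_mem_mulOp_graph μ hS.symm (pw_mem_sym μ (m + 2) f) h
  exact ⟨⟨_, h1⟩, rfl, mem_compress_graph_of_mem h⟩

/-- The matrix elements of the Hamiltonian between pure powers. -/
theorem exists_hamiltonian_pwSym (m : ℕ) {f f' : L2 μ} (h : (f, f') ∈ T.graph) :
    ∃ y : sym μ (m + 2), (pwSym μ (m + 2) f, y) ∈ (hamiltonian μ T W (m + 2)).graph ∧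
      ∀ g, inner ℂ (pwSym μ (m + 2) g) y = (m + 2) * (inner ℂ g f' * inner ℂ g f ^ (m + 1)) +
        (m + 2) / 2 * (pairInner W g g f f * inner ℂ g f ^ m) := by
  obtain ⟨y, hy, hy'⟩ := hS.pwSym_mem_interaction_graph m (T.mem_domain_of_mem_graph h)
  refine ⟨_, add_mem_graph (pw_mem_kinetic_graph μ hS.sa (m + 2) h)
    (smul_mem_graph (((1 / (((m + 2 : ℕ) : ℝ) - 1) : ℝ)) : ℂ) hy'), fun g => ?_⟩
  rw [inner_add_right, inner_smul_right]
  have h1 : inner ℂ (pwSym μ (m + 2) g) (⟨dpw μ (m + 2) f f', dpw_mem_sym μ (m + 2) f f'⟩ :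
      sym μ (m + 2)) = _ := inner_pw_dpw μ (m + 2) g f f'
  have h2 : inner ℂ (pwSym μ (m + 2) g) y = _ :=
    (congrArg (inner ℂ (pw μ (m + 2) g)) hy).trans (inner_pw_sumPairs m g f)
  rw [h1, h2, show m + 2 - 1 = m + 1 by omega]
  have h3 : ((m : ℂ) + 1) ≠ 0 := by exact_mod_cast Nat.succ_ne_zero m
  push_cast
  rw [show (m : ℂ) + 2 - 1 = m + 1 by ring]
  field_simp

theorem symCore_le_hamiltonian (m : ℕ) : symCore T (m + 2) ≤ (hamiltonian μ T W (m + 2)).domain := by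
  rintro _ ⟨a, rfl⟩
  rw [Finsupp.linearCombination_apply]
  refine Submodule.sum_mem _ fun f _ => Submodule.smul_mem _ _ ?_
  obtain ⟨y, hy, -⟩ := hS.exists_hamiltonian_pwSym m f.2.1
  exact (hamiltonian μ T W (m + 2)).mem_domain_of_mem_graph hy

/-- The interaction is bounded relative to the square root of the kinetic energy. -/
theorem norm_interaction_sq_le_kinetic (m : ℕ) (a : ExcDom T 0 →₀ ℂ) {k v : sym μ (m + 2)}
    (hk : (Finsupp.linearCombination ℂ (fun f : ExcDom T 0 => pwSym μ (m + 2) f.1.1) a, k) ∈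
      (kinetic μ T (m + 2)).graph)
    (hv : (Finsupp.linearCombination ℂ (fun f : ExcDom T 0 => pwSym μ (m + 2) f.1.1) a, v) ∈
      (interaction μ W (m + 2)).graph) :
    ‖v‖ ^ 2 ≤ ((m + 2) * (m + 1) / 2) ^ 2 * (2 * C₀) * (inner ℂ (Finsupp.linearCombination ℂ
      (fun f : ExcDom T 0 => pwSym μ (m + 2) f.1.1) a) k).re := by
  have h1 : (v : L2N μ (m + 2)) = sumPairs μ m (joinPair μ m
      (lcProd m (fun f : ExcDom T 0 => pairMul μ W f.1.1 f.1.1) a)) := by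
    choose y hy hy' using fun f : ExcDom T 0 =>
      hS.pwSym_mem_interaction_graph m (hS.excDom_mem f)
    have h2 := linearCombination_mem_graph hy' a
    have hdm := LinearPMap.mem_domain_of_mem_graph h2
    rw [(apply_eq_of_mem_graph hv hdm).symm.trans (apply_eq_of_mem_graph h2 hdm)]
    have h3 := Finsupp.apply_linearCombination ℂ (sym μ (m + 2)).subtype y a
    refine h3.trans ?_
    have h4 := Finsupp.apply_linearCombination ℂ ((sumPairs μ m).toLinearMap ∘ₗ
      (joinPair μ m).toLinearMap) (fun f : ExcDom T 0 => prodMul _ _ (pw μ m f.1.1)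
        (pairMul μ W f.1.1 f.1.1)) a
    refine Eq.trans ?_ h4.symm
    congr 2
    exact funext hy
  have h2 : (inner ℂ (Finsupp.linearCombination ℂ
      (fun f : ExcDom T 0 => pwSym μ (m + 2) f.1.1) a) k).re = (m + 2) * kinForm T 0 (m + 1) a := by
    have h3 := mem_compress_graph_of_mem (hS.lc_pwSym_mem_sumOp_graph (m + 2) a)
    have hdm := LinearPMap.mem_domain_of_mem_graph h3
    rw [(apply_eq_of_mem_graph hk hdm).symm.trans (apply_eq_of_mem_graph h3 hdm)]
    refine (congrArg Complex.re (inner_linearCombination _ _ a a)).trans ?_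
    rw [kinForm, show ((m : ℝ) + 2) = ((m + 2 : ℕ) : ℝ) by push_cast; ring, ← qform_const_mul]
    change (form _ a a).re = (form _ a a).re
    congr 2
    funext g f
    refine (inner_pw_dpw μ (m + 2) g.1.1 f.1.1 f.1.2).trans ?_
    rw [show m + 2 - 1 = m + 1 by omega]
    push_cast
    ring
  have h3 : ‖v‖ ≤ (m + 2) * (m + 1) / 2 *
      ‖lcProd m (fun f : ExcDom T 0 => pairMul μ W f.1.1 f.1.1) a‖ := by
    rw [← (joinPair μ m).norm_map]
    refine le_trans (le_of_eq ?_) (norm_sumPairs_le m _)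
    rw [← h1]
    rfl
  have h4 := hS.norm_lcProd_pairMul_sq_le m a
  have h5 := pow_le_pow_left₀ (norm_nonneg _) h3 2
  rw [mul_pow] at h5
  have h6 := hS.kinForm_nonneg (m + 1) a
  have h7 : kinForm T 0 (m + 1) a ≤ (m + 2) * kinForm T 0 (m + 1) a :=
    le_mul_of_one_le_left h6 (by linarith [(Nat.cast_nonneg m : (0 : ℝ) ≤ m)])
  rw [h2]
  refine h5.trans ?_
  rw [mul_assoc]
  refine mul_le_mul_of_nonneg_left (h4.trans ?_) (sq_nonneg _)
  exact mul_le_mul_of_nonneg_left h7 (by linarith [hS.pos])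

/-- Convergence in the graph norm of `H_N` along the core implies that of the kinetic and of the
interaction energy separately, since the latter is small relative to the former. -/
theorem closure_coreGraph_hamiltonian (m : ℕ) :
    (coreGraph (hamiltonian μ T W (m + 2)) (symCore T (m + 2))).topologicalClosure ≤
      (hamiltonian μ T W (m + 2)).graph := by
  set l : ℝ := 1 / (((m + 2 : ℕ) : ℝ) - 1) with hl
  have hl0 : 0 < l := by
    rw [hl]
    push_cast
    refine one_div_pos.2 ?_
    linarith [(Nat.cast_nonneg m : (0 : ℝ) ≤ m)]
  set c : ℝ := l ^ 2 * (((m + 2) * (m + 1) / 2) ^ 2 * (2 * C₀)) with hc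
  have hc0 : 0 ≤ c := by
    have := hS.pos
    positivity
  refine closure_coreGraph_add (c := 2 * c) (hS.closure_coreGraph_kinetic _)
    (closure_coreGraph_smul (Complex.ofReal_ne_zero.2 hl0.ne')
      (hS.closure_coreGraph_interaction _)) ?_
  rintro _ ⟨a, rfl⟩ k v hk hv
  obtain ⟨v, hv', rfl⟩ := exists_of_mem_smul_graph hv
  rw [← hl]
  have h1 := hS.norm_interaction_sq_le_kinetic m a hk hv'
  set x := Finsupp.linearCombination ℂ (fun f : ExcDom T 0 => pwSym μ (m + 2) f.1.1) a
  have h2 : (inner ℂ x k).re ≤ ‖x‖ * ‖k‖ := (Complex.re_le_norm _).trans (norm_inner_le_norm _ _)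
  have h3 : ‖(l : ℂ) • v‖ ^ 2 ≤ c * (‖x‖ * ‖k‖) := by
    rw [norm_smul, mul_pow, Complex.norm_real, Real.norm_eq_abs, sq_abs, hc, mul_assoc (l ^ 2)]
    refine mul_le_mul_of_nonneg_left (h1.trans (mul_le_mul_of_nonneg_left h2 ?_)) (sq_nonneg _)
    have := hS.pos
    positivity
  have h4 : ‖(l : ℂ) • v‖ ≤ 1 / 2 * ‖k‖ + c * ‖x‖ := by
    refine le_of_sq_le_sq ?_ (by positivity)
    nlinarith [sq_nonneg (1 / 2 * ‖k‖ - c * ‖x‖), sq_nonneg (1 / 2 * ‖k‖), sq_nonneg (c * ‖x‖)]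
  have h5 : ‖k‖ ≤ ‖k + (l : ℂ) • v‖ + ‖(l : ℂ) • v‖ := by
    simpa using norm_sub_le (k + (l : ℂ) • v) ((l : ℂ) • v)
  linarith

end IsSystem

end Hamiltonian

/-! ### Expansion in the condensate amplitudes -/

section PolynomialExpansion

open Filter Topology

/-- The coefficient of `x^(N-i) y^(N-j)` in `x^r y^s (x y + p)^(N-d)`, for `i + r = j + s`. -/
def binomCoeff (N d r i : ℕ) (p : ℂ) : ℂ :=
  if d ≤ i + r then ((N - d).choose (i + r - d) : ℂ) * p ^ (i + r - d) else 0

theorem expand_pow {N d r s : ℕ} (hd : d ≤ N) (hr : r ≤ d) (hs : s ≤ d) (x y p : ℂ) :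
    x ^ r * y ^ s * (x * y + p) ^ (N - d) = ∑ i ∈ Finset.range (N + 1), ∑ j ∈ Finset.range (N + 1),
      x ^ (N - i) * y ^ (N - j) * if i + r = j + s then binomCoeff N d r i p else 0 := by
  have h1 : ∀ i ∈ Finset.range (N + 1), (∑ j ∈ Finset.range (N + 1), x ^ (N - i) * y ^ (N - j) *
      if i + r = j + s then binomCoeff N d r i p else 0) =
      if d ≤ i + r ∧ i + r ≤ N then x ^ r * y ^ s * ((x * y) ^ (N - (i + r)) * p ^ (i + r - d) *
        ((N - d).choose (i + r - d) : ℂ)) else 0 := by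
    intro i hi
    rw [Finset.mem_range] at hi
    by_cases hdi : d ≤ i + r
    · have h2 : i + r - s ∈ Finset.range (N + 1) ∨ N < i + r - s := by
        rw [Finset.mem_range]; omega
      rw [binomCoeff, if_pos hdi]
      by_cases hiN : i + r ≤ N
      · rw [if_pos ⟨hdi, hiN⟩, Finset.sum_eq_single (i + r - s), if_pos (by omega), mul_pow]
        · have e1 : N - i = r + (N - (i + r)) := by omega
          have e2 : N - (i + r - s) = s + (N - (i + r)) := by omega
          rw [e1, e2, pow_add, pow_add]
          ring
        · intro j _ hj
          rw [if_neg (by omega), mul_zero]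
        · intro h
          rw [Finset.mem_range] at h
          omega
      · rw [if_neg (fun h => hiN h.2)]
        refine Finset.sum_eq_zero fun j hj => ?_
        rw [Nat.choose_eq_zero_of_lt (by omega)]
        simp
    · rw [if_neg (fun h => hdi h.1)]
      refine Finset.sum_eq_zero fun j hj => ?_
      rw [binomCoeff, if_neg hdi]
      simp
  rw [Finset.sum_congr rfl h1, ← Finset.sum_filter, add_comm (x * y), add_pow, Finset.mul_sum]
  refine Finset.sum_bij' (fun k _ => k + d - r) (fun i _ => i + r - d) ?_ ?_ ?_ ?_ ?_
  · intro k hk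
    rw [Finset.mem_range] at hk
    rw [Finset.mem_filter, Finset.mem_range]
    omega
  · intro i hi
    rw [Finset.mem_filter, Finset.mem_range] at hi
    rw [Finset.mem_range]
    omega
  · intro k hk
    omega
  · intro i hi
    rw [Finset.mem_filter, Finset.mem_range] at hi
    omega
  · intro k hk
    rw [Finset.mem_range] at hk
    have e1 : k + d - r + r - d = k := by omega
    have e2 : N - (k + d - r + r) = N - d - k := by omega
    rw [e1, e2]
    ring

theorem eq_zero_of_sum_pow_eq_zero {N : ℕ} {v : ℕ → ℂ}
    (h : ∀ α : ℂ, ∑ j ∈ Finset.range (N + 1), α ^ (N - j) * v j = 0) {j : ℕ} (hj : j ≤ N) :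
    v j = 0 := by
  have h1 := coeff_mem_of_forall_sum_pow_smul_mem (n := N + 1) (M := (⊥ : Submodule ℂ ℂ))
    (v := fun j => v (N - j)) (j := N - j) (fun α => by
      have h2 := h α
      rw [← Finset.sum_range_reflect] at h2
      rw [Submodule.mem_bot, ← h2]
      refine Finset.sum_congr rfl fun i hi => ?_
      have hi' : i ≤ N := Nat.lt_succ_iff.1 (Finset.mem_range.1 hi)
      have h3 : N + 1 - 1 - i = N - i := by omega
      rw [h3, Nat.sub_sub_self hi', smul_eq_mul]) (by omega)
  rwa [Submodule.mem_bot, Nat.sub_sub_self hj] at h1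

theorem eq_of_sum_sum_pow_eq {N : ℕ} {A B : ℕ → ℕ → ℂ}
    (h : ∀ x y : ℂ, ∑ i ∈ Finset.range (N + 1), ∑ j ∈ Finset.range (N + 1),
        x ^ (N - i) * y ^ (N - j) * A i j = ∑ i ∈ Finset.range (N + 1),
          ∑ j ∈ Finset.range (N + 1), x ^ (N - i) * y ^ (N - j) * B i j)
    {i j : ℕ} (hi : i ≤ N) (hj : j ≤ N) : A i j = B i j := by
  refine sub_eq_zero.1 (eq_zero_of_sum_pow_eq_zero (v := fun j => A i j - B i j) (fun y => ?_) hj)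
  refine eq_zero_of_sum_pow_eq_zero
    (v := fun i => ∑ j ∈ Finset.range (N + 1), y ^ (N - j) * (A i j - B i j)) (fun x => ?_) hi
  rw [← sub_eq_zero.2 (h x y), ← Finset.sum_sub_distrib]
  refine Finset.sum_congr rfl fun i _ => ?_
  rw [← Finset.sum_sub_distrib, Finset.mul_sum]
  refine Finset.sum_congr rfl fun j _ => ?_
  ring

/-! ### Quotients of binomial coefficients -/

variable {m i : ℕ} (p : ℂ)

theorem choose_succ_cast (n k : ℕ) :
    ((k : ℂ) + 1) * ((n + 1).choose (k + 1) : ℂ) = (n + 1) * (n.choose k : ℂ) := by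
  have := Nat.add_one_mul_choose_eq n k
  have h2 := congrArg (fun n : ℕ => (n : ℂ)) this
  push_cast at h2
  linear_combination -h2

theorem sub_mul_choose_cast (n k : ℕ) :
    ((n : ℂ) + 1 - k) * ((n + 1).choose k : ℂ) = (n + 1) * (n.choose k : ℂ) := by
  cases k with
  | zero => simp
  | succ k =>
    have h1 := choose_succ_cast n k
    have h2 : ((n + 1).choose (k + 1) : ℂ) = n.choose k + n.choose (k + 1) := by
      exact_mod_cast Nat.choose_succ_succ n k
    push_cast
    linear_combination ((n : ℂ) + 1) * h2 - h1

theorem binomCoeff_one_one : ((m : ℂ) + 2) * binomCoeff (m + 2) 1 1 i p =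
    (m + 2 - i) * ((m + 2).choose i : ℂ) * p ^ i := by
  have h := sub_mul_choose_cast (m + 1) i
  push_cast at h
  rw [binomCoeff, if_pos (by omega), show i + 1 - 1 = i by omega, show m + 2 - 1 = m + 1 by omega]
  linear_combination (-p ^ i) * h

theorem binomCoeff_one_zero : ((m : ℂ) + 2) * binomCoeff (m + 2) 1 0 i p =
    i * ((m + 2).choose i : ℂ) * p ^ (i - 1) := by
  cases i with
  | zero => simp [binomCoeff]
  | succ k =>
    have h := choose_succ_cast (m + 1) k
    push_cast at h
    rw [binomCoeff, if_pos (by omega), show k + 1 + 0 - 1 = k by omega,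
      show m + 2 - 1 = m + 1 by omega]
    push_cast
    linear_combination (-p ^ k) * h

theorem binomCoeff_two_two : ((m : ℂ) + 2) * (m + 1) * binomCoeff (m + 2) 2 2 i p =
    (m + 2 - i) * (m + 1 - i) * ((m + 2).choose i : ℂ) * p ^ i := by
  have h := sub_mul_choose_cast (m + 1) i
  have h' := sub_mul_choose_cast m i
  push_cast at h
  rw [binomCoeff, if_pos (by omega), show i + 2 - 2 = i by omega, show m + 2 - 2 = m by omega]
  linear_combination (-p ^ i * (m + 1 - i)) * h - p ^ i * (m + 2) * h'

theorem binomCoeff_two_one : ((m : ℂ) + 2) * (m + 1) * binomCoeff (m + 2) 2 1 i p =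
    i * (m + 2 - i) * ((m + 2).choose i : ℂ) * p ^ (i - 1) := by
  cases i with
  | zero => simp [binomCoeff]
  | succ k =>
    have h := choose_succ_cast (m + 1) k
    have h' := sub_mul_choose_cast m k
    push_cast at h
    rw [binomCoeff, if_pos (by omega), show k + 1 + 1 - 2 = k by omega,
      show m + 2 - 2 = m by omega, show k + 1 - 1 = k by omega]
    push_cast
    linear_combination (-p ^ k * (m + 1 - k)) * h - p ^ k * (m + 2) * h'

theorem binomCoeff_two_zero : ((m : ℂ) + 2) * (m + 1) * binomCoeff (m + 2) 2 0 i p =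
    i * (i - 1) * ((m + 2).choose i : ℂ) * p ^ (i - 2) := by
  match i with
  | 0 => simp [binomCoeff]
  | 1 => simp [binomCoeff]
  | k + 2 =>
    have h := choose_succ_cast (m + 1) (k + 1)
    have h' := choose_succ_cast m k
    push_cast at h
    rw [binomCoeff, if_pos (by omega), show k + 2 + 0 - 2 = k by omega,
      show m + 2 - 2 = m by omega]
    push_cast
    linear_combination (-p ^ k * (k + 1)) * h - p ^ k * (m + 2) * h'

theorem sqrt_choose_mul_self (N j : ℕ) :
    ((√(N.choose j : ℝ) : ℝ) : ℂ) * ((√(N.choose j : ℝ) : ℝ) : ℂ) = (N.choose j : ℂ) := by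
  rw [← Complex.ofReal_mul, Real.mul_self_sqrt (Nat.cast_nonneg _), Complex.ofReal_natCast]

theorem succ_mul_choose_succ_cast (N j : ℕ) :
    ((j : ℂ) + 1) * (N.choose (j + 1) : ℂ) = (N - j) * (N.choose j : ℂ) := by
  cases N with
  | zero => cases j <;> simp
  | succ n =>
    have h1 := choose_succ_cast n j
    have h2 := sub_mul_choose_cast n j
    push_cast
    linear_combination h1 - h2

theorem sqrt_choose_succ_mul (N j : ℕ) :
    ((√(N.choose (j + 1) : ℝ) : ℝ) : ℂ) * ((√(N.choose j : ℝ) : ℝ) : ℂ) *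
      ((√((j + 1) * (N - j) : ℝ) : ℝ) : ℂ) = (j + 1) * (N.choose (j + 1) : ℂ) := by
  have h0 : ((j : ℝ) + 1) * (N.choose (j + 1) : ℝ) = (N - j) * (N.choose j : ℝ) := by
    have := succ_mul_choose_succ_cast N j
    apply Complex.ofReal_injective
    push_cast
    exact this
  have h1 : √(N.choose (j + 1) : ℝ) * √(N.choose j : ℝ) * √((j + 1) * (N - j) : ℝ) =
      (j + 1) * (N.choose (j + 1) : ℝ) := by
    rw [← Real.sqrt_mul (Nat.cast_nonneg _), ← Real.sqrt_mul (by positivity)]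
    rw [show (N.choose (j + 1) : ℝ) * (N.choose j : ℝ) * (((j : ℝ) + 1) * (N - j)) =
      (((j : ℝ) + 1) * (N.choose (j + 1) : ℝ)) ^ 2 by
        linear_combination (-((j : ℝ) + 1) * N.choose (j + 1)) * h0]
    exact Real.sqrt_sq (by positivity)
  rw [← Complex.ofReal_mul, ← Complex.ofReal_mul, h1]
  push_cast
  ring

theorem sqrt_choose_add_two_mul (N j : ℕ) :
    ((√(N.choose (j + 2) : ℝ) : ℝ) : ℂ) * ((√(N.choose j : ℝ) : ℝ) : ℂ) *
      (((√((j + 1) * (j + 2) : ℝ) : ℝ) : ℂ) * ((√((N - j) * (N - j - 1) : ℝ) : ℝ) : ℂ)) =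
      (j + 1) * (j + 2) * (N.choose (j + 2) : ℂ) := by
  have h0 : ((j : ℝ) + 1) * (j + 2) * (N.choose (j + 2) : ℝ) =
      (N - j) * (N - j - 1) * (N.choose j : ℝ) := by
    have h1 := succ_mul_choose_succ_cast N j
    have h2 := succ_mul_choose_succ_cast N (j + 1)
    apply Complex.ofReal_injective
    push_cast at h2 ⊢
    rw [show (j : ℂ) + 1 + 1 = j + 2 by ring] at h2
    rw [show j + 1 + 1 = j + 2 by ring] at h2
    linear_combination ((j : ℂ) + 1) * h2 + ((N : ℂ) - j - 1) * h1
  have h1 : √(N.choose (j + 2) : ℝ) * √(N.choose j : ℝ) * (√((j + 1) * (j + 2) : ℝ) *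
      √((N - j) * (N - j - 1) : ℝ)) = (j + 1) * (j + 2) * (N.choose (j + 2) : ℝ) := by
    rw [← Real.sqrt_mul (Nat.cast_nonneg _), ← Real.sqrt_mul (by positivity),
      ← Real.sqrt_mul (by positivity)]
    rw [show (N.choose (j + 2) : ℝ) * (N.choose j : ℝ) * (((j : ℝ) + 1) * (j + 2) *
      ((N - j) * (N - j - 1))) = (((j : ℝ) + 1) * (j + 2) * (N.choose (j + 2) : ℝ)) ^ 2 by
        linear_combination (-((j : ℝ) + 1) * (j + 2) * N.choose (j + 2)) * h0]
    exact Real.sqrt_sq (by positivity)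
  rw [← Complex.ofReal_mul, ← Complex.ofReal_mul, ← Complex.ofReal_mul, h1]
  push_cast
  ring

end PolynomialExpansion

/-! ### The matrix of the excitation Hamiltonian -/

section ExcitationHamiltonian

open Filter Topology

theorem inner_smul_smul_smul_smul {E : Type*} [NormedAddCommGroup E] [InnerProductSpace ℂ E]
    (a b c d : ℂ) (x y : E) :
    inner ℂ (a • b • x) (c • d • y) = conj a * conj b * c * d * inner ℂ x y := by
  simp only [inner_smul_left, inner_smul_right]
  ring

variable {X : Type*} [MeasurableSpace X] {μ : Measure X} [SigmaFinite μ]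
  {W : X → X → ℝ} {T : L2 μ →ₗ.[ℂ] L2 μ} {C₀ t μ₀ : ℝ} {u : L2 μ} {m N : ℕ}

namespace IsSystem

variable (hS : IsSystem μ T W C₀)
include hS

theorem pairInner_comb_fst {u f g : L2 μ} (hu : u ∈ T.domain) (hf : f ∈ T.domain)
    (hg : g ∈ T.domain) (a b : L2 μ) (y : ℂ) : pairInner W a b (y • u + f) g =
      y * pairInner W a b u g + pairInner W a b f g := by
  have h1 := (hS.pairMem hu hg).smul_left y
  rw [pairInner, (h1.1.add_left (hS.pairMem hf hg)).2, h1.2, inner_add_right, inner_smul_right]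
  rfl

theorem pairInner_comb_snd {u f g : L2 μ} (hu : u ∈ T.domain) (hf : f ∈ T.domain)
    (hg : g ∈ T.domain) (a b : L2 μ) (y : ℂ) : pairInner W a b g (y • u + f) =
      y * pairInner W a b g u + pairInner W a b g f := by
  have h1 := (hS.pairMem hg hu).smul_right y
  rw [pairInner, (h1.1.add_right (hS.pairMem hg hf)).2, h1.2, inner_add_right, inner_smul_right]
  rfl

theorem pairInner_comb_both {u f : L2 μ} (hu : u ∈ T.domain) (hf : f ∈ T.domain)
    (a b : L2 μ) (y : ℂ) : pairInner W a b (y • u + f) (y • u + f) =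
      y ^ 2 * pairInner W a b u u + y * (pairInner W a b u f + pairInner W a b f u) +
        pairInner W a b f f := by
  rw [hS.pairInner_comb_fst hu hf (T.domain.add_mem (T.domain.smul_mem y hu) hf),
    hS.pairInner_comb_snd hu hf hu, hS.pairInner_comb_snd hu hf hf]
  ring

theorem pairInner_comb_left {u g a b : L2 μ} (hu : u ∈ T.domain) (hg : g ∈ T.domain)
    (ha : a ∈ T.domain) (hb : b ∈ T.domain) (x : ℂ) :
    pairInner W (x • u + g) (x • u + g) a b = conj x ^ 2 * pairInner W u u a b +
      conj x * (pairInner W u g a b + pairInner W g u a b) + pairInner W g g a b := by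
  have h := T.domain.add_mem (T.domain.smul_mem x hu) hg
  rw [← hS.conj_pairInner ha hb h h, hS.pairInner_comb_both hu hg]
  simp only [map_add, map_mul, map_pow, hS.conj_pairInner ha hb hu hu,
    hS.conj_pairInner ha hb hu hg, hS.conj_pairInner ha hb hg hu, hS.conj_pairInner ha hb hg hg]

/-- The interaction energy of the pairs `ψ' ⊗ ψ'` and `ψ ⊗ ψ`, for `ψ' = x u + g` and
`ψ = y u + f`. -/
theorem pairInner_expand {u f g : L2 μ} (hu : u ∈ T.domain) (hf : f ∈ T.domain)
    (hg : g ∈ T.domain) (x y : ℂ) :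
    pairInner W (x • u + g) (x • u + g) (y • u + f) (y • u + f) =
      conj x ^ 2 * y ^ 2 * pairInner W u u u u + 2 * (conj x ^ 2 * y ^ 1) * pairInner W u u f u +
      2 * (conj x ^ 1 * y ^ 2) * pairInner W g u u u + conj x ^ 2 * y ^ 0 * pairInner W u u f f +
      conj x ^ 0 * y ^ 2 * pairInner W g g u u +
      2 * (conj x ^ 1 * y ^ 1) * (pairInner W g u f u + pairInner W g u u f) +
      2 * (conj x ^ 1 * y ^ 0) * pairInner W u g f f +
      2 * (conj x ^ 0 * y ^ 1) * pairInner W g g u f +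
      conj x ^ 0 * y ^ 0 * pairInner W g g f f := by
  have h := T.domain.add_mem (T.domain.smul_mem y hu) hf
  rw [hS.pairInner_comb_left hu hg h h]
  simp only [hS.pairInner_comb_both hu hf]
  rw [hS.pairInner_swap (a := u) (b := u) hu hf, hS.pairInner_swap (a := u) (b := g) hu hu,
    hS.pairInner_swap (a := u) (b := g) hu hf, hS.pairInner_swap (a := u) (b := g) hf hu,
    hS.pairInner_swap (a := g) (b := g) hf hu, hS.pairInner_swap (a := g) (b := u) hf hf]
  ring

variable (hu : IsHartree T W u t μ₀)
include hu

theorem adjoint_excitationMap_mem_symCore {y : FockLE μ u N} (hy : y ∈ core T u N) :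
    ContinuousLinearMap.adjoint (excitationMap μ u N) y ∈ symCore T N := by
  obtain ⟨a, rfl⟩ := hy
  change coreVec T u N a ∈ (symCore T N).comap
    (ContinuousLinearMap.adjoint (excitationMap μ u N)).toLinearMap
  rw [coreVec, combination_apply]
  refine Submodule.sum_mem _ fun j hj => ?_
  rw [Finsupp.linearCombination_apply]
  refine Submodule.sum_mem _ fun f _ => Submodule.smul_mem _ _ ?_
  refine pureVec_mem_of_forall hu.norm (fun α => ?_) (Nat.lt_succ_iff.1 (Finset.mem_range.1 hj))
  change ContinuousLinearMap.adjoint (excitationMap μ u N) _ ∈ symCore T N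
  rw [adjoint_excitationMap_comp hu.norm]
  have h1 := T.graph.add_mem (T.graph.smul_mem α (hS.apply_u hu)) f.2.1
  refine ⟨Finsupp.single ⟨_, h1, inner_zero_left _⟩ 1, ?_⟩
  rw [Finsupp.linearCombination_single, one_smul]
  rfl

theorem core_le_excitationHamiltonian :
    core T u (m + 2) ≤ (excitationHamiltonian μ W u T (m + 2)).domain := fun _ hy =>
  hS.symCore_le_hamiltonian m (hS.adjoint_excitationMap_mem_symCore hu hy)

theorem isFormalAdjoint_excitationHamiltonian :
    (excitationHamiltonian μ W u T N).IsFormalAdjoint (excitationHamiltonian μ W u T N) :=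
  isFormalAdjoint_sandwich _ (hS.isFormalAdjoint_hamiltonian N)

theorem closure_coreGraph_excitationHamiltonian :
    (coreGraph (excitationHamiltonian μ W u T (m + 2)) (core T u (m + 2))).topologicalClosure ≤
      (excitationHamiltonian μ W u T (m + 2)).graph :=
  closure_coreGraph_sandwich (excitationMap_comp_adjoint hS hu)
    (adjoint_excitationMap_comp hu.norm) (fun _ hy => hS.adjoint_excitationMap_mem_symCore hu hy)
    (hS.closure_coreGraph_hamiltonian m)

theorem inner_u_snd (f : ExcDom T u) : inner ℂ u f.1.2 = -pairInner W u u f.1.1 u := by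
  have h1 := inner_eq_of_mem_graph hS.formal (hS.apply_u hu) f.2.1
  have hu' := hS.mem_domain hu
  rw [← h1, inner_sub_left, inner_smul_left, f.2.2, mul_zero, zero_sub, ← inner_conj_symm,
    inner_meanOp, hS.conj_pairInner (hS.excDom_mem f) hu' hu' hu']

/-- The matrix elements of the Hamiltonian between the pure powers of `x u + g` and `y u + f`. -/
theorem exists_hamiltonian_expand (f : ExcDom T u) (y : ℂ) : ∃ h : sym μ (m + 2),
    (pwSym μ (m + 2) (y • u + f.1.1), h) ∈ (hamiltonian μ T W (m + 2)).graph ∧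
      ∀ (g : ExcDom T u) (x : ℂ), inner ℂ (pwSym μ (m + 2) (x • u + g.1.1)) h =
        (m + 2) * ((conj x ^ 1 * y ^ 1 * t - conj x ^ 1 * y ^ 0 * pairInner W u u f.1.1 u -
          conj x ^ 0 * y ^ 1 * pairInner W g.1.1 u u u +
          conj x ^ 0 * y ^ 0 * inner ℂ g.1.1 f.1.2) *
            (conj x * y + inner ℂ g.1.1 f.1.1) ^ (m + 2 - 1)) +
        (m + 2) / 2 * (pairInner W (x • u + g.1.1) (x • u + g.1.1) (y • u + f.1.1)
          (y • u + f.1.1) * (conj x * y + inner ℂ g.1.1 f.1.1) ^ (m + 2 - 2)) := by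
  have h1 : (y • u + f.1.1, y • ((μ₀ : ℂ) • u - meanOp W u u) + f.1.2) ∈ T.graph :=
    T.graph.add_mem (T.graph.smul_mem y (hS.apply_u hu)) f.2.1
  obtain ⟨h, hh, hh'⟩ := hS.exists_hamiltonian_pwSym m h1
  refine ⟨h, hh, fun g x => ?_⟩
  have huu : inner ℂ u u = (1 : ℂ) := by
    rw [inner_self_eq_norm_sq_to_K, hu.norm]; simp
  have hgu : inner ℂ g.1.1 u = (0 : ℂ) := by
    rw [← inner_conj_symm, g.2.2, map_zero]
  rw [hh', hS.inner_u_apply_u hu]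
  have e1 : inner ℂ (x • u + g.1.1) (y • u + f.1.1) = conj x * y + inner ℂ g.1.1 f.1.1 := by
    simp only [inner_add_left, inner_add_right, inner_smul_left, inner_smul_right, huu, hgu, f.2.2]
    ring
  have e2 : inner ℂ (x • u + g.1.1) (y • ((μ₀ : ℂ) • u - meanOp W u u) + f.1.2) =
      conj x * y * (μ₀ - pairInner W u u u u) - conj x * pairInner W u u f.1.1 u -
        y * pairInner W g.1.1 u u u + inner ℂ g.1.1 f.1.2 := by
    simp only [inner_add_left, inner_add_right, inner_sub_right, inner_smul_left, inner_smul_right,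
      huu, hgu, inner_meanOp, hS.inner_u_snd hu f]
    ring
  rw [e1, e2, show m + 2 - 1 = m + 1 by omega, show m + 2 - 2 = m by omega]
  ring

variable (W T u t) in
/-- The matrix elements of the Hamiltonian between the components of pure powers, up to square roots
of binomial coefficients. -/
def hamiltonianCoeff (m i j : ℕ) (g f : ExcDom T u) : ℂ :=
  let p := inner ℂ g.1.1 f.1.1
  let c := fun d r s => if i + r = j + s then binomCoeff (m + 2) d r i p else 0
  (m + 2) * (t * c 1 1 1 - pairInner W u u f.1.1 u * c 1 1 0 - pairInner W g.1.1 u u u * c 1 0 1 +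
    inner ℂ g.1.1 f.1.2 * c 1 0 0) +
  (m + 2) / 2 * (pairInner W u u u u * c 2 2 2 + 2 * pairInner W u u f.1.1 u * c 2 2 1 +
    2 * pairInner W g.1.1 u u u * c 2 1 2 + pairInner W u u f.1.1 f.1.1 * c 2 2 0 +
    pairInner W g.1.1 g.1.1 u u * c 2 0 2 +
    2 * (pairInner W g.1.1 u f.1.1 u + pairInner W g.1.1 u u f.1.1) * c 2 1 1 +
    2 * pairInner W u g.1.1 f.1.1 f.1.1 * c 2 1 0 +
    2 * pairInner W g.1.1 g.1.1 u f.1.1 * c 2 0 1 +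
    pairInner W g.1.1 g.1.1 f.1.1 f.1.1 * c 2 0 0)

theorem hamiltonian_expand_eq (g f : ExcDom T u) (x y : ℂ) :
    (m + 2) * ((conj x ^ 1 * y ^ 1 * t - conj x ^ 1 * y ^ 0 * pairInner W u u f.1.1 u -
      conj x ^ 0 * y ^ 1 * pairInner W g.1.1 u u u + conj x ^ 0 * y ^ 0 * inner ℂ g.1.1 f.1.2) *
        (conj x * y + inner ℂ g.1.1 f.1.1) ^ (m + 2 - 1)) +
    (m + 2) / 2 * (pairInner W (x • u + g.1.1) (x • u + g.1.1) (y • u + f.1.1) (y • u + f.1.1) *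
      (conj x * y + inner ℂ g.1.1 f.1.1) ^ (m + 2 - 2)) =
    ∑ i ∈ Finset.range (m + 2 + 1), ∑ j ∈ Finset.range (m + 2 + 1),
      conj x ^ (m + 2 - i) * y ^ (m + 2 - j) * hamiltonianCoeff W T t u m i j g f := by
  have hE := fun d r s (hd : d ≤ m + 2) hr hs => expand_pow (d := d) (r := r) (s := s) hd hr hs
    (conj x) y (inner ℂ g.1.1 f.1.1)
  have e111 := hE 1 1 1 (by omega) (by omega) (by omega)
  have e110 := hE 1 1 0 (by omega) (by omega) (by omega)
  have e101 := hE 1 0 1 (by omega) (by omega) (by omega)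
  have e100 := hE 1 0 0 (by omega) (by omega) (by omega)
  have e222 := hE 2 2 2 (by omega) (by omega) (by omega)
  have e221 := hE 2 2 1 (by omega) (by omega) (by omega)
  have e212 := hE 2 1 2 (by omega) (by omega) (by omega)
  have e220 := hE 2 2 0 (by omega) (by omega) (by omega)
  have e202 := hE 2 0 2 (by omega) (by omega) (by omega)
  have e211 := hE 2 1 1 (by omega) (by omega) (by omega)
  have e210 := hE 2 1 0 (by omega) (by omega) (by omega)
  have e201 := hE 2 0 1 (by omega) (by omega) (by omega)
  have e200 := hE 2 0 0 (by omega) (by omega) (by omega)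
  rw [hS.pairInner_expand (hS.mem_domain hu) (hS.excDom_mem f) (hS.excDom_mem g)]
  generalize conj x = x at *
  set p : ℂ := inner ℂ g.1.1 f.1.1
  have key : ∀ i j, x ^ (m + 2 - i) * y ^ (m + 2 - j) * hamiltonianCoeff W T t u m i j g f =
      (m + 2) * (t * (x ^ (m + 2 - i) * y ^ (m + 2 - j) *
          if i + 1 = j + 1 then binomCoeff (m + 2) 1 1 i p else 0)
        - pairInner W u u f.1.1 u * (x ^ (m + 2 - i) * y ^ (m + 2 - j) *
          if i + 1 = j + 0 then binomCoeff (m + 2) 1 1 i p else 0)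
        - pairInner W g.1.1 u u u * (x ^ (m + 2 - i) * y ^ (m + 2 - j) *
          if i + 0 = j + 1 then binomCoeff (m + 2) 1 0 i p else 0)
        + inner ℂ g.1.1 f.1.2 * (x ^ (m + 2 - i) * y ^ (m + 2 - j) *
          if i + 0 = j + 0 then binomCoeff (m + 2) 1 0 i p else 0)) +
      (m + 2) / 2 * (pairInner W u u u u * (x ^ (m + 2 - i) * y ^ (m + 2 - j) *
          if i + 2 = j + 2 then binomCoeff (m + 2) 2 2 i p else 0)
        + 2 * pairInner W u u f.1.1 u * (x ^ (m + 2 - i) * y ^ (m + 2 - j) *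
          if i + 2 = j + 1 then binomCoeff (m + 2) 2 2 i p else 0)
        + 2 * pairInner W g.1.1 u u u * (x ^ (m + 2 - i) * y ^ (m + 2 - j) *
          if i + 1 = j + 2 then binomCoeff (m + 2) 2 1 i p else 0)
        + pairInner W u u f.1.1 f.1.1 * (x ^ (m + 2 - i) * y ^ (m + 2 - j) *
          if i + 2 = j + 0 then binomCoeff (m + 2) 2 2 i p else 0)
        + pairInner W g.1.1 g.1.1 u u * (x ^ (m + 2 - i) * y ^ (m + 2 - j) *
          if i + 0 = j + 2 then binomCoeff (m + 2) 2 0 i p else 0)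
        + 2 * (pairInner W g.1.1 u f.1.1 u + pairInner W g.1.1 u u f.1.1) *
          (x ^ (m + 2 - i) * y ^ (m + 2 - j) *
          if i + 1 = j + 1 then binomCoeff (m + 2) 2 1 i p else 0)
        + 2 * pairInner W u g.1.1 f.1.1 f.1.1 * (x ^ (m + 2 - i) * y ^ (m + 2 - j) *
          if i + 1 = j + 0 then binomCoeff (m + 2) 2 1 i p else 0)
        + 2 * pairInner W g.1.1 g.1.1 u f.1.1 * (x ^ (m + 2 - i) * y ^ (m + 2 - j) *
          if i + 0 = j + 1 then binomCoeff (m + 2) 2 0 i p else 0)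
        + pairInner W g.1.1 g.1.1 f.1.1 f.1.1 * (x ^ (m + 2 - i) * y ^ (m + 2 - j) *
          if i + 0 = j + 0 then binomCoeff (m + 2) 2 0 i p else 0)) := by
    intro i j
    simp only [hamiltonianCoeff]
    ring
  simp only [key, Finset.sum_add_distrib, Finset.sum_sub_distrib, ← Finset.mul_sum, ← e111, ← e110,
    ← e101, ← e100, ← e222, ← e221, ← e212, ← e220, ← e202, ← e211, ← e210, ← e201, ← e200]
  ring

/-- The matrix elements are the coefficients of a polynomial in `conj x` and `y`, the matrix element
of `H_N` between the powers of `x u + g` and `y u + f`. -/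
theorem exists_hasMatrix_excitationHamiltonian :
    ∃ e, HasMatrix (m + 2) (pureVec (m + 2)) (excitationHamiltonian μ W u T (m + 2)) e ∧
      ∀ i ≤ m + 2, ∀ j ≤ m + 2, ∀ g f, ((√((m + 2).choose i : ℝ) : ℝ) : ℂ) *
        ((√((m + 2).choose j : ℝ) : ℝ) : ℂ) * e i j g f = hamiltonianCoeff W T t u m i j g f := by
  set H := excitationHamiltonian μ W u T (m + 2) with hH
  have hdom := fun {j : ℕ} (hj : j ≤ m + 2) (f : ExcDom T u) =>
    hS.core_le_excitationHamiltonian hu (mem_range_combination (pureVec (m + 2)) hj f)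
  have h1 : ∃ A : ℕ → ExcDom T u → FockLE μ u (m + 2),
      ∀ j ≤ m + 2, ∀ f, (pureVec (m + 2) j f, A j f) ∈ H.graph := by
    classical
    refine ⟨fun j f => if h : j ≤ m + 2 then H ⟨_, hdom h f⟩ else 0, fun j hj f => ?_⟩
    beta_reduce
    rw [dif_pos hj]
    exact H.mem_graph ⟨_, hdom hj f⟩
  obtain ⟨A, hA⟩ := h1
  refine ⟨fun i j g f => inner ℂ (pureVec (m + 2) i g) (A j f),
    fun j hj f => ⟨_, hA j hj f, fun i hi g => rfl⟩, ?_⟩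
  intro i hi j hj g f
  refine eq_of_sum_sum_pow_eq (N := m + 2)
    (A := fun i j => ((√((m + 2).choose i : ℝ) : ℝ) : ℂ) *
      ((√((m + 2).choose j : ℝ) : ℝ) : ℂ) * inner ℂ (pureVec (m + 2) i g) (A j f))
    (B := fun i j => hamiltonianCoeff W T t u m i j g f) (fun x y => ?_) hi hj
  obtain ⟨h, hh, hh'⟩ := hS.exists_hamiltonian_expand hu (m := m) f y
  have h2 := hh' g (conj x)
  rw [hS.hamiltonian_expand_eq hu, Complex.conj_conj] at h2
  rw [← h2]
  have h3 : (excitationMap μ u (m + 2) (pwSym μ (m + 2) (y • u + f.1.1)),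
      excitationMap μ u (m + 2) h) ∈ H.graph :=
    mem_sandwich_graph.2 ⟨h, by rwa [adjoint_excitationMap_comp hu.norm], rfl⟩
  have h4 : (excitationMap μ u (m + 2) (pwSym μ (m + 2) (y • u + f.1.1)),
      ∑ j ∈ Finset.range (m + 2 + 1), y ^ (m + 2 - j) •
        ((√((m + 2).choose j : ℝ) : ℝ) : ℂ) • A j f) ∈ H.graph := by
    have h5 : ∑ j ∈ Finset.range (m + 2 + 1), (y ^ (m + 2 - j) •
        ((√((m + 2).choose j : ℝ) : ℝ) : ℂ) • pureVec (m + 2) j f, y ^ (m + 2 - j) •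
        ((√((m + 2).choose j : ℝ) : ℝ) : ℂ) • A j f) ∈ H.graph :=
      H.graph.sum_mem fun j hj => H.graph.smul_mem _ (H.graph.smul_mem _
        (hA j (Nat.lt_succ_iff.1 (Finset.mem_range.1 hj)) f))
    rw [excitationMap_pwSym hu.norm]
    convert h5 using 1
    exact Prod.ext (by simp [Prod.fst_sum]) (by simp [Prod.snd_sum])
  have h5 := LinearPMap.mem_graph_snd_inj _ h3 h4 rfl
  have h6 : inner ℂ (pwSym μ (m + 2) (conj x • u + g.1.1)) h =
      inner ℂ (excitationMap μ u (m + 2) (pwSym μ (m + 2) (conj x • u + g.1.1)))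
        (excitationMap μ u (m + 2) h) := by
    refine Eq.trans ?_ (ContinuousLinearMap.adjoint_inner_left (excitationMap μ u (m + 2)) h
      (excitationMap μ u (m + 2) (pwSym μ (m + 2) (conj x • u + g.1.1))))
    rw [adjoint_excitationMap_comp hu.norm]
  rw [h6, h5, excitationMap_pwSym hu.norm]
  rw [sum_inner]
  refine Finset.sum_congr rfl fun i _ => ?_
  rw [inner_sum]
  refine Finset.sum_congr rfl fun j _ => ?_
  refine Eq.trans ?_ (inner_smul_smul_smul_smul (conj x ^ (m + 2 - i)) _ (y ^ (m + 2 - j)) _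
    (pureVec (m + 2) i g) (A j f)).symm
  rw [map_pow, Complex.conj_conj, Complex.conj_ofReal]
  change _ = _ * inner ℂ (pureVec (m + 2) i g) (A j f)
  ring

end IsSystem

end ExcitationHamiltonian

/-! ### The matrix of the error -/

section ErrorMatrix

variable {X : Type*} [MeasurableSpace X] {μ : Measure X} [SigmaFinite μ]
  {W : X → X → ℝ} {T : L2 μ →ₗ.[ℂ] L2 μ} {C₀ t μ₀ : ℝ} {u : L2 μ} {m : ℕ}

variable (W T u) in
/-- The matrix elements of `U_N H_N U_N† - N E_H(u) - 1^{≤N} ℍ 1^{≤N}` between pure powers. -/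
def errorMatrix (N i j : ℕ) (g f : ExcDom T u) : ℂ :=
  let p := inner ℂ g.1.1 f.1.1
  if i = j then j * (j - 1) / (N - 1) * (1 / 2 * (pairInner W u u u u * p ^ j) -
      (pairInner W g.1.1 u f.1.1 u + pairInner W g.1.1 u u f.1.1) * p ^ (j - 1) +
      1 / 2 * (pairInner W g.1.1 g.1.1 f.1.1 f.1.1 * p ^ (j - 2)))
  else if i = j + 1 then j * ((√((j + 1) * (N - j) : ℝ) : ℝ) : ℂ) / (N - 1) *
    (pairInner W g.1.1 g.1.1 u f.1.1 * p ^ (j - 1) - pairInner W g.1.1 u u u * p ^ j)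
  else if j = i + 1 then i * ((√((i + 1) * (N - i) : ℝ) : ℝ) : ℂ) / (N - 1) *
    (pairInner W u g.1.1 f.1.1 f.1.1 * p ^ (i - 1) - pairInner W u u f.1.1 u * p ^ i)
  else if i = j + 2 then 1 / 2 * ((√((j + 1) * (j + 2) : ℝ) : ℝ) : ℂ) *
    (((√((N - j) * (N - j - 1) : ℝ) : ℝ) : ℂ) / (N - 1) - 1) *
      (pairInner W g.1.1 g.1.1 u u * p ^ j)
  else if j = i + 2 then 1 / 2 * ((√((i + 1) * (i + 2) : ℝ) : ℝ) : ℂ) *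
    (((√((N - i) * (N - i - 1) : ℝ) : ℝ) : ℂ) / (N - 1) - 1) *
      (pairInner W u u f.1.1 f.1.1 * p ^ i)
  else 0

/-- The terms of order `N` cancel by the definition of the Hartree energy, the terms linear in `g`
or `f` by the Hartree equation; the rest are identities for quotients of binomial coefficients. -/
theorem IsSystem.hasMatrix_error (hS : IsSystem μ T W C₀) (hu : IsHartree T W u t μ₀) :
    HasMatrix (m + 2) (pureVec (m + 2)) (excitationHamiltonian μ W u T (m + 2) -
      ((((m + 2 : ℕ) : ℝ) * hartreeEnergy μ W u t : ℝ) : ℂ) • idLE μ u (m + 2) -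
      truncatedBogoliubov μ W u T μ₀ (m + 2)) (errorMatrix W T u (m + 2)) := by
  obtain ⟨e, he, heq⟩ := hS.exists_hasMatrix_excitationHamiltonian hu (m := m)
  refine ((he.sub (hasMatrix_idLE.smul _)).sub (hS.hasMatrix_bogoliubov hu)).congr
    fun i hi j hj g f => ?_
  have hbi := sqrt_choose_ne_zero hi
  have hbj := sqrt_choose_ne_zero hj
  have heq := heq i hi j hj g f
  have hm1 : (m : ℂ) + 1 ≠ 0 := by exact_mod_cast Nat.succ_ne_zero m
  have hN1 : ((m + 2 : ℕ) : ℂ) - 1 = m + 1 := by push_cast; ring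
  have hE : ((((m + 2 : ℕ) : ℝ) * hartreeEnergy μ W u t : ℝ) : ℂ) =
      (m + 2) * (t + 1 / 2 * pairInner W u u u u) := by
    rw [Complex.ofReal_mul, hS.hartreeEnergy_eq hu]
    push_cast
    ring
  refine mul_left_cancel₀ hm1 (mul_left_cancel₀ (mul_ne_zero hbi hbj) ?_)
  rw [hE]
  simp only [hamiltonianCoeff] at heq
  simp only [errorMatrix, hN1]
  set p : ℂ := inner ℂ g.1.1 f.1.1
  generalize he' : e i j g f = e₀ at heq ⊢
  rcases lt_trichotomy i j with hij | hij | hij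
  · rcases (show j = i + 1 ∨ j = i + 2 ∨ i + 2 < j by omega) with h | h | h
    · subst h
      simp (disch := omega) only [if_neg, if_true] at heq ⊢
      have hq := sqrt_choose_succ_mul (m + 2) i
      rw [succ_mul_choose_succ_cast] at hq
      have T1 := binomCoeff_one_one (m := m) (i := i) p
      have T3 := binomCoeff_two_two (m := m) (i := i) p
      have T4 := binomCoeff_two_one (m := m) (i := i) p
      generalize ((√((i + 1) * ((m + 2 : ℕ) - i) : ℝ) : ℝ) : ℂ) = q at hq ⊢
      generalize ((√((m + 2).choose i : ℝ) : ℝ) : ℂ) = bi at *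
      generalize ((√((m + 2).choose (i + 1) : ℝ) : ℝ) : ℂ) = bj at *
      push_cast at hq
      clear hbi hbj
      simp only [mul_zero, sub_zero]
      field_simp
      linear_combination 2 * ((m + 1) * heq
        - i * (pairInner W u g.1.1 f.1.1 f.1.1 * p ^ (i - 1) - pairInner W u u f.1.1 u * p ^ i) * hq
        - pairInner W u u f.1.1 u * (m + 1) * T1 + pairInner W u u f.1.1 u * T3
        + pairInner W u g.1.1 f.1.1 f.1.1 * T4)
    · subst h
      simp (disch := omega) only [if_neg, if_true] at heq ⊢
      have hq := sqrt_choose_add_two_mul (m + 2) i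
      have hc1 := succ_mul_choose_succ_cast (m + 2) i
      have hc2 := succ_mul_choose_succ_cast (m + 2) (i + 1)
      have T3 := binomCoeff_two_two (m := m) (i := i) p
      generalize ((√(((m + 2 : ℕ) - i) * ((m + 2 : ℕ) - i - 1) : ℝ) : ℝ) : ℂ) = q at hq ⊢
      generalize ((√((i + 1) * (i + 2) : ℝ) : ℝ) : ℂ) = s at hq ⊢
      generalize ((√((m + 2).choose i : ℝ) : ℝ) : ℂ) = bi at *
      generalize ((√((m + 2).choose (i + 2) : ℝ) : ℝ) : ℂ) = bj at *
      push_cast at hq hc1 hc2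
      rw [show i + 1 + 1 = i + 2 by ring] at hc2
      clear hbi hbj
      simp only [mul_zero, sub_zero]
      field_simp
      linear_combination 2 * (m + 1) * heq
        - pairInner W u u f.1.1 f.1.1 * p ^ i * hq
        + pairInner W u u f.1.1 f.1.1 * T3
        - pairInner W u u f.1.1 f.1.1 * p ^ i * ((i + 1) * hc2 + (m + 2 - i - 1) * hc1)
    · simp (disch := omega) only [if_neg] at heq ⊢
      linear_combination (m + 1) * heq
  · subst hij
    simp (disch := omega) only [if_neg, if_true] at heq ⊢
    have hB := sqrt_choose_mul_self (m + 2) i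
    have T1 := binomCoeff_one_one (m := m) (i := i) p
    have T2 := binomCoeff_one_zero (m := m) (i := i) p
    have T3 := binomCoeff_two_two (m := m) (i := i) p
    have T4 := binomCoeff_two_one (m := m) (i := i) p
    have T5 := binomCoeff_two_zero (m := m) (i := i) p
    have hμ := hS.inner_u_apply_u hu
    have hp : (i : ℂ) * (p * p ^ (i - 1)) = i * p ^ i := by
      cases i with
      | zero => simp
      | succ k => rw [Nat.add_sub_cancel, ← pow_succ']
    generalize ((√((m + 2).choose i : ℝ) : ℝ) : ℂ) = bi at *
    set C : ℂ := ((m + 2).choose i : ℂ)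
    have hD : ((m : ℂ) + 1) * (i * (i - 1) / (m + 1) * (1 / 2 * (pairInner W u u u u * p ^ i) -
      (pairInner W g.1.1 u f.1.1 u + pairInner W g.1.1 u u f.1.1) * p ^ (i - 1) +
      1 / 2 * (pairInner W g.1.1 g.1.1 f.1.1 f.1.1 * p ^ (i - 2)))) =
        i * (i - 1) * (1 / 2 * (pairInner W u u u u * p ^ i) -
      (pairInner W g.1.1 u f.1.1 u + pairInner W g.1.1 u u f.1.1) * p ^ (i - 1) +
      1 / 2 * (pairInner W g.1.1 g.1.1 f.1.1 f.1.1 * p ^ (i - 2))) := by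
      field_simp
    rw [hD]
    linear_combination (m + 1) * heq + (m + 1) * t * T1 + (m + 1) * inner ℂ g.1.1 f.1.2 * T2
      + pairInner W u u u u / 2 * T3
      + (pairInner W g.1.1 u f.1.1 u + pairInner W g.1.1 u u f.1.1) * T4
      + pairInner W g.1.1 g.1.1 f.1.1 f.1.1 / 2 * T5
      - ((m + 1) * ((m + 2) * (t + 1 / 2 * pairInner W u u u u) * p ^ i
        + i * ((inner ℂ g.1.1 f.1.2 + pairInner W g.1.1 u f.1.1 u - μ₀ * p
          + pairInner W g.1.1 u u f.1.1) * p ^ (i - 1)))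
        + i * (i - 1) * (1 / 2 * (pairInner W u u u u * p ^ i) -
          (pairInner W g.1.1 u f.1.1 u + pairInner W g.1.1 u u f.1.1) * p ^ (i - 1) +
          1 / 2 * (pairInner W g.1.1 g.1.1 f.1.1 f.1.1 * p ^ (i - 2)))) * hB
      + (m + 1) * μ₀ * C * hp - (m + 1) * i * C * p ^ i * hμ
  · rcases (show i = j + 1 ∨ i = j + 2 ∨ j + 2 < i by omega) with h | h | h
    · subst h
      simp (disch := omega) only [if_neg, if_true] at heq ⊢
      have hq := sqrt_choose_succ_mul (m + 2) j
      have T2 := binomCoeff_one_zero (m := m) (i := j + 1) p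
      have T4 := binomCoeff_two_one (m := m) (i := j + 1) p
      have T5 := binomCoeff_two_zero (m := m) (i := j + 1) p
      rw [show j + 1 - 2 = j - 1 by omega] at T5
      rw [show j + 1 - 1 = j by omega] at T2 T4
      generalize ((√((j + 1) * ((m + 2 : ℕ) - j) : ℝ) : ℝ) : ℂ) = q at hq ⊢
      generalize ((√((m + 2).choose j : ℝ) : ℝ) : ℂ) = bj at *
      generalize ((√((m + 2).choose (j + 1) : ℝ) : ℝ) : ℂ) = bi at *
      push_cast at hq T2 T4 T5
      clear hbi hbj
      simp only [mul_zero, sub_zero]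
      field_simp
      linear_combination 2 * ((m + 1) * heq
        - j * (pairInner W g.1.1 g.1.1 u f.1.1 * p ^ (j - 1) - pairInner W g.1.1 u u u * p ^ j) * hq
        - pairInner W g.1.1 u u u * (m + 1) * T2 + pairInner W g.1.1 u u u * T4
        + pairInner W g.1.1 g.1.1 u f.1.1 * T5)
    · subst h
      simp (disch := omega) only [if_neg, if_true] at heq ⊢
      have hq := sqrt_choose_add_two_mul (m + 2) j
      have T5 := binomCoeff_two_zero (m := m) (i := j + 2) p
      rw [show j + 2 - 2 = j by omega] at T5
      generalize ((√(((m + 2 : ℕ) - j) * ((m + 2 : ℕ) - j - 1) : ℝ) : ℝ) : ℂ) = q at hq ⊢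
      generalize ((√((j + 1) * (j + 2) : ℝ) : ℝ) : ℂ) = s at hq ⊢
      generalize ((√((m + 2).choose j : ℝ) : ℝ) : ℂ) = bj at *
      generalize ((√((m + 2).choose (j + 2) : ℝ) : ℝ) : ℂ) = bi at *
      push_cast at hq T5
      clear hbi hbj
      simp only [mul_zero, sub_zero]
      field_simp
      linear_combination 2 * (m + 1) * heq
        - pairInner W g.1.1 g.1.1 u u * p ^ j * hq
        + pairInner W g.1.1 g.1.1 u u * T5
    · simp (disch := omega) only [if_neg] at heq ⊢
      linear_combination (m + 1) * heq

end ErrorMatrix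

/-! ### Bounds for the blocks of the error -/

section ErrorBound

variable {X : Type*} [MeasurableSpace X] {μ : Measure X} [SigmaFinite μ]
  {W : X → X → ℝ} {T : L2 μ →ₗ.[ℂ] L2 μ} {C₀ t μ₀ : ℝ} {u : L2 μ} {m : ℕ}

theorem norm_form_ofReal_mul_sq {ι κ : Type*} (r : ℝ) (K : ι → κ → ℂ) (a : ι →₀ ℂ) (b : κ →₀ ℂ) :
    ‖form (fun i j => (r : ℂ) * K i j) a b‖ ^ 2 = r ^ 2 * ‖form K a b‖ ^ 2 := by
  rw [form_const_mul, norm_mul, mul_pow, Complex.norm_real, Real.norm_eq_abs, sq_abs]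

theorem norm_form_sub_sq_le {ι κ : Type*} (K L : ι → κ → ℂ) (a : ι →₀ ℂ) (b : κ →₀ ℂ) :
    ‖form (fun i j => K i j - L i j) a b‖ ^ 2 ≤ 2 * (‖form K a b‖ ^ 2 + ‖form L a b‖ ^ 2) := by
  rw [form_sub]
  exact norm_sub_sq_le_two _ _

/-- For `M = N - 1`: the square root of `(N - j)(N - j - 1)` differs from `N - 1` by at most
`j + 1 ≤ M`. -/
theorem sq_sqrt_div_sub_one_le {M j : ℝ} (hj : 0 ≤ j) (hjM : j + 1 ≤ M) :
    (√((M + 1 - j) * (M + 1 - j - 1)) / M - 1) ^ 2 ≤ (j + 1) / M := by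
  have hM : 0 < M := by linarith
  set s := √((M + 1 - j) * (M + 1 - j - 1)) with hs
  have h1 : M - j ≤ s := Real.le_sqrt_of_sq_le (by nlinarith)
  have h2 : s ≤ M + 1 := by
    rw [hs, Real.sqrt_le_left (by linarith)]
    nlinarith
  have h3 : s / M - 1 = (s - M) / M := by field_simp
  have h4 : (s - M) ^ 2 ≤ (j + 1) ^ 2 := by
    exact sq_le_sq' (by linarith) (by linarith)
  rw [h3, div_pow, div_le_div_iff₀ (by positivity) hM]
  nlinarith [mul_le_mul_of_nonneg_right h4 hM.le,
    mul_nonneg (mul_nonneg (by linarith : 0 ≤ j + 1) hM.le) (by linarith : 0 ≤ M - (j + 1))]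

namespace IsSystem

variable (hS : IsSystem μ T W C₀) (hu : IsHartree T W u t μ₀)
include hS hu

theorem norm_pairInner_u_sq_le : ‖pairInner W u u u u‖ ^ 2 ≤ 2 * C₀ * t := by
  have h1 : ‖prodMul μ μ u u‖ ^ 2 = 1 := by
    have h := inner_prodMul μ μ u u u u
    rw [inner_self_eq_norm_sq_to_K, inner_self_eq_norm_sq_to_K, hu.norm] at h
    have h2 : ((‖prodMul μ μ u u‖ ^ 2 : ℝ) : ℂ) = 1 := by
      push_cast
      simpa using h
    exact_mod_cast h2
  refine (pow_le_pow_left₀ (norm_nonneg _) (norm_inner_le_norm _ _) 2).trans ?_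
  rw [mul_pow, h1, one_mul]
  exact hS.norm_pairMul_u_u_sq_le hu

variable (a b : ExcDom T u →₀ ℂ)

/-- The particle-preserving part of the error: the excited particles interact with each other,
and have depleted the condensate. -/
theorem norm_form_error_diag_sq_le (n : ℕ) :
    ‖form (fun g f : ExcDom T u => 1 / 2 * (pairInner W u u u u * inner ℂ g.1.1 f.1.1 ^ (n + 2)) -
      (pairInner W g.1.1 u f.1.1 u + pairInner W g.1.1 u u f.1.1) *
        inner ℂ g.1.1 f.1.1 ^ (n + 1) +
      1 / 2 * (pairInner W g.1.1 g.1.1 f.1.1 f.1.1 * inner ℂ g.1.1 f.1.1 ^ n)) a b‖ ^ 2 ≤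
      normForm T u (n + 2) a * (100 * (C₀ * (1 + t)) * kinForm T u (n + 1) b) := by
  have h1 := IsSystem.form_pow (n + 2) a b
  have h2 := hS.form_gu_fu hu (n + 1) a b
  have h3 := hS.form_gu_uf hu (n + 1) a b
  have h4 := hS.form_gg_ff hu n a b
  have h5 := hS.normForm_le_kinForm (u := u) (n + 1) b
  have h6 := hS.norm_pairInner_u_sq_le hu
  have heq : form (fun g f : ExcDom T u =>
      1 / 2 * (pairInner W u u u u * inner ℂ g.1.1 f.1.1 ^ (n + 2)) -
      (pairInner W g.1.1 u f.1.1 u + pairInner W g.1.1 u u f.1.1) *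
        inner ℂ g.1.1 f.1.1 ^ (n + 1) +
      1 / 2 * (pairInner W g.1.1 g.1.1 f.1.1 f.1.1 * inner ℂ g.1.1 f.1.1 ^ n)) a b =
      ((1 / 2 * pairInner W u u u u) *
        form (fun g f : ExcDom T u => inner ℂ g.1.1 f.1.1 ^ (n + 2)) a b -
      form (fun g f : ExcDom T u => pairInner W g.1.1 u f.1.1 u *
        inner ℂ g.1.1 f.1.1 ^ (n + 1)) a b) +
      (1 / 2 * form (fun g f : ExcDom T u => pairInner W g.1.1 g.1.1 f.1.1 f.1.1 *
        inner ℂ g.1.1 f.1.1 ^ n) a b -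
      form (fun g f : ExcDom T u => pairInner W g.1.1 u u f.1.1 *
        inner ℂ g.1.1 f.1.1 ^ (n + 1)) a b) := by
    rw [← form_const_mul, ← form_const_mul, ← form_sub, ← form_sub, ← form_add]
    congr 1
    funext g f
    ring
  rw [heq]
  set x := form (fun g f : ExcDom T u => inner ℂ g.1.1 f.1.1 ^ (n + 2)) a b
  set y := form (fun g f : ExcDom T u => pairInner W g.1.1 u f.1.1 u *
    inner ℂ g.1.1 f.1.1 ^ (n + 1)) a b
  set z := form (fun g f : ExcDom T u => pairInner W g.1.1 u u f.1.1 *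
    inner ℂ g.1.1 f.1.1 ^ (n + 1)) a b
  set v := form (fun g f : ExcDom T u => pairInner W g.1.1 g.1.1 f.1.1 f.1.1 *
    inner ℂ g.1.1 f.1.1 ^ n) a b
  have k1 := norm_add_sq_le_two ((1 / 2 * pairInner W u u u u) * x - y) (1 / 2 * v - z)
  have k2 := norm_sub_sq_le_two ((1 / 2 * pairInner W u u u u) * x) y
  have k3 := norm_sub_sq_le_two (1 / 2 * v) z
  have e1 : ‖(1 / 2 * pairInner W u u u u) * x‖ ^ 2 =
      1 / 4 * (‖pairInner W u u u u‖ ^ 2 * ‖x‖ ^ 2) := by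
    rw [norm_mul, norm_mul]
    norm_num
    ring
  have e2 : ‖1 / 2 * v‖ ^ 2 = 1 / 4 * ‖v‖ ^ 2 := by
    rw [norm_mul]
    norm_num
    ring
  have hC := hS.pos
  have ht := hS.t_nonneg hu
  have hn := normForm_nonneg (T := T) (u := u) (n + 2) a
  have hnb := normForm_nonneg (T := T) (u := u) (n + 2) b
  have hk := hS.kinForm_nonneg (u := u) (n + 1) b
  rw [show n + 1 + 1 = n + 2 by ring] at h2 h3 h5
  set na := normForm T u (n + 2) a
  set nb := normForm T u (n + 2) b
  set k := kinForm T u (n + 1) b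
  have m1 : ‖pairInner W u u u u‖ ^ 2 * ‖x‖ ^ 2 ≤ 2 * C₀ * t * (na * k) :=
    mul_le_mul h6 (h1.trans (mul_le_mul_of_nonneg_left h5 hn)) (sq_nonneg _) (by positivity)
  have m2 : na * (10 * C₀ * (k + t * nb)) ≤ na * (10 * C₀ * ((1 + t) * k)) := by
    refine mul_le_mul_of_nonneg_left (mul_le_mul_of_nonneg_left ?_ (by positivity)) hn
    nlinarith
  have m3 : 0 ≤ C₀ * (na * k) := by positivity
  have m4 : 0 ≤ t * (C₀ * (na * k)) := by positivity
  nlinarith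

/-- The creation of an excited particle by the collision of an excited particle with the
condensate. -/
theorem norm_form_error_up_sq_le (n : ℕ) :
    ‖form (fun g f : ExcDom T u => pairInner W g.1.1 g.1.1 u f.1.1 * inner ℂ g.1.1 f.1.1 ^ n -
      pairInner W g.1.1 u u u * inner ℂ g.1.1 f.1.1 ^ (n + 1)) a b‖ ^ 2 ≤
      normForm T u (n + 2) a * (24 * (C₀ * (1 + t)) * kinForm T u n b) := by
  have h1 := hS.form_gg_uf hu n a b
  have h2 := hS.form_gu_uu hu (n + 1) a b
  have h3 := norm_form_sub_sq_le (fun g f : ExcDom T u =>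
    pairInner W g.1.1 g.1.1 u f.1.1 * inner ℂ g.1.1 f.1.1 ^ n) (fun g f : ExcDom T u =>
      pairInner W g.1.1 u u u * inner ℂ g.1.1 f.1.1 ^ (n + 1)) a b
  have h5 := hS.normForm_le_kinForm (u := u) n b
  have hC := hS.pos
  have ht := hS.t_nonneg hu
  have hn := normForm_nonneg (T := T) (u := u) (n + 2) a
  have m : normForm T u (n + 2) a * (10 * C₀ * (kinForm T u n b + t * normForm T u (n + 1) b)) +
      normForm T u (n + 2) a * (2 * C₀ * t * normForm T u (n + 1) b) ≤
      normForm T u (n + 2) a * (12 * (C₀ * (1 + t)) * kinForm T u n b) := by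
    rw [← mul_add]
    refine mul_le_mul_of_nonneg_left ?_ hn
    have hk := hS.kinForm_nonneg (u := u) n b
    have h6 := mul_le_mul_of_nonneg_left h5 (mul_nonneg hC.le ht)
    have h7 := mul_nonneg hC.le hk
    nlinarith
  rw [show n + 1 + 1 = n + 2 by ring] at h2
  nlinarith

/-- The absorption of an excited particle by the condensate in a collision of two excited
particles. -/
theorem norm_form_error_down_sq_le (n : ℕ) :
    ‖form (fun g f : ExcDom T u => pairInner W u g.1.1 f.1.1 f.1.1 * inner ℂ g.1.1 f.1.1 ^ n -
      pairInner W u u f.1.1 u * inner ℂ g.1.1 f.1.1 ^ (n + 1)) a b‖ ^ 2 ≤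
      normForm T u (n + 1) a * (24 * (C₀ * (1 + t)) * kinForm T u (n + 1) b) := by
  have h1 := hS.form_ug_ff hu n a b
  have h2 := hS.form_uu_fu hu (n + 1) a b
  have h3 := norm_form_sub_sq_le (fun g f : ExcDom T u =>
    pairInner W u g.1.1 f.1.1 f.1.1 * inner ℂ g.1.1 f.1.1 ^ n) (fun g f : ExcDom T u =>
      pairInner W u u f.1.1 u * inner ℂ g.1.1 f.1.1 ^ (n + 1)) a b
  have h5 := hS.normForm_le_kinForm (u := u) (n + 1) b
  have hC := hS.pos
  have ht := hS.t_nonneg hu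
  have hn := normForm_nonneg (T := T) (u := u) (n + 1) a
  have m : normForm T u (n + 1) a * (2 * C₀ * kinForm T u (n + 1) b) + normForm T u (n + 1) a *
      (10 * C₀ * (kinForm T u (n + 1) b + t * normForm T u (n + 1 + 1) b)) ≤
      normForm T u (n + 1) a * (12 * (C₀ * (1 + t)) * kinForm T u (n + 1) b) := by
    rw [← mul_add]
    refine mul_le_mul_of_nonneg_left ?_ hn
    have hk := hS.kinForm_nonneg (u := u) (n + 1) b
    have h6 := mul_le_mul_of_nonneg_left h5 (mul_nonneg hC.le ht)
    have h7 := mul_nonneg (mul_nonneg hC.le ht) hk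
    nlinarith
  nlinarith

theorem norm_form_error_sq_le {i j : ℕ} (hi : i ≤ m + 2) (hj : j ≤ m + 2) :
    ‖form (errorMatrix W T u (m + 2) i j) a b‖ ^ 2 ≤ normForm T u i a *
      (200 * (C₀ * (1 + t)) / (m + 2) * (j ^ 3 * kinForm T u (j - 1) b + normForm T u j b)) := by
  have hC := hS.pos
  have ht := hS.t_nonneg hu
  have hD0 : 0 ≤ C₀ * (1 + t) := by positivity
  have hDt : C₀ * t ≤ C₀ * (1 + t) := by linarith
  have hDC : C₀ ≤ C₀ * (1 + t) := by linarith [mul_nonneg hC.le ht]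
  have hna := normForm_nonneg (T := T) (u := u) i a
  have hnb := normForm_nonneg (T := T) (u := u) j b
  have hk := hS.kinForm_nonneg (u := u) (j - 1) b
  have hN : (0 : ℝ) < m + 2 := by positivity
  have hM : (0 : ℝ) < m + 1 := by positivity
  have hMN : 1 / ((m : ℝ) + 1) ≤ 2 / (m + 2) := by
    rw [div_le_div_iff₀ hM hN]
    linarith [(Nat.cast_nonneg m : (0 : ℝ) ≤ m)]
  -- It suffices to bound the square of the coefficient, up to the factor `2 / N ≥ 1 / (N - 1)`.
  have finish : ∀ {r q s : ℝ} {K : ExcDom T u → ExcDom T u → ℂ},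
      ‖form K a b‖ ^ 2 ≤ normForm T u i a * q → 0 ≤ s → r ^ 2 ≤ s / (m + 1) →
      s * q ≤ 100 * (C₀ * (1 + t)) * (j ^ 3 * kinForm T u (j - 1) b + normForm T u j b) → 0 ≤ q →
      ‖form (fun g f => (r : ℂ) * K g f) a b‖ ^ 2 ≤ normForm T u i a *
        (200 * (C₀ * (1 + t)) / (m + 2) * (j ^ 3 * kinForm T u (j - 1) b + normForm T u j b)) := by
    intro r q s K hK hs hr hq hq0
    rw [norm_form_ofReal_mul_sq]
    have hr' : r ^ 2 ≤ s * (2 / (m + 2)) := by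
      refine hr.trans ?_
      rw [div_eq_mul_one_div]
      exact mul_le_mul_of_nonneg_left hMN hs
    calc r ^ 2 * ‖form K a b‖ ^ 2 ≤ s * (2 / (m + 2)) * (normForm T u i a * q) :=
          mul_le_mul hr' hK (sq_nonneg _) (by positivity)
      _ = normForm T u i a * (2 / (m + 2) * (s * q)) := by ring
      _ ≤ normForm T u i a * (2 / (m + 2) *
          (100 * (C₀ * (1 + t)) * (j ^ 3 * kinForm T u (j - 1) b + normForm T u j b))) := by gcongr
      _ = _ := by ring
  have zero : errorMatrix W T u (m + 2) i j = (fun _ _ => 0) →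
      ‖form (errorMatrix W T u (m + 2) i j) a b‖ ^ 2 ≤ normForm T u i a *
        (200 * (C₀ * (1 + t)) / (m + 2) * (j ^ 3 * kinForm T u (j - 1) b + normForm T u j b)) := by
    intro h
    rw [h, form_zero, norm_zero, zero_pow two_ne_zero]
    positivity
  have hN1 : ((m + 2 : ℕ) : ℂ) - 1 = m + 1 := by push_cast; ring
  rcases lt_trichotomy i j with hij | hij | hij
  · rcases (show j = i + 1 ∨ j = i + 2 ∨ i + 2 < j by omega) with h | h | h
    · subst h
      cases i with
      | zero =>
        refine zero (funext fun g => funext fun f => ?_)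
        simp [errorMatrix]
      | succ n =>
        have heq : errorMatrix W T u (m + 2) (n + 1) (n + 1 + 1) = fun g f =>
            (((n + 1) * √((n + 2) * (m + 1 - n)) / (m + 1) : ℝ) : ℂ) *
              (pairInner W u g.1.1 f.1.1 f.1.1 * inner ℂ g.1.1 f.1.1 ^ n -
                pairInner W u u f.1.1 u * inner ℂ g.1.1 f.1.1 ^ (n + 1)) := by
          funext g f
          simp (disch := omega) only [errorMatrix, if_neg, if_true, hN1, Nat.add_sub_cancel]
          rw [show ((n + 1 : ℕ) + 1 : ℝ) * ((m + 2 : ℕ) - (n + 1 : ℕ)) =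
            (n + 2) * (m + 1 - n) by push_cast; ring]
          push_cast
          ring
        rw [heq]
        have hnm : (n : ℝ) ≤ m := by exact_mod_cast (by omega : n ≤ m)
        refine finish (s := (n + 1) ^ 2 * (n + 2))
          (hS.norm_form_error_down_sq_le hu a b n) (by positivity) ?_ ?_ (by positivity)
        · rw [div_pow, mul_pow, Real.sq_sqrt (by nlinarith), div_le_div_iff₀ (by positivity) hM]
          have : (0 : ℝ) ≤ (n + 1) ^ 2 * (n + 2) * (m + 1) * n := by positivity
          nlinarith
        · simp only [Nat.add_sub_cancel] at hk ⊢
          have h1 : ((n : ℝ) + 1) ^ 2 * (n + 2) ≤ ((n + 1 + 1 : ℕ) : ℝ) ^ 3 := by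
            push_cast
            nlinarith [(Nat.cast_nonneg n : (0 : ℝ) ≤ n), pow_nonneg (Nat.cast_nonneg (α := ℝ) n) 2,
            pow_nonneg (Nat.cast_nonneg (α := ℝ) n) 3]
          have h2 := mul_le_mul_of_nonneg_right h1 (mul_nonneg hD0 hk)
          have h3 : 0 ≤ C₀ * (1 + t) * normForm T u (n + 1 + 1) b := by positivity
          have h4 : 0 ≤ ((n : ℝ) + 1) ^ 2 * (n + 2) * (C₀ * (1 + t) * kinForm T u (n + 1) b) := by positivity
          linarith
    · subst h
      have heq : errorMatrix W T u (m + 2) i (i + 2) = fun g f =>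
          ((1 / 2 * √((i + 1) * (i + 2)) *
            (√((m + 1 + 1 - i) * (m + 1 + 1 - i - 1)) / (m + 1) - 1) : ℝ) : ℂ) *
              (pairInner W u u f.1.1 f.1.1 * inner ℂ g.1.1 f.1.1 ^ i) := by
        funext g f
        simp (disch := omega) only [errorMatrix, if_neg, if_true, hN1]
        rw [show ((m + 2 : ℕ) : ℝ) = m + 1 + 1 by push_cast; ring]
        push_cast
        ring
      rw [heq]
      have him : (i : ℝ) ≤ m := by exact_mod_cast (by omega : i ≤ m)
      have hsq := sq_sqrt_div_sub_one_le (M := m + 1) (Nat.cast_nonneg i) (by linarith)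
      refine finish (s := 1 / 4 * ((i + 1) * (i + 2) * (i + 1)))
        (hS.form_uu_ff hu i a b) (by positivity) ?_ ?_ ?_
      · rw [mul_pow, mul_pow, Real.sq_sqrt (by positivity)]
        refine (mul_le_mul_of_nonneg_left hsq (by positivity)).trans_eq ?_
        ring
      · simp only [show i + 2 - 1 = i + 1 by omega] at hk ⊢
        have h1 : 1 / 4 * (((i : ℝ) + 1) * (i + 2) * (i + 1)) ≤ ((i + 2 : ℕ) : ℝ) ^ 3 := by
          push_cast
          nlinarith [(Nat.cast_nonneg i : (0 : ℝ) ≤ i), pow_nonneg (Nat.cast_nonneg (α := ℝ) i) 2,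
            pow_nonneg (Nat.cast_nonneg (α := ℝ) i) 3]
        have h2 := mul_le_mul h1 (mul_le_mul_of_nonneg_right hDC hk) (by positivity) (by positivity)
        have h3 : 0 ≤ C₀ * (1 + t) * normForm T u (i + 2) b := by positivity
        have h4 : 0 ≤ ((i + 2 : ℕ) : ℝ) ^ 3 * (C₀ * (1 + t) * kinForm T u (i + 1) b) := by positivity
        linarith
      · have := hS.kinForm_nonneg (u := u) (i + 1) b
        positivity
    · refine zero (funext fun g => funext fun f => ?_)
      simp (disch := omega) only [errorMatrix, if_neg]
  · subst hij
    rcases (show i = 0 ∨ i = 1 ∨ ∃ n, i = n + 2 by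
      rcases i with _ | _ | n <;> simp) with h | h | ⟨n, h⟩
    · subst h
      refine zero (funext fun g => funext fun f => ?_)
      simp [errorMatrix]
    · subst h
      refine zero (funext fun g => funext fun f => ?_)
      simp [errorMatrix]
    · subst h
      have heq : errorMatrix W T u (m + 2) (n + 2) (n + 2) = fun g f =>
          (((n + 2) * (n + 1) / (m + 1) : ℝ) : ℂ) *
            (1 / 2 * (pairInner W u u u u * inner ℂ g.1.1 f.1.1 ^ (n + 2)) -
            (pairInner W g.1.1 u f.1.1 u + pairInner W g.1.1 u u f.1.1) *
              inner ℂ g.1.1 f.1.1 ^ (n + 1) +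
            1 / 2 * (pairInner W g.1.1 g.1.1 f.1.1 f.1.1 * inner ℂ g.1.1 f.1.1 ^ n)) := by
        funext g f
        simp only [errorMatrix, if_true, hN1, Nat.add_sub_cancel, show n + 2 - 1 = n + 1 by omega]
        push_cast
        ring
      rw [heq]
      have hnm : (n : ℝ) ≤ m := by exact_mod_cast (by omega : n ≤ m)
      refine finish (s := (n + 2) ^ 2 * (n + 1))
        (hS.norm_form_error_diag_sq_le hu a b n) (by positivity) ?_ ?_ ?_
      · rw [div_pow, mul_pow, div_le_div_iff₀ (by positivity) hM]
        have : (0 : ℝ) ≤ (n + 2) ^ 2 * (n + 1) * (m + 1) * (m - n) :=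
          mul_nonneg (by positivity) (by linarith)
        nlinarith
      · simp only [show n + 2 - 1 = n + 1 by omega] at hk ⊢
        have h1 : ((n : ℝ) + 2) ^ 2 * (n + 1) ≤ ((n + 2 : ℕ) : ℝ) ^ 3 := by
          push_cast
          nlinarith [(Nat.cast_nonneg n : (0 : ℝ) ≤ n), pow_nonneg (Nat.cast_nonneg (α := ℝ) n) 2,
            pow_nonneg (Nat.cast_nonneg (α := ℝ) n) 3]
        have h2 := mul_le_mul_of_nonneg_right h1 (mul_nonneg hD0 hk)
        have h3 : 0 ≤ C₀ * (1 + t) * normForm T u (n + 2) b := by positivity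
        linarith
      · have := hS.kinForm_nonneg (u := u) (n + 1) b
        positivity
  · rcases (show i = j + 1 ∨ i = j + 2 ∨ j + 2 < i by omega) with h | h | h
    · subst h
      cases j with
      | zero =>
        refine zero (funext fun g => funext fun f => ?_)
        simp [errorMatrix]
      | succ n =>
        have heq : errorMatrix W T u (m + 2) (n + 1 + 1) (n + 1) = fun g f =>
            (((n + 1) * √((n + 2) * (m + 1 - n)) / (m + 1) : ℝ) : ℂ) *
              (pairInner W g.1.1 g.1.1 u f.1.1 * inner ℂ g.1.1 f.1.1 ^ n -
                pairInner W g.1.1 u u u * inner ℂ g.1.1 f.1.1 ^ (n + 1)) := by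
          funext g f
          simp (disch := omega) only [errorMatrix, if_neg, if_true, hN1, Nat.add_sub_cancel]
          rw [show ((n + 1 : ℕ) + 1 : ℝ) * ((m + 2 : ℕ) - (n + 1 : ℕ)) =
            (n + 2) * (m + 1 - n) by push_cast; ring]
          push_cast
          ring
        rw [heq]
        have hnm : (n : ℝ) ≤ m := by exact_mod_cast (by omega : n ≤ m)
        refine finish (s := (n + 1) ^ 2 * (n + 2))
          (hS.norm_form_error_up_sq_le hu a b n) (by positivity) ?_ ?_ ?_
        · rw [div_pow, mul_pow, Real.sq_sqrt (by nlinarith), div_le_div_iff₀ (by positivity) hM]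
          have : (0 : ℝ) ≤ (n + 1) ^ 2 * (n + 2) * (m + 1) * n := by positivity
          nlinarith
        · simp only [Nat.add_sub_cancel] at hk ⊢
          have h1 : ((n : ℝ) + 1) ^ 2 * (n + 2) ≤ 2 * ((n + 1 : ℕ) : ℝ) ^ 3 := by
            push_cast
            nlinarith [(Nat.cast_nonneg n : (0 : ℝ) ≤ n), pow_nonneg (Nat.cast_nonneg (α := ℝ) n) 2,
            pow_nonneg (Nat.cast_nonneg (α := ℝ) n) 3]
          have h2 := mul_le_mul_of_nonneg_right h1 (mul_nonneg hD0 hk)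
          have h3 : 0 ≤ C₀ * (1 + t) * normForm T u (n + 1) b := by positivity
          have h4 : 0 ≤ ((n + 1 : ℕ) : ℝ) ^ 3 * (C₀ * (1 + t) * kinForm T u n b) := by positivity
          linarith
        · have := hS.kinForm_nonneg (u := u) n b
          positivity
    · subst h
      have heq : errorMatrix W T u (m + 2) (j + 2) j = fun g f =>
          ((1 / 2 * √((j + 1) * (j + 2)) *
            (√((m + 1 + 1 - j) * (m + 1 + 1 - j - 1)) / (m + 1) - 1) : ℝ) : ℂ) *
              (pairInner W g.1.1 g.1.1 u u * inner ℂ g.1.1 f.1.1 ^ j) := by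
        funext g f
        simp (disch := omega) only [errorMatrix, if_neg, if_true, hN1]
        rw [show ((m + 2 : ℕ) : ℝ) = m + 1 + 1 by push_cast; ring]
        push_cast
        ring
      rw [heq]
      have hjm : (j : ℝ) ≤ m := by exact_mod_cast (by omega : j ≤ m)
      have hsq := sq_sqrt_div_sub_one_le (M := m + 1) (Nat.cast_nonneg j) (by linarith)
      refine finish (s := 1 / 4 * ((j + 1) * (j + 2) * (j + 1)))
        (hS.form_gg_uu hu j a b) (by positivity) ?_ ?_ (by positivity)
      · rw [mul_pow, mul_pow, Real.sq_sqrt (by positivity)]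
        refine (mul_le_mul_of_nonneg_left hsq (by positivity)).trans_eq ?_
        ring
      · have h0 : (j : ℝ) ^ 3 * normForm T u j b ≤ j ^ 3 * kinForm T u (j - 1) b := by
          cases j with
          | zero => simp
          | succ n => exact mul_le_mul_of_nonneg_left (hS.normForm_le_kinForm n b) (by positivity)
        have h1 : 1 / 4 * (((j : ℝ) + 1) * (j + 2) * (j + 1)) ≤ 3 * j ^ 3 + 1 := by
          rcases Nat.eq_zero_or_pos j with h | h
          · subst h
            norm_num
          · have : (1 : ℝ) ≤ j := by exact_mod_cast h
            nlinarith [pow_le_pow_right₀ this (by norm_num : 2 ≤ 3), le_self_pow₀ this three_ne_zero]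
        have h2 := mul_le_mul h1 (mul_le_mul_of_nonneg_right hDt hnb) (by positivity) (by positivity)
        have h3 := mul_le_mul_of_nonneg_left h0 hD0
        have h4 : 0 ≤ C₀ * (1 + t) * normForm T u j b := by positivity
        have h5 : 0 ≤ (j : ℝ) ^ 3 * (C₀ * (1 + t) * kinForm T u (j - 1) b) := by positivity
        linarith
    · refine zero (funext fun g => funext fun f => ?_)
      simp (disch := omega) only [errorMatrix, if_neg]

end IsSystem
end ErrorBound

/-! ### The error as an operator -/

section ErrorOperator

open Filter Topology

variable {X : Type*} [MeasurableSpace X] {μ : Measure X} [SigmaFinite μ]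
  {W : X → X → ℝ} {T : L2 μ →ₗ.[ℂ] L2 μ} {C₀ t μ₀ : ℝ} {u : L2 μ} {m N : ℕ}

variable (μ W u T t μ₀ N) in
/-- The error of the Bogoliubov approximation, `U_N H_N U_N† - N E_H(u) - 1^{≤N} ℍ 1^{≤N}`. -/
abbrev errorOp : FockLE μ u N →ₗ.[ℂ] FockLE μ u N :=
  excitationHamiltonian μ W u T N - ((N * hartreeEnergy μ W u t : ℝ) : ℂ) • idLE μ u N -
    truncatedBogoliubov μ W u T μ₀ N

theorem norm_sub_sq_le_of_intermediate {E : Type*} [NormedAddCommGroup E] [InnerProductSpace ℂ E]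
    {h k l x : E} {e c d q : ℝ} (hq : 0 ≤ q) (hd : ‖h - (e : ℂ) • x - l‖ ^ 2 ≤ d * (q + ‖x‖ ^ 2))
    (hc : ‖l - k‖ ^ 2 ≤ c * (q + ‖x‖ ^ 2)) :
    ‖h - k‖ ^ 2 ≤ (4 * d + 4 * e ^ 2 + 2 * c) * (q + ‖x‖ ^ 2) := by
  have h1 := norm_add_sq_le_two ((h - (e : ℂ) • x - l) + (e : ℂ) • x) (l - k)
  have h2 := norm_add_sq_le_two (h - (e : ℂ) • x - l) ((e : ℂ) • x)
  have h3 : ‖(e : ℂ) • x‖ ^ 2 = e ^ 2 * ‖x‖ ^ 2 := by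
    rw [norm_smul, mul_pow, Complex.norm_real, Real.norm_eq_abs, sq_abs]
  rw [show h - (e : ℂ) • x - l + (e : ℂ) • x + (l - k) = h - k by abel] at h1
  have h4 : 0 ≤ e ^ 2 * q := by positivity
  linarith

namespace IsSystem

variable (hS : IsSystem μ T W C₀) (hu : IsHartree T W u t μ₀)
include hS hu

/-- The error bound on the core. The constant is `5²` times that for a single block, for the five
diagonals of the matrix. -/
theorem norm_errorOp_coreVec_sq_le {b : ℕ → ExcDom T u →₀ ℂ} {y : FockLE μ u (m + 2)}
    (hy : (coreVec T u (m + 2) b, y) ∈ (errorOp μ W T t μ₀ u (m + 2)).graph) :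
    ‖y‖ ^ 2 ≤ 5000 * (C₀ * (1 + t)) / (m + 2) *
      (∑ j ∈ Finset.range (m + 2 + 1), j ^ 3 * kinForm T u (j - 1) (b j) +
        ‖coreVec T u (m + 2) b‖ ^ 2) := by
  have hC := hS.pos
  have ht := hS.t_nonneg hu
  have h := norm_sq_le_of_hasMatrix hS hu (hS.hasMatrix_error hu) (b := b)
    (β := fun j => 200 * (C₀ * (1 + t)) / (m + 2) *
      (j ^ 3 * kinForm T u (j - 1) (b j) + normForm T u j (b j))) ?_ ?_ ?_ hy
  · refine h.trans_eq ?_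
    rw [norm_coreVec_sq, ← Finset.sum_add_distrib, ← Finset.mul_sum]
    ring
  · intro i j hij g f
    rcases hij with hij | hij <;> simp (disch := omega) only [errorMatrix, if_neg]
  · intro j
    have h1 := hS.kinForm_nonneg (u := u) (j - 1) (b j)
    have h2 := normForm_nonneg (T := T) (u := u) j (b j)
    positivity
  · exact fun i hi j hj a => hS.norm_form_error_sq_le hu a (b j) hi hj

theorem sum_pow_three_kinForm_le {b : ℕ → ExcDom T u →₀ ℂ} {k : FockLE μ u N}
    (hk : (coreVec T u N b, k) ∈ (truncatedKinetic μ u T N).graph) :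
    ∑ j ∈ Finset.range (N + 1), (j : ℝ) ^ 3 * kinForm T u (j - 1) (b j) ≤
      N ^ 2 * (inner ℂ (coreVec T u N b) k).re := by
  rw [hS.re_inner_kinetic hu hk, Finset.mul_sum]
  refine Finset.sum_le_sum fun j hj => ?_
  have hjN : (j : ℝ) ≤ N := by
    exact_mod_cast Nat.lt_succ_iff.1 (Finset.mem_range.1 hj)
  have hk := hS.kinForm_nonneg (u := u) (j - 1) (b j)
  calc (j : ℝ) ^ 3 * kinForm T u (j - 1) (b j) = j ^ 2 * (j * kinForm T u (j - 1) (b j)) := by ring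
    _ ≤ _ := by gcongr

theorem norm_excitationHamiltonian_sub_sq_le {c : ℝ} {x h k l : FockLE μ u (m + 2)}
    (hx : x ∈ core T u (m + 2)) (hh : (x, h) ∈ (excitationHamiltonian μ W u T (m + 2)).graph)
    (hk : (x, k) ∈ (truncatedKinetic μ u T (m + 2)).graph)
    (hl : (x, l) ∈ (truncatedBogoliubov μ W u T μ₀ (m + 2)).graph)
    (hlk : ‖l - k‖ ^ 2 ≤ c * ((inner ℂ x k).re + ‖x‖ ^ 2)) :
    ‖h - k‖ ^ 2 ≤ (4 * (5000 * (C₀ * (1 + t)) * (m + 2)) +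
      4 * ((m + 2 : ℕ) * hartreeEnergy μ W u t) ^ 2 + 2 * c) * ((inner ℂ x k).re + ‖x‖ ^ 2) := by
  obtain ⟨b, rfl⟩ := hx
  have hC := hS.pos
  have ht := hS.t_nonneg hu
  have hy := hS.norm_errorOp_coreVec_sq_le hu (sub_mem_graph (sub_mem_graph hh
    (smul_mem_graph _ (mem_everywhere_graph (ContinuousLinearMap.id ℂ _) _))) hl)
  have hs := hS.sum_pow_three_kinForm_le hu hk
  have hq : 0 ≤ (inner ℂ (coreVec T u (m + 2) b) k).re := by
    rw [hS.re_inner_kinetic hu hk]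
    exact Finset.sum_nonneg fun j _ => mul_nonneg (Nat.cast_nonneg j) (hS.kinForm_nonneg _ _)
  refine norm_sub_sq_le_of_intermediate hq (hy.trans ?_) hlk
  have hm : (1 : ℝ) ≤ (m + 2) ^ 2 := by nlinarith [(Nat.cast_nonneg m : (0 : ℝ) ≤ m)]
  have h1 := mul_le_mul_of_nonneg_right hm (sq_nonneg ‖coreVec T u (m + 2) b‖)
  push_cast at hs
  calc _ ≤ 5000 * (C₀ * (1 + t)) / ((m : ℝ) + 2) * ((m + 2) ^ 2 *
        ((inner ℂ (coreVec T u (m + 2) b) k).re + ‖coreVec T u (m + 2) b‖ ^ 2)) := by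
        refine mul_le_mul_of_nonneg_left ?_ (by positivity)
        linarith
    _ = _ := by
        field_simp

theorem isPerturbation_excitationHamiltonian : IsPerturbation (truncatedKinetic μ u T (m + 2))
    (excitationHamiltonian μ W u T (m + 2)) (core T u (m + 2)) (hS.core_le_kinetic hu) := by
  have hle := hS.core_le_excitationHamiltonian hu (m := m)
  refine ⟨hS.isFormalAdjoint_excitationHamiltonian hu, hle,
    hS.closure_coreGraph_excitationHamiltonian hu, ?_⟩
  have hB := hS.isPerturbation_bogoliubov hu (N := m + 2)
  obtain ⟨c, hc, hb⟩ := hB.bound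
  have hC := hS.pos
  have ht := hS.t_nonneg hu
  refine ⟨4 * (5000 * (C₀ * (1 + t)) * (m + 2)) +
    4 * ((m + 2 : ℕ) * hartreeEnergy μ W u t) ^ 2 + 2 * c, by positivity, fun x => ?_⟩
  exact hS.norm_excitationHamiltonian_sub_sq_le hu x.2
    ((excitationHamiltonian μ W u T (m + 2)).mem_graph ⟨_, hle x.2⟩)
    ((truncatedKinetic μ u T (m + 2)).mem_graph ⟨_, hS.core_le_kinetic hu x.2⟩)
    ((truncatedBogoliubov μ W u T μ₀ (m + 2)).mem_graph ⟨_, hB.le x.2⟩) (hb x)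

theorem re_inner_component_kinetic {b : ℕ → ExcDom T u →₀ ℂ} {y : FockLE μ u N}
    (h : (coreVec T u N b, y) ∈ (truncatedKinetic μ u T N).graph) {j : ℕ} (hj : j ≤ N) :
    (inner ℂ ((coreVec T u N b : Fock μ u) j) ((y : Fock μ u) j)).re =
      j * kinForm T u (j - 1) (b j) := by
  have h1 := (hS.hasMatrix_kinetic hu).inner_eq (a := Pi.single j (b j)) h
  rw [sum_form_diag (fun j (g f : ExcDom T u) =>
    (j : ℂ) * (inner ℂ g.1.1 f.1.2 * inner ℂ g.1.1 f.1.1 ^ (j - 1)))] at h1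
  have h2 : combination N (pureVec N) (Pi.single j (b j)) =
      toSector μ u N j ((coreVec T u N b : Fock μ u) j) := by
    refine FockLE_ext fun i hi => ?_
    refine (component_coreVec hi (Pi.single j (b j))).trans ?_
    by_cases hij : i = j
    · subst hij
      rw [toSector_self hi, component_coreVec hi, Pi.single_eq_same]
    · rw [toSector_ne hij, Pi.single_eq_of_ne hij, map_zero]
  rw [h2, inner_toSector_left] at h1
  rw [h1, Finset.sum_eq_single j]
  · rw [Pi.single_eq_same, kinForm, ← qform_const_mul, qform]
    norm_cast
  · intro i _ hij
    rw [Pi.single_eq_of_ne hij]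
    simp [form]
  · intro h
    exact absurd (Finset.mem_range.2 (Nat.lt_succ_of_le hj)) h

theorem norm_errorOp_sq_le_of_mem_core {x k y : FockLE μ u (m + 2)} (hx : x ∈ core T u (m + 2))
    (hk : (x, k) ∈ (truncatedKinetic μ u T (m + 2)).graph)
    (hy : (x, y) ∈ (errorOp μ W T t μ₀ u (m + 2)).graph) :
    ‖y‖ ^ 2 ≤ 5000 * (C₀ * (1 + t)) / (m + 2) *
      (∑ j ∈ Finset.range (m + 2 + 1), (j : ℝ) ^ 2 *
        (inner ℂ (component (m + 2) j x) (component (m + 2) j k)).re + ‖x‖ ^ 2) := by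
  obtain ⟨b, rfl⟩ := hx
  refine (hS.norm_errorOp_coreVec_sq_le hu hy).trans_eq ?_
  congr 2
  refine Finset.sum_congr rfl fun j hj => ?_
  have h := hS.re_inner_component_kinetic hu hk (Nat.lt_succ_iff.1 (Finset.mem_range.1 hj))
  refine Eq.trans ?_ (congrArg (fun r => (j : ℝ) ^ 2 * r) h.symm)
  ring

/-- The error bound on the core extends to the domain of the kinetic energy, where it is continuous
in the graph norm for fixed `N`. -/
theorem exists_errorOp_bound {x k : FockLE μ u (m + 2)}
    (hk : (x, k) ∈ (truncatedKinetic μ u T (m + 2)).graph) :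
    ∃ y, (x, y) ∈ (errorOp μ W T t μ₀ u (m + 2)).graph ∧
      ‖y‖ ^ 2 ≤ 5000 * (C₀ * (1 + t)) / (m + 2) *
        (∑ j ∈ Finset.range (m + 2 + 1), (j : ℝ) ^ 2 *
          (inner ℂ (component (m + 2) j x) (component (m + 2) j k)).re + ‖x‖ ^ 2) := by
  have hcore := hS.hasCore_kinetic hu (N := m + 2)
  have hH := hS.isPerturbation_excitationHamiltonian hu (m := m)
  have hB := hS.isPerturbation_bogoliubov hu (N := m + 2)
  obtain ⟨z, k', hk', hz, hzk⟩ := hcore.isPerturbation.approx hcore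
    (LinearPMap.mem_domain_of_mem_graph hk)
  obtain rfl : k' = k := LinearPMap.mem_graph_snd_inj _ hk' hk rfl
  obtain ⟨a, ha, hza⟩ := hH.tendsto hcore hz hzk
  obtain ⟨b, hb, hzb⟩ := hB.tendsto hcore hz hzk
  have hmem := fun {v a b : FockLE μ u (m + 2)}
    (ha : (v, a) ∈ (excitationHamiltonian μ W u T (m + 2)).graph)
    (hb : (v, b) ∈ (truncatedBogoliubov μ W u T μ₀ (m + 2)).graph) =>
      sub_mem_graph (sub_mem_graph ha
        (smul_mem_graph ((((m + 2 : ℕ) : ℝ) * hartreeEnergy μ W u t : ℝ) : ℂ)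
          (mem_everywhere_graph (ContinuousLinearMap.id ℂ (FockLE μ u (m + 2))) v))) hb
  refine ⟨_, hmem ha hb, ?_⟩
  refine le_of_tendsto_of_tendsto' (((hza.sub (hz.const_smul _)).sub hzb).norm.pow 2)
    (((tendsto_finsetSum (Finset.range (m + 2 + 1)) fun j _ =>
      ((Complex.continuous_re.tendsto _).comp ((((component (m + 2) j).continuous.tendsto _).comp
        hz).inner (((component (m + 2) j).continuous.tendsto _).comp hzk))).const_mul
          ((j : ℝ) ^ 2)).add (hz.norm.pow 2)).const_mul _) fun n => ?_
  exact hS.norm_errorOp_sq_le_of_mem_core hu (z n).2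
    ((truncatedKinetic μ u T (m + 2)).mem_graph ⟨_, hcore.le (z n).2⟩)
    (hmem ((excitationHamiltonian μ W u T (m + 2)).mem_graph ⟨_, hH.le (z n).2⟩)
      ((truncatedBogoliubov μ W u T μ₀ (m + 2)).mem_graph ⟨_, hB.le (z n).2⟩))

end IsSystem
end ErrorOperator

/-! ### The number operator and the operator inequality -/

section NumberOperator

variable {X : Type*} [MeasurableSpace X] {μ : Measure X} [SigmaFinite μ]
  {W : X → X → ℝ} {T A : L2 μ →ₗ.[ℂ] L2 μ} {C₀ t μ₀ : ℝ} {u : L2 μ} {m N : ℕ}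

theorem mem_prodOp_graph {E : Type*} [NormedAddCommGroup E] [InnerProductSpace ℂ E]
    {A B : E →ₗ.[ℂ] E} {x y : E} :
    (x, y) ∈ (prodOp A B).graph ↔ ∃ z, (x, z) ∈ B.graph ∧ (z, y) ∈ A.graph := by
  rw [prodOp, Submodule.toLinearPMap_graph_eq]
  · exact Iff.rfl
  · rintro ⟨x, y⟩ ⟨z, hz, hz'⟩ (h0 : x = 0)
    exact LinearPMap.graph_fst_eq_zero_snd _ hz' (LinearPMap.graph_fst_eq_zero_snd _ hz h0)

theorem sqLE_smul_add_everywhere_id {E : Type*} [NormedAddCommGroup E] [InnerProductSpace ℂ E]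
    {A B : E →ₗ.[ℂ] E} {c : ℝ} (h : ∀ x y, (x, y) ∈ B.graph →
      ∃ z, (x, z) ∈ A.graph ∧ ‖z‖ ^ 2 ≤ c * ((inner ℂ x y).re + ‖x‖ ^ 2)) :
    SqLE A ((c : ℂ) • (B + everywhere (ContinuousLinearMap.id ℂ E))) := by
  rintro ⟨x, hx⟩
  have hy := LinearPMap.mem_graph B ⟨x, (Submodule.mem_inf.1 hx).1⟩
  obtain ⟨z, hz, hle⟩ := h x _ hy
  have hdm := LinearPMap.mem_domain_of_mem_graph hz
  refine ⟨hdm, ?_⟩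
  rw [apply_eq_of_mem_graph hz hdm, apply_eq_of_mem_graph (smul_mem_graph (c : ℂ)
    (add_mem_graph hy (mem_everywhere_graph (ContinuousLinearMap.id ℂ E) x))) hx]
  refine hle.trans_eq ?_
  rw [inner_smul_right, Complex.re_ofReal_mul, inner_add_right, Complex.add_re]
  congr 2
  exact norm_sq_eq_re_inner (𝕜 := ℂ) x

/-- On functions of no variables, `∑ A_i` is zero. -/
theorem mem_sumOp_zero_graph (hA : A.IsFormalAdjoint A) (hd : Dense (A.domain : Set (L2 μ)))
    (Φ : L2N μ 0) : (Φ, 0) ∈ (sumOp μ A 0).graph := by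
  have h1 := pw_mem_sumOp_graph μ 0 hA hd A.graph.zero_mem
  have h2 : Φ = Φ default • pw μ 0 0 := by
    refine Lp.ext ?_
    filter_upwards [Lp.coeFn_smul (Φ default) (pw μ 0 (0 : L2 μ)), coeFn_pw μ 0 (0 : L2 μ)] with x hx hp
    rw [hx, Pi.smul_apply, hp, Finset.univ_eq_empty, Finset.prod_empty, smul_eq_mul, mul_one,
      Subsingleton.elim x default]
  have h3 : dpw μ 0 (0 : L2 μ) 0 = 0 := by
    simp [dpw]
  rw [h3] at h1
  have h4 := (sumOp μ A 0).graph.smul_mem (Φ default) h1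
  rw [Prod.smul_mk, smul_zero, ← h2] at h4
  exact h4

/-- A vector `x` lies in the domain of the truncation of `dΓ(A)` if the vector with the components
`m² x_m` does. -/
theorem exists_mem_truncGamma_graph (hA : A.IsFormalAdjoint A)
    (hd : Dense (A.domain : Set (L2 μ))) {x z y : FockLE μ u N}
    (hz : ∀ m ≤ N, (z : Fock μ u) m = ((m : ℂ) ^ 2) • (x : Fock μ u) m)
    (hy : (z, y) ∈ (truncGamma A u N).graph) : ∃ k, (x, k) ∈ (truncGamma A u N).graph := by
  obtain ⟨y', hy', -⟩ := mem_compress_graph.1 hy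
  rw [mem_dGamma_graph] at hy'
  let k : FockLE μ u N := ∑ j ∈ Finset.range (N + 1),
    toSector μ u N j ((((j : ℂ) ^ 2)⁻¹) • y' j)
  have hk : ∀ m ≤ N, (k : Fock μ u) m = (((m : ℂ) ^ 2)⁻¹) • y' m := by
    intro m hm
    change component N m k = _
    rw [map_sum, Finset.sum_eq_single m]
    · exact toSector_self hm _
    · exact fun j _ hj => toSector_ne hj.symm _
    · exact fun h => absurd (Finset.mem_range.2 (Nat.lt_succ_of_le hm)) h
  refine ⟨k, mem_compress_graph_of_mem (mem_dGamma_graph.2 fun m => ?_)⟩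
  rcases le_or_gt m N with hm | hm
  · rw [hk m hm]
    rcases Nat.eq_zero_or_pos m with h0 | h0
    · subst h0
      rw [Nat.cast_zero, zero_pow two_ne_zero, inv_zero, zero_smul]
      exact mem_compress_graph_of_mem (mem_sumOp_zero_graph hA hd _)
    · have h := Submodule.smul_mem _ (((m : ℂ) ^ 2)⁻¹) (hy' m)
      rw [hz m hm, Prod.smul_mk, smul_smul, inv_mul_cancel₀, one_smul] at h
      · exact h
      · exact pow_ne_zero _ (Nat.cast_ne_zero.2 h0.ne')
  · rw [mem_FockLE.1 x.2 m hm, mem_FockLE.1 k.2 m hm]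
    exact Submodule.zero_mem _

namespace IsSystem

variable (hS : IsSystem μ T W C₀) (hu : IsHartree T W u t μ₀)
include hS hu

/-- The number operator acts as multiplication by `m` on the sector with `m` particles. -/
theorem number_component {x z : FockLE μ u N} (h : (x, z) ∈ (truncatedNumber μ u N).graph)
    (m : ℕ) (hm : m ≤ N) : (z : Fock μ u) m = (m : ℂ) • (x : Fock μ u) m := by
  have hfa := isFormalAdjoint_everywhere (B := Q μ u) fun x y => inner_Q_left μ u x y
  have hd : Dense ((everywhere (Q μ u)).domain : Set (L2 μ)) := dense_univ
  have hM := hasMatrix_truncGamma (N := N) (img := fun f : ExcDom T u => f.1.1) hfa hd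
    (fun f => by
      have h1 := mem_everywhere_graph (Q μ u) f.1.1
      rwa [Q_of_inner_eq_zero μ u hu.norm f.2.2] at h1) fun f => f.2.2
  have hsymm : (truncatedNumber μ u N).IsFormalAdjoint (truncatedNumber μ u N) :=
    isFormalAdjoint_compress _ (isFormalAdjoint_dGamma hfa hd)
  refine sub_eq_zero.1 (Subtype.ext (eq_zero_of_inner_excDom hS hu
    ((z : Fock μ u) m - (m : ℂ) • (x : Fock μ u) m).2 fun f => ?_))
  obtain ⟨y, hy, hyg⟩ := hM m hm f
  have hsr : ∀ v : FockLE μ u N, inner ℂ v ((m : ℂ) • pureVec N m f) =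
      m * inner ℂ v (pureVec N m f) := fun v => by
    have h := inner_smul_right (𝕜 := ℂ) v (pureVec N m f) (m : ℂ)
    exact h
  have hy2 : y = (m : ℂ) • pureVec N m f := by
    refine sub_eq_zero.1 (eq_zero_of_inner_pureVec hS hu fun i hi g => ?_)
    have h2 := inner_pureVec (N := N) (j := m) hi g f
    rw [inner_sub_right, hsr, hyg i hi g, h2]
    beta_reduce
    split_ifs with him
    · subst him
      cases i with
      | zero => simp
      | succ n => rw [Nat.add_sub_cancel, pow_succ']; ring
    · simp
  have h3 := inner_eq_of_mem_graph hsymm h hy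
  rw [hy2, hsr, pureVec, inner_toSector_right, inner_toSector_right] at h3
  have h4 : inner ℂ ((z : Fock μ u) m - (m : ℂ) • (x : Fock μ u) m) (pwPlus m f) = 0 := by
    have h5 := inner_smul_left (𝕜 := ℂ) (component N m x) (pwPlus m f) (m : ℂ)
    rw [Complex.conj_natCast] at h5
    rw [inner_sub_left]
    exact sub_eq_zero.2 (h3.trans h5.symm)
  exact h4

theorem re_inner_kinetic_number {x z k y : FockLE μ u N}
    (hz : ∀ j ≤ N, (z : Fock μ u) j = ((j : ℂ) ^ 2) • (x : Fock μ u) j)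
    (hk : (x, k) ∈ (truncatedKinetic μ u T N).graph)
    (hy : (z, y) ∈ (truncatedKinetic μ u T N).graph) :
    (inner ℂ x y).re = ∑ j ∈ Finset.range (N + 1), (j : ℝ) ^ 2 *
      (inner ℂ (component N j x) (component N j k)).re := by
  have h := inner_eq_of_mem_graph (hS.hasCore_kinetic hu).symm hk hy
  refine (congrArg Complex.re (h.symm.trans (inner_FockLE k z))).trans ?_
  rw [Complex.re_sum]
  refine Finset.sum_congr rfl fun j hj => ?_
  have h1 := inner_smul_right (𝕜 := ℂ) (component N j k) (component N j x) ((j : ℂ) ^ 2)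
  rw [hz j (Nat.lt_succ_iff.1 (Finset.mem_range.1 hj))]
  refine (congrArg Complex.re h1).trans ?_
  rw [← Complex.ofReal_natCast, ← Complex.ofReal_pow, Complex.re_ofReal_mul]
  exact congrArg _ (inner_re_symm (𝕜 := ℂ) (component N j k) (component N j x))

/-- The error bound as an operator inequality. -/
theorem sqLE_errorOp : SqLE (errorOp μ W T t μ₀ u (m + 2))
    (((5000 * (C₀ * (1 + t)) / (m + 2) : ℝ) : ℂ) •
      (prodOp (truncatedKinetic μ u T (m + 2))
        (prodOp (truncatedNumber μ u (m + 2)) (truncatedNumber μ u (m + 2)))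
        + idLE μ u (m + 2))) := by
  refine sqLE_smul_add_everywhere_id fun x y hy => ?_
  obtain ⟨z, hxz, hzy⟩ := mem_prodOp_graph.1 hy
  obtain ⟨v, hxv, hvz⟩ := mem_prodOp_graph.1 hxz
  have hz : ∀ j ≤ m + 2, (z : Fock μ u) j = ((j : ℂ) ^ 2) • (x : Fock μ u) j := fun j hj => by
    rw [hS.number_component hu hvz j hj, hS.number_component hu hxv j hj, smul_smul, sq]
  have hsa := hS.isSelfAdjoint_QTQ hu
  obtain ⟨k, hk⟩ := exists_mem_truncGamma_graph (isFormalAdjoint_of_isSelfAdjoint hsa)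
    hsa.dense_domain hz hzy
  obtain ⟨h, hh, hle⟩ := hS.exists_errorOp_bound hu hk
  rw [← hS.re_inner_kinetic_number hu hz hk hzy] at hle
  exact ⟨h, hh, hle⟩

end IsSystem

theorem isSystem_lebesgueOn {d : ℕ} {Ω : Set (EuclideanSpace ℝ (Fin d))}
    {T : L2 (lebesgueOn Ω) →ₗ.[ℂ] L2 (lebesgueOn Ω)} {w : EuclideanSpace ℝ (Fin d) → ℝ} {C₀ : ℝ}
    (hT : IsSelfAdjoint T) (hT1 : ∀ f : T.domain, ‖(f : L2 (lebesgueOn Ω))‖ ^ 2 ≤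
      (inner ℂ (f : L2 (lebesgueOn Ω)) (T f)).re) (hw : Measurable w) (hw' : ∀ x, w (-x) = w x)
    (hC₀ : 0 < C₀) (hb : SqLE (interaction (lebesgueOn Ω) (pairInteraction w) 2)
      ((C₀ : ℂ) • kinetic (lebesgueOn Ω) T 2)) :
    IsSystem (lebesgueOn Ω) T (pairInteraction w) C₀ where
  sa := hT
  one_le := hT1
  pos := hC₀
  meas := hw.comp (measurable_fst.sub measurable_snd)
  symm x y := by rw [pairInteraction, pairInteraction, ← hw', neg_sub]
  bound := hb

end NumberOperator

end MeanField

end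

theorem theorem1 (C₀ t : ℝ) (hC₀ : 0 < C₀) :
    ∃ C : ℝ, 0 < C ∧
      ∀ (d : ℕ) (Ω : Set (EuclideanSpace ℝ (Fin d))), IsOpen Ω →
      ∀ T : L2 (lebesgueOn Ω) →ₗ.[ℂ] L2 (lebesgueOn Ω), IsSelfAdjoint T →
        (∀ f : T.domain, ‖(f : L2 (lebesgueOn Ω))‖ ^ 2 ≤
          (inner ℂ (f : L2 (lebesgueOn Ω)) (T f)).re) →
      ∀ w : EuclideanSpace ℝ (Fin d) → ℝ, Measurable w → (∀ x, w (-x) = w x) →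
        SqLE (interaction (lebesgueOn Ω) (pairInteraction w) 2)
          ((C₀ : ℂ) • kinetic (lebesgueOn Ω) T 2) →
      ∀ u₀ : L2 (lebesgueOn Ω), ‖u₀‖ = 1 → HasFormValue T u₀ t →
      ∀ μ₀ : ℝ, SolvesHartree (lebesgueOn Ω) (pairInteraction w) u₀ T μ₀ →
      ∀ N : ℕ, 2 ≤ N →
        (IsSelfAdjoint (excitationHamiltonian (lebesgueOn Ω) (pairInteraction w) u₀ T N) ∧
          (excitationHamiltonian (lebesgueOn Ω) (pairInteraction w) u₀ T N).domain =
            (truncatedKinetic (lebesgueOn Ω) u₀ T N).domain) ∧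
        (IsSelfAdjoint (truncatedBogoliubov (lebesgueOn Ω) (pairInteraction w) u₀ T μ₀ N) ∧
          (truncatedBogoliubov (lebesgueOn Ω) (pairInteraction w) u₀ T μ₀ N).domain =
            (truncatedKinetic (lebesgueOn Ω) u₀ T N).domain) ∧
        SqLE
          (excitationHamiltonian (lebesgueOn Ω) (pairInteraction w) u₀ T N
            - ((N * hartreeEnergy (lebesgueOn Ω) (pairInteraction w) u₀ t : ℝ) : ℂ) •
              idLE (lebesgueOn Ω) u₀ N
            - truncatedBogoliubov (lebesgueOn Ω) (pairInteraction w) u₀ T μ₀ N)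
          (((C / N : ℝ) : ℂ) •
            (prodOp (truncatedKinetic (lebesgueOn Ω) u₀ T N)
              (prodOp (truncatedNumber (lebesgueOn Ω) u₀ N) (truncatedNumber (lebesgueOn Ω) u₀ N))
              + idLE (lebesgueOn Ω) u₀ N)) := by
  refine ⟨5000 * (C₀ * (1 + |t|)), by positivity, ?_⟩
  intro d Ω _ T hT hT1 w hw hw' hb u₀ hu₀ ht μ₀ hμ₀ N hN
  obtain ⟨m, rfl⟩ := Nat.exists_eq_add_of_le' hN
  have hS := isSystem_lebesgueOn hT hT1 hw hw' hC₀ hb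
  have hu : IsHartree T (pairInteraction w) u₀ t μ₀ := ⟨hu₀, ht, hμ₀⟩
  have hK := hS.hasCore_kinetic hu (N := m + 2)
  have hH := hS.isPerturbation_excitationHamiltonian hu (m := m)
  have hB := hS.isPerturbation_bogoliubov hu (N := m + 2)
  refine ⟨⟨hH.isSelfAdjoint hK, hH.domain_eq hK⟩, ⟨hB.isSelfAdjoint hK, hB.domain_eq hK⟩, ?_⟩
  have hc : 5000 * (C₀ * (1 + |t|)) / ((m + 2 : ℕ) : ℝ) = 5000 * (C₀ * (1 + t)) / (m + 2) := by
    rw [abs_of_nonneg (hS.t_nonneg hu), Nat.cast_add, Nat.cast_ofNat]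
  rw [hc]
  exact hS.sqLE_errorOp hu
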